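/- Let $\mathcal A$ be a Hopf $*$-algebra over $\mathbb C$ with coproduct $\phi$, counit $\epsilon$ and antipode $\kappa$ (for instance, the polynomial functions on a compact matrix quantum group $G$). Let $\Gamma$ be a bicovariant first-order $*$-calculus over $\mathcal A$, determined by its right ideal $\mathcal R\subseteq\ker\epsilon$ (which is $\mathrm{ad}$-invariant and satisfies $\kappa(\mathcal R)^*\subseteq\mathcal R$), and let $\Gamma^\wedge$ be its universal differential envelope. Let $\pi\colon\mathcal A\to\Gamma_{inv}=\mathcal A/(\mathbb C1\oplus\mathcal R)$, $\pi(a)=\kappa(a^{(1)})da^{(2)}$, be the projection onto the left-invariant elements, with $\pi(a)\circ b=\pi(ab-\epsilon(a)b)$, $\varpi\pi=(\pi\otimes\mathrm{id})\mathrm{ad}$, $\pi(a)^*=-\pi(\kappa(a)^*)$. Let $\Gamma_{inv}^\otimes$ be the tensor algebra of $\Gamma_{inv}$, $\Gamma_{inv}^\wedge\subseteq\Gamma^\wedge$ the left-invariant subalgebra, $\iota\colon\Gamma_{inv}^\wedge\to\Gamma_{inv}^\otimes$ a grade-preserving hermitian section of the factorization map which intertwines the adjoint coactions, and $\delta=\iota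 d\colon\Gamma_{inv}\to\Gamma_{inv}^{\otimes2}$. Let $P=(\mathcal B,i,F)$ be a quantum principal bundle over a $*$-algebra $\mathcal V$ with structure Hopf $*$-algebra $\mathcal A$. A calculus on $P$ is a graded-differential $*$-algebra $\Omega(P)$ (with $(\alpha\beta)^*=(-1)^{\partial\alpha\,\partial\beta}\beta^*\alpha^*$) with $\Omega^0(P)=\mathcal B$, generated by $\mathcal B$, for which $F$ extends to a homomorphism $\widehat F\colon\Omega(P)\to\Omega(P)\mathbin{\widehat\otimes}\Gamma^\wedge$ of graded-differential $*$-algebras. Put $F^\wedge=(\mathrm{id}\otimes p_*)\widehat F$, where $p_*\colon\Gamma^\wedge\to\mathcal A$ is the projection, and $\mathrm{hor}(P)=\widehat F^{-1}(\Omega(P)\otimes\mathcal A)$; write $F^\wedge(\varphi)=\sum_k\varphi_k\otimes c_k$. A connection is a hermitian linear map $\omega\colon\Gamma_{inv}\to\Omega^1(P)$ with $\widehat F\omega(\vartheta)=(\omega\otimes\mathrm{id})\varpi(\vartheta)+1\otimes\vartheta$; it is regular if $\omega(\vartheta)\varphi=(-1)^{\partial\varphi}\sum_k\varphi_k\,\omega(\vartheta\circ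 c_k)$ for all $\vartheta\in\Gamma_{inv}$, $\varphi\in\mathrm{hor}(P)$. Let $\omega^\otimes$ be the unital multiplicative extension of $\omega$ to $\Gamma_{inv}^\otimes$, let $m_\omega\colon\mathrm{hor}(P)\otimes\Gamma^\wedge_{inv}\to\Omega(P)$, $m_\omega(\varphi\otimes\vartheta)=\varphi\,\omega^\otimes(\iota\vartheta)$, be the (bijective) decomposition map, and put $h_\omega=(\mathrm{id}\otimes p_*)m_\omega^{-1}$, $D_\omega=h_\omega d$, $R_\omega=D_\omega\omega$. For $\vartheta\in\Gamma_{inv}$, $\varphi\in\mathrm{hor}(P)$, $a\in\mathcal A$ put $$\ell_\omega(\vartheta,\varphi)=\omega(\vartheta)\varphi-(-1)^{\partial\varphi}\sum_k\varphi_k\,\omega(\vartheta\circ c_k),$$ $$\rho(\vartheta,a)=\delta(\vartheta)\circ a-\delta(\vartheta\circ a)-(\vartheta\circ a^{(1)})\otimes\pi(a^{(2)})-\pi(a^{(1)})\otimes(\vartheta\circ a^{(2)}),\qquad u_\omega=\omega^\otimes\rho,$$ $$n_\omega(\vartheta,\varphi)=R_\omega(\vartheta)\varphi-\sum_k\varphi_kR_\omega(\vartheta\circ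 c_k)+\sum_k\varphi_k\,u_\omega(\vartheta,c_k),$$ where $\circ$ is extended to $\Gamma_{inv}^\otimes$ by $1\circ a=\epsilon(a)1$, $(\xi\eta)\circ a=(\xi\circ a^{(1)})(\eta\circ a^{(2)})$. Let $\omega$ be any connection on $P$. Then all $\ell_\omega(\vartheta,\varphi)$ and $n_\omega(\vartheta,\varphi)$ lie in $\mathrm{hor}(P)$, and the two-sided ideal $\mathcal N_\omega\subseteq\mathrm{hor}(P)$ which they generate satisfies $$F^\wedge(\mathcal N_\omega)\subseteq\mathcal N_\omega\otimes\mathcal A,\qquad *(\mathcal N_\omega)=\mathcal N_\omega,\qquad D_\omega(\mathcal N_\omega)\subseteq\mathcal N_\omega.$$ Hence the calculus can be renormalized so that the projected $\omega$ becomes regular: there are a calculus $\Omega'(P)$ on $P$ (over the same $\Gamma$) and a surjective homomorphism $q\colon\Omega(P)\to\Omega'(P)$ of graded-differential $*$-algebras, which is the identity on $\mathcal B$ and intertwines the maps $\widehat F$, such that $\mathrm{hor}(P)\cap\ker q=\mathcal N_\omega$, $q(\mathrm{hor}(P))$ is the algebra $\mathrm{hor}'(P)$ of horizontal forms of $\Omega'(P)$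 (so $\mathrm{hor}'(P)\cong\mathrm{hor}(P)/\mathcal N_\omega$), $\tau=q\omega$ is a regular connection, and $D_\tau q=qD_\omega$ on $\mathrm{hor}(P)$. -/

import Mathlib

open scoped TensorProduct

noncomputable section

namespace QPB

universe u v w

/-! ### Hopf *-algebras and bicovariant *-calculi -/

/-- A Hopf `*`-algebra over `ℂ`. -/
class HopfStarAlgebra (A : Type u) [Ring A] [StarRing A] [HopfAlgebra ℂ A] [StarModule ℂ A] :
    Prop where
  comul_star : ∀ a : A,
    Coalgebra.comul (R := ℂ) (star a) = star (Coalgebra.comul (R := ℂ) a)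
  counit_star : ∀ a : A,
    Coalgebra.counit (R := ℂ) (star a) = star (Coalgebra.counit (R := ℂ) a)
  antipode_star : ∀ a : A,
    HopfAlgebra.antipode ℂ (star (HopfAlgebra.antipode ℂ (star a))) = a

section Hopf

variable {A : Type u} [Ring A] [HopfAlgebra ℂ A]

/-- Convolution `a ↦ ∑ f (a⁽¹⁾) * g (a⁽²⁾)` of linear maps from `A` to an algebra. -/
def conv {W : Type v} [Ring W] [Algebra ℂ W] (f g : A →ₗ[ℂ] W) : A →ₗ[ℂ] W :=
  LinearMap.mul' ℂ W ∘ₗ TensorProduct.map f g ∘ₗ Coalgebra.comul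

theorem conv_repr {W : Type v} [Ring W] [Algebra ℂ W] (f g : A →ₗ[ℂ] W) {a : A} {ι : Type*}
    (r : Coalgebra.Repr ℂ a ι) :
    conv f g a = ∑ i ∈ r.index, f (r.left i) * g (r.right i) := by
  simp [conv, ← r.eq]

theorem conv_assoc {W : Type v} [Ring W] [Algebra ℂ W] (f g h : A →ₗ[ℂ] W) :
    conv (conv f g) h = conv f (conv g h) :=
  congrArg WithConv.ofConv
    (mul_assoc (WithConv.toConv f) (WithConv.toConv g) (WithConv.toConv h))

variable (A) in
/-- The adjoint coaction `ad a = ∑ a⁽²⁾ ⊗ κ(a⁽¹⁾) a⁽³⁾`. -/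
def ad : A →ₗ[ℂ] A ⊗[ℂ] A :=
  (LinearMap.mul' ℂ A ∘ₗ (HopfAlgebra.antipode ℂ).rTensor A).lTensor A ∘ₗ
    (TensorProduct.leftComm ℂ A A A).toLinearMap ∘ₗ
    Coalgebra.comul.lTensor A ∘ₗ Coalgebra.comul

open WithConv in
theorem conv_antipode_left {W : Type v} [Ring W] [Algebra ℂ W] (f : A →ₐ[ℂ] W) :
    (toConv (f.toLinearMap ∘ₗ HopfAlgebra.antipode ℂ) : WithConv (A →ₗ[ℂ] W)) *
      toConv f.toLinearMap = 1 := by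
  ext a
  rw [(Coalgebra.Repr.arbitrary ℂ a).convMul_apply]
  simp only [LinearMap.comp_apply, AlgHom.toLinearMap_apply, ← map_mul, ← map_sum]
  rw [HopfAlgebra.sum_antipode_mul_eq_algebraMap_counit]
  simp

open WithConv in
theorem conv_antipode_right {W : Type v} [Ring W] [Algebra ℂ W] (f : A →ₐ[ℂ] W) :
    (toConv f.toLinearMap : WithConv (A →ₗ[ℂ] W)) *
      toConv (f.toLinearMap ∘ₗ HopfAlgebra.antipode ℂ) = 1 := by
  ext a
  rw [(Coalgebra.Repr.arbitrary ℂ a).convMul_apply]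
  simp only [LinearMap.comp_apply, AlgHom.toLinearMap_apply, ← map_mul, ← map_sum]
  rw [HopfAlgebra.sum_mul_antipode_eq_algebraMap_counit]
  simp

open WithConv in
theorem comul_antipode {a : A} {ι : Type*} (r : Coalgebra.Repr ℂ a ι) :
    Coalgebra.comul (R := ℂ) (HopfAlgebra.antipode ℂ a) =
      ∑ i ∈ r.index, HopfAlgebra.antipode ℂ (r.right i) ⊗ₜ[ℂ] HopfAlgebra.antipode ℂ (r.left i) := by
  let i1 : A →ₐ[ℂ] A ⊗[ℂ] A := Algebra.TensorProduct.includeLeft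
  let i2 : A →ₐ[ℂ] A ⊗[ℂ] A := Algebra.TensorProduct.includeRight
  have hδ : (toConv Coalgebra.comul : WithConv (A →ₗ[ℂ] A ⊗[ℂ] A)) =
      toConv i1.toLinearMap * toConv i2.toLinearMap := by
    ext b
    rw [(Coalgebra.Repr.arbitrary ℂ b).convMul_apply]
    simp [i1, i2, (Coalgebra.Repr.arbitrary ℂ b).eq]
  have h : toConv (i2.toLinearMap ∘ₗ HopfAlgebra.antipode ℂ) *
      toConv (i1.toLinearMap ∘ₗ HopfAlgebra.antipode ℂ) =
      toConv (Coalgebra.comul ∘ₗ HopfAlgebra.antipode ℂ : A →ₗ[ℂ] A ⊗[ℂ] A) := by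
    refine left_inv_eq_right_inv ?_ (LinearMap.comul_right_inv (R := ℂ) (C := A))
    rw [hδ, mul_assoc, ← mul_assoc (toConv (i1.toLinearMap ∘ₗ _)), conv_antipode_left, one_mul,
      conv_antipode_left]
  have := congr($h a)
  rw [r.convMul_apply] at this
  simpa [i1, i2] using this.symm

end Hopf

/-- A bicovariant first-order `*`-calculus `Γ` over `A`, given by the right ideal `𝓡 ⊆ ker ε` which
determines it: `𝓡` is `ad`-invariant and `κ(𝓡)* ⊆ 𝓡`. -/
structure BicovariantStarCalculus (A : Type u) [Ring A] [StarRing A] [HopfAlgebra ℂ A] where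
  ideal : Submodule ℂ A
  counit_eq_zero : ∀ r ∈ ideal, Coalgebra.counit (R := ℂ) r = 0
  mul_mem : ∀ r ∈ ideal, ∀ a : A, r * a ∈ ideal
  ad_mem : ∀ r ∈ ideal, ad A r ∈ LinearMap.range (ideal.subtype.rTensor A)
  star_mem : ∀ r ∈ ideal, star (HopfAlgebra.antipode ℂ r) ∈ ideal

/-! ### Gradings and conjugate-linear antihomomorphisms -/

/-- The linear map which multiplies the component of degree `n` by `s n`. -/
def degreeScale {W : Type u} [Ring W] [Algebra ℂ W] (𝒲 : ℕ → Submodule ℂ W) [GradedAlgebra 𝒲]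
    (s : ℕ → ℂ) : W →ₗ[ℂ] W :=
  DirectSum.toModule ℂ ℕ W (fun n => s n • (𝒲 n).subtype) ∘ₗ
    (DirectSum.decomposeLinearEquiv 𝒲).toLinearMap

/-- The parity automorphism `x ↦ (-1)^{∂x} x`. -/
def parity {W : Type u} [Ring W] [Algebra ℂ W] (𝒲 : ℕ → Submodule ℂ W) [GradedAlgebra 𝒲] :
    W →ₗ[ℂ] W :=
  degreeScale 𝒲 fun n => (-1) ^ n

/-- The opposite of a complex algebra, with the conjugate scalar multiplication. An algebra
homomorphism into it is a conjugate-linear antihomomorphism into the original algebra. -/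
def ConjOp (W : Type u) : Type u := Wᵐᵒᵖ

instance (W : Type u) [Ring W] : Ring (ConjOp W) := inferInstanceAs (Ring Wᵐᵒᵖ)

instance (W : Type u) [Ring W] [Algebra ℂ W] : Algebra ℂ (ConjOp W) :=
  RingHom.toAlgebra' ((algebraMap ℂ Wᵐᵒᵖ).comp (starRingEnd ℂ))
    fun c x => Algebra.commutes (A := Wᵐᵒᵖ) (starRingEnd ℂ c) x

def ConjOp.mk {W : Type u} (x : W) : ConjOp W := MulOpposite.op x

def ConjOp.un {W : Type u} (x : ConjOp W) : W := MulOpposite.unop x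

theorem ConjOp.smul_def {W : Type u} [Ring W] [Algebra ℂ W] (c : ℂ) (x : ConjOp W) :
    c • x = ConjOp.mk (star c • x.un) := by
  rw [Algebra.smul_def]
  change MulOpposite.op (x.un * algebraMap ℂ W (star c)) = MulOpposite.op _
  rw [← Algebra.commutes, Algebra.smul_def]

/-- The conjugate-linear map underlying a homomorphism into `ConjOp`. -/
def ConjOp.toAnti {X : Type u} {W : Type v} [Ring X] [Algebra ℂ X] [Ring W] [Algebra ℂ W]
    (f : X →ₐ[ℂ] ConjOp W) : X →ₗ⋆[ℂ] W where
  toFun x := (f x).un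
  map_add' x y := by rw [map_add]; rfl
  map_smul' c x := by rw [map_smul, ConjOp.smul_def]; rfl

/-- The conjugate-linear map into an algebra, as a linear map into `ConjOp`. -/
def ConjOp.ofAnti {X : Type u} {W : Type v} [AddCommGroup X] [Module ℂ X] [Ring W] [Algebra ℂ W]
    (f : X →ₗ⋆[ℂ] W) : X →ₗ[ℂ] ConjOp W where
  toFun x := ConjOp.mk (f x)
  map_add' x y := by rw [map_add]; rfl
  map_smul' c x := by rw [map_smulₛₗ, RingHom.id_apply, ConjOp.smul_def]; rfl

/-- Turns an antimultiplicative conjugate-linear map `s` into the graded one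
`x ↦ (-1)^{n(n-1)/2} s x` for `x` of degree `n`. -/
def gradedStar {W : Type u} [Ring W] [Algebra ℂ W] (𝒲 : ℕ → Submodule ℂ W) [GradedAlgebra 𝒲]
    (s : W →ₗ⋆[ℂ] W) : W →ₗ⋆[ℂ] W :=
  s.comp (degreeScale 𝒲 fun n => (-1) ^ (n * (n - 1) / 2))

/-! ### The universal differential envelope -/

section Envelope

variable {A : Type u} [Ring A] [StarRing A] [HopfAlgebra ℂ A]
variable (Γ : BicovariantStarCalculus A)

/-- The generator `a`. -/
def preInc : A →ₗ[ℂ] TensorAlgebra ℂ (A × A) := TensorAlgebra.ι ℂ ∘ₗ LinearMap.inl ℂ A A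

/-- The generator `da`. -/
def preDif : A →ₗ[ℂ] TensorAlgebra ℂ (A × A) := TensorAlgebra.ι ℂ ∘ₗ LinearMap.inr ℂ A A

/-- The relations of the envelope in the generators `a`, `da` (`a ∈ A`): those of the algebra `A`,
the Leibniz rule, the relations `∑ κ(r⁽¹⁾) dr⁽²⁾ = 0` (`r ∈ 𝓡`), which generate the relations
`∑ aₖ dbₖ = 0` of `Γ` as a left module, and their differentials. -/
inductive EnvRel : TensorAlgebra ℂ (A × A) → TensorAlgebra ℂ (A × A) → Prop
  | one : EnvRel (preInc 1) 1
  | mul (a b : A) : EnvRel (preInc (a * b)) (preInc a * preInc b)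
  | leibniz (a b : A) :
      EnvRel (preDif (a * b)) (preDif a * preInc b + preInc a * preDif b)
  | first (r : A) (hr : r ∈ Γ.ideal) :
      EnvRel (conv (preInc ∘ₗ HopfAlgebra.antipode ℂ) preDif r) 0
  | second (r : A) (hr : r ∈ Γ.ideal) :
      EnvRel (conv (preDif ∘ₗ HopfAlgebra.antipode ℂ) preDif r) 0

/-- The universal differential envelope `Γ^∧`. -/
def Env : Type u := RingQuot (EnvRel Γ)

instance : Ring (Env Γ) := inferInstanceAs (Ring (RingQuot (EnvRel Γ)))

instance : Algebra ℂ (Env Γ) := inferInstanceAs (Algebra ℂ (RingQuot (EnvRel Γ)))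

namespace Env

def mk : TensorAlgebra ℂ (A × A) →ₐ[ℂ] Env Γ := RingQuot.mkAlgHom ℂ (EnvRel Γ)

variable {Γ} in
theorem mk_rel {x y : TensorAlgebra ℂ (A × A)} (h : EnvRel Γ x y) : mk Γ x = mk Γ y :=
  RingQuot.mkAlgHom_rel ℂ h

/-- The inclusion `A → Γ^∧`. -/
def inc : A →ₐ[ℂ] Env Γ :=
  AlgHom.ofLinearMap ((mk Γ).toLinearMap ∘ₗ preInc)
    (by simpa using mk_rel (EnvRel.one (Γ := Γ)))
    (fun a b => by simpa using mk_rel (EnvRel.mul (Γ := Γ) a b))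

/-- The differential `A → Γ^∧`. -/
def dif : A →ₗ[ℂ] Env Γ := (mk Γ).toLinearMap ∘ₗ preDif

theorem dif_mul (a b : A) : dif Γ (a * b) = dif Γ a * inc Γ b + inc Γ a * dif Γ b := by
  have := mk_rel (EnvRel.leibniz (Γ := Γ) a b)
  rwa [map_add, map_mul (mk Γ) (preDif a), map_mul (mk Γ) (preInc a)] at this

theorem dif_one : dif Γ 1 = 0 := by
  have := dif_mul Γ 1 1
  simpa using this

/-- The map `π(a) = ∑ κ(a⁽¹⁾) da⁽²⁾`. -/
def germ : A →ₗ[ℂ] Env Γ := conv ((inc Γ).toLinearMap ∘ₗ HopfAlgebra.antipode ℂ) (dif Γ)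

theorem mk_conv (f g : A →ₗ[ℂ] TensorAlgebra ℂ (A × A)) (a : A) :
    mk Γ (conv f g a) = conv ((mk Γ).toLinearMap ∘ₗ f) ((mk Γ).toLinearMap ∘ₗ g) a := by
  rw [conv_repr f g (Coalgebra.Repr.arbitrary ℂ a), conv_repr _ _ (Coalgebra.Repr.arbitrary ℂ a)]
  simp

theorem germ_ideal (r : A) (hr : r ∈ Γ.ideal) : germ Γ r = 0 := by
  have := mk_rel (EnvRel.first (Γ := Γ) r hr)
  rwa [mk_conv, map_zero] at this

theorem dif_ideal (r : A) (hr : r ∈ Γ.ideal) :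
    conv (dif Γ ∘ₗ HopfAlgebra.antipode ℂ) (dif Γ) r = 0 := by
  have := mk_rel (EnvRel.second (Γ := Γ) r hr)
  rwa [mk_conv, map_zero] at this

theorem germ_one : germ Γ 1 = 0 := by
  simp [germ, conv, Bialgebra.comul_one, Algebra.TensorProduct.one_def, dif_one]

/-- Homomorphisms out of `Γ^∧`. -/
def lift {W : Type v} [Ring W] [Algebra ℂ W] (f : A →ₐ[ℂ] W) (g : A →ₗ[ℂ] W)
    (hl : ∀ a b, g (a * b) = g a * f b + f a * g b)
    (h1 : ∀ r ∈ Γ.ideal, conv (f.toLinearMap ∘ₗ HopfAlgebra.antipode ℂ) g r = 0)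
    (h2 : ∀ r ∈ Γ.ideal, conv (g ∘ₗ HopfAlgebra.antipode ℂ) g r = 0) : Env Γ →ₐ[ℂ] W :=
  RingQuot.liftAlgHom ℂ ⟨TensorAlgebra.lift ℂ (f.toLinearMap.coprod g), by
    have hc : ∀ (p q : A →ₗ[ℂ] TensorAlgebra ℂ (A × A)) (a : A),
        TensorAlgebra.lift ℂ (f.toLinearMap.coprod g) (conv p q a) =
          conv ((TensorAlgebra.lift ℂ (f.toLinearMap.coprod g)).toLinearMap ∘ₗ p)
            ((TensorAlgebra.lift ℂ (f.toLinearMap.coprod g)).toLinearMap ∘ₗ q) a := by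
      intro p q a
      rw [conv_repr p q (Coalgebra.Repr.arbitrary ℂ a),
        conv_repr _ _ (Coalgebra.Repr.arbitrary ℂ a)]
      simp
    have hi : (TensorAlgebra.lift ℂ (f.toLinearMap.coprod g)).toLinearMap ∘ₗ preInc =
        f.toLinearMap := by ext a; simp [preInc]
    have hd : (TensorAlgebra.lift ℂ (f.toLinearMap.coprod g)).toLinearMap ∘ₗ preDif = g := by
      ext a; simp [preDif]
    have hi' : ∀ a, TensorAlgebra.lift ℂ (f.toLinearMap.coprod g) (preInc a) = f a :=
      fun a => congr($hi a)
    have hd' : ∀ a, TensorAlgebra.lift ℂ (f.toLinearMap.coprod g) (preDif a) = g a :=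
      fun a => congr($hd a)
    intro x y h
    induction h with
    | one => simp [hi']
    | mul a b => simp [hi']
    | leibniz a b => simp [hi', hd', hl]
    | first r hr => rw [hc, ← LinearMap.comp_assoc, hi, hd, h1 r hr, map_zero]
    | second r hr => rw [hc, ← LinearMap.comp_assoc, hd, h2 r hr, map_zero]⟩

section lift

variable {W : Type v} [Ring W] [Algebra ℂ W] (f : A →ₐ[ℂ] W) (g : A →ₗ[ℂ] W)
    (hl : ∀ a b, g (a * b) = g a * f b + f a * g b)
    (h1 : ∀ r ∈ Γ.ideal, conv (f.toLinearMap ∘ₗ HopfAlgebra.antipode ℂ) g r = 0)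
    (h2 : ∀ r ∈ Γ.ideal, conv (g ∘ₗ HopfAlgebra.antipode ℂ) g r = 0)

@[simp] theorem lift_inc (a : A) : lift Γ f g hl h1 h2 (inc Γ a) = f a := by
  change RingQuot.liftAlgHom ℂ _ (RingQuot.mkAlgHom ℂ (EnvRel Γ) (preInc a)) = _
  rw [RingQuot.liftAlgHom_mkAlgHom_apply]
  simp [preInc]

@[simp] theorem lift_dif (a : A) : lift Γ f g hl h1 h2 (dif Γ a) = g a := by
  change RingQuot.liftAlgHom ℂ _ (RingQuot.mkAlgHom ℂ (EnvRel Γ) (preDif a)) = _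
  rw [RingQuot.liftAlgHom_mkAlgHom_apply]
  simp [preDif]

end lift

theorem hom_ext {W : Type v} [Ring W] [Algebra ℂ W] {F G : Env Γ →ₐ[ℂ] W}
    (hi : ∀ a, F (inc Γ a) = G (inc Γ a)) (hd : ∀ a, F (dif Γ a) = G (dif Γ a)) : F = G := by
  refine RingQuot.ringQuot_ext' ℂ (s := EnvRel Γ) (B := W) F G ?_
  ext a
  · exact hi a
  · exact hd a

/-- The projection `p_* : Γ^∧ → A`. -/
def proj : Env Γ →ₐ[ℂ] A :=
  lift Γ (AlgHom.id ℂ A) 0 (by simp) (by simp [conv]) (by simp [conv])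

/-- The component `Γ^{∧n} = A (dA)ⁿ`. -/
def grade (n : ℕ) : Submodule ℂ (Env Γ) :=
  LinearMap.range (inc Γ).toLinearMap * LinearMap.range (dif Γ) ^ n

theorem inc_mem (a : A) : inc Γ a ∈ grade Γ 0 := by
  rw [grade, pow_zero, mul_one]
  exact ⟨a, rfl⟩

theorem dif_mem (a : A) : dif Γ a ∈ grade Γ 1 := by
  rw [grade, pow_one, ← one_mul (dif Γ a)]
  exact Submodule.mul_mem_mul ⟨1, map_one (inc Γ)⟩ ⟨a, rfl⟩

theorem inc_mul_inc :
    LinearMap.range (inc Γ).toLinearMap * LinearMap.range (inc Γ).toLinearMap ≤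
      LinearMap.range (inc Γ).toLinearMap := by
  rw [Submodule.mul_le]
  rintro _ ⟨a, rfl⟩ _ ⟨b, rfl⟩
  exact ⟨a * b, map_mul (inc Γ) a b⟩

theorem dif_mul_inc :
    LinearMap.range (dif Γ) * LinearMap.range (inc Γ).toLinearMap ≤
      LinearMap.range (inc Γ).toLinearMap * LinearMap.range (dif Γ) := by
  rw [Submodule.mul_le]
  rintro _ ⟨a, rfl⟩ _ ⟨b, rfl⟩
  have h : dif Γ a * inc Γ b = inc Γ 1 * dif Γ (a * b) - inc Γ a * dif Γ b := by
    rw [dif_mul, map_one, one_mul, add_sub_cancel_right]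
  rw [AlgHom.toLinearMap_apply, h]
  exact sub_mem (Submodule.mul_mem_mul ⟨1, rfl⟩ ⟨a * b, rfl⟩)
    (Submodule.mul_mem_mul ⟨a, rfl⟩ ⟨b, rfl⟩)

theorem dif_pow_mul_inc (n : ℕ) :
    LinearMap.range (dif Γ) ^ n * LinearMap.range (inc Γ).toLinearMap ≤ grade Γ n := by
  induction n with
  | zero => simp [grade]
  | succ n ih =>
    rw [pow_succ, mul_assoc]
    refine (mul_le_mul_right (dif_mul_inc Γ) _).trans ?_
    rw [← mul_assoc, grade, pow_succ, ← mul_assoc]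
    exact mul_le_mul_left ih _

theorem grade_mul (m n : ℕ) : grade Γ m * grade Γ n ≤ grade Γ (m + n) := by
  have h : grade Γ m * grade Γ n = LinearMap.range (inc Γ).toLinearMap *
      (LinearMap.range (dif Γ) ^ m * LinearMap.range (inc Γ).toLinearMap) *
        LinearMap.range (dif Γ) ^ n := by simp only [grade, mul_assoc]
  rw [h]
  refine (mul_le_mul_left (mul_le_mul_right (dif_pow_mul_inc Γ m) _) _).trans ?_
  rw [grade, ← mul_assoc, mul_assoc, ← pow_add]
  exact mul_le_mul_left (inc_mul_inc Γ) _

instance : SetLike.GradedMonoid (grade Γ) where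
  one_mem := by rw [← map_one (inc Γ)]; exact inc_mem Γ 1
  mul_mem _ _ _ _ hx hy := grade_mul Γ _ _ (Submodule.mul_mem_mul hx hy)

open DirectSum in
def gradeInc : A →ₐ[ℂ] ⨁ n, grade Γ n :=
  AlgHom.ofLinearMap
    (DirectSum.lof ℂ ℕ (fun n => grade Γ n) 0 ∘ₗ
      (inc Γ).toLinearMap.codRestrict (grade Γ 0) (inc_mem Γ))
    (DirectSum.of_eq_of_gradedMonoid_eq (Sigma.subtype_ext rfl (map_one (inc Γ))))
    (fun a b => by
      rw [LinearMap.comp_apply, LinearMap.comp_apply, LinearMap.comp_apply, DirectSum.lof_eq_of,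
        DirectSum.lof_eq_of, DirectSum.lof_eq_of, DirectSum.of_mul_of]
      exact DirectSum.of_eq_of_gradedMonoid_eq (Sigma.subtype_ext rfl (map_mul (inc Γ) a b)))

open DirectSum in
def gradeDif : A →ₗ[ℂ] ⨁ n, grade Γ n :=
  DirectSum.lof ℂ ℕ (fun n => grade Γ n) 1 ∘ₗ (dif Γ).codRestrict (grade Γ 1) (dif_mem Γ)

open DirectSum in
theorem gradeInc_mul_gradeDif (a b : A) : gradeInc Γ a * gradeDif Γ b =
    DirectSum.lof ℂ ℕ (fun n => grade Γ n) 1 ⟨inc Γ a * dif Γ b, by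
      have := SetLike.mul_mem_graded (inc_mem Γ a) (dif_mem Γ b)
      rwa [zero_add] at this⟩ := by
  change DirectSum.of _ _ _ * DirectSum.of _ _ _ = _
  rw [DirectSum.of_mul_of]
  exact DirectSum.of_eq_of_gradedMonoid_eq (Sigma.subtype_ext (zero_add 1) rfl)

open DirectSum in
theorem gradeDif_mul_gradeInc (a b : A) : gradeDif Γ a * gradeInc Γ b =
    DirectSum.lof ℂ ℕ (fun n => grade Γ n) 1 ⟨dif Γ a * inc Γ b, by
      have := SetLike.mul_mem_graded (dif_mem Γ a) (inc_mem Γ b)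
      rwa [add_zero] at this⟩ := by
  change DirectSum.of _ _ _ * DirectSum.of _ _ _ = _
  rw [DirectSum.of_mul_of]
  exact DirectSum.of_eq_of_gradedMonoid_eq (Sigma.subtype_ext (add_zero 1) rfl)

open DirectSum in
theorem gradeDif_mul_gradeDif (a b : A) : gradeDif Γ a * gradeDif Γ b =
    DirectSum.lof ℂ ℕ (fun n => grade Γ n) (1 + 1) ⟨dif Γ a * dif Γ b,
      SetLike.mul_mem_graded (dif_mem Γ a) (dif_mem Γ b)⟩ := by
  change DirectSum.of _ _ _ * DirectSum.of _ _ _ = _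
  rw [DirectSum.of_mul_of]
  exact DirectSum.of_eq_of_gradedMonoid_eq (Sigma.subtype_ext rfl rfl)

open DirectSum in
def decomposeHom : Env Γ →ₐ[ℂ] ⨁ n, grade Γ n :=
  lift Γ (W := ⨁ n, grade Γ n) (gradeInc Γ) (gradeDif Γ)
    (fun a b => by
      rw [gradeInc_mul_gradeDif, gradeDif_mul_gradeInc, ← map_add]
      exact congrArg (DirectSum.lof ℂ ℕ (fun n => grade Γ n) 1) (Subtype.ext (dif_mul Γ a b)))
    (fun r hr => by
      rw [conv_repr _ _ (Coalgebra.Repr.arbitrary ℂ r)]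
      simp only [LinearMap.comp_apply, AlgHom.toLinearMap_apply, gradeInc_mul_gradeDif]
      rw [← map_sum, ← map_zero (DirectSum.lof ℂ ℕ (fun n => grade Γ n) 1)]
      refine congrArg _ (Subtype.ext ?_)
      have := germ_ideal Γ r hr
      rw [germ, conv_repr _ _ (Coalgebra.Repr.arbitrary ℂ r)] at this
      simpa using this)
    (fun r hr => by
      rw [conv_repr _ _ (Coalgebra.Repr.arbitrary ℂ r)]
      simp only [LinearMap.comp_apply, gradeDif_mul_gradeDif]
      rw [← map_sum, ← map_zero (DirectSum.lof ℂ ℕ (fun n => grade Γ n) (1 + 1))]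
      refine congrArg _ (Subtype.ext ?_)
      have := dif_ideal Γ r hr
      rw [conv_repr _ _ (Coalgebra.Repr.arbitrary ℂ r)] at this
      simpa using this)

theorem coe_decomposeHom (x : Env Γ) :
    DirectSum.coeAlgHom (grade Γ) (decomposeHom Γ x) = x := by
  have h : (DirectSum.coeAlgHom (grade Γ)).comp (decomposeHom Γ) = AlgHom.id ℂ (Env Γ) := by
    refine hom_ext Γ (fun a => ?_) (fun a => ?_)
    · rw [AlgHom.comp_apply, decomposeHom, lift_inc]
      exact DirectSum.coeAlgHom_of _ _ _
    · rw [AlgHom.comp_apply, decomposeHom, lift_dif]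
      exact DirectSum.coeAlgHom_of _ _ _
  exact congr($h x)

open DirectSum in
theorem decomposeHom_mem_range (n : ℕ) {x : Env Γ} (hx : x ∈ grade Γ n) :
    decomposeHom Γ x ∈ LinearMap.range (DirectSum.lof ℂ ℕ (fun n => grade Γ n) n) := by
  have hmul : ∀ (m n : ℕ) (x y : Env Γ),
      decomposeHom Γ x ∈ LinearMap.range (DirectSum.lof ℂ ℕ (fun n => grade Γ n) m) →
      decomposeHom Γ y ∈ LinearMap.range (DirectSum.lof ℂ ℕ (fun n => grade Γ n) n) →
      decomposeHom Γ (x * y) ∈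
        LinearMap.range (DirectSum.lof ℂ ℕ (fun n => grade Γ n) (m + n)) := by
    rintro m n x y ⟨u, hu⟩ ⟨v, hv⟩
    rw [map_mul, ← hu, ← hv, DirectSum.lof_eq_of, DirectSum.lof_eq_of, DirectSum.of_mul_of]
    exact ⟨_, rfl⟩
  have hp : ∀ y ∈ LinearMap.range (dif Γ) ^ n,
      decomposeHom Γ y ∈ LinearMap.range (DirectSum.lof ℂ ℕ (fun n => grade Γ n) n) := by
    clear hx
    intro y hy
    induction hy using Submodule.pow_induction_on_right' with
    | algebraMap r =>
      rw [AlgHom.commutes, DirectSum.algebraMap_apply]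
      exact ⟨_, rfl⟩
    | add x y i hx hy ihx ihy => rw [map_add]; exact add_mem ihx ihy
    | mul_mem i x hx ih m hm =>
      obtain ⟨a, rfl⟩ := hm
      refine hmul i 1 _ _ ih ?_
      rw [decomposeHom, lift_dif]
      exact ⟨_, rfl⟩
  refine Submodule.mul_induction_on hx ?_ ?_
  · rintro _ ⟨a, rfl⟩ y hy
    have := hmul 0 n (inc Γ a) y (by rw [decomposeHom, lift_inc]; exact ⟨_, rfl⟩) (hp y hy)
    rwa [zero_add] at this
  · intro x y hx hy
    rw [map_add]
    exact add_mem hx hy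

instance gradedAlgebra : GradedAlgebra (grade Γ) :=
  GradedAlgebra.ofAlgHom (grade Γ) (decomposeHom Γ)
    (by ext x; exact coe_decomposeHom Γ x)
    (fun n x => by
      obtain ⟨y, hy⟩ := decomposeHom_mem_range Γ n x.2
      have h := coe_decomposeHom Γ x
      rw [← hy, DirectSum.lof_eq_of, DirectSum.coeAlgHom_of] at h
      rw [← hy, Subtype.ext h, DirectSum.lof_eq_of])

/-- The differential of `Γ^∧`, as the upper right entry of the homomorphism
`x ↦ !![(-1)^{∂x} x, dx; 0, x]`. -/
def matrixHom : Env Γ →ₐ[ℂ] Matrix (Fin 2) (Fin 2) (Env Γ) :=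
  lift Γ
    (AlgHom.ofLinearMap
      { toFun := fun a => !![inc Γ a, dif Γ a; 0, inc Γ a]
        map_add' := fun a b => by ext i j; fin_cases i <;> fin_cases j <;> simp
        map_smul' := fun c a => by ext i j; fin_cases i <;> fin_cases j <;> simp }
      (by ext i j; fin_cases i <;> fin_cases j <;> simp [dif_one])
      (fun a b => by
        ext i j; fin_cases i <;> fin_cases j <;>
          simp [dif_mul, add_comm]))
    { toFun := fun a => !![-dif Γ a, 0; 0, dif Γ a]
      map_add' := fun a b => by ext i j; fin_cases i <;> fin_cases j <;> simp [add_comm]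
      map_smul' := fun c a => by ext i j; fin_cases i <;> fin_cases j <;> simp }
    (fun a b => by
      ext i j; fin_cases i <;> fin_cases j <;>
        simp [dif_mul, add_comm])
    (fun r hr => by
      have h1 := germ_ideal Γ r hr
      have h2 := dif_ideal Γ r hr
      rw [germ, conv_repr _ _ (Coalgebra.Repr.arbitrary ℂ r)] at h1
      rw [conv_repr _ _ (Coalgebra.Repr.arbitrary ℂ r)] at h2 ⊢
      simp only [LinearMap.comp_apply, AlgHom.toLinearMap_apply] at h1 h2
      ext i j; fin_cases i <;> fin_cases j <;>
        simp [Matrix.sum_apply, h1, h2])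
    (fun r hr => by
      have h2 := dif_ideal Γ r hr
      rw [conv_repr _ _ (Coalgebra.Repr.arbitrary ℂ r)] at h2 ⊢
      simp only [LinearMap.comp_apply] at h2
      ext i j; fin_cases i <;> fin_cases j <;>
        simp [Matrix.sum_apply, h2])

def d : Env Γ →ₗ[ℂ] Env Γ := Matrix.entryLinearMap ℂ (Env Γ) 0 1 ∘ₗ (matrixHom Γ).toLinearMap

theorem d_inc (a : A) : d Γ (inc Γ a) = dif Γ a := by
  simp [d, matrixHom]

theorem d_inc_mul_dif (a b : A) : d Γ (inc Γ a * dif Γ b) = dif Γ a * dif Γ b := by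
  simp [d, matrixHom]

open WithConv in
/-- `dκ(a⁽¹⁾) a⁽²⁾ = -π(a)`. -/
theorem conv_dif_antipode_inc :
    conv (dif Γ ∘ₗ HopfAlgebra.antipode ℂ) (inc Γ).toLinearMap = -germ Γ := by
  ext a
  have h : dif Γ (∑ i ∈ (Coalgebra.Repr.arbitrary ℂ a).index,
      HopfAlgebra.antipode ℂ ((Coalgebra.Repr.arbitrary ℂ a).left i) *
        (Coalgebra.Repr.arbitrary ℂ a).right i) = 0 := by
    rw [HopfAlgebra.sum_antipode_mul_eq_algebraMap_counit, Algebra.algebraMap_eq_smul_one,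
      map_smul, dif_one, smul_zero]
  rw [map_sum] at h
  simp only [dif_mul, Finset.sum_add_distrib] at h
  rw [LinearMap.neg_apply, germ, conv_repr _ _ (Coalgebra.Repr.arbitrary ℂ a),
    conv_repr _ _ (Coalgebra.Repr.arbitrary ℂ a)]
  exact eq_neg_of_add_eq_zero_left h

open WithConv in
/-- `dπ(a) = -∑ π(a⁽¹⁾) π(a⁽²⁾)`. -/
theorem d_germ (a : A) : d Γ (germ Γ a) = -conv (germ Γ) (germ Γ) a := by
  have h1 : d Γ (germ Γ a) = conv (dif Γ ∘ₗ HopfAlgebra.antipode ℂ) (dif Γ) a := by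
    rw [germ, conv_repr _ _ (Coalgebra.Repr.arbitrary ℂ a),
      conv_repr _ _ (Coalgebra.Repr.arbitrary ℂ a), map_sum]
    simp [d_inc_mul_dif]
  have h2 : dif Γ ∘ₗ HopfAlgebra.antipode ℂ =
      -conv (germ Γ) ((inc Γ).toLinearMap ∘ₗ HopfAlgebra.antipode ℂ) := by
    apply toConv_injective
    have h3 : toConv (dif Γ ∘ₗ HopfAlgebra.antipode ℂ) * toConv (inc Γ).toLinearMap =
        -toConv (germ Γ) := congrArg toConv (conv_dif_antipode_inc Γ)
    calc toConv (dif Γ ∘ₗ HopfAlgebra.antipode ℂ)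
        = toConv (dif Γ ∘ₗ HopfAlgebra.antipode ℂ) * (toConv (inc Γ).toLinearMap *
            toConv ((inc Γ).toLinearMap ∘ₗ HopfAlgebra.antipode ℂ)) := by
          rw [conv_antipode_right, mul_one]
      _ = -(toConv (germ Γ) * toConv ((inc Γ).toLinearMap ∘ₗ HopfAlgebra.antipode ℂ)) := by
          rw [← mul_assoc, h3, neg_mul]
  have h4 : conv (dif Γ ∘ₗ HopfAlgebra.antipode ℂ) (dif Γ) = -conv (germ Γ) (germ Γ) := by
    conv_lhs => rw [h2]
    have h5 : conv (conv (germ Γ) ((inc Γ).toLinearMap ∘ₗ HopfAlgebra.antipode ℂ)) (dif Γ) =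
        conv (germ Γ) (germ Γ) := by rw [conv_assoc]; rfl
    rw [← h5]
    exact congrArg ofConv (neg_mul (toConv (conv (germ Γ) _)) (toConv (dif Γ)))
  rw [h1, h4, LinearMap.neg_apply]

section Star

variable [StarModule ℂ A] [HopfStarAlgebra A]

theorem antipode_star_antipode (a : A) :
    HopfAlgebra.antipode ℂ (star (HopfAlgebra.antipode ℂ a)) = star a := by
  have := HopfStarAlgebra.antipode_star (star a)
  rwa [star_star] at this

theorem conv_star_antipode {W : Type v} [Ring W] [Algebra ℂ W] (f g : A →ₗ[ℂ] W) {r : A}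
    {ι : Type*} (s : Coalgebra.Repr ℂ r ι) :
    conv (f ∘ₗ HopfAlgebra.antipode ℂ) g (star (HopfAlgebra.antipode ℂ r)) =
      ∑ i ∈ s.index, f (star (s.right i)) * g (star (HopfAlgebra.antipode ℂ (s.left i))) := by
  rw [conv, LinearMap.comp_apply, LinearMap.comp_apply, HopfStarAlgebra.comul_star,
    comul_antipode s]
  simp [star_sum, antipode_star_antipode]

/-- The antimultiplicative conjugate-linear map with `a ↦ a*` and `da ↦ d(a*)`. -/
def antiHom : Env Γ →ₐ[ℂ] ConjOp (Env Γ) :=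
  lift Γ
    (AlgHom.ofLinearMap
      (ConjOp.ofAnti ((inc Γ).toLinearMap.comp (starLinearEquiv ℂ (A := A)).toLinearMap))
      (by
        change MulOpposite.op (inc Γ (star 1)) = MulOpposite.op 1
        rw [star_one, map_one])
      (fun a b => by
        change MulOpposite.op (inc Γ (star (a * b))) =
          MulOpposite.op (inc Γ (star b) * inc Γ (star a))
        rw [star_mul, map_mul]))
    (ConjOp.ofAnti ((dif Γ).comp (starLinearEquiv ℂ (A := A)).toLinearMap))
    (fun a b => by
      change MulOpposite.op (dif Γ (star (a * b))) =
        MulOpposite.op (inc Γ (star b) * dif Γ (star a)) +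
          MulOpposite.op (dif Γ (star b) * inc Γ (star a))
      rw [star_mul, dif_mul, add_comm, MulOpposite.op_add])
    (fun r hr => by
      have h := congr($(conv_dif_antipode_inc Γ) (star (HopfAlgebra.antipode ℂ r)))
      rw [LinearMap.neg_apply, germ_ideal Γ _ (Γ.star_mem r hr), neg_zero,
        conv_star_antipode _ _ (Coalgebra.Repr.arbitrary ℂ r)] at h
      rw [conv_repr _ _ (Coalgebra.Repr.arbitrary ℂ r)]
      have h' := congrArg (MulOpposite.opAddEquiv (α := Env Γ)) h
      rw [map_sum] at h'
      exact h')
    (fun r hr => by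
      have h := dif_ideal Γ _ (Γ.star_mem r hr)
      rw [conv_star_antipode _ _ (Coalgebra.Repr.arbitrary ℂ r)] at h
      rw [conv_repr _ _ (Coalgebra.Repr.arbitrary ℂ r)]
      have h' := congrArg (MulOpposite.opAddEquiv (α := Env Γ)) h
      rw [map_sum] at h'
      exact h')

/-- The graded `*`-structure of `Γ^∧`, with `(αβ)* = (-1)^{∂α∂β} β* α*` and `(dα)* = d(α*)`. -/
def st : Env Γ →ₗ⋆[ℂ] Env Γ := gradedStar (grade Γ) (ConjOp.toAnti (antiHom Γ))

end Star

end Env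

/-! ### Left-invariant forms -/

/-- `Γ_inv = A / (ℂ1 ⊕ 𝓡)`, the space of left-invariant elements of `Γ`. -/
abbrev LeftInv : Type u := A ⧸ (Submodule.span ℂ {(1 : A)} ⊔ Γ.ideal)

namespace LeftInv

/-- The projection `π : A → Γ_inv`. -/
def proj : A →ₗ[ℂ] LeftInv Γ := Submodule.mkQ _

variable {Γ} in
theorem le_ker {W : Type v} [AddCommGroup W] [Module ℂ W] {σ : ℂ →+* ℂ} {f : A →ₛₗ[σ] W}
    (h1 : f 1 = 0) (hr : ∀ r ∈ Γ.ideal, f r = 0) :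
    Submodule.span ℂ {(1 : A)} ⊔ Γ.ideal ≤ LinearMap.ker f :=
  sup_le (by simpa [Submodule.span_le] using h1) hr

theorem proj_one : proj Γ 1 = 0 :=
  (Submodule.Quotient.mk_eq_zero _).2
    (Submodule.mem_sup_left (Submodule.mem_span_singleton_self 1))

theorem proj_ideal (r : A) (hr : r ∈ Γ.ideal) : proj Γ r = 0 :=
  (Submodule.Quotient.mk_eq_zero _).2 (Submodule.mem_sup_right hr)

/-- The inclusion `Γ_inv → Γ^∧`, `π(a) ↦ ∑ κ(a⁽¹⁾) da⁽²⁾`. -/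
def toEnv : LeftInv Γ →ₗ[ℂ] Env Γ :=
  Submodule.liftQ _ (Env.germ Γ) (le_ker (Env.germ_one Γ) (Env.germ_ideal Γ))

/-- The right `A`-module structure `π(a) ∘ b = π(ab - ε(a)b)`. -/
def circ : LeftInv Γ →ₗ[ℂ] A →ₗ[ℂ] LeftInv Γ :=
  Submodule.liftQ _
    ((LinearMap.mul ℂ A).compr₂ (proj Γ) -
      (Coalgebra.counit : A →ₗ[ℂ] ℂ).smulRight (proj Γ))
    (le_ker (by ext b; simp) (fun r hr => by
      ext b; simp [proj_ideal Γ _ (Γ.mul_mem r hr b), Γ.counit_eq_zero r hr]))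

/-- The adjoint coaction `ϖ π = (π ⊗ id) ad`. -/
def coact : LeftInv Γ →ₗ[ℂ] LeftInv Γ ⊗[ℂ] A :=
  Submodule.liftQ _ ((proj Γ).rTensor A ∘ₗ ad A)
    (le_ker (by simp [ad, Algebra.TensorProduct.one_def, proj_one]) (fun r hr => by
      obtain ⟨t, ht⟩ := Γ.ad_mem r hr
      have h : proj Γ ∘ₗ Γ.ideal.subtype = 0 := by
        ext x; exact proj_ideal Γ x x.2
      rw [LinearMap.comp_apply, ← ht, ← LinearMap.comp_apply, ← LinearMap.rTensor_comp, h,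
        LinearMap.rTensor_zero, LinearMap.zero_apply]))

/-- The `*`-structure `π(a)* = -π(κ(a)*)`. -/
def st [StarModule ℂ A] : LeftInv Γ →ₗ⋆[ℂ] LeftInv Γ :=
  Submodule.liftQ _
    (-((proj Γ).comp ((starLinearEquiv ℂ (A := A)).toLinearMap.comp (HopfAlgebra.antipode ℂ))))
    (le_ker (by simp [proj_one]) (fun r hr => by simp [proj_ideal Γ _ (Γ.star_mem r hr)]))

end LeftInv

/-- `Γ_inv^⊗`. -/
abbrev InvTensor : Type u := TensorAlgebra ℂ (LeftInv Γ)

namespace InvTensor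

/-- The component `Γ_inv^{⊗n}`. -/
abbrev grade : ℕ → Submodule ℂ (InvTensor Γ) :=
  fun n => LinearMap.range (TensorAlgebra.ι ℂ : LeftInv Γ →ₗ[ℂ] InvTensor Γ) ^ n

/-- The graded `*`-structure of `Γ_inv^⊗`. -/
def st [StarModule ℂ A] : InvTensor Γ →ₗ⋆[ℂ] InvTensor Γ :=
  gradedStar (grade Γ) (ConjOp.toAnti (TensorAlgebra.lift ℂ
    (ConjOp.ofAnti ((TensorAlgebra.ι ℂ : LeftInv Γ →ₗ[ℂ] InvTensor Γ).comp (LeftInv.st Γ)))))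

/-- The adjoint coaction on `Γ_inv^⊗`, the multiplicative extension of `ϖ`. -/
def coact : InvTensor Γ →ₐ[ℂ] InvTensor Γ ⊗[ℂ] A :=
  TensorAlgebra.lift ℂ
    ((TensorAlgebra.ι ℂ : LeftInv Γ →ₗ[ℂ] InvTensor Γ).rTensor A ∘ₗ LeftInv.coact Γ)

/-- The extension of `∘` to `Γ_inv^⊗` with `1 ∘ a = ε(a)1` and
`(ϑη) ∘ a = ∑ (ϑ ∘ a⁽¹⁾)(η ∘ a⁽²⁾)`: multiplicative for the convolution product. -/
def circ : InvTensor Γ →ₐ[ℂ] WithConv (A →ₗ[ℂ] InvTensor Γ) :=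
  TensorAlgebra.lift ℂ ((WithConv.linearEquiv ℂ (A →ₗ[ℂ] InvTensor Γ)).symm.toLinearMap ∘ₗ
    (LeftInv.circ Γ).compr₂ (TensorAlgebra.ι ℂ))

/-- The canonical homomorphism `Γ_inv^⊗ → Γ^∧`. -/
def toEnv : InvTensor Γ →ₐ[ℂ] Env Γ := TensorAlgebra.lift ℂ (LeftInv.toEnv Γ)

end InvTensor

/-- The left-invariant subalgebra `Γ_inv^∧ ⊆ Γ^∧`, generated by `Γ_inv`. -/
abbrev InvEnv : Subalgebra ℂ (Env Γ) := (InvTensor.toEnv Γ).range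

theorem d_toEnv_mem (ϑ : LeftInv Γ) : Env.d Γ (LeftInv.toEnv Γ ϑ) ∈ InvEnv Γ := by
  obtain ⟨a, rfl⟩ := Submodule.mkQ_surjective _ ϑ
  have hg : ∀ b, Env.germ Γ b ∈ InvEnv Γ := fun b =>
    ⟨TensorAlgebra.ι ℂ (LeftInv.proj Γ b), TensorAlgebra.lift_ι_apply _ _⟩
  change Env.d Γ (Env.germ Γ a) ∈ _
  rw [Env.d_germ, conv_repr _ _ (Coalgebra.Repr.arbitrary ℂ a)]
  exact neg_mem (sum_mem fun i _ => mul_mem (hg _) (hg _))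

/-- A grade-preserving hermitian section `ι : Γ_inv^∧ → Γ_inv^⊗` of the factorization map,
intertwining the adjoint actions. As `Γ_inv^⊗ → Γ_inv^∧` is onto and compatible with gradings, `*`
and adjoint actions, the conditions are stated on elements of `Γ_inv^⊗`. -/
structure EnvSection [StarModule ℂ A] where
  sec : InvEnv Γ →ₗ[ℂ] InvTensor Γ
  isSection : ∀ x : InvEnv Γ, InvTensor.toEnv Γ (sec x) = x
  grade_mem : ∀ (n : ℕ) (t : InvTensor Γ), t ∈ InvTensor.grade Γ n →
    sec ((InvTensor.toEnv Γ).rangeRestrict t) ∈ InvTensor.grade Γ n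
  hermitian : ∀ t : InvTensor Γ,
    sec ((InvTensor.toEnv Γ).rangeRestrict (InvTensor.st Γ t)) =
      InvTensor.st Γ (sec ((InvTensor.toEnv Γ).rangeRestrict t))
  covariant : ∀ t : InvTensor Γ,
    InvTensor.coact Γ (sec ((InvTensor.toEnv Γ).rangeRestrict t)) =
      (sec ∘ₗ (InvTensor.toEnv Γ).rangeRestrict.toLinearMap).rTensor A (InvTensor.coact Γ t)

namespace EnvSection

variable {Γ} [StarModule ℂ A] (s : EnvSection Γ)

/-- The embedded differential `δ = ι d : Γ_inv → Γ_inv^{⊗2}`. -/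
def delta : LeftInv Γ →ₗ[ℂ] InvTensor Γ :=
  s.sec ∘ₗ (Env.d Γ ∘ₗ LeftInv.toEnv Γ).codRestrict (Subalgebra.toSubmodule (InvEnv Γ))
    (d_toEnv_mem Γ)

/-- `ρ(ϑ,a) = δ(ϑ)∘a - δ(ϑ∘a) - (ϑ∘a⁽¹⁾)⊗π(a⁽²⁾) - π(a⁽¹⁾)⊗(ϑ∘a⁽²⁾)`. -/
def rho (ϑ : LeftInv Γ) : A →ₗ[ℂ] InvTensor Γ :=
  (InvTensor.circ Γ (s.delta ϑ)).ofConv - s.delta ∘ₗ LeftInv.circ Γ ϑ -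
    conv (TensorAlgebra.ι ℂ ∘ₗ LeftInv.circ Γ ϑ) (TensorAlgebra.ι ℂ ∘ₗ LeftInv.proj Γ) -
    conv (TensorAlgebra.ι ℂ ∘ₗ LeftInv.proj Γ) (TensorAlgebra.ι ℂ ∘ₗ LeftInv.circ Γ ϑ)

end EnvSection

end Envelope

/-! ### Quantum principal bundles and their calculi -/

section Bundle

/-- A quantum principal bundle `P = (𝓑, i, F)` over the quantum space represented by `V`, with the
structure quantum group represented by `A`. -/
structure QuantumPrincipalBundle (A : Type u) [Ring A] [StarRing A] [HopfAlgebra ℂ A]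
    [StarModule ℂ A] (V : Type*) [Ring V] [StarRing V] [Algebra ℂ V] [StarModule ℂ V]
    (B : Type v) [Ring B] [StarRing B] [Algebra ℂ B] [StarModule ℂ B] where
  i : V →⋆ₐ[ℂ] B
  F : B →⋆ₐ[ℂ] B ⊗[ℂ] A
  coassoc : ∀ b : B, TensorProduct.assoc ℂ B A A (F.toAlgHom.toLinearMap.rTensor A (F b)) =
    Coalgebra.comul.lTensor B (F b)
  counit : ∀ b : B, (Coalgebra.counit : A →ₗ[ℂ] ℂ).lTensor B (F b) = b ⊗ₜ 1
  i_injective : Function.Injective i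
  mem_range_i : ∀ b : B, b ∈ Set.range i ↔ F b = b ⊗ₜ 1
  /-- The action is free: every `1 ⊗ a` is of the form `∑ qₖ F(bₖ)`. -/
  free : ∀ a : A, ∃ (n : ℕ) (q b : Fin n → B), ∑ k, (q k ⊗ₜ[ℂ] (1 : A)) * F (b k) = 1 ⊗ₜ a

variable {A : Type u} [Ring A] [StarRing A] [HopfAlgebra ℂ A] [StarModule ℂ A]
  [HopfStarAlgebra A]
variable {V : Type*} [Ring V] [StarRing V] [Algebra ℂ V] [StarModule ℂ V]
variable {B : Type v} [Ring B] [StarRing B] [Algebra ℂ B] [StarModule ℂ B]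

/-- A differential calculus `Ω(P)` on a quantum principal bundle: a graded-differential `*`-algebra
with `Ω⁰(P) = 𝓑`, generated by `𝓑`, such that `F` extends to a homomorphism
`F̂ : Ω(P) → Ω(P) ⊗̂ Γ^∧` of graded-differential `*`-algebras. -/
structure BundleCalculus (P : QuantumPrincipalBundle A V B) (Γ : BicovariantStarCalculus A) where
  Ω : Type w
  [ring : Ring Ω]
  [algebra : Algebra ℂ Ω]
  gr : ℕ → Submodule ℂ Ω
  [graded : GradedAlgebra gr]
  d : Ω →ₗ[ℂ] Ω
  st : Ω →ₗ⋆[ℂ] Ω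
  d_mem : ∀ (n : ℕ) (x : Ω), x ∈ gr n → d x ∈ gr (n + 1)
  d_d : ∀ x : Ω, d (d x) = 0
  d_mul : ∀ (n : ℕ) (x y : Ω), x ∈ gr n → d (x * y) = d x * y + (-1) ^ n * (x * d y)
  st_mem : ∀ (n : ℕ) (x : Ω), x ∈ gr n → st x ∈ gr n
  st_st : ∀ x : Ω, st (st x) = x
  st_mul : ∀ (m n : ℕ) (x y : Ω), x ∈ gr m → y ∈ gr n →
    st (x * y) = (-1) ^ (m * n) * (st y * st x)
  st_d : ∀ x : Ω, st (d x) = d (st x)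
  /-- the identification of `𝓑` with `Ω⁰(P)` -/
  incl : B →ₐ[ℂ] Ω
  incl_injective : Function.Injective incl
  range_incl : LinearMap.range incl.toLinearMap = gr 0
  incl_star : ∀ b : B, incl (star b) = st (incl b)
  generated : Algebra.adjoin ℂ (Set.range incl ∪ Set.range fun b => d (incl b)) = ⊤
  Fhat : Ω →ₗ[ℂ] Ω ⊗[ℂ] Env Γ
  Fhat_one : Fhat 1 = 1 ⊗ₜ 1
  Fhat_mul : ∀ x y : Ω, GradedTensorProduct.of ℂ gr (Env.grade Γ) (Fhat (x * y)) =
    GradedTensorProduct.of ℂ gr (Env.grade Γ) (Fhat x) *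
      GradedTensorProduct.of ℂ gr (Env.grade Γ) (Fhat y)
  Fhat_mem : ∀ (n : ℕ) (x : Ω), x ∈ gr n → Fhat x ∈
    ⨆ (i : ℕ) (j : ℕ) (_ : i + j = n),
      LinearMap.range (TensorProduct.map (gr i).subtype (Env.grade Γ j).subtype)
  Fhat_d : ∀ x : Ω, Fhat (d x) =
    TensorProduct.map d LinearMap.id (Fhat x) +
      TensorProduct.map (parity gr) (Env.d Γ) (Fhat x)
  Fhat_st : ∀ x : Ω, Fhat (st x) = TensorProduct.map st (Env.st Γ) (Fhat x)
  Fhat_incl : ∀ b : B, Fhat (incl b) =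
    TensorProduct.map incl.toLinearMap (Env.inc Γ).toLinearMap (P.F b)

attribute [instance] BundleCalculus.ring BundleCalculus.algebra BundleCalculus.graded

namespace BundleCalculus

variable {P : QuantumPrincipalBundle A V B} {Γ : BicovariantStarCalculus A}
variable (C : BundleCalculus.{u, v, w} P Γ)

/-- The right action `F^∧ = (id ⊗ p_*) F̂ : Ω(P) → Ω(P) ⊗ A`. -/
def act : C.Ω →ₗ[ℂ] C.Ω ⊗[ℂ] A := (Env.proj Γ).toLinearMap.lTensor C.Ω ∘ₗ C.Fhat

/-- The horizontal forms `hor(P) = F̂⁻¹(Ω(P) ⊗ A)`. -/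
def hor : Submodule ℂ C.Ω :=
  (LinearMap.range ((Env.inc Γ).toLinearMap.lTensor C.Ω)).comap C.Fhat

/-- `∑ φₖ f(cₖ)`, where `F^∧(φ) = ∑ φₖ ⊗ cₖ`. -/
def twist (φ : C.Ω) (f : A →ₗ[ℂ] C.Ω) : C.Ω :=
  LinearMap.mul' ℂ C.Ω (f.lTensor C.Ω (C.act φ))

/-- A connection on `P`: a hermitian first-order map `ω : Γ_inv → Ω(P)` with
`F̂ ω(ϑ) = (ω ⊗ id) ϖ(ϑ) + 1 ⊗ ϑ`. -/
structure Connection where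
  ω : LeftInv Γ →ₗ[ℂ] C.Ω
  mem_one : ∀ ϑ, ω ϑ ∈ C.gr 1
  hermitian : ∀ ϑ, ω (LeftInv.st Γ ϑ) = C.st (ω ϑ)
  Fhat_ω : ∀ ϑ, C.Fhat (ω ϑ) =
    TensorProduct.map ω (Env.inc Γ).toLinearMap (LeftInv.coact Γ ϑ) + 1 ⊗ₜ LeftInv.toEnv Γ ϑ

namespace Connection

variable {C} (W : C.Connection) (s : EnvSection Γ)

/-- The multiplicative extension `ω^⊗`. -/
def tensor : InvTensor Γ →ₐ[ℂ] C.Ω := TensorAlgebra.lift ℂ W.ω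

/-- The decomposition map `m_ω(φ ⊗ ϑ) = φ ω^∧(ϑ)`, with `ω^∧ = ω^⊗ ι`. -/
def decomp : C.hor ⊗[ℂ] InvEnv Γ →ₗ[ℂ] C.Ω :=
  LinearMap.mul' ℂ C.Ω ∘ₗ TensorProduct.map C.hor.subtype (W.tensor.toLinearMap ∘ₗ s.sec)

open Classical in
/-- The inverse of the decomposition map `m_ω`, which is a bijection for every connection (the value
`0` in the definition is never taken). -/
def decompInv : C.Ω →ₗ[ℂ] C.hor ⊗[ℂ] InvEnv Γ :=
  if h : Function.Bijective (W.decomp s) then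
    (LinearEquiv.ofBijective (W.decomp s) h).symm.toLinearMap
  else 0

/-- The horizontal projection `h_ω = (id ⊗ p_*) m_ω⁻¹`; the values of `p_*` on `Γ_inv^∧` are
scalars, which are read off with the counit. -/
def horProj : C.Ω →ₗ[ℂ] C.hor :=
  (TensorProduct.rid ℂ C.hor).toLinearMap ∘ₗ
    ((Coalgebra.counit : A →ₗ[ℂ] ℂ) ∘ₗ (Env.proj Γ).toLinearMap ∘ₗ
      (InvEnv Γ).val.toLinearMap).lTensor C.hor ∘ₗ W.decompInv s

/-- The covariant derivative `D_ω = h_ω d`. -/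
def D : C.Ω →ₗ[ℂ] C.Ω := C.hor.subtype ∘ₗ W.horProj s ∘ₗ C.d

/-- The curvature `R_ω = D_ω ω`. -/
def curvature : LeftInv Γ →ₗ[ℂ] C.Ω := W.D s ∘ₗ W.ω

/-- `ℓ_ω(ϑ, φ) = ω(ϑ)φ - (-1)^{∂φ} ∑ φₖ ω(ϑ ∘ cₖ)`. -/
def ell (ϑ : LeftInv Γ) (φ : C.Ω) : C.Ω :=
  W.ω ϑ * φ - C.twist (parity C.gr φ) (W.ω ∘ₗ LeftInv.circ Γ ϑ)

/-- `ω` is regular: `ω(ϑ)φ = (-1)^{∂φ} ∑ φₖ ω(ϑ ∘ cₖ)` for all horizontal `φ`. -/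
def IsRegular : Prop := ∀ (ϑ : LeftInv Γ), ∀ φ ∈ C.hor,
  W.ω ϑ * φ = C.twist (parity C.gr φ) (W.ω ∘ₗ LeftInv.circ Γ ϑ)

/-- `u_ω(ϑ, a) = ω^⊗ ρ(ϑ, a)`. -/
def u (ϑ : LeftInv Γ) : A →ₗ[ℂ] C.Ω := W.tensor.toLinearMap ∘ₗ s.rho ϑ

/-- `n_ω(ϑ, φ) = R_ω(ϑ)φ - ∑ φₖ R_ω(ϑ ∘ cₖ) + ∑ φₖ u_ω(ϑ, cₖ)`. -/
def n (ϑ : LeftInv Γ) (φ : C.Ω) : C.Ω :=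
  W.curvature s ϑ * φ - C.twist φ (W.curvature s ∘ₗ LeftInv.circ Γ ϑ) + C.twist φ (W.u s ϑ)

/-- The two-sided ideal `𝓝_ω` of `hor(P)` generated by all `ℓ_ω(ϑ, φ)` and `n_ω(ϑ, φ)`, with
`ϑ ∈ Γ_inv` and `φ ∈ hor(P)`: the linear span of the products `α x β` of such a generator `x` with
`α, β ∈ hor(P)`. -/
def irregIdeal : Submodule ℂ C.Ω :=
  Submodule.span ℂ {y | ∃ α ∈ C.hor, ∃ β ∈ C.hor, ∃ (ϑ : LeftInv Γ), ∃ φ ∈ C.hor,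
    y = α * W.ell ϑ φ * β ∨ y = α * W.n s ϑ φ * β}

end Connection

/-- A homomorphism of calculi on `P`: a homomorphism of graded-differential `*`-algebras which is
the identity on `𝓑` and intertwines the maps `F̂`. -/
structure Hom (C C' : BundleCalculus.{u, v, w} P Γ) where
  toAlgHom : C.Ω →ₐ[ℂ] C'.Ω
  map_mem : ∀ (n : ℕ) (x : C.Ω), x ∈ C.gr n → toAlgHom x ∈ C'.gr n
  map_d : ∀ x : C.Ω, toAlgHom (C.d x) = C'.d (toAlgHom x)
  map_st : ∀ x : C.Ω, toAlgHom (C.st x) = C'.st (toAlgHom x)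
  map_incl : ∀ b : B, toAlgHom (C.incl b) = C'.incl b
  map_Fhat : ∀ x : C.Ω, C'.Fhat (toAlgHom x) =
    toAlgHom.toLinearMap.rTensor (Env Γ) (C.Fhat x)

end BundleCalculus

end Bundle

end QPB

end

open scoped TensorProduct

noncomputable section

namespace QPB

universe u v w

open WithConv

/-! ### Convolution calculus -/

section Convolution

variable {A : Type u} [Ring A] [HopfAlgebra ℂ A] {W : Type v} [Ring W] [Algebra ℂ W]

/-! The two families of generators are one family and its differentials. For horizontal `φ` the
element `ℓ_ω(ϑ, φ)` is horizontal, because the fibre term `1 ⊗ ϑ` of `F̂ω(ϑ)` contributes equally to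
both of its summands (`FhatHom_ell`). Modulo the `ℓ`'s, `ω` moves past horizontal forms as if it
were regular. Expanding `dℓ_ω(ϑ, φ)` with `dω = R_ω + ω^⊗δ` then gives exactly `n_ω(ϑ, φ)`, where
`u_ω` collects the products of two values of `ω` (`map_n`). Hence `𝓝_ω Ω(P)` is the differential
ideal of `Ω(P)` generated by the `ℓ_ω(ϑ, φ)`. Since `F^∧` and `*` commute with `d`, its stability is
decided on the `ℓ`'s: there `F^∧` acts through the adjoint coaction (`act_ell`), and `ℓ_ω(ϑ, φ)*` is
again a combination of such elements (`st_ell`).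

The way back from `Ω(P)` to horizontal forms is the projection `h_ω`. It is left `hor(P)`-linear and
is the identity on `hor(P)`, so `hor(P) ∩ NΩ(P) = N` for every compatible ideal `N` of `hor(P)`
(`mem_of_mem_mul_top`), and `D_ω = h_ω d` preserves `𝓝_ω`. That `NΩ(P)` is two-sided follows from
the rule for moving `ω(ϑ)` past `N`, whose error terms `ℓ` remain in `N`
(`IsHorIdeal.mul_mem_left`).

The bijectivity of `m_ω`, on which `h_ω` depends, is proved rather than assumed. The kernel of
`Γ_inv^⊗ → Γ^∧` is generated by the elements `q(r) = ∑ π(r⁽¹⁾) ⊗ π(r⁽²⁾)` with `r ∈ 𝓡`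
(`mem_relIdeal_of_toEnv_eq_zero`), as one sees by letting `Γ^∧` act on the quadratic algebra. The
map `a ↦ dω(π(a)) + ∑ ω(π(a⁽¹⁾)) ω(π(a⁽²⁾))` has horizontal values, and `π(r) = 0`, so `ω^⊗(q(r))`
is horizontal (`tensor_quad_mem_hor`). Replacing a tensor by its `ι`-representative therefore costs
only terms of lower filtration, whence surjectivity. Injectivity holds because the leading term of
`F̂ω^⊗(t)` is `1 ⊗ t`. The same fact makes `R_ω` and `u_ω` horizontal, since `δ(π(a)) + q(a)` and
`ρ(ϑ, a)` are quadratic relations.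

All structure passes to `Ω(P) / 𝓝_ω Ω(P)`. The generators have positive degree, so `𝓑` is not
affected. The quotient map intertwines the decompositions, hence the horizontal projections, so
`hor'(P)` is the image of `hor(P)`, and regularity is the vanishing of the images of the `ℓ`'s.

Most computations take place in the convolution algebra of maps on `A`, which acts on maps out of
`Ω(P)` through `F^∧` (`pr`). There Sweedler sums become associativity and cancellation against the
antipode. -/

/-- The constant `w`, as the element `a ↦ ε(a) w` of the convolution algebra. -/
def cst (w : W) : WithConv (A →ₗ[ℂ] W) := toConv ((Coalgebra.counit : A →ₗ[ℂ] ℂ).smulRight w)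

@[simp] theorem cst_apply (w : W) (a : A) :
    (cst w : WithConv (A →ₗ[ℂ] W)).ofConv a = Coalgebra.counit (R := ℂ) a • w := rfl

/-- Together with `mul_cst_apply`, this lets fixed elements of `W` enter convolution identities as
factors. -/
theorem cst_mul_apply (w : W) (f : WithConv (A →ₗ[ℂ] W)) (a : A) :
    (cst w * f).ofConv a = w * f.ofConv a := by
  have h : cst w * f = toConv (LinearMap.mulLeft ℂ w ∘ₗ (1 * f).ofConv) := by
    ext b
    rw [(Coalgebra.Repr.arbitrary ℂ b).convMul_apply]
    change _ = w * (1 * f).ofConv b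
    rw [(Coalgebra.Repr.arbitrary ℂ b).convMul_apply, Finset.mul_sum]
    simp [Algebra.algebraMap_eq_smul_one]
  rw [h, one_mul]
  rfl

theorem mul_cst_apply (w : W) (f : WithConv (A →ₗ[ℂ] W)) (a : A) :
    (f * cst w).ofConv a = f.ofConv a * w := by
  have h : f * cst w = toConv (LinearMap.mulRight ℂ w ∘ₗ (f * 1).ofConv) := by
    ext b
    rw [(Coalgebra.Repr.arbitrary ℂ b).convMul_apply]
    change _ = (f * 1).ofConv b * w
    rw [(Coalgebra.Repr.arbitrary ℂ b).convMul_apply, Finset.sum_mul]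
    simp [Algebra.algebraMap_eq_smul_one]
  rw [h, mul_one]
  rfl

theorem cst_mul (x y : W) : (cst (x * y) : WithConv (A →ₗ[ℂ] W)) = cst x * cst y := by
  ext a
  rw [cst_mul_apply]
  simp

theorem comp_cst {W' : Type*} [Ring W'] [Algebra ℂ W'] (h : W →ₐ[ℂ] W') (w : W) :
    toConv (h.toLinearMap ∘ₗ (cst w : WithConv (A →ₗ[ℂ] W)).ofConv) = cst (h w) := by
  ext a
  exact map_smul h _ w

/-- Splitting the coproduct into two convolution factors exposes the inclusion of `A` on the right,
which can then be cancelled against its composite with the antipode. -/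
theorem toConv_map_comul (f : A →ₗ[ℂ] W) :
    toConv (TensorProduct.map f LinearMap.id ∘ₗ Coalgebra.comul : A →ₗ[ℂ] W ⊗[ℂ] A) =
    toConv ((Algebra.TensorProduct.includeLeft : W →ₐ[ℂ] W ⊗[ℂ] A).toLinearMap ∘ₗ f) *
    toConv (Algebra.TensorProduct.includeRight : A →ₐ[ℂ] W ⊗[ℂ] A).toLinearMap := by
  ext a
  rw [(Coalgebra.Repr.arbitrary ℂ a).convMul_apply]
  simp [← (Coalgebra.Repr.arbitrary ℂ a).eq]

theorem conv_eq (f g : A →ₗ[ℂ] W) : conv f g = (toConv f * toConv g).ofConv := rfl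

theorem toConv_conv (f g : A →ₗ[ℂ] W) : toConv (conv f g) = toConv f * toConv g := rfl

/-- Composition with an algebra homomorphism is multiplicative for the convolution. -/
theorem toConv_comp_mul {W' : Type*} [Ring W'] [Algebra ℂ W'] (h : W →ₐ[ℂ] W')
    (f g : WithConv (A →ₗ[ℂ] W)) :
    toConv (h.toLinearMap ∘ₗ (f * g).ofConv) =
      toConv (h.toLinearMap ∘ₗ f.ofConv) * toConv (h.toLinearMap ∘ₗ g.ofConv) := by
  rw [LinearMap.algHom_comp_convMul_distrib]

theorem algHom_conv {W' : Type*} [Ring W'] [Algebra ℂ W'] (h : W →ₐ[ℂ] W')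
    (f g : A →ₗ[ℂ] W) (a : A) :
    h (conv f g a) = conv (h.toLinearMap ∘ₗ f) (h.toLinearMap ∘ₗ g) a :=
  congr(($(toConv_comp_mul h (toConv f) (toConv g))).ofConv a)

/-- For an `f`-derivation `g` and `p = (f κ) * g` one has `g κ = -p * (f κ)`. -/
theorem derivation_antipode (f : A →ₐ[ℂ] W) (g : A →ₗ[ℂ] W)
    (hl : ∀ a b, g (a * b) = g a * f b + f a * g b) :
    toConv (g ∘ₗ HopfAlgebra.antipode ℂ) =
      -(toConv (f.toLinearMap ∘ₗ HopfAlgebra.antipode ℂ) * toConv g *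
        toConv (f.toLinearMap ∘ₗ HopfAlgebra.antipode ℂ)) := by
  have h1 : g 1 = 0 := by simpa using hl 1 1
  have h2 : toConv (g ∘ₗ HopfAlgebra.antipode ℂ) * toConv f.toLinearMap +
      toConv (f.toLinearMap ∘ₗ HopfAlgebra.antipode ℂ) * toConv g = 0 := by
    ext a
    change (toConv (g ∘ₗ HopfAlgebra.antipode ℂ) * toConv f.toLinearMap) a +
      (toConv (f.toLinearMap ∘ₗ HopfAlgebra.antipode ℂ) * toConv g) a = 0
    rw [(Coalgebra.Repr.arbitrary ℂ a).convMul_apply,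
      (Coalgebra.Repr.arbitrary ℂ a).convMul_apply, ← Finset.sum_add_distrib]
    have h3 := congrArg g (HopfAlgebra.sum_antipode_mul_eq_algebraMap_counit
      (R := ℂ) (Coalgebra.Repr.arbitrary ℂ a))
    rw [Algebra.algebraMap_eq_smul_one, map_smul, h1, smul_zero, map_sum] at h3
    rw [← h3]
    exact Finset.sum_congr rfl fun i _ => (hl _ _).symm
  calc _ = toConv (g ∘ₗ HopfAlgebra.antipode ℂ) * (toConv f.toLinearMap *
        toConv (f.toLinearMap ∘ₗ HopfAlgebra.antipode ℂ)) := by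
        rw [conv_antipode_right, mul_one]
    _ = _ := by rw [← mul_assoc, eq_neg_of_add_eq_zero_left h2, neg_mul]

/-- Substitute `g κ = -p * (f κ)` with `p = (f κ) * g`, and absorb the last factor into the second
`p`. This turns the differentiated relations of `Γ^∧` into the quadratic relations `∑ π(r⁽¹⁾)
π(r⁽²⁾) = 0`. -/
theorem derivation_antipode_mul (f : A →ₐ[ℂ] W) (g : A →ₗ[ℂ] W)
    (hl : ∀ a b, g (a * b) = g a * f b + f a * g b) :
    conv (g ∘ₗ HopfAlgebra.antipode ℂ) g =
      -conv (conv (f.toLinearMap ∘ₗ HopfAlgebra.antipode ℂ) g)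
        (conv (f.toLinearMap ∘ₗ HopfAlgebra.antipode ℂ) g) := by
  apply toConv_injective
  rw [toConv_neg, toConv_conv, toConv_conv, toConv_conv, derivation_antipode f g hl, neg_mul,
    ← mul_assoc]

/-- A linear map on `A ⊗ A` which factors over `y ⊗ κ(x) z` turns `ad` into a convolution. -/
theorem comp_ad (Φ : A ⊗[ℂ] A →ₗ[ℂ] W) (f g h : A →ₗ[ℂ] W)
    (H : ∀ x y z, Φ (y ⊗ₜ (HopfAlgebra.antipode ℂ x * z)) = f x * (g y * h z)) :
    toConv (Φ ∘ₗ ad A) = toConv f * (toConv g * toConv h) := by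
  have : Φ ∘ₗ (LinearMap.mul' ℂ A ∘ₗ (HopfAlgebra.antipode ℂ).rTensor A).lTensor A ∘ₗ
      (TensorProduct.leftComm ℂ A A A).toLinearMap =
      LinearMap.mul' ℂ W ∘ₗ TensorProduct.map f (LinearMap.mul' ℂ W ∘ₗ TensorProduct.map g h) := by
    ext x y z
    simp [H]
  apply ofConv_injective
  change Φ ∘ₗ ad A = LinearMap.mul' ℂ W ∘ₗ TensorProduct.map f (conv g h) ∘ₗ Coalgebra.comul
  have h2 : TensorProduct.map f (conv g h) =
      TensorProduct.map f (LinearMap.mul' ℂ W ∘ₗ TensorProduct.map g h) ∘ₗ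
        Coalgebra.comul.lTensor A := by
    ext; simp [conv]
  rw [h2]
  ext a
  exact congr($this (Coalgebra.comul.lTensor A (Coalgebra.comul a)))

/-- `ad(ab) = ∑ (1 ⊗ κ(b⁽¹⁾)) ad(a) φ(b⁽²⁾)`. -/
theorem ad_mul (a b : A) : ad A (a * b) =
    (toConv ((Algebra.TensorProduct.includeRight : A →ₐ[ℂ] A ⊗[ℂ] A).toLinearMap ∘ₗ
      HopfAlgebra.antipode ℂ) * (cst (ad A a) *
        toConv (Bialgebra.comulAlgHom ℂ A).toLinearMap)).ofConv b := by
  -- The antipode reverses products, so the new factor `κ(x)` comes out on the far left.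
  have key : ∀ (t : A ⊗[ℂ] (A ⊗[ℂ] A)) (x : A) (w : A ⊗[ℂ] A),
      (LinearMap.mul' ℂ A ∘ₗ (HopfAlgebra.antipode ℂ).rTensor A).lTensor A
        (TensorProduct.leftComm ℂ A A A (t * x ⊗ₜ w)) =
      (1 ⊗ₜ HopfAlgebra.antipode ℂ x) *
        ((LinearMap.mul' ℂ A ∘ₗ (HopfAlgebra.antipode ℂ).rTensor A).lTensor A
        (TensorProduct.leftComm ℂ A A A t) * w) := by
    intro t x w
    induction t with
    | zero => simp
    | add s t hs ht => simp [add_mul, mul_add, hs, ht]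
    | tmul p q =>
      induction q with
      | zero => simp
      | add s t hs ht => simp only [TensorProduct.tmul_add, add_mul, mul_add, map_add, hs, ht]
      | tmul q r =>
        induction w with
        | zero => simp
        | add s t hs ht => simp only [TensorProduct.tmul_add, mul_add, map_add, hs, ht]
        | tmul y z => simp [HopfAlgebra.antipode_mul_antidistrib, mul_assoc]
  rw [(Coalgebra.Repr.arbitrary ℂ b).convMul_apply]
  simp only [cst_mul_apply]
  change (LinearMap.mul' ℂ A ∘ₗ (HopfAlgebra.antipode ℂ).rTensor A).lTensor A
        (TensorProduct.leftComm ℂ A A A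
          (Coalgebra.comul.lTensor A (Coalgebra.comul (a * b)))) = _
  have hm : ∀ s t : A ⊗[ℂ] A, (Coalgebra.comul (R := ℂ)).lTensor A (s * t) =
      (Coalgebra.comul (R := ℂ)).lTensor A s * (Coalgebra.comul (R := ℂ)).lTensor A t :=
    map_mul (Algebra.TensorProduct.map (AlgHom.id ℂ A) (Bialgebra.comulAlgHom ℂ A))
  rw [Bialgebra.comul_mul, hm]
  conv_lhs => enter [2, 2, 2]; rw [← (Coalgebra.Repr.arbitrary ℂ b).eq]
  simp only [map_sum, Finset.mul_sum, LinearMap.lTensor_tmul, key]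
  rfl

theorem ad_one : ad A 1 = 1 := by
  simp [ad, Algebra.TensorProduct.one_def]

/-- `∑ (1 ⊗ b⁽¹⁾) ad(a b⁽²⁾) = ad(a) φ(b)`. -/
theorem sum_mul_ad_mul (a : A) {b : A} {ι : Type*} (r : Coalgebra.Repr ℂ b ι) :
    ∑ i ∈ r.index, (1 ⊗ₜ r.left i) * ad A (a * r.right i) = ad A a * Coalgebra.comul b := by
  have h : toConv (Algebra.TensorProduct.includeRight : A →ₐ[ℂ] A ⊗[ℂ] A).toLinearMap *
      toConv (ad A ∘ₗ LinearMap.mulLeft ℂ a) =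
      cst (ad A a) * toConv (Bialgebra.comulAlgHom ℂ A).toLinearMap := by
    have h' : toConv (ad A ∘ₗ LinearMap.mulLeft ℂ a) =
        toConv ((Algebra.TensorProduct.includeRight : A →ₐ[ℂ] A ⊗[ℂ] A).toLinearMap ∘ₗ
          HopfAlgebra.antipode ℂ) * (cst (ad A a) *
            toConv (Bialgebra.comulAlgHom ℂ A).toLinearMap) :=
      ofConv_injective (LinearMap.ext (ad_mul a))
    rw [h', ← mul_assoc, conv_antipode_right, one_mul]
  have h2 := congr(($h).ofConv b)
  erw [r.convMul_apply, cst_mul_apply] at h2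
  exact h2

/-- `(ε ⊗ id) ad(a) = ε(a) 1`. -/
theorem counit_ad (a : A) : (TensorProduct.lid ℂ A) ((Coalgebra.counit : A →ₗ[ℂ] ℂ).rTensor A
    (ad A a)) = Coalgebra.counit (R := ℂ) a • 1 := by
  have h := comp_ad (W := A) ((TensorProduct.lid ℂ A).toLinearMap ∘ₗ
    (Coalgebra.counit : A →ₗ[ℂ] ℂ).rTensor A) (HopfAlgebra.antipode ℂ)
      (cst (1 : A) : WithConv (A →ₗ[ℂ] A)).ofConv LinearMap.id (fun x y z => by simp)
  have h1 : (cst (1 : A) : WithConv (A →ₗ[ℂ] A)) = 1 := by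
    ext a; simp [Algebra.algebraMap_eq_smul_one]
  rw [toConv_ofConv, h1, one_mul, LinearMap.antipode_mul_id] at h
  have := congr(($h).ofConv a)
  rw [LinearMap.convOne_apply, Algebra.algebraMap_eq_smul_one] at this
  exact this

theorem convMul_apply_mul (f g : WithConv (A →ₗ[ℂ] W))
    {a b : A} {ι κ : Type*} (r : Coalgebra.Repr ℂ a ι) (s : Coalgebra.Repr ℂ b κ) :
    (f * g).ofConv (a * b) = ∑ i ∈ r.index, ∑ j ∈ s.index,
      f.ofConv (r.left i * s.left j) * g.ofConv (r.right i * s.right j) := by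
  rw [LinearMap.convMul_apply, Bialgebra.comul_mul, ← r.eq, ← s.eq, Finset.sum_mul_sum]
  simp

theorem conv_antipode_conv (f : A →ₐ[ℂ] W) (g : A →ₗ[ℂ] W) :
    conv (f.toLinearMap ∘ₗ HopfAlgebra.antipode ℂ) (conv f.toLinearMap g) = g := by
  apply toConv_injective
  rw [toConv_conv, toConv_conv, ← mul_assoc, conv_antipode_left, one_mul]

end Convolution

/-! ### Degree scaling -/

section Degree

variable {W : Type u} [Ring W] [Algebra ℂ W] (𝒲 : ℕ → Submodule ℂ W) [GradedAlgebra 𝒲]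

theorem degreeScale_of_mem (s : ℕ → ℂ) {n : ℕ} {x : W} (hx : x ∈ 𝒲 n) :
    degreeScale 𝒲 s x = s n • x := by
  have h := DirectSum.decompose_of_mem 𝒲 hx
  change DirectSum.toModule ℂ ℕ W (fun n => s n • (𝒲 n).subtype) (DirectSum.decompose 𝒲 x) = _
  rw [h]
  erw [DirectSum.toModule_lof]
  rfl

theorem parity_of_mem {n : ℕ} {x : W} (hx : x ∈ 𝒲 n) : parity 𝒲 x = (-1) ^ n * x := by
  rw [parity, degreeScale_of_mem 𝒲 _ hx, Algebra.smul_def]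
  simp

theorem parity_of_mem_zero {x : W} (hx : x ∈ 𝒲 0) : parity 𝒲 x = x := by
  rw [parity_of_mem 𝒲 hx]; simp

theorem parity_of_mem_one {x : W} (hx : x ∈ 𝒲 1) : parity 𝒲 x = -x := by
  rw [parity_of_mem 𝒲 hx]; simp

variable {𝒲} in
theorem linearMap_ext_of_grade {M : Type*} [AddCommGroup M] [Module ℂ M] {σ : ℂ →+* ℂ}
    {f g : W →ₛₗ[σ] M} (h : ∀ n, ∀ x ∈ 𝒲 n, f x = g x) (x : W) : f x = g x := by
  induction x using DirectSum.Decomposition.inductionOn 𝒲 with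
  | zero => simp
  | homogeneous x => exact h _ _ x.2
  | add x y hx hy => rw [map_add, map_add, hx, hy]

theorem parity_mul (x y : W) : parity 𝒲 (x * y) = parity 𝒲 x * parity 𝒲 y := by
  induction x using DirectSum.Decomposition.inductionOn 𝒲 with
  | zero => simp
  | add x y hx hy => rw [map_add, add_mul, add_mul, map_add, hx, hy]
  | @homogeneous m x =>
    induction y using DirectSum.Decomposition.inductionOn 𝒲 with
    | zero => simp
    | add x y hx hy => rw [map_add, mul_add, mul_add, map_add, hx, hy]
    | @homogeneous n y =>
      rw [parity, degreeScale_of_mem 𝒲 _ x.2, degreeScale_of_mem 𝒲 _ y.2,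
        degreeScale_of_mem 𝒲 _ (SetLike.mul_mem_graded x.2 y.2), smul_mul_smul_comm, pow_add]

/-- The parity as an algebra homomorphism. -/
def parityHom : W →ₐ[ℂ] W :=
  AlgHom.ofLinearMap (parity 𝒲) (parity_of_mem_zero 𝒲 (SetLike.GradedOne.one_mem))
    (parity_mul 𝒲)

theorem parityHom_apply (x : W) : parityHom 𝒲 x = parity 𝒲 x := rfl

theorem parity_mem {n : ℕ} {x : W} (hx : x ∈ 𝒲 n) : parity 𝒲 x ∈ 𝒲 n := by
  rw [parity, degreeScale_of_mem 𝒲 _ hx]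
  exact Submodule.smul_mem _ _ hx

theorem parity_parity (x : W) : parity 𝒲 (parity 𝒲 x) = x := by
  refine linearMap_ext_of_grade (𝒲 := 𝒲) (f := parity 𝒲 ∘ₗ parity 𝒲) (g := LinearMap.id)
    (fun n x hx => ?_) x
  rw [LinearMap.comp_apply, parity_of_mem 𝒲 (parity_mem 𝒲 hx), parity_of_mem 𝒲 hx, ← mul_assoc,
    ← pow_add, ← two_mul]
  simp

end Degree

/-! ### Structure of the envelope -/

section Envelope

variable {A : Type u} [Ring A] [StarRing A] [HopfAlgebra ℂ A]
variable (Γ : BicovariantStarCalculus A)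

namespace Env

theorem subalgebra_eq_top {S : Subalgebra ℂ (Env Γ)} (hi : ∀ a, inc Γ a ∈ S)
    (hd : ∀ a, dif Γ a ∈ S) : S = ⊤ := by
  have h : S.comap (mk Γ) = ⊤ := by
    rw [eq_top_iff, ← TensorAlgebra.adjoin_range_ι, Algebra.adjoin_le_iff]
    rintro _ ⟨⟨a, b⟩, rfl⟩
    have : TensorAlgebra.ι ℂ ((a, b) : A × A) = preInc a + preDif b := by
      simp [preInc, preDif, ← map_add]
    rw [this]
    change mk Γ _ ∈ S
    rw [map_add]
    exact add_mem (hi a) (hd b)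
  rw [eq_top_iff]
  intro x _
  obtain ⟨t, rfl⟩ := RingQuot.mkAlgHom_surjective ℂ (EnvRel Γ) x
  have : t ∈ S.comap (mk Γ) := by rw [h]; trivial
  exact this

theorem proj_inc (a : A) : proj Γ (inc Γ a) = a := by simp [proj]

theorem proj_dif (a : A) : proj Γ (dif Γ a) = 0 := by simp [proj]

theorem proj_of_mem {n : ℕ} {x : Env Γ} (hx : x ∈ grade Γ (n + 1)) : proj Γ x = 0 := by
  refine Submodule.mul_induction_on hx ?_ ?_
  · intro a _ y hy
    rw [pow_succ] at hy
    rw [map_mul]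
    suffices proj Γ y = 0 by rw [this, mul_zero]
    refine Submodule.mul_induction_on hy ?_ ?_
    · rintro z _ _ ⟨b, rfl⟩
      rw [map_mul, proj_dif, mul_zero]
    · intro x y hx hy
      rw [map_add, hx, hy, add_zero]
  · intro x y hx hy
    rw [map_add, hx, hy, add_zero]

/-- Upper triangular matrices of this shape multiply by the graded Leibniz rule. The set of `x` for
which the description holds is thus a subalgebra, and it contains the generators. In this way `d` is
seen to be a graded derivation. -/
theorem matrixHom_apply (x : Env Γ) : matrixHom Γ x = !![parity (grade Γ) x, d Γ x; 0, x] := by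
  let S : Subalgebra ℂ (Env Γ) :=
    { carrier := {x | matrixHom Γ x = !![parity (grade Γ) x, d Γ x; 0, x]}
      mul_mem' := by
        intro x y hx hy
        have h := map_mul (matrixHom Γ) x y
        rw [Set.mem_ofPred_eq] at hx hy ⊢
        rw [hx, hy] at h
        ext i j
        fin_cases i <;> fin_cases j
        · rw [h]; simp [parity_mul]
        · rfl
        · rw [h]; simp
        · rw [h]; simp
      add_mem' := by
        intro x y hx hy
        rw [Set.mem_ofPred_eq] at hx hy ⊢
        rw [map_add, hx, hy]
        ext i j
        fin_cases i <;> fin_cases j <;> simp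
      algebraMap_mem' := by
        intro c
        rw [Set.mem_ofPred_eq]
        ext i j
        have hc : parity (grade Γ) (algebraMap ℂ (Env Γ) c) = algebraMap ℂ (Env Γ) c :=
          (parityHom (grade Γ)).commutes c
        have hM := (matrixHom Γ).commutes c
        fin_cases i <;> fin_cases j
        · rw [hM]; simp [hc, Matrix.algebraMap_matrix_apply]
        · rfl
        · rw [hM]; simp [Matrix.algebraMap_matrix_apply]
        · rw [hM]; simp [Matrix.algebraMap_matrix_apply] }
  have h : S = ⊤ := by
    refine subalgebra_eq_top Γ (fun a => ?_) (fun a => ?_)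
    · change matrixHom Γ _ = _
      ext i j
      fin_cases i <;> fin_cases j <;>
        simp [matrixHom, d_inc, parity_of_mem_zero (grade Γ) (inc_mem Γ a)]
    · change matrixHom Γ _ = _
      have : d Γ (dif Γ a) = 0 := by simp [d, matrixHom]
      ext i j
      fin_cases i <;> fin_cases j <;>
        simp [matrixHom, this, parity_of_mem_one (grade Γ) (dif_mem Γ a)]
  have hx : x ∈ S := by rw [h]; trivial
  exact hx

theorem d_mul (x y : Env Γ) :
    d Γ (x * y) = parity (grade Γ) x * d Γ y + d Γ x * y := by
  have h := congr($(map_mul (matrixHom Γ) x y) 0 1)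
  rw [matrixHom_apply, matrixHom_apply, matrixHom_apply] at h
  simpa [Matrix.mul_apply] using h

theorem d_dif (a : A) : d Γ (dif Γ a) = 0 := by simp [d, matrixHom]

theorem d_one : d Γ 1 = 0 := by
  rw [← map_one (inc Γ), d_inc, dif_one]

theorem d_mem {n : ℕ} {x : Env Γ} (hx : x ∈ grade Γ n) : d Γ x ∈ grade Γ (n + 1) := by
  -- Products of differentials are closed, so only the coefficient in `A` is differentiated.
  have hz : ∀ n, ∀ y ∈ LinearMap.range (dif Γ) ^ n, d Γ y = 0 := by
    intro n y hy
    induction hy using Submodule.pow_induction_on_left' with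
    | algebraMap r => rw [Algebra.algebraMap_eq_smul_one, map_smul, d_one, smul_zero]
    | add x y i hx hy ihx ihy => rw [map_add, ihx, ihy, add_zero]
    | mem_mul m hm i x hx ih =>
      obtain ⟨a, rfl⟩ := hm
      rw [d_mul, ih, d_dif, mul_zero, zero_mul, add_zero]
  refine Submodule.mul_induction_on hx ?_ ?_
  · rintro _ ⟨a, rfl⟩ y hy
    rw [d_mul, hz n y hy, mul_zero, zero_add, AlgHom.toLinearMap_apply, d_inc, grade, pow_succ',
      ← one_mul (dif Γ a * y)]
    exact Submodule.mul_mem_mul ⟨1, map_one (inc Γ)⟩ (Submodule.mul_mem_mul ⟨a, rfl⟩ hy)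
  · intro x y hx hy
    rw [map_add]
    exact add_mem hx hy

theorem proj_d (x : Env Γ) : proj Γ (d Γ x) = 0 :=
  linearMap_ext_of_grade (𝒲 := grade Γ) (f := (proj Γ).toLinearMap ∘ₗ d Γ) (g := 0)
    (fun _ _ hx => proj_of_mem Γ (d_mem Γ hx)) x

theorem inc_proj_of_mem {x : Env Γ} (hx : x ∈ grade Γ 0) : inc Γ (proj Γ x) = x := by
  rw [grade, pow_zero, mul_one] at hx
  obtain ⟨a, rfl⟩ := hx
  rw [AlgHom.toLinearMap_apply, proj_inc]

/-! The convolution algebra of maps `A → Γ^∧`. -/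

/-- The inclusion, as an element of the convolution algebra. -/
abbrev cinc : WithConv (A →ₗ[ℂ] Env Γ) := toConv (inc Γ).toLinearMap

/-- The convolution inverse of the inclusion. -/
abbrev cinv : WithConv (A →ₗ[ℂ] Env Γ) := toConv ((inc Γ).toLinearMap ∘ₗ HopfAlgebra.antipode ℂ)

theorem cinc_mul_cinv : cinc Γ * cinv Γ = 1 := conv_antipode_right (inc Γ)

theorem cinv_mul_cinc : cinv Γ * cinc Γ = 1 := conv_antipode_left (inc Γ)

theorem toConv_germ : toConv (germ Γ) = cinv Γ * toConv (dif Γ) := rfl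

theorem toConv_dif : toConv (dif Γ) = cinc Γ * toConv (germ Γ) := by
  rw [toConv_germ, ← mul_assoc, cinc_mul_cinv, one_mul]

theorem toConv_dif_antipode :
    toConv (dif Γ ∘ₗ HopfAlgebra.antipode ℂ) = -(toConv (germ Γ) * cinv Γ) :=
  derivation_antipode (inc Γ) (dif Γ) (dif_mul Γ)

theorem germ_mem (a : A) : germ Γ a ∈ grade Γ 1 := by
  rw [germ, conv_repr _ _ (Coalgebra.Repr.arbitrary ℂ a), grade, pow_one]
  exact sum_mem fun i _ => Submodule.mul_mem_mul ⟨_, rfl⟩ ⟨_, rfl⟩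

/-- Apply the Leibniz rule to `κ(b⁽¹⁾) κ(a⁽¹⁾) d(a⁽²⁾b⁽²⁾)`. Differentiating `a` gives `π(a)`
conjugated by `b`; when `b` is differentiated, `κ(a⁽¹⁾)` and `a⁽²⁾` meet and collapse to `ε(a)`. -/
theorem germ_mul (a b : A) : germ Γ (a * b) =
    (cinv Γ * cst (germ Γ a) * cinc Γ).ofConv b + Coalgebra.counit (R := ℂ) a • germ Γ b := by
  have hc : ∑ i ∈ (Coalgebra.Repr.arbitrary ℂ a).index,
      inc Γ (HopfAlgebra.antipode ℂ ((Coalgebra.Repr.arbitrary ℂ a).left i)) *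
        inc Γ ((Coalgebra.Repr.arbitrary ℂ a).right i) =
      Coalgebra.counit (R := ℂ) a • 1 := by
    simp only [← map_mul, ← map_sum, HopfAlgebra.sum_antipode_mul_eq_algebraMap_counit]
    rw [AlgHom.commutes, Algebra.algebraMap_eq_smul_one]
  have hg := conv_repr ((inc Γ).toLinearMap ∘ₗ HopfAlgebra.antipode ℂ) (dif Γ)
    (Coalgebra.Repr.arbitrary ℂ a)
  have hgb := conv_repr ((inc Γ).toLinearMap ∘ₗ HopfAlgebra.antipode ℂ) (dif Γ)
    (Coalgebra.Repr.arbitrary ℂ b)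
  rw [mul_assoc, (Coalgebra.Repr.arbitrary ℂ b).convMul_apply]
  simp only [cst_mul_apply]
  rw [germ, hg, hgb, conv, LinearMap.comp_apply, LinearMap.comp_apply, Bialgebra.comul_mul]
  conv_lhs =>
    enter [2, 2]
    rw [← (Coalgebra.Repr.arbitrary ℂ a).eq, ← (Coalgebra.Repr.arbitrary ℂ b).eq]
  rw [Finset.sum_mul_sum, Finset.sum_comm, Finset.smul_sum, map_sum, map_sum,
    ← Finset.sum_add_distrib]
  refine Finset.sum_congr rfl fun j _ => ?_
  simp only [map_sum, Algebra.TensorProduct.tmul_mul_tmul, TensorProduct.map_tmul,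
    LinearMap.mul'_apply, LinearMap.comp_apply, AlgHom.toLinearMap_apply,
    HopfAlgebra.antipode_mul_antidistrib, map_mul, dif_mul, mul_add,
    Finset.sum_add_distrib]
  congr 1
  · rw [Finset.sum_mul, Finset.mul_sum]
    simp only [mul_assoc]
  · have := congrArg (fun z => inc Γ (HopfAlgebra.antipode ℂ
      ((Coalgebra.Repr.arbitrary ℂ b).left j)) * z * dif Γ
        ((Coalgebra.Repr.arbitrary ℂ b).right j)) hc
    simp only [Finset.mul_sum, Finset.sum_mul, mul_smul_comm, smul_mul_assoc, mul_one] at this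
    rw [← this]
    simp only [mul_assoc]

end Env

/-! ### Left-invariant forms -/

theorem LeftInv.induction {p : LeftInv Γ → Prop} (h : ∀ a, p (LeftInv.proj Γ a)) (ϑ) : p ϑ := by
  obtain ⟨a, rfl⟩ := Submodule.mkQ_surjective _ ϑ
  exact h a

namespace LeftInv

@[simp] theorem toEnv_proj (a : A) : toEnv Γ (proj Γ a) = Env.germ Γ a := rfl

theorem toEnv_comp_proj : toEnv Γ ∘ₗ proj Γ = Env.germ Γ := rfl

theorem circ_proj (a b : A) : circ Γ (proj Γ a) b =
    proj Γ (a * b) - Coalgebra.counit (R := ℂ) a • proj Γ b := rfl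

theorem proj_mul (a b : A) : proj Γ (a * b) =
    circ Γ (proj Γ a) b + Coalgebra.counit (R := ℂ) a • proj Γ b := by
  rw [circ_proj, sub_add_cancel]

theorem coact_proj (a : A) : coact Γ (proj Γ a) = (proj Γ).rTensor A (ad A a) := rfl

theorem st_proj [StarModule ℂ A] (a : A) :
    st Γ (proj Γ a) = -proj Γ (star (HopfAlgebra.antipode ℂ a)) := rfl

theorem toEnv_mem (ϑ : LeftInv Γ) : toEnv Γ ϑ ∈ Env.grade Γ 1 := by
  induction ϑ using LeftInv.induction with
  | h a => exact Env.germ_mem Γ a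

theorem circ_one (ϑ : LeftInv Γ) : circ Γ ϑ 1 = ϑ := by
  induction ϑ using LeftInv.induction with
  | h a => simp [circ_proj, proj_one]

theorem circ_mul (ϑ : LeftInv Γ) (a b : A) : circ Γ ϑ (a * b) = circ Γ (circ Γ ϑ a) b := by
  induction ϑ using LeftInv.induction with
  | h x =>
    rw [circ_proj, circ_proj, map_sub, map_smul, LinearMap.sub_apply, LinearMap.smul_apply,
      circ_proj, circ_proj, Bialgebra.counit_mul, mul_assoc, smul_sub, smul_smul]
    abel

/-- `ϑ ∘ b = ∑ κ(b⁽¹⁾) ϑ b⁽²⁾` in `Γ^∧`. -/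
theorem toEnv_circ (ϑ : LeftInv Γ) : toConv (toEnv Γ ∘ₗ circ Γ ϑ) =
    Env.cinv Γ * cst (toEnv Γ ϑ) * Env.cinc Γ := by
  induction ϑ using LeftInv.induction with
  | h a =>
    ext b
    change toEnv Γ (circ Γ (proj Γ a) b) = _
    rw [circ_proj, map_sub, map_smul, toEnv_proj, toEnv_proj, Env.germ_mul, add_sub_cancel_right]
    rfl

/-- `ϑ b = ∑ b⁽¹⁾ (ϑ ∘ b⁽²⁾)`, mapped to an algebra. -/
theorem comp_inc_conv_circ {W : Type*} [Ring W] [Algebra ℂ W] (h : Env Γ →ₐ[ℂ] W)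
    (ϑ : LeftInv Γ) : toConv (h.toLinearMap ∘ₗ (Env.inc Γ).toLinearMap) *
      toConv (h.toLinearMap ∘ₗ toEnv Γ ∘ₗ circ Γ ϑ) =
    cst (h (toEnv Γ ϑ)) * toConv (h.toLinearMap ∘ₗ (Env.inc Γ).toLinearMap) := by
  have h1 : Env.cinc Γ * toConv (toEnv Γ ∘ₗ circ Γ ϑ) = cst (toEnv Γ ϑ) * Env.cinc Γ := by
    rw [toEnv_circ, mul_assoc, ← mul_assoc (Env.cinc Γ), Env.cinc_mul_cinv, one_mul]
  rw [← comp_cst, ← toConv_comp_mul h (cst (toEnv Γ ϑ)) (Env.cinc Γ), ← h1, toConv_comp_mul]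

/-- `∑ (1 ⊗ b⁽¹⁾) ϖ(ϑ ∘ b⁽²⁾) = ∑ (ϑₖ ∘ b⁽¹⁾) ⊗ cₖ b⁽²⁾`, where `ϖ(ϑ) = ∑ ϑₖ ⊗ cₖ`. -/
theorem coact_circ (ϑ : LeftInv Γ) {b : A} {ι : Type*} (r : Coalgebra.Repr ℂ b ι) :
    ∑ i ∈ r.index, (LinearMap.mulLeft ℂ (r.left i)).lTensor (LeftInv Γ)
      (coact Γ (circ Γ ϑ (r.right i))) =
    ∑ i ∈ r.index, TensorProduct.map ((circ Γ).flip (r.left i)) (LinearMap.mulRight ℂ (r.right i))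
      (coact Γ ϑ) := by
  induction ϑ using LeftInv.induction with
  | h a =>
    have h1 : ∀ (x : A) (z : A ⊗[ℂ] A), (LinearMap.mulLeft ℂ x).lTensor (LeftInv Γ)
        ((proj Γ).rTensor A z) = (proj Γ).rTensor A (1 ⊗ₜ x * z) := by
      intro x z
      induction z with
      | zero => simp
      | add s t hs ht => rw [mul_add, map_add, map_add, map_add, hs, ht]
      | tmul y z => simp
    have h2 : ∀ (x y : A) (z : A ⊗[ℂ] A), TensorProduct.map ((circ Γ).flip x)
        (LinearMap.mulRight ℂ y) ((proj Γ).rTensor A z) = (proj Γ).rTensor A (z * x ⊗ₜ y) -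
          proj Γ x ⊗ₜ (TensorProduct.lid ℂ A
            ((Coalgebra.counit : A →ₗ[ℂ] ℂ).rTensor A z) * y) := by
      intro x y z
      induction z with
      | zero => simp
      | add s t hs ht =>
        simp only [add_mul, map_add, hs, ht, TensorProduct.tmul_add]
        abel
      | tmul p q => simp [circ_proj, TensorProduct.sub_tmul, TensorProduct.smul_tmul]
    have h3 := sum_mul_ad_mul a r
    have h4 := sum_mul_ad_mul 1 r
    simp only [one_mul, ad_one] at h4
    simp only [circ_proj, map_sub, map_smul, coact_proj, h1, h2, counit_ad,
      Finset.sum_sub_distrib, ← map_sum, ← Finset.smul_sum, h3, h4, ← Finset.mul_sum, r.eq]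
    congr 1
    rw [← r.eq]
    simp [Finset.smul_sum, TensorProduct.tmul_smul]

end LeftInv

end Envelope

section Envelope

variable {A : Type u} [Ring A] [StarRing A] [HopfAlgebra ℂ A]
variable (Γ : BicovariantStarCalculus A)

/-! ### Homomorphisms given on `A` and `Γ_inv` -/

section LiftInv

variable {Γ} {W : Type v} [Ring W] [Algebra ℂ W]

/-- As `da = ∑ a⁽¹⁾ π(a⁽²⁾)`, the only candidate for the image of `d` is the convolution of `f` with
`pπ`. The hypothesis moves `f b` to the left of `p`, and `π(ab) = π(a) ∘ b + ε(a) π(b)` supplies the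
two Leibniz terms. -/
theorem conv_proj_leibniz (f : A →ₐ[ℂ] W) (p : LeftInv Γ →ₗ[ℂ] W)
    (h : ∀ ϑ b, p ϑ * f b =
      (toConv f.toLinearMap * toConv (p ∘ₗ LeftInv.circ Γ ϑ)).ofConv b) (a b : A) :
    conv f.toLinearMap (p ∘ₗ LeftInv.proj Γ) (a * b) =
      conv f.toLinearMap (p ∘ₗ LeftInv.proj Γ) a * f b +
        f a * conv f.toLinearMap (p ∘ₗ LeftInv.proj Γ) b := by
  have h1 : f a = ∑ i ∈ (Coalgebra.Repr.arbitrary ℂ a).index,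
      Coalgebra.counit (R := ℂ) ((Coalgebra.Repr.arbitrary ℂ a).right i) •
        f ((Coalgebra.Repr.arbitrary ℂ a).left i) := by
    have := congr(($(mul_one (toConv f.toLinearMap))).ofConv a)
    rw [(Coalgebra.Repr.arbitrary ℂ a).convMul_apply] at this
    simpa [Algebra.algebraMap_eq_smul_one] using this.symm
  rw [conv_eq, convMul_apply_mul _ _ (Coalgebra.Repr.arbitrary ℂ a)
    (Coalgebra.Repr.arbitrary ℂ b), (Coalgebra.Repr.arbitrary ℂ a).convMul_apply, h1,
    Finset.sum_mul, Finset.sum_mul, ← Finset.sum_add_distrib]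
  refine Finset.sum_congr rfl fun i _ => ?_
  rw [mul_assoc]
  change _ = f _ * (p _ * f b) + _
  rw [h, (Coalgebra.Repr.arbitrary ℂ b).convMul_apply,
    (Coalgebra.Repr.arbitrary ℂ b).convMul_apply, Finset.mul_sum, Finset.mul_sum,
    ← Finset.sum_add_distrib]
  refine Finset.sum_congr rfl fun j _ => ?_
  simp only [LinearMap.comp_apply, AlgHom.toLinearMap_apply, LeftInv.proj_mul, map_mul, map_add,
    map_smul, mul_add, smul_mul_assoc, mul_smul_comm, mul_assoc]

/-- The homomorphism `Γ^∧ → W` with prescribed values on `A` and `Γ_inv`. -/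
def Env.liftInv (f : A →ₐ[ℂ] W) (p : LeftInv Γ →ₗ[ℂ] W)
    (h : ∀ ϑ b, p ϑ * f b =
      (toConv f.toLinearMap * toConv (p ∘ₗ LeftInv.circ Γ ϑ)).ofConv b)
    (hq : ∀ r ∈ Γ.ideal, conv (p ∘ₗ LeftInv.proj Γ) (p ∘ₗ LeftInv.proj Γ) r = 0) : Env Γ →ₐ[ℂ] W :=
  Env.lift Γ f (conv f.toLinearMap (p ∘ₗ LeftInv.proj Γ)) (conv_proj_leibniz f p h)
    (fun r hr => by
      rw [conv_antipode_conv, LinearMap.comp_apply, LeftInv.proj_ideal Γ r hr, map_zero])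
    (fun r hr => by
      rw [derivation_antipode_mul f _ (conv_proj_leibniz f p h), conv_antipode_conv,
        LinearMap.neg_apply, hq r hr, neg_zero])

variable (f : A →ₐ[ℂ] W) (p : LeftInv Γ →ₗ[ℂ] W)
    (h : ∀ ϑ b, p ϑ * f b =
      (toConv f.toLinearMap * toConv (p ∘ₗ LeftInv.circ Γ ϑ)).ofConv b)
    (hq : ∀ r ∈ Γ.ideal, conv (p ∘ₗ LeftInv.proj Γ) (p ∘ₗ LeftInv.proj Γ) r = 0)

theorem Env.liftInv_inc (a : A) : Env.liftInv f p h hq (Env.inc Γ a) = f a := by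
  simp [Env.liftInv]

theorem Env.liftInv_dif (a : A) : Env.liftInv f p h hq (Env.dif Γ a) =
    conv f.toLinearMap (p ∘ₗ LeftInv.proj Γ) a := by
  simp [Env.liftInv]

theorem Env.liftInv_toEnv (ϑ : LeftInv Γ) :
    Env.liftInv f p h hq (LeftInv.toEnv Γ ϑ) = p ϑ := by
  induction ϑ using LeftInv.induction with
  | h a =>
    rw [LeftInv.toEnv_proj, Env.germ, algHom_conv]
    have h1 : (Env.liftInv f p h hq).toLinearMap ∘ₗ (Env.inc Γ).toLinearMap ∘ₗ
        HopfAlgebra.antipode ℂ = f.toLinearMap ∘ₗ HopfAlgebra.antipode ℂ := by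
      ext a; exact Env.liftInv_inc f p h hq _
    have h2 : (Env.liftInv f p h hq).toLinearMap ∘ₗ Env.dif Γ =
        conv f.toLinearMap (p ∘ₗ LeftInv.proj Γ) := by
      ext a; exact Env.liftInv_dif f p h hq _
    rw [h1, h2, conv_antipode_conv]
    rfl

end LiftInv

/-! ### The tensor algebra of `Γ_inv` -/

namespace InvTensor

theorem toEnv_ι (ϑ : LeftInv Γ) : toEnv Γ (TensorAlgebra.ι ℂ ϑ) = LeftInv.toEnv Γ ϑ :=
  TensorAlgebra.lift_ι_apply _ _

theorem circ_ι (ϑ : LeftInv Γ) :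
    circ Γ (TensorAlgebra.ι ℂ ϑ) = toConv (TensorAlgebra.ι ℂ ∘ₗ LeftInv.circ Γ ϑ) :=
  TensorAlgebra.lift_ι_apply _ _

theorem circ_algebraMap (c : ℂ) (a : A) : (circ Γ (algebraMap ℂ _ c)).ofConv a =
    Coalgebra.counit (R := ℂ) a • algebraMap ℂ (InvTensor Γ) c := by
  rw [AlgHom.commutes]
  change c • algebraMap ℂ (InvTensor Γ) (Coalgebra.counit a) = _
  rw [Algebra.algebraMap_eq_smul_one, Algebra.algebraMap_eq_smul_one, smul_comm]

theorem circ_apply_one (t : InvTensor Γ) : (circ Γ t).ofConv 1 = t := by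
  induction t using TensorAlgebra.induction with
  | algebraMap c => rw [circ_algebraMap, Bialgebra.counit_one, one_smul]
  | ι ϑ =>
    rw [circ_ι]
    exact congrArg _ (LeftInv.circ_one Γ ϑ)
  | mul s t hs ht =>
    rw [map_mul, LinearMap.convMul_apply, Bialgebra.comul_one, Algebra.TensorProduct.one_def,
      TensorProduct.map_tmul, LinearMap.mul'_apply, hs, ht]
  | add s t hs ht => rw [map_add, ofConv_add, LinearMap.add_apply, hs, ht]

theorem circ_apply_mul (t : InvTensor Γ) (a b : A) :
    (circ Γ t).ofConv (a * b) = (circ Γ ((circ Γ t).ofConv a)).ofConv b := by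
  induction t using TensorAlgebra.induction generalizing a b with
  | algebraMap c =>
    rw [circ_algebraMap, circ_algebraMap, map_smul, ofConv_smul, LinearMap.smul_apply,
      circ_algebraMap, Bialgebra.counit_mul, mul_smul]
  | ι ϑ =>
    rw [circ_ι]
    change TensorAlgebra.ι ℂ _ = (circ Γ (TensorAlgebra.ι ℂ _)).ofConv b
    rw [circ_ι, LeftInv.circ_mul]
    rfl
  | mul s t hs ht =>
    rw [map_mul (circ Γ), convMul_apply_mul _ _ (Coalgebra.Repr.arbitrary ℂ a)
      (Coalgebra.Repr.arbitrary ℂ b), (Coalgebra.Repr.arbitrary ℂ a).convMul_apply, map_sum,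
      ofConv_sum, LinearMap.sum_apply]
    refine Finset.sum_congr rfl fun i _ => ?_
    rw [map_mul, (Coalgebra.Repr.arbitrary ℂ b).convMul_apply]
    simp only [hs, ht]
  | add s t hs ht =>
    rw [map_add, ofConv_add, LinearMap.add_apply, LinearMap.add_apply, map_add, ofConv_add,
      LinearMap.add_apply, hs, ht]

theorem circ_mem {n : ℕ} {t : InvTensor Γ} (ht : t ∈ grade Γ n) (a : A) :
    (circ Γ t).ofConv a ∈ grade Γ n := by
  induction ht using Submodule.pow_induction_on_left' generalizing a with
  | algebraMap r =>
    rw [circ_algebraMap]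
    refine Submodule.smul_mem _ _ ?_
    change _ ∈ LinearMap.range (TensorAlgebra.ι ℂ : LeftInv Γ →ₗ[ℂ] InvTensor Γ) ^ 0
    rw [pow_zero]
    exact Submodule.algebraMap_mem r
  | add x y i hx hy ihx ihy => rw [map_add]; exact add_mem (ihx a) (ihy a)
  | mem_mul m hm i x hx ih =>
    obtain ⟨ϑ, rfl⟩ := hm
    change _ ∈ LinearMap.range (TensorAlgebra.ι ℂ : LeftInv Γ →ₗ[ℂ] InvTensor Γ) ^ (i + 1)
    rw [map_mul (circ Γ), (Coalgebra.Repr.arbitrary ℂ a).convMul_apply, circ_ι, pow_succ']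
    exact sum_mem fun i _ => Submodule.mul_mem_mul ⟨_, rfl⟩ (ih _)

/-- `t ∘ a = ∑ κ(a⁽¹⁾) t a⁽²⁾` in `Γ^∧`. -/
theorem toEnv_circ (t : InvTensor Γ) : toConv ((toEnv Γ).toLinearMap ∘ₗ (circ Γ t).ofConv) =
    Env.cinv Γ * cst (toEnv Γ t) * Env.cinc Γ := by
  induction t using TensorAlgebra.induction with
  | algebraMap c =>
    have h : (cst (algebraMap ℂ (Env Γ) c) : WithConv (A →ₗ[ℂ] Env Γ)) =
        algebraMap ℂ (WithConv (A →ₗ[ℂ] Env Γ)) c := by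
      ext a
      change Coalgebra.counit (R := ℂ) a • algebraMap ℂ (Env Γ) c =
        c • algebraMap ℂ (Env Γ) (Coalgebra.counit a)
      rw [Algebra.algebraMap_eq_smul_one, Algebra.algebraMap_eq_smul_one, smul_comm]
    rw [AlgHom.commutes (toEnv Γ), h, ← Algebra.commutes, mul_assoc, Env.cinv_mul_cinc, mul_one,
      AlgHom.commutes]
    ext a
    change toEnv Γ (c • algebraMap ℂ _ _) = c • algebraMap ℂ _ _
    rw [map_smul, AlgHom.commutes]
  | ι ϑ =>
    rw [circ_ι, toEnv_ι, ← LeftInv.toEnv_circ]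
    apply congrArg
    ext a
    exact toEnv_ι Γ _
  | mul s t hs ht =>
    rw [map_mul (circ Γ), toConv_comp_mul, hs, ht, map_mul, cst_mul]
    calc _ = Env.cinv Γ * cst (toEnv Γ s) * (Env.cinc Γ * Env.cinv Γ) * cst (toEnv Γ t) *
          Env.cinc Γ := by simp only [mul_assoc]
      _ = _ := by rw [Env.cinc_mul_cinv, mul_one]; simp only [mul_assoc]
  | add s t hs ht =>
    have h : (cst (toEnv Γ s + toEnv Γ t) : WithConv (A →ₗ[ℂ] Env Γ)) =
        cst (toEnv Γ s) + cst (toEnv Γ t) := by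
      ext a; simp [smul_add]
    rw [map_add, map_add, h, mul_add, add_mul, ← hs, ← ht, ofConv_add, LinearMap.comp_add,
      toConv_add]

theorem toEnv_mem {n : ℕ} {t : InvTensor Γ} (ht : t ∈ grade Γ n) :
    toEnv Γ t ∈ Env.grade Γ n := by
  induction ht using Submodule.pow_induction_on_right' with
  | algebraMap r =>
    rw [AlgHom.commutes]
    exact SetLike.algebraMap_mem_graded (Env.grade Γ) r
  | add x y i hx hy ihx ihy => rw [map_add]; exact add_mem ihx ihy
  | mul_mem i x hx ih m hm =>
    obtain ⟨ϑ, rfl⟩ := hm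
    rw [map_mul, toEnv_ι]
    have h1 := Env.grade_mul Γ i 1 (Submodule.mul_mem_mul ih (LeftInv.toEnv_mem Γ ϑ))
    have h2 : i.succ = i + 1 := rfl
    rw [h2]
    exact h1

/-- The quadratic element `∑ π(a⁽¹⁾) ⊗ π(a⁽²⁾)`. -/
def quad : A →ₗ[ℂ] InvTensor Γ :=
  conv (TensorAlgebra.ι ℂ ∘ₗ LeftInv.proj Γ) (TensorAlgebra.ι ℂ ∘ₗ LeftInv.proj Γ)

theorem quad_mem (a : A) : quad Γ a ∈ grade Γ 2 := by
  have h : quad Γ a ∈ LinearMap.range (TensorAlgebra.ι ℂ : LeftInv Γ →ₗ[ℂ] InvTensor Γ) ^ 2 := by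
    rw [quad, conv_repr _ _ (Coalgebra.Repr.arbitrary ℂ a), pow_two]
    exact sum_mem fun i _ => Submodule.mul_mem_mul
      (LinearMap.mem_range_self _ _) (LinearMap.mem_range_self _ _)
  exact h

theorem toEnv_quad (a : A) : toEnv Γ (quad Γ a) = -Env.d Γ (Env.germ Γ a) := by
  rw [Env.d_germ, neg_neg, quad, algHom_conv]
  have h : (toEnv Γ).toLinearMap ∘ₗ TensorAlgebra.ι ℂ ∘ₗ LeftInv.proj Γ = Env.germ Γ := by
    ext a; exact toEnv_ι Γ _
  rw [h]

theorem toEnv_quad_ideal (r : A) (hr : r ∈ Γ.ideal) : toEnv Γ (quad Γ r) = 0 := by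
  rw [toEnv_quad, Env.germ_ideal Γ r hr, map_zero, neg_zero]

/-- `q(r) ∘ a = q(ra)` for `r ∈ 𝓡`. -/
theorem circ_quad (r : A) (hr : r ∈ Γ.ideal) (a : A) :
    (circ Γ (quad Γ r)).ofConv a = quad Γ (r * a) := by
  let ra := Coalgebra.Repr.arbitrary ℂ a
  let rr := Coalgebra.Repr.arbitrary ℂ r
  let P : A →ₗ[ℂ] InvTensor Γ := TensorAlgebra.ι ℂ ∘ₗ LeftInv.proj Γ
  have hP : ∀ x y, (circ Γ (P x)).ofConv y = P (x * y) - Coalgebra.counit (R := ℂ) x • P y := by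
    intro x y
    change (circ Γ (TensorAlgebra.ι ℂ _)).ofConv y = _
    rw [circ_ι]
    change TensorAlgebra.ι ℂ _ = _
    rw [LeftInv.circ_proj, map_sub, map_smul]
    rfl
  have hz : ∀ y, P (r * y) = 0 := fun y => by
    change TensorAlgebra.ι ℂ (LeftInv.proj Γ (r * y)) = 0
    rw [LeftInv.proj_ideal Γ _ (Γ.mul_mem r hr y), map_zero]
  have h1 : ∑ i ∈ rr.index, Coalgebra.counit (R := ℂ) (rr.right i) • rr.left i = r := by
    have := congrArg (TensorProduct.rid ℂ A) (Coalgebra.lTensor_counit_comul (R := ℂ) r)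
    rw [← rr.eq] at this
    simpa only [map_sum, LinearMap.lTensor_tmul, LinearMap.rTensor_tmul, TensorProduct.rid_tmul,
      TensorProduct.lid_tmul, one_smul] using this
  have h2 : ∑ i ∈ rr.index, Coalgebra.counit (R := ℂ) (rr.left i) • rr.right i = r := by
    have := congrArg (TensorProduct.lid ℂ A) (Coalgebra.rTensor_counit_comul (R := ℂ) r)
    rw [← rr.eq] at this
    simpa only [map_sum, LinearMap.lTensor_tmul, LinearMap.rTensor_tmul, TensorProduct.rid_tmul,
      TensorProduct.lid_tmul, one_smul] using this
  -- The correction terms vanish: summing the counit over one leg of the coproduct gives back `r`,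
  -- and `𝓡` is a right ideal on which both `π` and `ε` are zero.
  have e1 : ∀ y z, ∑ i ∈ rr.index, P (rr.left i * y) *
      (Coalgebra.counit (R := ℂ) (rr.right i) • P z) = 0 := by
    intro y z
    rw [← zero_mul (P z), ← hz y]
    conv_rhs => rw [← h1]
    simp [Finset.sum_mul]
  have e2 : ∀ y z, ∑ i ∈ rr.index, (Coalgebra.counit (R := ℂ) (rr.left i) • P y) *
      (P (rr.right i * z) - Coalgebra.counit (R := ℂ) (rr.right i) • P z) = 0 := by
    intro y z
    have : P y * (P (r * z) - Coalgebra.counit (R := ℂ) r • P z) = 0 := by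
      rw [hz, Γ.counit_eq_zero r hr, zero_smul, sub_zero, mul_zero]
    rw [← this]
    conv_rhs => rw [← h2]
    simp [Finset.sum_mul, Finset.mul_sum, mul_sub, Finset.sum_sub_distrib, Finset.sum_smul,
      mul_smul]
    exact Finset.sum_congr rfl fun _ _ => smul_comm _ _ _
  rw [quad, conv_eq, convMul_apply_mul _ _ rr ra, rr.convMul_apply, map_sum, ofConv_sum,
    LinearMap.sum_apply]
  change ∑ i ∈ rr.index, (circ Γ (P (rr.left i) * P (rr.right i))).ofConv a =
    ∑ i ∈ rr.index, ∑ j ∈ ra.index, P _ * P _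
  simp only [map_mul, ra.convMul_apply, hP]
  rw [Finset.sum_comm, Finset.sum_comm (s := rr.index)]
  refine Finset.sum_congr rfl fun j _ => ?_
  rw [← sub_eq_zero, ← Finset.sum_sub_distrib]
  have h3 := congrArg₂ (· + ·) (e1 (ra.left j) (ra.right j)) (e2 (ra.left j) (ra.right j))
  rw [← Finset.sum_add_distrib, add_zero] at h3
  rw [← neg_eq_zero, ← Finset.sum_neg_distrib, ← h3]
  refine Finset.sum_congr rfl fun i _ => ?_
  rw [sub_mul, mul_sub]
  abel

/-- The space of the quadratic relations. -/
def quadRel : Submodule ℂ (InvTensor Γ) := Γ.ideal.map (quad Γ)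

/-- The ideal generated by the quadratic relations. -/
def relIdeal : Submodule ℂ (InvTensor Γ) := ⊤ * quadRel Γ * ⊤

theorem mul_mem_relIdeal (s : InvTensor Γ) {t : InvTensor Γ} (ht : t ∈ relIdeal Γ) :
    s * t ∈ relIdeal Γ := by
  have h : (⊤ : Submodule ℂ (InvTensor Γ)) * relIdeal Γ ≤ relIdeal Γ := by
    rw [relIdeal, ← mul_assoc, ← mul_assoc]
    exact mul_le_mul_left (mul_le_mul_left le_top _) _
  exact h (Submodule.mul_mem_mul trivial ht)

theorem relIdeal_mul_mem (s : InvTensor Γ) {t : InvTensor Γ} (ht : t ∈ relIdeal Γ) :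
    t * s ∈ relIdeal Γ := by
  have h : relIdeal Γ * (⊤ : Submodule ℂ (InvTensor Γ)) ≤ relIdeal Γ := by
    rw [relIdeal, mul_assoc]
    exact mul_le_mul_right le_top _
  exact h (Submodule.mul_mem_mul ht trivial)

theorem quad_mem_relIdeal {r : A} (hr : r ∈ Γ.ideal) : quad Γ r ∈ relIdeal Γ := by
  have := Submodule.mul_mem_mul (Submodule.mul_mem_mul (Submodule.mem_top (x := (1 : InvTensor Γ)))
    (Submodule.mem_map_of_mem (f := quad Γ) hr)) (Submodule.mem_top (x := (1 : InvTensor Γ)))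
  rwa [one_mul, mul_one] at this

theorem relIdeal_induction {p : InvTensor Γ → Prop}
    (h : ∀ x y, ∀ r ∈ Γ.ideal, p (x * quad Γ r * y)) (hadd : ∀ x y, p x → p y → p (x + y))
    {t : InvTensor Γ} (ht : t ∈ relIdeal Γ) : p t := by
  refine Submodule.mul_induction_on ht (fun x hx y _ => ?_) hadd
  refine Submodule.mul_induction_on hx (fun x _ q hq => ?_) (fun x x' hx hx' => ?_)
  · obtain ⟨r, hr, rfl⟩ := hq
    exact h x y r hr
  · rw [add_mul]
    exact hadd _ _ hx hx'

theorem circ_mem_relIdeal {t : InvTensor Γ} (ht : t ∈ relIdeal Γ) (a : A) :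
    (circ Γ t).ofConv a ∈ relIdeal Γ := by
  refine relIdeal_induction Γ (p := fun t => (circ Γ t).ofConv a ∈ relIdeal Γ)
    (fun x y r hr => ?_) (fun x y hx hy => ?_) ht
  · rw [map_mul, map_mul, (Coalgebra.Repr.arbitrary ℂ a).convMul_apply]
    refine sum_mem fun i _ => relIdeal_mul_mem Γ _ ?_
    rw [(Coalgebra.Repr.arbitrary ℂ _).convMul_apply]
    refine sum_mem fun j _ => mul_mem_relIdeal Γ _ ?_
    rw [circ_quad Γ r hr]
    exact quad_mem_relIdeal Γ (Γ.mul_mem r hr _)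
  · rw [map_add]
    exact add_mem hx hy

/-- The quadratic algebra `Γ_inv^⊗ / ⟨q(𝓡)⟩`, as a vector space. -/
abbrev QuadQuot : Type u := InvTensor Γ ⧸ relIdeal Γ

/-- The right action of `A` on the quadratic algebra. -/
def actA : A →ₐ[ℂ] (Module.End ℂ (QuadQuot Γ))ᵐᵒᵖ :=
  AlgHom.ofLinearMap
    { toFun := fun a => MulOpposite.op ((relIdeal Γ).mapQ (relIdeal Γ)
        { toFun := fun t => (circ Γ t).ofConv a
          map_add' := fun s t => by rw [map_add]; rfl
          map_smul' := fun c t => by rw [map_smul]; rfl } (fun _ ht => circ_mem_relIdeal Γ ht a))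
      map_add' := fun a b => by
        apply MulOpposite.unop_injective
        ext t
        exact congrArg (relIdeal Γ).mkQ (map_add (circ Γ t).ofConv a b)
      map_smul' := fun c a => by
        apply MulOpposite.unop_injective
        ext t
        exact congrArg (relIdeal Γ).mkQ (map_smul (circ Γ t).ofConv c a) }
    (by
      apply MulOpposite.unop_injective
      ext t
      exact congrArg (relIdeal Γ).mkQ (circ_apply_one Γ t))
    (fun a b => by
      apply MulOpposite.unop_injective
      ext t
      exact congrArg (relIdeal Γ).mkQ (circ_apply_mul Γ t a b))

/-- The right multiplications of the quadratic algebra by elements of `Γ_inv`. -/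
def actInv : LeftInv Γ →ₗ[ℂ] (Module.End ℂ (QuadQuot Γ))ᵐᵒᵖ where
  toFun ϑ := MulOpposite.op ((relIdeal Γ).mapQ (relIdeal Γ)
    (LinearMap.mulRight ℂ (TensorAlgebra.ι ℂ ϑ)) (fun _ ht => relIdeal_mul_mem Γ _ ht))
  map_add' ϑ η := by
    apply MulOpposite.unop_injective
    ext t
    exact congrArg (relIdeal Γ).mkQ (by rw [map_add]; exact mul_add _ _ _)
  map_smul' c ϑ := by
    apply MulOpposite.unop_injective
    ext t
    exact congrArg (relIdeal Γ).mkQ (by rw [map_smul]; exact mul_smul_comm _ _ _)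

theorem actA_mk (a : A) (t : InvTensor Γ) : (actA Γ a).unop ((relIdeal Γ).mkQ t) =
    (relIdeal Γ).mkQ ((circ Γ t).ofConv a) := rfl

theorem actInv_mk (ϑ : LeftInv Γ) (t : InvTensor Γ) : (actInv Γ ϑ).unop ((relIdeal Γ).mkQ t) =
    (relIdeal Γ).mkQ (t * TensorAlgebra.ι ℂ ϑ) := rfl

theorem op_sum_apply {M : Type*} [AddCommGroup M] [Module ℂ M] {ι : Type*} (s : Finset ι)
    (f : ι → (Module.End ℂ M)ᵐᵒᵖ) (x : M) :
    (∑ i ∈ s, f i).unop x = ∑ i ∈ s, (f i).unop x := by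
  have h := map_sum (MulOpposite.opAddEquiv (α := Module.End ℂ M)).symm f s
  rw [← LinearMap.sum_apply]
  exact congr($h x)

/-- The right action of `Γ^∧` on the quadratic algebra. -/
def actEnv : Env Γ →ₐ[ℂ] (Module.End ℂ (QuadQuot Γ))ᵐᵒᵖ :=
  -- The first condition is `(tϑ) ∘ b = ∑ (t ∘ b⁽¹⁾)(ϑ ∘ b⁽²⁾)`. The second says that `t q(r)` lies
  -- in the ideal.
  Env.liftInv (actA Γ) (actInv Γ)
    (fun ϑ b => by
      apply MulOpposite.unop_injective
      refine Submodule.linearMap_qext _ (LinearMap.ext fun t => ?_)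
      rw [(Coalgebra.Repr.arbitrary ℂ b).convMul_apply]
      change (actA Γ b).unop ((actInv Γ ϑ).unop ((relIdeal Γ).mkQ t)) =
        (∑ i ∈ _, _ : (Module.End ℂ (QuadQuot Γ))ᵐᵒᵖ).unop ((relIdeal Γ).mkQ t)
      rw [op_sum_apply, actInv_mk, actA_mk, map_mul, circ_ι,
        (Coalgebra.Repr.arbitrary ℂ b).convMul_apply, map_sum]
      rfl)
    (fun r hr => by
      apply MulOpposite.unop_injective
      refine Submodule.linearMap_qext _ (LinearMap.ext fun t => ?_)
      rw [conv_repr _ _ (Coalgebra.Repr.arbitrary ℂ r)]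
      change (∑ i ∈ _, _ : (Module.End ℂ (QuadQuot Γ))ᵐᵒᵖ).unop ((relIdeal Γ).mkQ t) = 0
      rw [op_sum_apply]
      have h : t * quad Γ r ∈ relIdeal Γ := mul_mem_relIdeal Γ t (quad_mem_relIdeal Γ hr)
      rw [← Submodule.Quotient.mk_eq_zero, quad, conv_repr _ _ (Coalgebra.Repr.arbitrary ℂ r),
        Finset.mul_sum] at h
      rw [← h]
      change _ = (relIdeal Γ).mkQ _
      rw [map_sum]
      refine Finset.sum_congr rfl fun i _ => congrArg (relIdeal Γ).mkQ ?_
      exact mul_assoc _ _ _)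

theorem actEnv_inc (a : A) : actEnv Γ (Env.inc Γ a) = actA Γ a := Env.liftInv_inc _ _ _ _ a

theorem actEnv_toEnv (t s : InvTensor Γ) : (actEnv Γ (toEnv Γ t)).unop ((relIdeal Γ).mkQ s) =
    (relIdeal Γ).mkQ (s * t) := by
  induction t using TensorAlgebra.induction generalizing s with
  | algebraMap c =>
    rw [AlgHom.commutes, AlgHom.commutes, Algebra.algebraMap_eq_smul_one,
      Algebra.algebraMap_eq_smul_one, mul_smul_comm, map_smul, mul_one]
    rfl
  | ι ϑ =>
    rw [toEnv_ι, actEnv, Env.liftInv_toEnv]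
    rfl
  | mul t t' h h' =>
    rw [map_mul, map_mul]
    change (actEnv Γ (toEnv Γ t')).unop ((actEnv Γ (toEnv Γ t)).unop _) = _
    rw [h, h', mul_assoc]
  | add t t' h h' =>
    rw [map_add, map_add, mul_add, map_add, ← h, ← h']
    rfl

/-- The kernel of `Γ_inv^⊗ → Γ^∧` is generated by the quadratic relations. -/
theorem mem_relIdeal_of_toEnv_eq_zero {t : InvTensor Γ} (ht : toEnv Γ t = 0) :
    t ∈ relIdeal Γ := by
  -- Acting on the class of `1` with the image of `t` gives back the class of `t`.
  have h := actEnv_toEnv Γ t 1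
  rw [ht, map_zero, one_mul] at h
  exact (Submodule.Quotient.mk_eq_zero _).1 h.symm

theorem toEnv_relIdeal {t : InvTensor Γ} (ht : t ∈ relIdeal Γ) : toEnv Γ t = 0 := by
  refine relIdeal_induction Γ (p := fun t => toEnv Γ t = 0) (fun x y r hr => ?_)
    (fun x y hx hy => ?_) ht
  · rw [map_mul, map_mul, toEnv_quad_ideal Γ r hr, mul_zero, zero_mul]
  · rw [map_add, hx, hy, add_zero]

/-- The projection `Γ^∧ → Γ_inv^∧`, `a ϑ ↦ ε(a) ϑ`. -/
def _root_.QPB.Env.fiber : Env Γ →ₗ[ℂ] Env Γ :=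
  (relIdeal Γ).liftQ (toEnv Γ).toLinearMap (fun _ ht => toEnv_relIdeal Γ ht) ∘ₗ
    LinearMap.applyₗ ((relIdeal Γ).mkQ 1) ∘ₗ (MulOpposite.opLinearEquiv ℂ).symm.toLinearMap ∘ₗ
      (actEnv Γ).toLinearMap

theorem _root_.QPB.Env.fiber_apply (x : Env Γ) : Env.fiber Γ x =
    (relIdeal Γ).liftQ (toEnv Γ).toLinearMap (fun _ ht => toEnv_relIdeal Γ ht)
      ((actEnv Γ x).unop ((relIdeal Γ).mkQ 1)) := rfl

theorem _root_.QPB.Env.fiber_inc_mul (a : A) (t : InvTensor Γ) :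
    Env.fiber Γ (Env.inc Γ a * toEnv Γ t) = Coalgebra.counit (R := ℂ) a • toEnv Γ t := by
  have h : (actEnv Γ (Env.inc Γ a * toEnv Γ t)).unop ((relIdeal Γ).mkQ 1) =
      (relIdeal Γ).mkQ (Coalgebra.counit (R := ℂ) a • t) := by
    rw [map_mul, actEnv_inc]
    change (actEnv Γ (toEnv Γ t)).unop ((actA Γ a).unop _) = _
    rw [actA_mk, actEnv_toEnv, ← map_one (algebraMap ℂ (InvTensor Γ)), circ_algebraMap, map_one,
      smul_mul_assoc, one_mul]
  rw [Env.fiber_apply, h, map_smul, map_smul]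
  rfl

end InvTensor

end Envelope

/-! ### Homogeneous relations, the star on the envelope, and the right coaction by translations -/

section Envelope

variable {A : Type u} [Ring A] [StarRing A] [HopfAlgebra ℂ A]
variable (Γ : BicovariantStarCalculus A)

namespace InvTensor

theorem mem_grade_zero {t : InvTensor Γ} (ht : t ∈ grade Γ 0) :
    ∃ c : ℂ, algebraMap ℂ (InvTensor Γ) c = t := by
  have h : t ∈ LinearMap.range (TensorAlgebra.ι ℂ : LeftInv Γ →ₗ[ℂ] InvTensor Γ) ^ 0 := ht
  rw [pow_zero] at h
  exact Submodule.mem_one.1 h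

theorem one_mem_grade : (1 : InvTensor Γ) ∈ grade Γ 0 := SetLike.GradedOne.one_mem

theorem mul_mem_grade {m n : ℕ} {s t : InvTensor Γ} (hs : s ∈ grade Γ m) (ht : t ∈ grade Γ n) :
    s * t ∈ grade Γ (m + n) := SetLike.GradedMul.mul_mem hs ht

theorem ι_mem_grade (ϑ : LeftInv Γ) : TensorAlgebra.ι ℂ ϑ ∈ grade Γ 1 := by
  have h : TensorAlgebra.ι ℂ ϑ ∈
      LinearMap.range (TensorAlgebra.ι ℂ : LeftInv Γ →ₗ[ℂ] InvTensor Γ) ^ 1 := by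
    rw [pow_one]; exact LinearMap.mem_range_self _ _
  exact h

/-- The homogeneous elements of the kernel of `Γ_inv^⊗ → Γ^∧` are spanned by the products of the
quadratic relations with homogeneous elements. -/
theorem mem_of_toEnv_eq_zero {n : ℕ} {t : InvTensor Γ} (ht : t ∈ grade Γ n)
    (h0 : toEnv Γ t = 0) {S : Submodule ℂ (InvTensor Γ)}
    (h : ∀ i j, i + 2 + j = n → ∀ x ∈ grade Γ i, ∀ r ∈ Γ.ideal, ∀ y ∈ grade Γ j,
      x * quad Γ r * y ∈ S) : t ∈ S := by
  -- Projection to degree `n` keeps only those homogeneous products whose degrees add up to `n`.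
  have key : ∀ s ∈ relIdeal Γ, (DirectSum.decompose (grade Γ) s n : InvTensor Γ) ∈ S := by
    intro s hs
    refine relIdeal_induction Γ
      (p := fun s => (DirectSum.decompose (grade Γ) s n : InvTensor Γ) ∈ S)
      (fun x y r hr => ?_) (fun x y hx hy => ?_) hs
    · induction x using DirectSum.Decomposition.inductionOn (grade Γ) with
      | zero => simp
      | add x x' hx hx' =>
        rw [add_mul, add_mul, DirectSum.decompose_add]
        exact add_mem hx hx'
      | @homogeneous i x =>
        induction y using DirectSum.Decomposition.inductionOn (grade Γ) with
        | zero => simp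
        | add y y' hy hy' =>
          rw [mul_add, DirectSum.decompose_add]
          exact add_mem hy hy'
        | @homogeneous j y =>
          have hm := mul_mem_grade Γ (mul_mem_grade Γ x.2 (quad_mem Γ r)) y.2
          by_cases hn : i + 2 + j = n
          · subst hn
            rw [DirectSum.decompose_of_mem_same _ hm]
            exact h i j rfl x x.2 r hr y y.2
          · rw [DirectSum.decompose_of_mem_ne _ hm hn]
            exact zero_mem _
    · rw [DirectSum.decompose_add]
      exact add_mem hx hy
  have := key t (mem_relIdeal_of_toEnv_eq_zero Γ h0)
  rwa [DirectSum.decompose_of_mem_same _ ht] at this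

/-- In degree two both outer factors of a product `x q(r) y` are scalars. Through this, quadratic
tensors which agree in `Γ^∧` are compared by means of an element of `𝓡`. -/
theorem mem_quadRel {t : InvTensor Γ} (ht : t ∈ grade Γ 2) (h0 : toEnv Γ t = 0) :
    ∃ r ∈ Γ.ideal, quad Γ r = t := by
  have : t ∈ quadRel Γ := by
    refine mem_of_toEnv_eq_zero Γ ht h0 fun i j hij x hx r hr y hy => ?_
    obtain rfl : i = 0 := by omega
    obtain rfl : j = 0 := by omega
    obtain ⟨c, rfl⟩ := mem_grade_zero Γ hx
    obtain ⟨e, rfl⟩ := mem_grade_zero Γ hy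
    rw [← Algebra.commutes, ← Algebra.smul_def, ← Algebra.smul_def]
    exact Submodule.smul_mem _ _ (Submodule.smul_mem _ _ (Submodule.mem_map_of_mem hr))
  exact this

/-- The relations only start in degree two. -/
theorem eq_zero_of_toEnv {n : ℕ} (hn : n < 2) {t : InvTensor Γ} (ht : t ∈ grade Γ n)
    (h0 : toEnv Γ t = 0) : t = 0 :=
  mem_of_toEnv_eq_zero Γ ht h0 (S := ⊥) fun i j hij => by omega

end InvTensor

namespace Env

section Star

variable [StarModule ℂ A] [HopfStarAlgebra A]

theorem antiHom_inc (a : A) : antiHom Γ (inc Γ a) = ConjOp.mk (inc Γ (star a)) := by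
  rw [antiHom, lift_inc]; rfl

theorem antiHom_dif (a : A) : antiHom Γ (dif Γ a) = ConjOp.mk (dif Γ (star a)) := by
  rw [antiHom, lift_dif]; rfl

theorem proj_antiHom (x : Env Γ) : proj Γ (antiHom Γ x).un = star (proj Γ x) := by
  let S : Subalgebra ℂ (Env Γ) :=
    { carrier := {x | proj Γ (antiHom Γ x).un = star (proj Γ x)}
      mul_mem' := by
        intro x y hx hy
        rw [Set.mem_ofPred_eq] at hx hy ⊢
        rw [map_mul (proj Γ) x y, star_mul, ← hx, ← hy, ← map_mul, map_mul (antiHom Γ)]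
        rfl
      add_mem' := by
        intro x y hx hy
        rw [Set.mem_ofPred_eq] at hx hy ⊢
        rw [map_add (proj Γ) x y, star_add, ← hx, ← hy, ← map_add, map_add (antiHom Γ)]
        rfl
      algebraMap_mem' := by
        intro c
        rw [Set.mem_ofPred_eq, AlgHom.commutes, AlgHom.commutes]
        change proj Γ (algebraMap ℂ (Env Γ) (star c)) = _
        rw [AlgHom.commutes, algebraMap_star_comm] }
  have h : S = ⊤ := by
    refine subalgebra_eq_top Γ (fun a => ?_) (fun a => ?_)
    · change proj Γ (antiHom Γ _).un = star (proj Γ _)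
      rw [antiHom_inc, proj_inc]
      exact proj_inc Γ _
    · change proj Γ (antiHom Γ _).un = star (proj Γ _)
      rw [antiHom_dif, proj_dif, star_zero]
      exact proj_dif Γ _
  have hx : x ∈ S := by rw [h]; trivial
  exact hx

theorem st_of_mem {n : ℕ} {x : Env Γ} (hx : x ∈ grade Γ n) :
    st Γ x = (-1 : ℂ) ^ (n * (n - 1) / 2) • (antiHom Γ x).un := by
  change (ConjOp.toAnti (antiHom Γ)) (degreeScale (grade Γ) _ x) = _
  rw [degreeScale_of_mem _ _ hx, map_smulₛₗ]
  simp
  rfl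

theorem st_inc (a : A) : st Γ (inc Γ a) = inc Γ (star a) := by
  rw [st_of_mem Γ (inc_mem Γ a), antiHom_inc]
  simp
  rfl

/-- The signs of the graded star play no role, since `p_*` lives in degree zero. -/
theorem proj_st (x : Env Γ) : proj Γ (st Γ x) = star (proj Γ x) := by
  refine linearMap_ext_of_grade (𝒲 := grade Γ) (σ := starRingEnd ℂ)
    (f := (proj Γ).toLinearMap.comp (st Γ))
    (g := (starLinearEquiv ℂ (A := A)).toLinearMap.comp (proj Γ).toLinearMap) (fun n x hx => ?_) x
  change proj Γ (st Γ x) = star (proj Γ x)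
  rw [st_of_mem Γ hx, map_smul, proj_antiHom]
  cases n with
  | zero => simp
  | succ n => rw [proj_of_mem Γ hx, star_zero, smul_zero]

end Star

end Env

/-- If `F : Γ_inv → W` and `g : A → W` commute and `ϖ(ϑ) = ∑ xₖ ⊗ vₖ`, then
`∑ g(b⁽¹⁾) (F ⊗ g)ϖ(ϑ ∘ b⁽²⁾) = ∑ F(xₖ ∘ b⁽¹⁾) g(vₖ b⁽²⁾)`. -/
theorem LeftInv.conv_coact_circ {W : Type*} [Ring W] [Algebra ℂ W] (F : LeftInv Γ →ₗ[ℂ] W)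
    (g : A →ₐ[ℂ] W) (hc : ∀ ϑ a, F ϑ * g a = g a * F ϑ) {ϑ : LeftInv Γ}
    {S : Finset (LeftInv Γ × A)} (hS : LeftInv.coact Γ ϑ = ∑ p ∈ S, p.1 ⊗ₜ[ℂ] p.2) :
    toConv g.toLinearMap * toConv ((LinearMap.mul' ℂ W ∘ₗ TensorProduct.map F g.toLinearMap ∘ₗ
      LeftInv.coact Γ) ∘ₗ LeftInv.circ Γ ϑ) =
    ∑ p ∈ S, toConv (F ∘ₗ LeftInv.circ Γ p.1) * (cst (g p.2) * toConv g.toLinearMap) := by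
  ext b
  have h1 : ∀ (x : A) (z : LeftInv Γ ⊗[ℂ] A), g x * LinearMap.mul' ℂ W
      (TensorProduct.map F g.toLinearMap z) = LinearMap.mul' ℂ W (TensorProduct.map F g.toLinearMap
        ((LinearMap.mulLeft ℂ x).lTensor (LeftInv Γ) z)) := by
    intro x z
    induction z with
    | zero => simp
    | add s t hs ht => simp only [map_add, mul_add, hs, ht]
    | tmul ϑ y =>
      simp only [TensorProduct.map_tmul, LinearMap.mul'_apply, LinearMap.lTensor_tmul,
        LinearMap.mulLeft_apply, AlgHom.toLinearMap_apply]
      rw [map_mul, ← mul_assoc, ← hc, mul_assoc]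
  have h2 := congrArg (LinearMap.mul' ℂ W ∘ₗ TensorProduct.map F g.toLinearMap)
    (LeftInv.coact_circ Γ ϑ (Coalgebra.Repr.arbitrary ℂ b))
  rw [(Coalgebra.Repr.arbitrary ℂ b).convMul_apply, ofConv_sum, LinearMap.sum_apply]
  simp only [(Coalgebra.Repr.arbitrary ℂ b).convMul_apply, cst_mul_apply]
  rw [Finset.sum_comm]
  rw [map_sum, map_sum, hS] at h2
  simp only [LinearMap.comp_apply, AlgHom.toLinearMap_apply, h1]
  simp only [LinearMap.comp_apply] at h2
  rw [h2]
  simp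

namespace Env

/-- The inclusion `Γ^∧ → Γ^∧ ⊗ A`. -/
abbrev inlR : Env Γ →ₐ[ℂ] Env Γ ⊗[ℂ] A := Algebra.TensorProduct.includeLeft

/-- The inclusion `A → Γ^∧ ⊗ A`. -/
abbrev inrR : A →ₐ[ℂ] Env Γ ⊗[ℂ] A := Algebra.TensorProduct.includeRight

/-- The left-invariant elements, coacted on by right translations. -/
def germR : LeftInv Γ →ₗ[ℂ] Env Γ ⊗[ℂ] A := (LeftInv.toEnv Γ).rTensor A ∘ₗ LeftInv.coact Γ

theorem germR_eq : germR Γ = LinearMap.mul' ℂ (Env Γ ⊗[ℂ] A) ∘ₗ TensorProduct.map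
    ((inlR Γ).toLinearMap ∘ₗ LeftInv.toEnv Γ) (inrR Γ).toLinearMap ∘ₗ LeftInv.coact Γ := by
  rw [germR, ← LinearMap.comp_assoc]
  congr 1
  ext ϑ a
  simp

/-- The triple convolution form of `ad`. Its outer factors are inverse to each other, which makes
products of such expressions collapse. -/
theorem toConv_germR : toConv (germR Γ ∘ₗ LeftInv.proj Γ) =
    toConv ((inrR Γ).toLinearMap ∘ₗ HopfAlgebra.antipode ℂ) *
      (toConv ((inlR Γ).toLinearMap ∘ₗ germ Γ) * toConv (inrR Γ).toLinearMap) := by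
  rw [← comp_ad ((germ Γ).rTensor A) _ _ _ (fun x y z => by simp)]
  apply congrArg
  ext a
  change (LeftInv.toEnv Γ).rTensor A ((LeftInv.proj Γ).rTensor A (ad A a)) = _
  rw [← LinearMap.comp_apply, ← LinearMap.rTensor_comp]
  rfl

/-- The right coaction of `A` on itself, with values in `Γ^∧ ⊗ A`. -/
def incR : A →ₐ[ℂ] Env Γ ⊗[ℂ] A :=
  (Algebra.TensorProduct.map (inc Γ) (AlgHom.id ℂ A)).comp (Bialgebra.comulAlgHom ℂ A)

theorem toConv_incR : toConv (incR Γ).toLinearMap =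
    toConv ((inlR Γ).toLinearMap ∘ₗ (inc Γ).toLinearMap) * toConv (inrR Γ).toLinearMap :=
  toConv_map_comul (inc Γ).toLinearMap

/-- This is the commutation condition for lifting the coaction to `Γ^∧`. It combines the covariance
of `∘` under `ϖ` with the rule `ϑ b = ∑ b⁽¹⁾ (ϑ ∘ b⁽²⁾)` in the first leg. -/
theorem germR_mul_incR (ϑ : LeftInv Γ) (b : A) : germR Γ ϑ * incR Γ b =
    (toConv (incR Γ).toLinearMap * toConv (germR Γ ∘ₗ LeftInv.circ Γ ϑ)).ofConv b := by
  obtain ⟨S, hS⟩ := TensorProduct.exists_finset (LeftInv.coact Γ ϑ)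
  have h1 := LeftInv.conv_coact_circ Γ ((inlR Γ).toLinearMap ∘ₗ LeftInv.toEnv Γ) (inrR Γ)
    (fun ϑ a => by simp) hS
  rw [← germR_eq] at h1
  have h3 : cst (germR Γ ϑ) = ∑ p ∈ S,
      (cst (LeftInv.toEnv Γ p.1 ⊗ₜ p.2) : WithConv (A →ₗ[ℂ] Env Γ ⊗[ℂ] A)) := by
    ext a
    rw [ofConv_sum, LinearMap.sum_apply]
    simp only [cst_apply, ← Finset.smul_sum]
    rw [germR, LinearMap.comp_apply, hS, map_sum]
    rfl
  have h5 : ∀ v : A, toConv ((inlR Γ).toLinearMap ∘ₗ (inc Γ).toLinearMap) * cst (inrR Γ v) =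
      cst (inrR Γ v) * toConv ((inlR Γ).toLinearMap ∘ₗ (inc Γ).toLinearMap) := by
    intro v
    ext a
    rw [cst_mul_apply, mul_cst_apply]
    simp
  have h6 : cst (germR Γ ϑ) * toConv (incR Γ).toLinearMap =
      toConv (incR Γ).toLinearMap * toConv (germR Γ ∘ₗ LeftInv.circ Γ ϑ) := by
    rw [toConv_incR, mul_assoc, h1, h3, Finset.mul_sum, Finset.sum_mul]
    refine Finset.sum_congr rfl fun p _ => ?_
    have h7 : (LeftInv.toEnv Γ p.1 ⊗ₜ[ℂ] p.2 : Env Γ ⊗[ℂ] A) =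
      inlR Γ (LeftInv.toEnv Γ p.1) * inrR Γ p.2 := by simp
    rw [LinearMap.comp_assoc, ← mul_assoc (toConv ((inlR Γ).toLinearMap ∘ₗ (inc Γ).toLinearMap))
      (toConv ((inlR Γ).toLinearMap ∘ₗ LeftInv.toEnv Γ ∘ₗ _)), LeftInv.comp_inc_conv_circ,
      mul_assoc (cst _) (toConv _), ← mul_assoc (toConv _) (cst _), h5, h7, cst_mul]
    simp only [mul_assoc]
  rw [← h6, cst_mul_apply]
  rfl

/-- The inner factors cancel against the antipode, so the product is governed by a single `ad`. The
quadratic condition for lifting the coaction then follows from the `ad`-invariance of `𝓡`. -/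
theorem toConv_germR_mul : toConv (conv (germR Γ ∘ₗ LeftInv.proj Γ) (germR Γ ∘ₗ LeftInv.proj Γ)) =
    toConv ((conv (germ Γ) (germ Γ)).rTensor A ∘ₗ ad A) := by
  have h1 : toConv ((inlR Γ).toLinearMap ∘ₗ conv (germ Γ) (germ Γ)) = _ :=
    toConv_comp_mul (inlR Γ) (toConv (germ Γ)) (toConv (germ Γ))
  rw [toConv_conv, toConv_germR, comp_ad ((conv (germ Γ) (germ Γ)).rTensor A)
    ((inrR Γ).toLinearMap ∘ₗ HopfAlgebra.antipode ℂ)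
    ((inlR Γ).toLinearMap ∘ₗ conv (germ Γ) (germ Γ)) (inrR Γ).toLinearMap
    (fun x y z => by simp), h1]
  simp only [mul_assoc]
  rw [← mul_assoc (toConv (inrR Γ).toLinearMap), conv_antipode_right, one_mul]

/-- The right coaction of `A` on `Γ^∧` by translations, with `a ↦ a⁽¹⁾ ⊗ a⁽²⁾` and
`da ↦ da⁽¹⁾ ⊗ a⁽²⁾`. -/
def coactR : Env Γ →ₐ[ℂ] Env Γ ⊗[ℂ] A :=
  liftInv (incR Γ) (germR Γ) (germR_mul_incR Γ)
    (fun r hr => by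
      have hk : conv (germ Γ) (germ Γ) ∘ₗ Γ.ideal.subtype = 0 := by
        ext x
        have := Env.d_germ Γ (x : A)
        rw [germ_ideal Γ _ x.2, map_zero] at this
        exact neg_eq_zero.1 this.symm
      obtain ⟨t, ht⟩ := Γ.ad_mem r hr
      refine congr(($(toConv_germR_mul Γ)).ofConv r).trans ?_
      change (conv (germ Γ) (germ Γ)).rTensor A (ad A r) = 0
      rw [← ht, ← LinearMap.comp_apply, ← LinearMap.rTensor_comp, hk, LinearMap.rTensor_zero,
        LinearMap.zero_apply])

theorem coactR_inc (a : A) :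
    coactR Γ (inc Γ a) = (inc Γ).toLinearMap.rTensor A (Coalgebra.comul a) :=
  liftInv_inc _ _ _ _ a

theorem coactR_dif (a : A) : coactR Γ (dif Γ a) = (dif Γ).rTensor A (Coalgebra.comul a) := by
  rw [coactR, liftInv_dif]
  have h : toConv (conv (incR Γ).toLinearMap (germR Γ ∘ₗ LeftInv.proj Γ)) =
      toConv ((dif Γ).rTensor A ∘ₗ Coalgebra.comul) := by
    have h1 : toConv ((inlR Γ).toLinearMap ∘ₗ (toConv (dif Γ)).ofConv) = _ :=
      congrArg (fun f => toConv ((inlR Γ).toLinearMap ∘ₗ ofConv f)) (toConv_dif Γ)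
    rw [toConv_comp_mul] at h1
    rw [toConv_conv, toConv_germR, toConv_incR]
    refine Eq.trans ?_ (toConv_map_comul (dif Γ)).symm
    change _ = toConv ((inlR Γ).toLinearMap ∘ₗ dif Γ) * _
    rw [h1]
    simp only [mul_assoc]
    rw [← mul_assoc (toConv (inrR Γ).toLinearMap), conv_antipode_right, one_mul]
  exact congr(($h).ofConv a)

end Env

end Envelope

/-! ### The differential of `ϑ ∘ a`, and the tensors `δ(ϑ)` and `ρ(ϑ, a)` -/

section Envelope

variable {A : Type u} [Ring A] [StarRing A] [HopfAlgebra ℂ A]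

namespace Env

variable (Γ : BicovariantStarCalculus A)

/-- The Leibniz rule for the convolution product. -/
theorem toConv_d_mul (f g : WithConv (A →ₗ[ℂ] Env Γ)) :
    toConv (d Γ ∘ₗ (f * g).ofConv) =
      toConv (parity (grade Γ) ∘ₗ f.ofConv) * toConv (d Γ ∘ₗ g.ofConv) +
        toConv (d Γ ∘ₗ f.ofConv) * g := by
  ext a
  change d Γ ((f * g).ofConv a) = (_ * _ : WithConv (A →ₗ[ℂ] Env Γ)).ofConv a +
    (_ * _ : WithConv (A →ₗ[ℂ] Env Γ)).ofConv a
  rw [(Coalgebra.Repr.arbitrary ℂ a).convMul_apply, (Coalgebra.Repr.arbitrary ℂ a).convMul_apply,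
    (Coalgebra.Repr.arbitrary ℂ a).convMul_apply, map_sum, ← Finset.sum_add_distrib]
  exact Finset.sum_congr rfl fun i _ => d_mul Γ _ _

end Env

variable {Γ : BicovariantStarCalculus A}

/-- `d(ϑ ∘ a)` in `Γ^∧`. -/
theorem LeftInv.toConv_d_toEnv_circ (ϑ : LeftInv Γ) :
    toConv (Env.d Γ ∘ₗ LeftInv.toEnv Γ ∘ₗ LeftInv.circ Γ ϑ) =
      Env.cinv Γ * cst (Env.d Γ (LeftInv.toEnv Γ ϑ)) * Env.cinc Γ -
      toConv (LeftInv.toEnv Γ ∘ₗ LeftInv.circ Γ ϑ) * toConv (Env.germ Γ) -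
      toConv (Env.germ Γ) * toConv (LeftInv.toEnv Γ ∘ₗ LeftInv.circ Γ ϑ) := by
  have h : toConv (Env.d Γ ∘ₗ LeftInv.toEnv Γ ∘ₗ LeftInv.circ Γ ϑ) =
      toConv (Env.d Γ ∘ₗ (toConv (LeftInv.toEnv Γ ∘ₗ LeftInv.circ Γ ϑ)).ofConv) := rfl
  have hJ : toConv (parity (Env.grade Γ) ∘ₗ (Env.cinv Γ).ofConv) = Env.cinv Γ := by
    ext a
    exact parity_of_mem_zero _ (Env.inc_mem Γ _)
  have hdJ : toConv (Env.d Γ ∘ₗ (Env.cinv Γ).ofConv) = -(toConv (Env.germ Γ) * Env.cinv Γ) := by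
    rw [← Env.toConv_dif_antipode]
    ext a
    exact Env.d_inc Γ _
  have hdI : toConv (Env.d Γ ∘ₗ (Env.cinc Γ).ofConv) = Env.cinc Γ * toConv (Env.germ Γ) := by
    rw [← Env.toConv_dif]
    ext a
    exact Env.d_inc Γ _
  have hx : toConv (parity (Env.grade Γ) ∘ₗ
      (cst (LeftInv.toEnv Γ ϑ) : WithConv (A →ₗ[ℂ] Env Γ)).ofConv) =
      -cst (LeftInv.toEnv Γ ϑ) := by
    ext a
    change parity (Env.grade Γ) (Coalgebra.counit (R := ℂ) a • LeftInv.toEnv Γ ϑ) =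
      -(Coalgebra.counit (R := ℂ) a • LeftInv.toEnv Γ ϑ)
    rw [map_smul, parity_of_mem_one _ (LeftInv.toEnv_mem Γ ϑ), smul_neg]
  have hdx : toConv (Env.d Γ ∘ₗ
      (cst (LeftInv.toEnv Γ ϑ) : WithConv (A →ₗ[ℂ] Env Γ)).ofConv) =
      cst (Env.d Γ (LeftInv.toEnv Γ ϑ)) := by
    ext a
    exact map_smul (Env.d Γ) _ _
  rw [h, LeftInv.toEnv_circ, mul_assoc, Env.toConv_d_mul, Env.toConv_d_mul, hJ, hdJ, hdI, hx, hdx]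
  noncomm_ring

namespace EnvSection

variable [StarModule ℂ A] (s : EnvSection Γ)

theorem toEnv_delta (ϑ : LeftInv Γ) :
    InvTensor.toEnv Γ (s.delta ϑ) = Env.d Γ (LeftInv.toEnv Γ ϑ) :=
  s.isSection _

theorem toEnv_sec (t : InvTensor Γ) :
    InvTensor.toEnv Γ (s.sec ((InvTensor.toEnv Γ).rangeRestrict t)) = InvTensor.toEnv Γ t :=
  s.isSection _

theorem delta_mem (ϑ : LeftInv Γ) : s.delta ϑ ∈ InvTensor.grade Γ 2 := by
  induction ϑ using LeftInv.induction with
  | h a =>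
    have h := s.grade_mem 2 (-InvTensor.quad Γ a) (neg_mem (InvTensor.quad_mem Γ a))
    have h2 : s.delta (LeftInv.proj Γ a) =
        s.sec ((InvTensor.toEnv Γ).rangeRestrict (-InvTensor.quad Γ a)) := by
      refine congrArg s.sec (Subtype.ext ?_)
      change Env.d Γ (Env.germ Γ a) = InvTensor.toEnv Γ (-InvTensor.quad Γ a)
      rw [map_neg, InvTensor.toEnv_quad, neg_neg]
    rw [h2]
    exact h

/-- In `Γ^∧` one has `dπ(a) = -∑ π(a⁽¹⁾) π(a⁽²⁾)`, so `δ(π(a))` and `-q(a)` are two lifts of the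
same element and differ by a quadratic relation. -/
theorem exists_delta_eq (a : A) : ∃ r ∈ Γ.ideal,
    s.delta (LeftInv.proj Γ a) = InvTensor.quad Γ r - InvTensor.quad Γ a := by
  obtain ⟨r, hr, h⟩ := InvTensor.mem_quadRel Γ
    (add_mem (s.delta_mem (LeftInv.proj Γ a)) (InvTensor.quad_mem Γ a)) (by
      rw [map_add, toEnv_delta, InvTensor.toEnv_quad, LeftInv.toEnv_proj, add_neg_cancel])
  exact ⟨r, hr, by rw [h, add_sub_cancel_right]⟩

/-- Normalization of the section is automatic, since `Γ_inv^⊗ → Γ^∧` is injective in degree zero. -/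
theorem sec_one : s.sec 1 = 1 := by
  have h : (1 : InvEnv Γ) = (InvTensor.toEnv Γ).rangeRestrict 1 := (map_one _).symm
  rw [h, ← sub_eq_zero]
  refine InvTensor.eq_zero_of_toEnv Γ two_pos
    (sub_mem (s.grade_mem 0 _ (InvTensor.one_mem_grade Γ)) (InvTensor.one_mem_grade Γ)) ?_
  rw [map_sub, toEnv_sec, sub_self]

theorem rho_mem (ϑ : LeftInv Γ) (a : A) : s.rho ϑ a ∈ InvTensor.grade Γ 2 := by
  have h : ∀ f g : A →ₗ[ℂ] LeftInv Γ, conv (TensorAlgebra.ι ℂ ∘ₗ f) (TensorAlgebra.ι ℂ ∘ₗ g) a ∈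
      InvTensor.grade Γ (1 + 1) := by
    intro f g
    rw [conv_repr _ _ (Coalgebra.Repr.arbitrary ℂ a)]
    exact sum_mem fun i _ =>
      InvTensor.mul_mem_grade Γ (InvTensor.ι_mem_grade Γ _) (InvTensor.ι_mem_grade Γ _)
  exact sub_mem (sub_mem (sub_mem (InvTensor.circ_mem Γ (s.delta_mem ϑ) a) (s.delta_mem _))
    (h _ _)) (h _ _)

/-- The definition of `ρ` is the formula for `d(ϑ ∘ a)` in `Γ^∧`, lifted term by term to tensors.
Being of degree two, `ρ(ϑ, a)` is then a quadratic relation. -/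
theorem toEnv_rho (ϑ : LeftInv Γ) (a : A) : InvTensor.toEnv Γ (s.rho ϑ a) = 0 := by
  have hι : ∀ f : A →ₗ[ℂ] LeftInv Γ, (InvTensor.toEnv Γ).toLinearMap ∘ₗ TensorAlgebra.ι ℂ ∘ₗ f =
      LeftInv.toEnv Γ ∘ₗ f := by
    intro f
    ext a
    exact InvTensor.toEnv_ι Γ _
  have h1 := InvTensor.toEnv_circ Γ (s.delta ϑ)
  rw [toEnv_delta] at h1
  have h2 : InvTensor.toEnv Γ (s.delta (LeftInv.circ Γ ϑ a)) = _ :=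
    (s.toEnv_delta _).trans congr(($(LeftInv.toConv_d_toEnv_circ ϑ)).ofConv a)
  have h3 := congr(($h1).ofConv a)
  change InvTensor.toEnv Γ ((InvTensor.circ Γ (s.delta ϑ)).ofConv a) = _ at h3
  change InvTensor.toEnv Γ ((InvTensor.circ Γ (s.delta ϑ)).ofConv a -
    s.delta (LeftInv.circ Γ ϑ a) - conv _ _ a - conv _ _ a) = 0
  rw [map_sub, map_sub, map_sub, h3, h2, algHom_conv, algHom_conv, hι, hι,
    LeftInv.toEnv_comp_proj]
  simp only [ofConv_sub, LinearMap.sub_apply, conv_eq]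
  abel

theorem exists_rho_eq (ϑ : LeftInv Γ) (a : A) :
    ∃ r ∈ Γ.ideal, InvTensor.quad Γ r = s.rho ϑ a :=
  InvTensor.mem_quadRel Γ (s.rho_mem ϑ a) (s.toEnv_rho ϑ a)

end EnvSection

end Envelope

/-! ### Tensor products over a field -/

section Tensor

variable {M : Type*} {N : Type*} [AddCommGroup M] [Module ℂ M] [AddCommGroup N] [Module ℂ N]

/-- An element of `M ⊗ N` lies in `M' ⊗ N` if all its slices lie in `M'`. -/
theorem mem_range_rTensor (M' : Submodule ℂ M) (z : M ⊗[ℂ] N)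
    (h : ∀ f : N →ₗ[ℂ] ℂ, TensorProduct.rid ℂ M (f.lTensor M z) ∈ M') :
    z ∈ LinearMap.range (M'.subtype.rTensor N) := by
  let b := Module.Basis.ofVectorSpace ℂ N
  obtain ⟨c, rfl⟩ := TensorProduct.eq_repr_basis_right b z
  refine sum_mem fun i _ => ?_
  have hi := h (b.coord i)
  have : TensorProduct.rid ℂ M ((b.coord i).lTensor M (c.sum fun i m => m ⊗ₜ b i)) = c i := by
    rw [Finsupp.sum, map_sum, map_sum, Finset.sum_eq_single i]
    · simp
    · intro j _ hj
      simp [Finsupp.single_eq_of_ne' hj]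
    · intro h0
      simp [Finsupp.notMem_support_iff.1 h0]
  rw [this] at hi
  exact ⟨⟨c i, hi⟩ ⊗ₜ b i, rfl⟩

/-- Reduces membership in a tensor product to membership of single vectors, where sums and
intersections of subspaces can be handled directly. -/
theorem mem_range_rTensor_iff (M' : Submodule ℂ M) (z : M ⊗[ℂ] N) :
    z ∈ LinearMap.range (M'.subtype.rTensor N) ↔
      ∀ f : N →ₗ[ℂ] ℂ, TensorProduct.rid ℂ M (f.lTensor M z) ∈ M' := by
  refine ⟨?_, mem_range_rTensor M' z⟩
  rintro ⟨t, rfl⟩ f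
  induction t with
  | zero => simp
  | add x y hx hy => simp only [map_add]; exact add_mem hx hy
  | tmul x y =>
    simp only [LinearMap.rTensor_tmul, LinearMap.lTensor_tmul, TensorProduct.rid_tmul]
    exact Submodule.smul_mem _ _ x.2

theorem slice_rTensor {M' : Type*} [AddCommGroup M'] [Module ℂ M'] (g : M →ₗ[ℂ] M')
    (f : N →ₗ[ℂ] ℂ) (z : M ⊗[ℂ] N) :
    TensorProduct.rid ℂ M' (f.lTensor M' (g.rTensor N z)) =
      g (TensorProduct.rid ℂ M (f.lTensor M z)) := by
  induction z with
  | zero => simp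
  | add x y hx hy => simp only [map_add, hx, hy]
  | tmul x y => simp

variable {W : Type u} [Ring W] [Algebra ℂ W] (𝒲 : ℕ → Submodule ℂ W) [GradedAlgebra 𝒲]

theorem gradedProj_of_mem {n : ℕ} {x : W} (hx : x ∈ 𝒲 n) : GradedAlgebra.proj 𝒲 n x = x := by
  rw [GradedAlgebra.proj_apply, DirectSum.decompose_of_mem_same 𝒲 hx]

theorem gradedProj_of_mem_ne {m n : ℕ} (h : m ≠ n) {x : W} (hx : x ∈ 𝒲 m) :
    GradedAlgebra.proj 𝒲 n x = 0 := by
  rw [GradedAlgebra.proj_apply, DirectSum.decompose_of_mem_ne 𝒲 hx h]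

theorem gradedProj_mem (n : ℕ) (x : W) : GradedAlgebra.proj 𝒲 n x ∈ 𝒲 n :=
  ((DirectSum.decompose 𝒲 x) n).2

theorem exists_sum_gradedProj (x : W) :
    ∃ K, ∀ L, K ≤ L → ∑ n ∈ Finset.range L, GradedAlgebra.proj 𝒲 n x = x := by
  induction x using DirectSum.Decomposition.inductionOn 𝒲 with
  | zero => exact ⟨0, by simp⟩
  | @homogeneous m x =>
    refine ⟨m + 1, fun L hL => ?_⟩
    rw [Finset.sum_eq_single m, gradedProj_of_mem 𝒲 x.2]
    · intro n _ hn
      exact gradedProj_of_mem_ne 𝒲 hn.symm x.2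
    · intro h
      exact absurd (Finset.mem_range.2 hL) h
  | add x y hx hy =>
    obtain ⟨K, hK⟩ := hx
    obtain ⟨K', hK'⟩ := hy
    refine ⟨max K K', fun L hL => ?_⟩
    simp only [map_add, Finset.sum_add_distrib]
    rw [hK L ((le_max_left _ _).trans hL), hK' L ((le_max_right _ _).trans hL)]

theorem exists_sum_lTensor_gradedProj (z : M ⊗[ℂ] W) :
    ∃ K, ∀ L, K ≤ L → ∑ n ∈ Finset.range L, (GradedAlgebra.proj 𝒲 n).lTensor M z = z := by
  induction z with
  | zero => exact ⟨0, by simp⟩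
  | tmul m x =>
    obtain ⟨K, hK⟩ := exists_sum_gradedProj 𝒲 x
    refine ⟨K, fun L hL => ?_⟩
    simp only [LinearMap.lTensor_tmul]
    rw [← TensorProduct.tmul_sum, hK L hL]
  | add x y hx hy =>
    obtain ⟨K, hK⟩ := hx
    obtain ⟨K', hK'⟩ := hy
    refine ⟨max K K', fun L hL => ?_⟩
    simp only [map_add, Finset.sum_add_distrib]
    rw [hK L ((le_max_left _ _).trans hL), hK' L ((le_max_right _ _).trans hL)]

theorem eq_zero_of_lTensor_gradedProj {z : M ⊗[ℂ] W}
    (h : ∀ n, (GradedAlgebra.proj 𝒲 n).lTensor M z = 0) : z = 0 := by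
  obtain ⟨K, hK⟩ := exists_sum_lTensor_gradedProj 𝒲 z
  rw [← hK K le_rfl]
  exact Finset.sum_eq_zero fun n _ => h n

theorem eq_zero_of_rTensor_gradedProj {z : W ⊗[ℂ] M}
    (h : ∀ n, (GradedAlgebra.proj 𝒲 n).rTensor M z = 0) : z = 0 := by
  rw [← (TensorProduct.comm ℂ W M).map_eq_zero_iff]
  refine eq_zero_of_lTensor_gradedProj 𝒲 fun n => ?_
  have := congrArg (TensorProduct.comm ℂ W M) (h n)
  rw [map_zero] at this
  rw [← this]
  simp only [LinearMap.lTensor, LinearMap.rTensor, TensorProduct.map_comm]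

end Tensor

/-! ### Calculi on bundles -/

namespace BundleCalculus

variable {A : Type u} [Ring A] [StarRing A] [HopfAlgebra ℂ A] [StarModule ℂ A]
  [HopfStarAlgebra A]
variable {V : Type*} [Ring V] [StarRing V] [Algebra ℂ V] [StarModule ℂ V]
variable {B : Type v} [Ring B] [StarRing B] [Algebra ℂ B] [StarModule ℂ B]
variable {P : QuantumPrincipalBundle A V B} {Γ : BicovariantStarCalculus A}
variable (C : BundleCalculus P Γ)

/-- The algebra `Ω(P) ⊗̂ Γ^∧`. -/
abbrev GT := GradedTensorProduct ℂ C.gr (Env.grade Γ)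

/-- The inclusion of `Ω(P)`. -/
abbrev inl : C.Ω →ₐ[ℂ] C.GT := GradedTensorProduct.includeLeft C.gr (Env.grade Γ)

/-- The inclusion of `Γ^∧`. -/
abbrev inr : Env Γ →ₐ[ℂ] C.GT := GradedTensorProduct.includeRight C.gr (Env.grade Γ)

/-- The identification of the vector spaces `Ω(P) ⊗ Γ^∧` and `Ω(P) ⊗̂ Γ^∧`. -/
abbrev toGT : C.Ω ⊗[ℂ] Env Γ ≃ₗ[ℂ] C.GT := GradedTensorProduct.of ℂ C.gr (Env.grade Γ)

theorem toGT_tmul (x : C.Ω) (v : Env Γ) : C.toGT (x ⊗ₜ v) = C.inl x * C.inr v :=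
  (GradedTensorProduct.tmul_one_mul_one_tmul C.gr (Env.grade Γ) x v).symm

theorem inr_mul_inl {m n : ℕ} {x : C.Ω} (hx : x ∈ C.gr m) {v : Env Γ} (hv : v ∈ Env.grade Γ n) :
    C.inr v * C.inl x = (-1) ^ (n * m) * (C.inl x * C.inr v) := by
  rw [← toGT_tmul]
  have h := GradedTensorProduct.tmul_coe_mul_coe_tmul (R := ℂ) C.gr (Env.grade Γ) (1 : C.Ω)
    ⟨v, hv⟩ ⟨x, hx⟩ (1 : Env Γ)
  simp only [one_mul, mul_one] at h
  refine h.trans ?_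
  have hs : ∀ (k : ℕ) (z : C.GT), (-1 : ℤˣ) ^ k • z = (-1) ^ k * z := by
    intro k z
    rcases Nat.even_or_odd k with hk | hk
    · rw [hk.neg_one_pow, hk.neg_one_pow, one_smul, one_mul]
    · rw [hk.neg_one_pow, hk.neg_one_pow, Units.neg_smul, one_smul, neg_one_mul]
  rw [← hs]

theorem inr_inc_mul_inl (a : A) (x : C.Ω) :
    C.inr (Env.inc Γ a) * C.inl x = C.inl x * C.inr (Env.inc Γ a) :=
  linearMap_ext_of_grade (𝒲 := C.gr)
    (f := LinearMap.mulLeft ℂ (C.inr (Env.inc Γ a)) ∘ₗ C.inl.toLinearMap)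
    (g := LinearMap.mulRight ℂ (C.inr (Env.inc Γ a)) ∘ₗ C.inl.toLinearMap)
    (fun m x hx => by simpa using C.inr_mul_inl hx (Env.inc_mem Γ a)) x

theorem inr_mul_inl_of_mem_one {v : Env Γ} (hv : v ∈ Env.grade Γ 1) (x : C.Ω) :
    C.inr v * C.inl x = C.inl (parity C.gr x) * C.inr v :=
  linearMap_ext_of_grade (𝒲 := C.gr)
    (f := LinearMap.mulLeft ℂ (C.inr v) ∘ₗ C.inl.toLinearMap)
    (g := LinearMap.mulRight ℂ (C.inr v) ∘ₗ C.inl.toLinearMap ∘ₗ parity C.gr)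
    (fun m x hx => by
      have h := C.inr_mul_inl hx hv
      rw [one_mul] at h
      simp only [LinearMap.comp_apply, LinearMap.mulLeft_apply, LinearMap.mulRight_apply,
        AlgHom.toLinearMap_apply]
      rw [h, parity_of_mem C.gr hx, map_mul, map_pow, map_neg, map_one, mul_assoc]) x

/-- The map `F̂`, as a homomorphism. -/
def FhatHom : C.Ω →ₐ[ℂ] C.GT :=
  AlgHom.ofLinearMap (C.toGT.toLinearMap ∘ₗ C.Fhat) (congrArg C.toGT C.Fhat_one) C.Fhat_mul

theorem FhatHom_apply (x : C.Ω) : C.FhatHom x = C.toGT (C.Fhat x) := rfl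

theorem algHom_ext {W : Type*} [Ring W] [Algebra ℂ W] {f g : C.Ω →ₐ[ℂ] W}
    (h : ∀ b, f (C.incl b) = g (C.incl b)) (hd : ∀ b, f (C.d (C.incl b)) = g (C.d (C.incl b))) :
    f = g := by
  refine AlgHom.ext_of_adjoin_eq_top C.generated ?_
  rintro x (⟨b, rfl⟩ | ⟨b, rfl⟩)
  · exact h b
  · exact hd b

theorem incl_mem (b : B) : C.incl b ∈ C.gr 0 := by
  rw [← C.range_incl]
  exact ⟨b, rfl⟩

/-- The projection `id ⊗ p_*`, as a homomorphism. -/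
def projGT : C.GT →ₐ[ℂ] C.Ω ⊗[ℂ] A :=
  GradedTensorProduct.lift C.gr (Env.grade Γ) Algebra.TensorProduct.includeLeft
    (Algebra.TensorProduct.includeRight.comp (Env.proj Γ)) (by
      intro i j x v
      cases j with
      | zero => simp
      | succ j => simp [Env.proj_of_mem Γ v.2])

theorem projGT_toGT (z : C.Ω ⊗[ℂ] Env Γ) :
    C.projGT (C.toGT z) = (Env.proj Γ).toLinearMap.lTensor C.Ω z := by
  induction z with
  | zero => simp
  | add x y hx hy => rw [map_add, map_add, map_add, hx, hy]
  | tmul x v =>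
    refine (GradedTensorProduct.lift_tmul C.gr (Env.grade Γ) _ _ _ x v).trans ?_
    simp

/-- The right action `F^∧`, as a homomorphism. -/
def actHom : C.Ω →ₐ[ℂ] C.Ω ⊗[ℂ] A := C.projGT.comp C.FhatHom

theorem actHom_apply (x : C.Ω) : C.actHom x = C.act x := C.projGT_toGT (C.Fhat x)

theorem act_mul (x y : C.Ω) : C.act (x * y) = C.act x * C.act y := by
  rw [← actHom_apply, map_mul, actHom_apply, actHom_apply]

theorem act_incl (b : B) : C.act (C.incl b) = C.incl.toLinearMap.rTensor A (P.F b) := by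
  rw [act, LinearMap.comp_apply, C.Fhat_incl]
  induction P.F b with
  | zero => simp
  | add x y hx hy => simp only [map_add, hx, hy]
  | tmul x a => simp [Env.proj_inc]

theorem act_d (x : C.Ω) : C.act (C.d x) = C.d.rTensor A (C.act x) := by
  rw [act, LinearMap.comp_apply, LinearMap.comp_apply, C.Fhat_d]
  induction C.Fhat x with
  | zero => simp
  | add x y hx hy =>
    simp only [map_add] at hx hy ⊢
    rw [← hx, ← hy]
    abel
  | tmul x v => simp [Env.proj_d]

theorem act_mem {n : ℕ} {x : C.Ω} (hx : x ∈ C.gr n) :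
    C.act x ∈ LinearMap.range ((C.gr n).subtype.rTensor A) := by
  have h : (⨆ (i : ℕ) (j : ℕ) (_ : i + j = n),
      LinearMap.range (TensorProduct.map (C.gr i).subtype (Env.grade Γ j).subtype)) ≤
      (LinearMap.range ((C.gr n).subtype.rTensor A)).comap
        ((Env.proj Γ).toLinearMap.lTensor C.Ω) := by
    refine iSup_le fun i => iSup_le fun j => iSup_le fun hij => ?_
    rintro _ ⟨z, rfl⟩
    induction z with
    | zero => simp
    | add x y hx hy => rw [map_add]; exact add_mem hx hy
    | tmul x v =>
      cases j with
      | succ j =>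
        rw [Submodule.mem_comap]
        simp [Env.proj_of_mem Γ v.2]
      | zero =>
        obtain rfl : i = n := by omega
        exact ⟨x ⊗ₜ Env.proj Γ v, by simp⟩
  exact h (C.Fhat_mem n x hx)

theorem act_parity (x : C.Ω) :
    C.act (parity C.gr x) = (parity C.gr).rTensor A (C.act x) :=
  linearMap_ext_of_grade (𝒲 := C.gr) (f := C.act ∘ₗ parity C.gr)
    (g := (parity C.gr).rTensor A ∘ₗ C.act) (fun n x hx => by
      obtain ⟨z, hz⟩ := C.act_mem hx
      rw [LinearMap.comp_apply, LinearMap.comp_apply, ← hz, parity, degreeScale_of_mem _ _ hx,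
        map_smul, ← hz]
      clear hz
      induction z with
      | zero => simp
      | add x y hx hy => simp only [map_add, smul_add, hx, hy]
      | tmul x a =>
        simp [degreeScale_of_mem _ _ x.2, TensorProduct.smul_tmul']) x

theorem act_st (x : C.Ω) : C.act (C.st x) =
    TensorProduct.map C.st (starLinearEquiv ℂ (A := A)).toLinearMap (C.act x) := by
  rw [act, LinearMap.comp_apply, LinearMap.comp_apply, C.Fhat_st]
  induction C.Fhat x with
  | zero => simp
  | add x y hx hy => simp only [map_add, hx, hy]
  | tmul x v => simp [Env.proj_st]

/-- Both sides are algebra homomorphisms in `x`, so they need only be compared on `𝓑` and `d𝓑`.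
There the coassociativity of `F` applies, because `F^∧` commutes with `d`. -/
theorem act_coassoc (x : C.Ω) : TensorProduct.assoc ℂ C.Ω A A (C.act.rTensor A (C.act x)) =
    Coalgebra.comul.lTensor C.Ω (C.act x) := by
  -- An arbitrary `g` is allowed so as to treat `b` and `db` alike.
  have hF : ∀ (g : B →ₗ[ℂ] C.Ω) (b : B), TensorProduct.assoc ℂ C.Ω A A
      ((g.rTensor A).rTensor A (P.F.toAlgHom.toLinearMap.rTensor A (P.F b))) =
      Coalgebra.comul.lTensor C.Ω (g.rTensor A (P.F b)) := by
    intro g b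
    have h := congrArg (g.rTensor (A ⊗[ℂ] A)) (P.coassoc b)
    have h1 : ∀ z, g.rTensor (A ⊗[ℂ] A) (TensorProduct.assoc ℂ B A A z) =
        TensorProduct.assoc ℂ C.Ω A A ((g.rTensor A).rTensor A z) := by
      intro z
      induction z with
      | zero => simp
      | add x y hx hy => simp only [map_add, hx, hy]
      | tmul x a =>
        induction x with
        | zero => simp
        | add x y hx hy => simp only [map_add, TensorProduct.add_tmul, hx, hy]
        | tmul x a => simp
    have h2 : ∀ z, g.rTensor (A ⊗[ℂ] A) ((Coalgebra.comul (R := ℂ) (A := A)).lTensor B z) =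
        (Coalgebra.comul (R := ℂ) (A := A)).lTensor C.Ω (g.rTensor A z) := by
      intro z
      induction z with
      | zero => simp
      | add x y hx hy => simp only [map_add, hx, hy]
      | tmul x a => simp
    rw [h1, h2] at h
    exact h
  let f : C.Ω →ₐ[ℂ] C.Ω ⊗[ℂ] (A ⊗[ℂ] A) :=
    (Algebra.TensorProduct.assoc ℂ ℂ ℂ C.Ω A A).toAlgHom.comp
      ((Algebra.TensorProduct.map C.actHom (AlgHom.id ℂ A)).comp C.actHom)
  let g : C.Ω →ₐ[ℂ] C.Ω ⊗[ℂ] (A ⊗[ℂ] A) :=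
    (Algebra.TensorProduct.map (AlgHom.id ℂ C.Ω) (Bialgebra.comulAlgHom ℂ A)).comp C.actHom
  have hact : C.actHom.toLinearMap = C.act := LinearMap.ext C.actHom_apply
  have hf : ∀ x, f x = TensorProduct.assoc ℂ C.Ω A A (C.act.rTensor A (C.act x)) := by
    intro x
    rw [← hact]
    rfl
  have hg : ∀ x, g x = Coalgebra.comul.lTensor C.Ω (C.act x) := by
    intro x
    rw [← hact]
    rfl
  have hc1 : C.act ∘ₗ C.incl.toLinearMap =
      C.incl.toLinearMap.rTensor A ∘ₗ P.F.toAlgHom.toLinearMap :=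
    LinearMap.ext C.act_incl
  have hc2 : C.act ∘ₗ C.d ∘ₗ C.incl.toLinearMap =
      (C.d ∘ₗ C.incl.toLinearMap).rTensor A ∘ₗ P.F.toAlgHom.toLinearMap := by
    ext b
    rw [LinearMap.comp_apply, LinearMap.comp_apply, AlgHom.toLinearMap_apply, act_d, act_incl,
      LinearMap.rTensor_comp]
    rfl
  have hfg : f = g := by
    refine C.algHom_ext (fun b => ?_) (fun b => ?_)
    · rw [hf, hg, act_incl, ← hF, ← LinearMap.comp_apply (C.act.rTensor A),
        ← LinearMap.rTensor_comp, hc1, LinearMap.rTensor_comp]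
      rfl
    · have hd : C.act (C.d (C.incl b)) = (C.d ∘ₗ C.incl.toLinearMap).rTensor A (P.F b) :=
        congr($hc2 b)
      rw [hf, hg, hd, ← hF, ← LinearMap.comp_apply (C.act.rTensor A),
        ← LinearMap.rTensor_comp, hc2, LinearMap.rTensor_comp]
      rfl
  rw [← hf, hfg, hg]

theorem act_counit (x : C.Ω) : TensorProduct.rid ℂ C.Ω
    ((Coalgebra.counit : A →ₗ[ℂ] ℂ).lTensor C.Ω (C.act x)) = x := by
  let f : C.Ω →ₐ[ℂ] C.Ω := (Algebra.TensorProduct.rid ℂ ℂ C.Ω).toAlgHom.comp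
    ((Algebra.TensorProduct.map (AlgHom.id ℂ C.Ω) (Bialgebra.counitAlgHom ℂ A)).comp C.actHom)
  have hact : C.actHom.toLinearMap = C.act := LinearMap.ext C.actHom_apply
  have hf : ∀ x, f x = TensorProduct.rid ℂ C.Ω
      ((Coalgebra.counit : A →ₗ[ℂ] ℂ).lTensor C.Ω (C.act x)) := by
    intro x
    rw [← hact]
    rfl
  have hF : ∀ (g : B →ₗ[ℂ] C.Ω) (b : B), TensorProduct.rid ℂ C.Ω
      ((Coalgebra.counit : A →ₗ[ℂ] ℂ).lTensor C.Ω (g.rTensor A (P.F b))) = g b := by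
    intro g b
    rw [slice_rTensor, P.counit, TensorProduct.rid_tmul, one_smul]
  have h : f = AlgHom.id ℂ C.Ω := by
    refine C.algHom_ext (fun b => ?_) (fun b => ?_)
    · rw [hf, act_incl, hF]
      rfl
    · rw [hf, act_d, act_incl, ← LinearMap.comp_apply (C.d.rTensor A), ← LinearMap.rTensor_comp, hF]
      rfl
  rw [← hf, h]
  rfl

end BundleCalculus

namespace Env

variable {A : Type u} [Ring A] [StarRing A] [HopfAlgebra ℂ A]
variable (Γ : BicovariantStarCalculus A)

/-- Preservation of degrees is what allows the coaction to be extended to `Ω(P) ⊗̂ Γ^∧`, where the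
sign rule refers to homogeneous elements. -/
theorem coactR_mem {n : ℕ} {x : Env Γ} (hx : x ∈ grade Γ n) :
    coactR Γ x ∈ LinearMap.range ((grade Γ n).subtype.rTensor A) := by
  have hmul : ∀ (m n : ℕ) (x y : Env Γ ⊗[ℂ] A),
      x ∈ LinearMap.range ((grade Γ m).subtype.rTensor A) →
      y ∈ LinearMap.range ((grade Γ n).subtype.rTensor A) →
      x * y ∈ LinearMap.range ((grade Γ (m + n)).subtype.rTensor A) := by
    rintro m n _ _ ⟨s, rfl⟩ ⟨t, rfl⟩
    induction s with
    | zero => simp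
    | add x y hx hy => rw [map_add, add_mul]; exact add_mem hx hy
    | tmul x a =>
      induction t with
      | zero => simp
      | add x y hx hy => rw [map_add, mul_add]; exact add_mem hx hy
      | tmul y b => exact ⟨⟨x * y, SetLike.mul_mem_graded x.2 y.2⟩ ⊗ₜ (a * b), by simp⟩
  have hr : ∀ (n : ℕ) (f : A →ₗ[ℂ] Env Γ), (∀ a, f a ∈ grade Γ n) → ∀ z : A ⊗[ℂ] A,
      f.rTensor A z ∈ LinearMap.range ((grade Γ n).subtype.rTensor A) := by
    intro n f hf z
    refine ⟨(f.codRestrict _ hf).rTensor A z, ?_⟩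
    rw [← LinearMap.comp_apply, ← LinearMap.rTensor_comp]
    rfl
  have hi : ∀ a, coactR Γ (inc Γ a) ∈ LinearMap.range ((grade Γ 0).subtype.rTensor A) := by
    intro a
    rw [coactR_inc]
    exact hr 0 _ (inc_mem Γ) _
  have hp : ∀ y ∈ LinearMap.range (dif Γ) ^ n,
      coactR Γ y ∈ LinearMap.range ((grade Γ n).subtype.rTensor A) := by
    clear hx
    intro y hy
    induction hy using Submodule.pow_induction_on_right' with
    | algebraMap r =>
      rw [← (inc Γ).commutes]
      exact hi _
    | add x y i hx hy ihx ihy => rw [map_add]; exact add_mem ihx ihy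
    | mul_mem i x hx ih m hm =>
      obtain ⟨a, rfl⟩ := hm
      rw [map_mul, coactR_dif]
      exact hmul i 1 _ _ ih (hr 1 _ (dif_mem Γ) _)
  refine Submodule.mul_induction_on hx ?_ ?_
  · rintro _ ⟨a, rfl⟩ y hy
    have := hmul 0 n _ _ (hi a) (hp y hy)
    rw [zero_add] at this
    rwa [map_mul]
  · intro x y hx hy
    rw [map_add]
    exact add_mem hx hy

end Env

/-! ### Horizontal forms: star, grading, and invariance under the right action -/

namespace BundleCalculus

variable {A : Type u} [Ring A] [StarRing A] [HopfAlgebra ℂ A] [StarModule ℂ A]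
  [HopfStarAlgebra A]
variable {V : Type*} [Ring V] [StarRing V] [Algebra ℂ V] [StarModule ℂ V]
variable {B : Type v} [Ring B] [StarRing B] [Algebra ℂ B] [StarModule ℂ B]
variable {P : QuantumPrincipalBundle A V B} {Γ : BicovariantStarCalculus A}
variable (C : BundleCalculus P Γ)

/-- The inclusion of `Ω(P) ⊗ A`. -/
def hinc : C.Ω ⊗[ℂ] A →ₐ[ℂ] C.GT :=
  Algebra.TensorProduct.lift C.inl (C.inr.comp (Env.inc Γ))
    (fun x a => (C.inr_inc_mul_inl a x).symm)

@[simp] theorem hinc_tmul (x : C.Ω) (a : A) :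
    C.hinc (x ⊗ₜ a) = C.inl x * C.inr (Env.inc Γ a) :=
  Algebra.TensorProduct.lift_tmul _ _ _ _ _

theorem hinc_eq (z : C.Ω ⊗[ℂ] A) :
    C.hinc z = C.toGT ((Env.inc Γ).toLinearMap.lTensor C.Ω z) := by
  induction z with
  | zero => simp
  | add x y hx hy => simp only [map_add, hx, hy]
  | tmul x a => rw [hinc_tmul, LinearMap.lTensor_tmul, toGT_tmul]; rfl

theorem projGT_hinc (z : C.Ω ⊗[ℂ] A) : C.projGT (C.hinc z) = z := by
  rw [hinc_eq, projGT_toGT, ← LinearMap.comp_apply, ← LinearMap.lTensor_comp]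
  have : (Env.proj Γ).toLinearMap ∘ₗ (Env.inc Γ).toLinearMap = LinearMap.id :=
    LinearMap.ext (Env.proj_inc Γ)
  rw [this, LinearMap.lTensor_id, LinearMap.id_apply]

theorem act_eq_of_FhatHom_eq {x : C.Ω} {z : C.Ω ⊗[ℂ] A} (h : C.FhatHom x = C.hinc z) :
    C.act x = z := by
  rw [← actHom_apply, actHom, AlgHom.comp_apply, h, projGT_hinc]

theorem mem_hor_of_FhatHom_eq {x : C.Ω} {z : C.Ω ⊗[ℂ] A} (h : C.FhatHom x = C.hinc z) :
    x ∈ C.hor := by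
  rw [FhatHom_apply, hinc_eq] at h
  exact ⟨z, C.toGT.injective h.symm⟩

theorem FhatHom_of_mem_hor {x : C.Ω} (hx : x ∈ C.hor) : C.FhatHom x = C.hinc (C.act x) := by
  obtain ⟨z, hz⟩ := hx
  have h : C.FhatHom x = C.hinc z := by rw [FhatHom_apply, ← hz, hinc_eq]
  rw [h, C.act_eq_of_FhatHom_eq h]

theorem mul_mem_hor {x y : C.Ω} (hx : x ∈ C.hor) (hy : y ∈ C.hor) : x * y ∈ C.hor :=
  C.mem_hor_of_FhatHom_eq (z := C.act x * C.act y) (by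
    rw [map_mul, map_mul, C.FhatHom_of_mem_hor hx, C.FhatHom_of_mem_hor hy])

theorem incl_mem_hor (b : B) : C.incl b ∈ C.hor := by
  refine C.mem_hor_of_FhatHom_eq (z := C.incl.toLinearMap.rTensor A (P.F b)) ?_
  rw [FhatHom_apply, C.Fhat_incl, hinc_eq, ← LinearMap.comp_apply (LinearMap.lTensor _ _),
    LinearMap.lTensor_comp_rTensor]

theorem one_mem_hor : (1 : C.Ω) ∈ C.hor := by
  rw [← map_one C.incl]
  exact C.incl_mem_hor 1

theorem st_mem_hor {x : C.Ω} (hx : x ∈ C.hor) : C.st x ∈ C.hor := by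
  obtain ⟨z, hz⟩ := hx
  refine ⟨TensorProduct.map C.st (starLinearEquiv ℂ (A := A)).toLinearMap z, ?_⟩
  rw [C.Fhat_st, ← hz]
  clear hz
  induction z with
  | zero => simp
  | add x y hx hy => simp only [map_add, hx, hy]
  | tmul x a => simp [Env.st_inc]

/-- Since `F̂` preserves the total degree, a component of bidegree `(i, j)` can only come from
degree `i + j`. -/
theorem map_gradedProj_Fhat (i j : ℕ) (x : C.Ω) :
    TensorProduct.map (GradedAlgebra.proj C.gr i) (GradedAlgebra.proj (Env.grade Γ) j)
      (C.Fhat x) =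
    TensorProduct.map (GradedAlgebra.proj C.gr i) (GradedAlgebra.proj (Env.grade Γ) j)
      (C.Fhat (GradedAlgebra.proj C.gr (i + j) x)) := by
  have h : ∀ (n : ℕ) (y : C.Ω), y ∈ C.gr n → n ≠ i + j →
      TensorProduct.map (GradedAlgebra.proj C.gr i) (GradedAlgebra.proj (Env.grade Γ) j)
        (C.Fhat y) = 0 := by
    intro n y hy hn
    have h1 : (⨆ (k : ℕ) (l : ℕ) (_ : k + l = n),
        LinearMap.range (TensorProduct.map (C.gr k).subtype (Env.grade Γ l).subtype)) ≤
        LinearMap.ker (TensorProduct.map (GradedAlgebra.proj C.gr i)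
          (GradedAlgebra.proj (Env.grade Γ) j)) := by
      refine iSup_le fun k => iSup_le fun l => iSup_le fun hkl => ?_
      rintro _ ⟨z, rfl⟩
      induction z with
      | zero => simp
      | add x y hx hy => rw [map_add]; exact add_mem hx hy
      | tmul x v =>
        rw [LinearMap.mem_ker, TensorProduct.map_tmul, TensorProduct.map_tmul]
        by_cases hk : k = i
        · have hl : l ≠ j := by omega
          rw [Submodule.subtype_apply, Submodule.subtype_apply,
            gradedProj_of_mem_ne (Env.grade Γ) hl v.2, TensorProduct.tmul_zero]
        · rw [Submodule.subtype_apply, Submodule.subtype_apply,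
            gradedProj_of_mem_ne C.gr hk x.2, TensorProduct.zero_tmul]
    exact h1 (C.Fhat_mem n y hy)
  refine linearMap_ext_of_grade (𝒲 := C.gr)
    (f := TensorProduct.map (GradedAlgebra.proj C.gr i) (GradedAlgebra.proj (Env.grade Γ) j) ∘ₗ
      C.Fhat)
    (g := TensorProduct.map (GradedAlgebra.proj C.gr i) (GradedAlgebra.proj (Env.grade Γ) j) ∘ₗ
      C.Fhat ∘ₗ GradedAlgebra.proj C.gr (i + j)) (fun n x hx => ?_) x
  simp only [LinearMap.comp_apply]
  by_cases hn : n = i + j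
  · subst hn
    rw [gradedProj_of_mem C.gr hx]
  · rw [gradedProj_of_mem_ne C.gr hn hx, h n x hx hn, map_zero, map_zero]

theorem map_gradedProj (i j : ℕ) (z : C.Ω ⊗[ℂ] Env Γ) :
    (GradedAlgebra.proj C.gr i).rTensor _ ((GradedAlgebra.proj (Env.grade Γ) j).lTensor _ z) =
    TensorProduct.map (GradedAlgebra.proj C.gr i) (GradedAlgebra.proj (Env.grade Γ) j) z := by
  rw [← LinearMap.comp_apply, LinearMap.rTensor_comp_lTensor]

/-- In fibre degree zero `Γ^∧` is just `A`, so only the components of positive fibre degree obstruct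
horizontality. In this form horizontality is visibly inherited by homogeneous components. -/
theorem mem_hor_iff_map_gradedProj (x : C.Ω) : x ∈ C.hor ↔ ∀ i j, j ≠ 0 →
    TensorProduct.map (GradedAlgebra.proj C.gr i) (GradedAlgebra.proj (Env.grade Γ) j)
      (C.Fhat x) = 0 := by
  constructor
  · rintro ⟨z, hz⟩ i j hj
    rw [← hz]
    clear hz
    induction z with
    | zero => simp
    | add x y hx hy => simp only [map_add, hx, hy, add_zero]
    | tmul x a =>
      rw [LinearMap.lTensor_tmul, TensorProduct.map_tmul, AlgHom.toLinearMap_apply,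
        gradedProj_of_mem_ne (Env.grade Γ) hj.symm (Env.inc_mem Γ a), TensorProduct.tmul_zero]
  · intro h
    have h1 : ∀ j, j ≠ 0 → (GradedAlgebra.proj (Env.grade Γ) j).lTensor C.Ω (C.Fhat x) = 0 :=
      fun j hj => eq_zero_of_rTensor_gradedProj C.gr fun i => by
        rw [map_gradedProj, h i j hj]
    obtain ⟨K, hK⟩ := exists_sum_lTensor_gradedProj (Env.grade Γ) (C.Fhat x)
    have h2 := hK (K + 1) (Nat.le_succ K)
    rw [Finset.sum_eq_single_of_mem 0 (by simp) (fun j _ hj => h1 j hj)] at h2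
    change C.Fhat x ∈ LinearMap.range ((Env.inc Γ).toLinearMap.lTensor C.Ω)
    rw [← h2]
    induction C.Fhat x with
    | zero => simp
    | add x y hx hy => rw [map_add]; exact add_mem hx hy
    | tmul x v =>
      refine ⟨x ⊗ₜ Env.proj Γ (GradedAlgebra.proj (Env.grade Γ) 0 v), ?_⟩
      rw [LinearMap.lTensor_tmul, LinearMap.lTensor_tmul, AlgHom.toLinearMap_apply,
        Env.inc_proj_of_mem Γ (gradedProj_mem (Env.grade Γ) 0 v)]

theorem gradedProj_mem_hor (n : ℕ) {x : C.Ω} (hx : x ∈ C.hor) :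
    GradedAlgebra.proj C.gr n x ∈ C.hor := by
  rw [mem_hor_iff_map_gradedProj] at hx ⊢
  intro i j hj
  rw [map_gradedProj_Fhat]
  by_cases hn : n = i + j
  · rw [hn, gradedProj_of_mem C.gr (gradedProj_mem C.gr _ x), ← map_gradedProj_Fhat, hx i j hj]
  · rw [gradedProj_of_mem_ne C.gr hn (gradedProj_mem C.gr _ x), map_zero, map_zero]

/-- Induction over horizontal forms by homogeneous ones. -/
theorem hor_induction {p : C.Ω → Prop} (h0 : p 0) (hadd : ∀ x y, p x → p y → p (x + y))
    (h : ∀ n, ∀ x ∈ C.hor, x ∈ C.gr n → p x) {x : C.Ω} (hx : x ∈ C.hor) : p x := by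
  obtain ⟨K, hK⟩ := exists_sum_gradedProj C.gr x
  rw [← hK K le_rfl]
  exact Finset.sum_induction _ p hadd h0
    fun n _ => h n _ (C.gradedProj_mem_hor n hx) (gradedProj_mem C.gr n x)

theorem parity_mem_hor {x : C.Ω} (hx : x ∈ C.hor) : parity C.gr x ∈ C.hor := by
  refine C.hor_induction (p := fun x => parity C.gr x ∈ C.hor) (by simp)
    (fun x y hx hy => by rw [map_add]; exact add_mem hx hy) (fun n x hx hn => ?_) hx
  rw [parity, degreeScale_of_mem _ _ hn]
  exact Submodule.smul_mem _ _ hx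

/-- The right coaction of `A` on `Ω(P) ⊗̂ Γ^∧`, acting on the second factor. -/
def coactGT : C.GT →ₐ[ℂ] C.GT ⊗[ℂ] A :=
  GradedTensorProduct.lift C.gr (Env.grade Γ)
    ((Algebra.TensorProduct.includeLeft : C.GT →ₐ[ℂ] C.GT ⊗[ℂ] A).comp C.inl)
    ((Algebra.TensorProduct.map C.inr (AlgHom.id ℂ A)).comp (Env.coactR Γ)) (by
      intro i j x v
      obtain ⟨z, hz⟩ := Env.coactR_mem Γ v.2
      simp only [AlgHom.comp_apply, ← hz]
      clear hz
      induction z with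
      | zero => simp
      | add x y hx hy => simp only [map_add, mul_add, add_mul, smul_add, hx, hy]
      | tmul y a =>
        simp only [LinearMap.rTensor_tmul, Submodule.subtype_apply,
          Algebra.TensorProduct.map_tmul, Algebra.TensorProduct.includeLeft_apply,
          Algebra.TensorProduct.tmul_mul_tmul, AlgHom.id_apply, one_mul, mul_one]
        rw [C.inr_mul_inl x.2 y.2]
        rcases Nat.even_or_odd (j * i) with hk | hk
        · rw [hk.neg_one_pow, hk.neg_one_pow, one_smul, one_mul]
        · rw [hk.neg_one_pow, hk.neg_one_pow, Units.neg_smul, one_smul, neg_one_mul,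
            TensorProduct.neg_tmul, neg_neg])

theorem coactGT_mul (x : C.Ω) (v : Env Γ) : C.coactGT (C.inl x * C.inr v) =
    (C.inl x ⊗ₜ 1) * C.inr.toLinearMap.rTensor A (Env.coactR Γ v) := by
  rw [← toGT_tmul]
  exact GradedTensorProduct.lift_tmul C.gr (Env.grade Γ) _ _ _ x v

/-- The map `x ⊗ a ↦ x g(a)`. -/
def incMap (g : A →ₗ[ℂ] Env Γ) : C.Ω ⊗[ℂ] A →ₗ[ℂ] C.GT :=
  LinearMap.mul' ℂ C.GT ∘ₗ TensorProduct.map C.inl.toLinearMap (C.inr.toLinearMap ∘ₗ g)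

theorem incMap_tmul (g : A →ₗ[ℂ] Env Γ) (x : C.Ω) (a : A) :
    C.incMap g (x ⊗ₜ a) = C.inl x * C.inr (g a) := rfl

theorem hinc_eq_incMap : C.hinc.toLinearMap = C.incMap (Env.inc Γ).toLinearMap := by
  ext x a
  exact C.hinc_tmul x a

/-- Serves both for `g = inc` and for `g = dif`, the two kinds of terms in `F̂(b)` and `F̂(db)`. -/
theorem coactGT_incMap {g : A →ₗ[ℂ] Env Γ}
    (hg : ∀ a, Env.coactR Γ (g a) = g.rTensor A (Coalgebra.comul a)) (z : C.Ω ⊗[ℂ] A) :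
    C.coactGT (C.incMap g z) = (C.incMap g).rTensor A
      ((TensorProduct.assoc ℂ C.Ω A A).symm (Coalgebra.comul.lTensor C.Ω z)) := by
  induction z with
  | zero => simp
  | add x y hx hy => simp only [map_add, hx, hy]
  | tmul x a =>
    rw [incMap_tmul, coactGT_mul, hg, LinearMap.lTensor_tmul]
    induction Coalgebra.comul (R := ℂ) a with
    | zero => simp
    | add y z hy hz => simp only [map_add, mul_add, TensorProduct.tmul_add, hy, hz]
    | tmul b c =>
      simp [incMap_tmul]

theorem coactGT_incMap_act {g : A →ₗ[ℂ] Env Γ}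
    (hg : ∀ a, Env.coactR Γ (g a) = g.rTensor A (Coalgebra.comul a)) (x : C.Ω) :
    C.coactGT (C.incMap g (C.act x)) = (C.incMap g).rTensor A (C.act.rTensor A (C.act x)) := by
  rw [C.coactGT_incMap hg, ← act_coassoc, LinearEquiv.symm_apply_apply]

theorem Fhat_d_incl (b : B) : C.FhatHom (C.d (C.incl b)) =
    C.incMap (Env.inc Γ).toLinearMap (C.act (C.d (C.incl b))) +
      C.incMap (Env.dif Γ) (C.act (C.incl b)) := by
  rw [act_d, act_incl, FhatHom_apply, C.Fhat_d, C.Fhat_incl]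
  induction P.F b with
  | zero => simp
  | add x y hx hy =>
    simp only [map_add] at hx hy ⊢
    rw [add_add_add_comm, hx, hy]
    abel
  | tmul x a =>
    simp only [TensorProduct.map_tmul, LinearMap.rTensor_tmul, AlgHom.toLinearMap_apply, map_add,
      toGT_tmul, incMap_tmul, LinearMap.id_apply, Env.d_inc,
      parity_of_mem_zero C.gr (C.incl_mem x)]

/-- A mixed coassociativity law between `F^∧` and `F̂`. Both sides are homomorphisms, so it is
checked on `b` and `db`, where it reduces to the coassociativity of `F^∧`. -/
theorem FhatHom_rTensor_act (x : C.Ω) :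
    C.FhatHom.toLinearMap.rTensor A (C.act x) = C.coactGT (C.FhatHom x) := by
  let f : C.Ω →ₐ[ℂ] C.GT ⊗[ℂ] A :=
    (Algebra.TensorProduct.map C.FhatHom (AlgHom.id ℂ A)).comp C.actHom
  have hact : C.actHom.toLinearMap = C.act := LinearMap.ext C.actHom_apply
  have hf : ∀ x, f x = C.FhatHom.toLinearMap.rTensor A (C.act x) := by
    intro x
    rw [← hact]
    rfl
  have h1 : C.FhatHom.toLinearMap ∘ₗ C.incl.toLinearMap =
      C.incMap (Env.inc Γ).toLinearMap ∘ₗ C.act ∘ₗ C.incl.toLinearMap := by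
    rw [← hinc_eq_incMap]
    exact LinearMap.ext fun b => C.FhatHom_of_mem_hor (C.incl_mem_hor b)
  have h2 : C.FhatHom.toLinearMap ∘ₗ C.d ∘ₗ C.incl.toLinearMap =
      C.incMap (Env.inc Γ).toLinearMap ∘ₗ C.act ∘ₗ C.d ∘ₗ C.incl.toLinearMap +
        C.incMap (Env.dif Γ) ∘ₗ C.act ∘ₗ C.incl.toLinearMap :=
    LinearMap.ext C.Fhat_d_incl
  have hfg : f = C.coactGT.comp C.FhatHom := by
    refine C.algHom_ext (fun b => ?_) (fun b => ?_)
    · rw [hf, AlgHom.comp_apply]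
      have h3 : C.FhatHom (C.incl b) = C.incMap (Env.inc Γ).toLinearMap (C.act (C.incl b)) :=
        congr($h1 b)
      rw [h3, C.coactGT_incMap_act (Env.coactR_inc Γ), act_incl,
        ← LinearMap.comp_apply (LinearMap.rTensor _ _), ← LinearMap.rTensor_comp, h1,
        LinearMap.rTensor_comp, LinearMap.rTensor_comp]
      rfl
    · rw [hf, AlgHom.comp_apply, C.Fhat_d_incl, map_add,
        C.coactGT_incMap_act (Env.coactR_inc Γ), C.coactGT_incMap_act (Env.coactR_dif Γ),
        act_d, act_incl, ← LinearMap.comp_apply (C.d.rTensor A), ← LinearMap.rTensor_comp,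
        ← LinearMap.comp_apply (LinearMap.rTensor _ _), ← LinearMap.rTensor_comp, h2,
        LinearMap.rTensor_add]
      simp only [LinearMap.add_apply, LinearMap.rTensor_comp, LinearMap.comp_apply]
  rw [← hf, hfg, AlgHom.comp_apply]

/-- The right action maps horizontal forms to horizontal forms. -/
theorem act_mem_hor {x : C.Ω} (hx : x ∈ C.hor) :
    C.act x ∈ LinearMap.range (C.hor.subtype.rTensor A) := by
  -- A functional on the last leg turns mixed coassociativity into a formula for `F̂` on a slice of
  -- `F^∧(x)`, whose value has no component of positive fibre degree.
  refine mem_range_rTensor _ _ fun f => ?_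
  refine C.mem_hor_of_FhatHom_eq
    (z := C.act (TensorProduct.rid ℂ _ (f.lTensor _ (C.act x)))) ?_
  have h := C.FhatHom_rTensor_act x
  have h3 : C.FhatHom x = C.incMap (Env.inc Γ).toLinearMap (C.act x) := by
    rw [C.FhatHom_of_mem_hor hx, ← hinc_eq_incMap]
    rfl
  rw [h3, C.coactGT_incMap_act (Env.coactR_inc Γ), ← hinc_eq_incMap] at h
  have h4 := congrArg (fun z => TensorProduct.rid ℂ C.GT (f.lTensor C.GT z)) h
  simp only [slice_rTensor] at h4
  exact h4

end BundleCalculus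

/-! ### The right action of the convolution algebra through `F^∧` -/

namespace BundleCalculus

variable {A : Type u} [Ring A] [StarRing A] [HopfAlgebra ℂ A] [StarModule ℂ A]
  [HopfStarAlgebra A]
variable {V : Type*} [Ring V] [StarRing V] [Algebra ℂ V] [StarModule ℂ V]
variable {B : Type v} [Ring B] [StarRing B] [Algebra ℂ B] [StarModule ℂ B]
variable {P : QuantumPrincipalBundle A V B} {Γ : BicovariantStarCalculus A}
variable (C : BundleCalculus P Γ)

section Pairing

variable {W : Type*} [Ring W] [Algebra ℂ W]

/-- The map `φ ↦ ∑ j(φₖ) f(cₖ)`, where `F^∧(φ) = ∑ φₖ ⊗ cₖ`. This is a right action of the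
convolution algebra. -/
def pr (j : C.Ω →ₗ[ℂ] W) (f : WithConv (A →ₗ[ℂ] W)) : C.Ω →ₗ[ℂ] W :=
  LinearMap.mul' ℂ W ∘ₗ TensorProduct.map j f.ofConv ∘ₗ C.act

theorem pr_apply (j : C.Ω →ₗ[ℂ] W) (f : WithConv (A →ₗ[ℂ] W)) (x : C.Ω) :
    C.pr j f x = LinearMap.mul' ℂ W (TensorProduct.map j f.ofConv (C.act x)) := rfl

theorem twist_eq (x : C.Ω) (f : A →ₗ[ℂ] C.Ω) :
    C.twist x f = C.pr LinearMap.id (toConv f) x := rfl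

/-- This is the coassociativity of `F^∧`, in the form in which it is used from here on. -/
theorem pr_pr (j : C.Ω →ₗ[ℂ] W) (f g : WithConv (A →ₗ[ℂ] W)) :
    C.pr (C.pr j f) g = C.pr j (f * g) := by
  ext x
  let M : C.Ω ⊗[ℂ] (A ⊗[ℂ] A) →ₗ[ℂ] W := LinearMap.mul' ℂ W ∘ₗ
    TensorProduct.map j (LinearMap.mul' ℂ W ∘ₗ TensorProduct.map f.ofConv g.ofConv)
  have h1 : ∀ z, M (TensorProduct.assoc ℂ C.Ω A A z) = LinearMap.mul' ℂ W (TensorProduct.map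
      (LinearMap.mul' ℂ W ∘ₗ TensorProduct.map j f.ofConv) g.ofConv z) := by
    intro z
    induction z with
    | zero => simp
    | add x y hx hy => simp only [map_add, hx, hy]
    | tmul x a =>
      induction x with
      | zero => simp
      | add x y hx hy => simp only [map_add, TensorProduct.add_tmul, hx, hy]
      | tmul x b => simp [M, mul_assoc]
  have h2 : ∀ z, M (Coalgebra.comul.lTensor C.Ω z) =
      LinearMap.mul' ℂ W (TensorProduct.map j (f * g).ofConv z) := by
    intro z
    induction z with
    | zero => simp
    | add x y hx hy => simp only [map_add, hx, hy]
    | tmul x a => rfl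
  rw [pr_apply, pr_apply, ← h2, ← act_coassoc, h1,
    ← LinearMap.comp_apply (TensorProduct.map (_ ∘ₗ _) _) (LinearMap.rTensor _ _),
    LinearMap.map_comp_rTensor]
  rfl

theorem pr_one (j : C.Ω →ₗ[ℂ] W) : C.pr j 1 = j := by
  ext x
  conv_rhs => rw [← C.act_counit x]
  rw [pr_apply]
  induction C.act x with
  | zero => simp
  | add x y hx hy => simp only [map_add, hx, hy]
  | tmul x a =>
    simp [Algebra.algebraMap_eq_smul_one]

theorem pr_add_left (j j' : C.Ω →ₗ[ℂ] W) (f : WithConv (A →ₗ[ℂ] W)) :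
    C.pr (j + j') f = C.pr j f + C.pr j' f := by
  simp [pr, TensorProduct.map_add_left, LinearMap.comp_add, LinearMap.add_comp]

theorem pr_add_right (j : C.Ω →ₗ[ℂ] W) (f g : WithConv (A →ₗ[ℂ] W)) :
    C.pr j (f + g) = C.pr j f + C.pr j g := by
  simp [pr, TensorProduct.map_add_right, LinearMap.comp_add, LinearMap.add_comp]

theorem pr_neg_left (j : C.Ω →ₗ[ℂ] W) (f : WithConv (A →ₗ[ℂ] W)) :
    C.pr (-j) f = -C.pr j f := by
  rw [eq_neg_iff_add_eq_zero, ← pr_add_left, neg_add_cancel]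
  simp [pr]

theorem pr_neg_right (j : C.Ω →ₗ[ℂ] W) (f : WithConv (A →ₗ[ℂ] W)) :
    C.pr j (-f) = -C.pr j f := by
  rw [eq_neg_iff_add_eq_zero, ← pr_add_right, neg_add_cancel]
  simp [pr]

theorem pr_sub_left (j j' : C.Ω →ₗ[ℂ] W) (f : WithConv (A →ₗ[ℂ] W)) :
    C.pr (j - j') f = C.pr j f - C.pr j' f := by
  rw [sub_eq_add_neg, pr_add_left, pr_neg_left, ← sub_eq_add_neg]

theorem pr_sub_right (j : C.Ω →ₗ[ℂ] W) (f g : WithConv (A →ₗ[ℂ] W)) :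
    C.pr j (f - g) = C.pr j f - C.pr j g := by
  rw [sub_eq_add_neg, pr_add_right, pr_neg_right, ← sub_eq_add_neg]

theorem pr_sum_right {ι : Type*} (s : Finset ι) (j : C.Ω →ₗ[ℂ] W)
    (f : ι → WithConv (A →ₗ[ℂ] W)) : C.pr j (∑ i ∈ s, f i) = ∑ i ∈ s, C.pr j (f i) :=
  map_sum (AddMonoidHom.mk' (C.pr j) (C.pr_add_right j)) f s

theorem comp_pr {W' : Type*} [Ring W'] [Algebra ℂ W'] (h : W →ₐ[ℂ] W') (j : C.Ω →ₗ[ℂ] W)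
    (f : WithConv (A →ₗ[ℂ] W)) : h.toLinearMap ∘ₗ C.pr j f =
      C.pr (h.toLinearMap ∘ₗ j) (toConv (h.toLinearMap ∘ₗ f.ofConv)) := by
  ext x
  rw [LinearMap.comp_apply, pr_apply, pr_apply]
  induction C.act x with
  | zero => simp
  | add x y hx hy => simp only [map_add, hx, hy]
  | tmul x a => simp

theorem map_pr {W' : Type*} [Ring W'] [Algebra ℂ W'] (h : W →ₐ[ℂ] W') (j : C.Ω →ₗ[ℂ] W)
    (f : WithConv (A →ₗ[ℂ] W)) (x : C.Ω) : h (C.pr j f x) =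
      C.pr (h.toLinearMap ∘ₗ j) (toConv (h.toLinearMap ∘ₗ f.ofConv)) x :=
  congr($(C.comp_pr h j f) x)

theorem mul_pr (w : W) (j : C.Ω →ₗ[ℂ] W) (f : WithConv (A →ₗ[ℂ] W)) (x : C.Ω) :
    w * C.pr j f x = C.pr (LinearMap.mulLeft ℂ w ∘ₗ j) f x := by
  rw [pr_apply, pr_apply]
  induction C.act x with
  | zero => simp
  | add x y hx hy => simp only [map_add, mul_add, hx, hy]
  | tmul x a => simp [mul_assoc]

theorem pr_cst (j : C.Ω →ₗ[ℂ] W) (w : W) : C.pr j (cst w) = LinearMap.mulRight ℂ w ∘ₗ j := by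
  conv_rhs => rw [← C.pr_one j]
  ext x
  rw [LinearMap.comp_apply, pr_apply, pr_apply]
  induction C.act x with
  | zero => simp
  | add x y hx hy => simp only [map_add, hx, hy]
  | tmul x a => simp [cst_apply, Algebra.algebraMap_eq_smul_one]

theorem pr_cst_mul (j : C.Ω →ₗ[ℂ] W) (w : W) (f : WithConv (A →ₗ[ℂ] W)) :
    C.pr j (cst w * f) = C.pr (LinearMap.mulRight ℂ w ∘ₗ j) f := by
  rw [← pr_pr, pr_cst]

theorem pr_comp (j : C.Ω →ₗ[ℂ] W) (f : WithConv (A →ₗ[ℂ] W)) {g : C.Ω →ₗ[ℂ] C.Ω}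
    (hg : ∀ x, C.act (g x) = g.rTensor A (C.act x)) : C.pr (j ∘ₗ g) f = C.pr j f ∘ₗ g := by
  ext x
  rw [LinearMap.comp_apply, pr_apply, pr_apply, hg,
    ← LinearMap.comp_apply (TensorProduct.map _ _) (LinearMap.rTensor _ _),
    LinearMap.map_comp_rTensor]

theorem pr_comp_d (j : C.Ω →ₗ[ℂ] W) (f : WithConv (A →ₗ[ℂ] W)) :
    C.pr (j ∘ₗ C.d) f = C.pr j f ∘ₗ C.d := C.pr_comp j f C.act_d

theorem pr_comp_parity (j : C.Ω →ₗ[ℂ] W) (f : WithConv (A →ₗ[ℂ] W)) :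
    C.pr (j ∘ₗ parity C.gr) f = C.pr j f ∘ₗ parity C.gr := C.pr_comp j f C.act_parity

theorem pr_mem (j : C.Ω →ₗ[ℂ] W) (f : WithConv (A →ₗ[ℂ] W)) {N : Submodule ℂ C.Ω} {x : C.Ω}
    (hx : C.act x ∈ LinearMap.range (N.subtype.rTensor A)) {S : Submodule ℂ W}
    (h : ∀ y ∈ N, ∀ a, j y * f.ofConv a ∈ S) : C.pr j f x ∈ S := by
  obtain ⟨z, hz⟩ := hx
  rw [pr_apply, ← hz]
  clear hz
  induction z with
  | zero => simp
  | add x y hx hy => simp only [map_add]; exact add_mem hx hy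
  | tmul x a => exact h _ x.2 a

/-- The first legs of `F^∧(x)` are horizontal when `x` is, so the values of `j` elsewhere do not
matter. -/
theorem pr_congr {j j' : C.Ω →ₗ[ℂ] W} (f : WithConv (A →ₗ[ℂ] W)) (h : ∀ x ∈ C.hor, j x = j' x)
    {x : C.Ω} (hx : x ∈ C.hor) : C.pr j f x = C.pr j' f x := by
  rw [← sub_eq_zero, ← LinearMap.sub_apply, ← pr_sub_left]
  exact C.pr_mem (S := ⊥) _ _ (C.act_mem_hor hx) fun y hy a => by simp [h y hy]

end Pairing

theorem pr_inl (f : A →ₗ[ℂ] C.Ω) :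
    C.pr C.inl.toLinearMap (toConv (C.inl.toLinearMap ∘ₗ f)) =
      C.inl.toLinearMap ∘ₗ C.pr LinearMap.id (toConv f) := by
  rw [comp_pr, LinearMap.comp_id]

/-- The inclusion of `A` in `Ω(P) ⊗̂ Γ^∧`. -/
def incGT : A →ₐ[ℂ] C.GT := C.inr.comp (Env.inc Γ)

theorem FhatHom_eq_pr {x : C.Ω} (hx : x ∈ C.hor) :
    C.FhatHom x = C.pr C.inl.toLinearMap (toConv C.incGT.toLinearMap) x := by
  rw [C.FhatHom_of_mem_hor hx, pr_apply]
  induction C.act x with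
  | zero => simp
  | add x y hx hy => simp only [map_add, hx, hy]
  | tmul x a => exact C.hinc_tmul x a

/-- On horizontal forms `F̂(φ) = ∑ φₖ ⊗ cₖ`, so replacing `F̂` by the inclusion of `Ω(P)` costs one
convolution factor, the inclusion of `A`. -/
theorem pr_FhatHom (f : WithConv (A →ₗ[ℂ] C.GT)) {g : C.Ω →ₗ[ℂ] C.Ω}
    (hg : ∀ x ∈ C.hor, g x ∈ C.hor) (hg' : ∀ x, C.act (g x) = g.rTensor A (C.act x))
    {x : C.Ω} (hx : x ∈ C.hor) :
    C.pr (C.FhatHom.toLinearMap ∘ₗ g) f x =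
      C.pr (C.inl.toLinearMap ∘ₗ g) (toConv C.incGT.toLinearMap * f) x := by
  rw [C.pr_congr (j' := C.pr C.inl.toLinearMap (toConv C.incGT.toLinearMap) ∘ₗ g) f
    (fun y hy => C.FhatHom_eq_pr (hg y hy)) hx, ← C.pr_comp _ _ hg', pr_pr]

theorem hinc_map (g : C.Ω →ₗ[ℂ] C.Ω) (a : A) (x : C.Ω) :
    C.hinc (TensorProduct.map g (LinearMap.mulLeft ℂ a) (C.act x)) =
      C.pr (C.inl.toLinearMap ∘ₗ g) (cst (C.incGT a) * toConv C.incGT.toLinearMap) x := by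
  rw [pr_apply]
  induction C.act x with
  | zero => simp
  | add x y hx hy => simp only [map_add, hx, hy]
  | tmul x b =>
    rw [TensorProduct.map_tmul, TensorProduct.map_tmul, hinc_tmul, LinearMap.mul'_apply,
      cst_mul_apply]
    change C.inl (g x) * C.inr (Env.inc Γ (a * b)) =
      C.inl (g x) * (C.inr (Env.inc Γ a) * C.inr (Env.inc Γ b))
    rw [map_mul, map_mul]

theorem inl_mul_incGT (x : C.Ω) (a : A) : C.inl x * C.incGT a = C.incGT a * C.inl x :=
  (C.inr_inc_mul_inl a x).symm

end BundleCalculus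

/-! ### Connections: horizontality of `ℓ_ω` and of the covariant part of `d` -/

namespace BundleCalculus.Connection

variable {A : Type u} [Ring A] [StarRing A] [HopfAlgebra ℂ A] [StarModule ℂ A]
  [HopfStarAlgebra A]
variable {V : Type*} [Ring V] [StarRing V] [Algebra ℂ V] [StarModule ℂ V]
variable {B : Type v} [Ring B] [StarRing B] [Algebra ℂ B] [StarModule ℂ B]
variable {P : QuantumPrincipalBundle A V B} {Γ : BicovariantStarCalculus A}
variable {C : BundleCalculus P Γ} (W : C.Connection)

/-- The horizontal part `(ω ⊗ id) ϖ(ϑ)` of `F̂ ω(ϑ)`. -/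
def coactω : LeftInv Γ →ₗ[ℂ] C.GT :=
  LinearMap.mul' ℂ C.GT ∘ₗ TensorProduct.map (C.inl.toLinearMap ∘ₗ W.ω) C.incGT.toLinearMap ∘ₗ
    LeftInv.coact Γ

theorem FhatHom_ω (ϑ : LeftInv Γ) :
    C.FhatHom (W.ω ϑ) = W.coactω ϑ + C.inr (LeftInv.toEnv Γ ϑ) := by
  rw [FhatHom_apply, W.Fhat_ω, map_add, toGT_tmul, map_one, one_mul, coactω,
    LinearMap.comp_apply, LinearMap.comp_apply]
  congr 1
  induction LeftInv.coact Γ ϑ with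
  | zero => simp
  | add x y hx hy => simp only [map_add, hx, hy]
  | tmul x a => exact C.toGT_tmul _ _

theorem coactω_eq_sum {ϑ : LeftInv Γ} {S : Finset (LeftInv Γ × A)}
    (hS : LeftInv.coact Γ ϑ = ∑ p ∈ S, p.1 ⊗ₜ[ℂ] p.2) :
    W.coactω ϑ = ∑ p ∈ S, C.inl (W.ω p.1) * C.incGT p.2 := by
  rw [coactω, LinearMap.comp_apply, LinearMap.comp_apply, hS, map_sum, map_sum]
  rfl

/-- The map `φ ↦ ℓ_ω(ϑ, φ)`. -/
def ellMap (ϑ : LeftInv Γ) : C.Ω →ₗ[ℂ] C.Ω :=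
  LinearMap.mulLeft ℂ (W.ω ϑ) -
    C.pr LinearMap.id (toConv (W.ω ∘ₗ LeftInv.circ Γ ϑ)) ∘ₗ parity C.gr

theorem ellMap_apply (ϑ : LeftInv Γ) (x : C.Ω) : W.ellMap ϑ x = W.ell ϑ x := rfl

/-- `F̂ω(ϑ ∘ c)` has a part in `Ω(P) ⊗ A` and a pure fibre part. The inclusion of `A` is carried
across the first by the covariance of `∘` under `ϖ`, and across the second by `ϑ b = ∑ b⁽¹⁾ (ϑ ∘
b⁽²⁾)`. -/
theorem conv_FhatHom_ω_circ {ϑ : LeftInv Γ} {S : Finset (LeftInv Γ × A)}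
    (hS : LeftInv.coact Γ ϑ = ∑ p ∈ S, p.1 ⊗ₜ[ℂ] p.2) :
    toConv C.incGT.toLinearMap * toConv (C.FhatHom.toLinearMap ∘ₗ W.ω ∘ₗ LeftInv.circ Γ ϑ) =
      ∑ p ∈ S, toConv (C.inl.toLinearMap ∘ₗ W.ω ∘ₗ LeftInv.circ Γ p.1) *
        (cst (C.incGT p.2) * toConv C.incGT.toLinearMap) +
      cst (C.inr (LeftInv.toEnv Γ ϑ)) * toConv C.incGT.toLinearMap := by
  have h1 : toConv (C.FhatHom.toLinearMap ∘ₗ W.ω ∘ₗ LeftInv.circ Γ ϑ) =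
      toConv (W.coactω ∘ₗ LeftInv.circ Γ ϑ) +
        toConv (C.inr.toLinearMap ∘ₗ LeftInv.toEnv Γ ∘ₗ LeftInv.circ Γ ϑ) := by
    ext a
    exact W.FhatHom_ω _
  have h2 := LeftInv.comp_inc_conv_circ Γ C.inr ϑ
  have h3 := LeftInv.conv_coact_circ Γ (C.inl.toLinearMap ∘ₗ W.ω) C.incGT
    (fun ϑ a => C.inl_mul_incGT _ a) hS
  rw [h1, mul_add, coactω, h3]
  congr 1

/-- The term `1 ⊗ ϑ` of `F̂ω(ϑ)` occurs in `F̂(ω(ϑ)φ)` and, after transport across `A` and `φ`,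
identically in `F̂` of the twisted product, so it cancels. The rest lies in `Ω(P) ⊗ A`, which yields
horizontality and the covariance of `ℓ` at once. -/
theorem FhatHom_ell {ϑ : LeftInv Γ} {S : Finset (LeftInv Γ × A)}
    (hS : LeftInv.coact Γ ϑ = ∑ p ∈ S, p.1 ⊗ₜ[ℂ] p.2) {x : C.Ω} (hx : x ∈ C.hor) :
    C.FhatHom (W.ell ϑ x) =
      C.hinc (∑ p ∈ S, TensorProduct.map (W.ellMap p.1) (LinearMap.mulLeft ℂ p.2) (C.act x)) := by
  have h1 : C.FhatHom (C.pr LinearMap.id (toConv (W.ω ∘ₗ LeftInv.circ Γ ϑ)) (parity C.gr x)) =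
      C.pr C.inl.toLinearMap (toConv C.incGT.toLinearMap *
        toConv (C.FhatHom.toLinearMap ∘ₗ W.ω ∘ₗ LeftInv.circ Γ ϑ)) (parity C.gr x) := by
    rw [map_pr]
    exact C.pr_FhatHom (g := LinearMap.id) _ (fun _ h => h) (fun x => by simp)
      (C.parity_mem_hor hx)
  -- Moving the one-form `ϑ` to the left of `φ` costs the sign `(-1)^{∂φ}`, which undoes the parity
  -- in the definition of `ℓ`.
  have h2 : C.pr C.inl.toLinearMap (cst (C.inr (LeftInv.toEnv Γ ϑ)) * toConv C.incGT.toLinearMap)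
      (parity C.gr x) = C.inr (LeftInv.toEnv Γ ϑ) *
        C.pr C.inl.toLinearMap (toConv C.incGT.toLinearMap) x := by
    rw [pr_cst_mul, ← LinearMap.comp_apply, ← pr_comp_parity, mul_pr]
    congr 2
    ext y
    exact (C.inr_mul_inl_of_mem_one (LeftInv.toEnv_mem Γ ϑ) y).symm
  have h3 : ∀ p ∈ S, C.inl (W.ω p.1) * C.incGT p.2 *
        C.pr C.inl.toLinearMap (toConv C.incGT.toLinearMap) x -
      C.pr C.inl.toLinearMap (toConv (C.inl.toLinearMap ∘ₗ W.ω ∘ₗ LeftInv.circ Γ p.1) *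
        (cst (C.incGT p.2) * toConv C.incGT.toLinearMap)) (parity C.gr x) =
      C.hinc (TensorProduct.map (W.ellMap p.1) (LinearMap.mulLeft ℂ p.2) (C.act x)) := by
    intro p _
    rw [hinc_map, ellMap, LinearMap.comp_sub, pr_sub_left, LinearMap.sub_apply]
    congr 1
    · rw [pr_cst_mul, mul_pr]
      congr 2
      ext y
      simp only [LinearMap.comp_apply, LinearMap.mulLeft_apply, LinearMap.mulRight_apply,
        AlgHom.toLinearMap_apply, map_mul]
      rw [mul_assoc, ← inl_mul_incGT, mul_assoc]
    · rw [← pr_pr, ← LinearMap.comp_apply, ← pr_comp_parity]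
      rw [pr_inl, LinearMap.comp_assoc]
  rw [ell, twist_eq, map_sub, map_mul, W.FhatHom_ω, C.FhatHom_eq_pr hx, h1,
    W.conv_FhatHom_ω_circ hS, pr_add_right, LinearMap.add_apply, h2, add_mul, W.coactω_eq_sum hS,
    add_sub_add_right_eq_sub, Finset.sum_mul, pr_sum_right, LinearMap.sum_apply,
    ← Finset.sum_sub_distrib, map_sum]
  exact Finset.sum_congr rfl h3

theorem ell_mem_hor (ϑ : LeftInv Γ) {x : C.Ω} (hx : x ∈ C.hor) : W.ell ϑ x ∈ C.hor := by
  obtain ⟨S, hS⟩ := TensorProduct.exists_finset (LeftInv.coact Γ ϑ)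
  exact C.mem_hor_of_FhatHom_eq (W.FhatHom_ell hS hx)

theorem act_ell {ϑ : LeftInv Γ} {S : Finset (LeftInv Γ × A)}
    (hS : LeftInv.coact Γ ϑ = ∑ p ∈ S, p.1 ⊗ₜ[ℂ] p.2) {x : C.Ω} (hx : x ∈ C.hor) :
    C.act (W.ell ϑ x) =
      ∑ p ∈ S, TensorProduct.map (W.ellMap p.1) (LinearMap.mulLeft ℂ p.2) (C.act x) :=
  C.act_eq_of_FhatHom_eq (W.FhatHom_ell hS hx)

theorem act_ω (ϑ : LeftInv Γ) : C.act (W.ω ϑ) = W.ω.rTensor A (LeftInv.coact Γ ϑ) := by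
  rw [act, LinearMap.comp_apply, W.Fhat_ω, map_add, LinearMap.lTensor_tmul,
    AlgHom.toLinearMap_apply, Env.proj_of_mem Γ (LeftInv.toEnv_mem Γ ϑ), TensorProduct.tmul_zero,
    add_zero]
  induction LeftInv.coact Γ ϑ with
  | zero => simp
  | add x y hx hy => simp only [map_add, hx, hy]
  | tmul x a => simp [Env.proj_inc]

/-- `Xπ = (k κ) * (ω π) * k` -/
theorem toConv_coactω_proj : toConv (W.coactω ∘ₗ LeftInv.proj Γ) =
    toConv (C.incGT.toLinearMap ∘ₗ HopfAlgebra.antipode ℂ) *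
      (toConv (C.inl.toLinearMap ∘ₗ W.ω ∘ₗ LeftInv.proj Γ) * toConv C.incGT.toLinearMap) := by
  rw [← comp_ad (LinearMap.mul' ℂ C.GT ∘ₗ TensorProduct.map
    (C.inl.toLinearMap ∘ₗ W.ω ∘ₗ LeftInv.proj Γ) C.incGT.toLinearMap)]
  · ext a
    change W.coactω (LeftInv.proj Γ a) = _
    rw [coactω, LinearMap.comp_apply, LinearMap.comp_apply, LeftInv.coact_proj,
      ← LinearMap.comp_apply (TensorProduct.map _ _), LinearMap.map_comp_rTensor]
    rfl
  · intro x y z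
    simp only [LinearMap.comp_apply, TensorProduct.map_tmul, LinearMap.mul'_apply,
      AlgHom.toLinearMap_apply, map_mul]
    rw [← mul_assoc, inl_mul_incGT, mul_assoc]

/-- The horizontal part `dφ - (-1)^{∂φ} ∑ φₖ ω(π(cₖ))` of `dφ`. -/
def covD : C.Ω →ₗ[ℂ] C.Ω :=
  C.d - C.pr (parity C.gr) (toConv (W.ω ∘ₗ LeftInv.proj Γ))

theorem d_eq (x : C.Ω) :
    C.d x = W.covD x + C.pr (parity C.gr) (toConv (W.ω ∘ₗ LeftInv.proj Γ)) x := by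
  simp [covD]

theorem FhatHom_d_of_mem_hor {x : C.Ω} (hx : x ∈ C.hor) : C.FhatHom (C.d x) =
    C.pr (C.inl.toLinearMap ∘ₗ C.d) (toConv C.incGT.toLinearMap) x +
      C.pr (C.inl.toLinearMap ∘ₗ parity C.gr) (toConv (C.inr.toLinearMap ∘ₗ Env.dif Γ)) x := by
  obtain ⟨z, hz⟩ := hx
  have h : C.act x = z := by
    rw [C.act_eq_of_FhatHom_eq]
    rw [FhatHom_apply, ← hz, hinc_eq]
  rw [FhatHom_apply, C.Fhat_d, ← hz, pr_apply, pr_apply, h]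
  clear hz h
  induction z with
  | zero => simp
  | add x y hx hy =>
    simp only [map_add] at hx hy ⊢
    rw [add_add_add_comm, hx, hy]
    abel
  | tmul x a =>
    simp only [LinearMap.lTensor_tmul, TensorProduct.map_tmul, map_add, toGT_tmul,
      AlgHom.toLinearMap_apply, Env.d_inc]
    rfl

/-- The fibre part of `F̂(dφ)` is `(-1)^{∂φ} ∑ φₖ ⊗ dcₖ`. As `dc = ∑ c⁽¹⁾ π(c⁽²⁾)`, this is exactly
the fibre part produced by the subtracted term. -/
theorem FhatHom_covD {x : C.Ω} (hx : x ∈ C.hor) :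
    C.FhatHom (W.covD x) = C.hinc (W.covD.rTensor A (C.act x)) := by
  have hJ : toConv C.incGT.toLinearMap *
      toConv (C.incGT.toLinearMap ∘ₗ HopfAlgebra.antipode ℂ) = 1 := conv_antipode_right _
  have h1 : toConv C.incGT.toLinearMap *
      toConv (C.FhatHom.toLinearMap ∘ₗ W.ω ∘ₗ LeftInv.proj Γ) =
      toConv (C.inl.toLinearMap ∘ₗ W.ω ∘ₗ LeftInv.proj Γ) * toConv C.incGT.toLinearMap +
        toConv (C.inr.toLinearMap ∘ₗ Env.dif Γ) := by
    have h2 : toConv (C.FhatHom.toLinearMap ∘ₗ W.ω ∘ₗ LeftInv.proj Γ) =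
        toConv (W.coactω ∘ₗ LeftInv.proj Γ) + toConv (C.inr.toLinearMap ∘ₗ Env.germ Γ) := by
      ext a
      exact W.FhatHom_ω _
    have h3 := congrArg (fun f : WithConv (A →ₗ[ℂ] Env Γ) =>
      toConv (C.inr.toLinearMap ∘ₗ f.ofConv)) (Env.toConv_dif Γ)
    simp only [toConv_comp_mul] at h3
    rw [h2, mul_add, W.toConv_coactω_proj, ← mul_assoc, hJ, one_mul]
    exact congrArg _ h3.symm
  have h4 : C.FhatHom (C.pr (parity C.gr) (toConv (W.ω ∘ₗ LeftInv.proj Γ)) x) =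
      C.pr (C.inl.toLinearMap ∘ₗ C.pr (parity C.gr) (toConv (W.ω ∘ₗ LeftInv.proj Γ)))
          (toConv C.incGT.toLinearMap) x +
        C.pr (C.inl.toLinearMap ∘ₗ parity C.gr) (toConv (C.inr.toLinearMap ∘ₗ Env.dif Γ)) x := by
    rw [map_pr]
    refine (C.pr_FhatHom _ (fun _ h => C.parity_mem_hor h) C.act_parity hx).trans ?_
    refine (congrArg (fun f => C.pr (C.inl.toLinearMap ∘ₗ parity C.gr) f x) h1).trans ?_
    rw [pr_add_right, LinearMap.add_apply, ← pr_pr, comp_pr]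
  have h5 : C.hinc (W.covD.rTensor A (C.act x)) =
      C.pr (C.inl.toLinearMap ∘ₗ W.covD) (toConv C.incGT.toLinearMap) x := by
    rw [pr_apply]
    induction C.act x with
    | zero => simp
    | add x y hx hy => simp only [map_add, hx, hy]
    | tmul x a => exact C.hinc_tmul _ _
  rw [h5]
  conv_lhs => rw [covD, LinearMap.sub_apply, map_sub, FhatHom_d_of_mem_hor hx, h4]
  rw [add_sub_add_right_eq_sub, covD, LinearMap.comp_sub, pr_sub_left, LinearMap.sub_apply]

theorem covD_mem_hor {x : C.Ω} (hx : x ∈ C.hor) : W.covD x ∈ C.hor :=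
  C.mem_hor_of_FhatHom_eq (W.FhatHom_covD hx)

end BundleCalculus.Connection

/-! ### The structure equation, and horizontality of the curvature and of `u_ω` -/

section Convolution

variable {A : Type u} [Ring A] [HopfAlgebra ℂ A] {W : Type v} [Ring W] [Algebra ℂ W]

/-- The variant of `comp_ad` for maps which differentiate the leg `κ(x) z` and so produce two terms
by the Leibniz rule. -/
theorem comp_ad_add (Φ : A ⊗[ℂ] A →ₗ[ℂ] W) (f g h f' g' h' : A →ₗ[ℂ] W)
    (H : ∀ x y z, Φ (y ⊗ₜ (HopfAlgebra.antipode ℂ x * z)) =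
      f x * (g y * h z) + f' x * (g' y * h' z)) :
    toConv (Φ ∘ₗ ad A) = toConv f * (toConv g * toConv h) +
      toConv f' * (toConv g' * toConv h') := by
  have : Φ ∘ₗ (LinearMap.mul' ℂ A ∘ₗ (HopfAlgebra.antipode ℂ).rTensor A).lTensor A ∘ₗ
      (TensorProduct.leftComm ℂ A A A).toLinearMap =
      LinearMap.mul' ℂ W ∘ₗ TensorProduct.map f (LinearMap.mul' ℂ W ∘ₗ TensorProduct.map g h) +
      LinearMap.mul' ℂ W ∘ₗ
        TensorProduct.map f' (LinearMap.mul' ℂ W ∘ₗ TensorProduct.map g' h') := by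
    ext x y z
    simp [H]
  apply ofConv_injective
  change Φ ∘ₗ ad A = LinearMap.mul' ℂ W ∘ₗ TensorProduct.map f (conv g h) ∘ₗ Coalgebra.comul +
    LinearMap.mul' ℂ W ∘ₗ TensorProduct.map f' (conv g' h') ∘ₗ Coalgebra.comul
  have h2 : ∀ f g h : A →ₗ[ℂ] W, TensorProduct.map f (conv g h) =
      TensorProduct.map f (LinearMap.mul' ℂ W ∘ₗ TensorProduct.map g h) ∘ₗ
        Coalgebra.comul.lTensor A := by
    intro f g h
    ext; simp [conv]
  rw [h2, h2]
  ext a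
  exact congr($this (Coalgebra.comul.lTensor A (Coalgebra.comul a)))

end Convolution

namespace BundleCalculus

variable {A : Type u} [Ring A] [StarRing A] [HopfAlgebra ℂ A] [StarModule ℂ A]
  [HopfStarAlgebra A]
variable {V : Type*} [Ring V] [StarRing V] [Algebra ℂ V] [StarModule ℂ V]
variable {B : Type v} [Ring B] [StarRing B] [Algebra ℂ B] [StarModule ℂ B]
variable {P : QuantumPrincipalBundle A V B} {Γ : BicovariantStarCalculus A}

/-- The differential of `Ω(P) ⊗̂ Γ^∧`. -/
def dGT (C : BundleCalculus P Γ) : C.GT →ₗ[ℂ] C.GT :=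
  C.toGT.toLinearMap ∘ₗ (TensorProduct.map C.d LinearMap.id +
    TensorProduct.map (parity C.gr) (Env.d Γ)) ∘ₗ C.toGT.symm.toLinearMap

theorem dGT_mul (C : BundleCalculus P Γ) (x : C.Ω) (v : Env Γ) :
    C.dGT (C.inl x * C.inr v) =
      C.inl (C.d x) * C.inr v + C.inl (parity C.gr x) * C.inr (Env.d Γ v) := by
  rw [← toGT_tmul, dGT, LinearMap.comp_apply, LinearMap.comp_apply, LinearEquiv.coe_coe,
    LinearEquiv.coe_coe, LinearEquiv.symm_apply_apply, LinearMap.add_apply, map_add,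
    TensorProduct.map_tmul, TensorProduct.map_tmul, toGT_tmul, toGT_tmul, LinearMap.id_apply]

theorem FhatHom_d (C : BundleCalculus P Γ) (x : C.Ω) :
    C.FhatHom (C.d x) = C.dGT (C.FhatHom x) := by
  rw [FhatHom_apply, C.Fhat_d, FhatHom_apply, dGT, LinearMap.comp_apply, LinearMap.comp_apply,
    LinearEquiv.coe_coe, LinearEquiv.coe_coe, LinearEquiv.symm_apply_apply]
  rfl

theorem d_one (C : BundleCalculus P Γ) : C.d 1 = 0 := by
  have h := C.d_mul 0 1 1 SetLike.GradedOne.one_mem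
  simpa using h

namespace Connection

variable {C : BundleCalculus P Γ} (W : C.Connection)

/-- The map `a ↦ dω(π(a)) + ∑ ω(π(a⁽¹⁾)) ω(π(a⁽²⁾))`. -/
def structMap : A →ₗ[ℂ] C.Ω :=
  C.d ∘ₗ W.ω ∘ₗ LeftInv.proj Γ + conv (W.ω ∘ₗ LeftInv.proj Γ) (W.ω ∘ₗ LeftInv.proj Γ)

/-- The differential falls on `ω` or on the leg `κ(a⁽¹⁾) a⁽³⁾` in `A`. The latter gives one term for
each factor, and these become the two products with `π`. They are cross terms, to be cancelled
against those of the square of `F̂ωπ`. -/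
theorem toConv_dGT_coactω : toConv (C.dGT ∘ₗ W.coactω ∘ₗ LeftInv.proj Γ) =
    toConv (C.incGT.toLinearMap ∘ₗ HopfAlgebra.antipode ℂ) *
      (toConv (C.inl.toLinearMap ∘ₗ C.d ∘ₗ W.ω ∘ₗ LeftInv.proj Γ) *
        toConv C.incGT.toLinearMap) -
    toConv (W.coactω ∘ₗ LeftInv.proj Γ) * toConv (C.inr.toLinearMap ∘ₗ Env.germ Γ) -
    toConv (C.inr.toLinearMap ∘ₗ Env.germ Γ) * toConv (W.coactω ∘ₗ LeftInv.proj Γ) := by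
  have hdω : ∀ y, parity C.gr (W.ω y) = -W.ω y := fun y => parity_of_mem_one C.gr (W.mem_one y)
  have hanti : ∀ (a : A) (y : LeftInv Γ), C.inr (Env.dif Γ a) * C.inl (W.ω y) =
      -(C.inl (W.ω y) * C.inr (Env.dif Γ a)) := by
    intro a y
    rw [C.inr_mul_inl_of_mem_one (Env.dif_mem Γ a), hdω, map_neg, neg_mul]
  let Φ : A ⊗[ℂ] A →ₗ[ℂ] C.GT := LinearMap.mul' ℂ C.GT ∘ₗ TensorProduct.map
    (C.inl.toLinearMap ∘ₗ C.d ∘ₗ W.ω ∘ₗ LeftInv.proj Γ) C.incGT.toLinearMap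
  let Ψ : A ⊗[ℂ] A →ₗ[ℂ] C.GT := LinearMap.mul' ℂ C.GT ∘ₗ TensorProduct.map
    (C.inl.toLinearMap ∘ₗ W.ω ∘ₗ LeftInv.proj Γ) (C.inr.toLinearMap ∘ₗ Env.dif Γ)
  have h1 : C.dGT ∘ₗ W.coactω ∘ₗ LeftInv.proj Γ = Φ ∘ₗ ad A - Ψ ∘ₗ ad A := by
    ext a
    simp only [LinearMap.comp_apply, LinearMap.sub_apply, coactω, LeftInv.coact_proj]
    induction ad A a with
    | zero => simp
    | add x y hx hy => simp only [map_add, hx, hy]; abel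
    | tmul y z =>
      simp only [LinearMap.rTensor_tmul, TensorProduct.map_tmul, LinearMap.mul'_apply,
        LinearMap.comp_apply, AlgHom.toLinearMap_apply, Φ, Ψ]
      refine (C.dGT_mul _ _).trans ?_
      rw [hdω, map_neg, neg_mul, ← sub_eq_add_neg]
      exact congrArg (fun v => C.inl (C.d (W.ω (LeftInv.proj Γ y))) * C.incGT z -
        C.inl (W.ω (LeftInv.proj Γ y)) * C.inr v) (Env.d_inc Γ z)
  have h2 : toConv (Φ ∘ₗ ad A) = toConv (C.incGT.toLinearMap ∘ₗ HopfAlgebra.antipode ℂ) *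
      (toConv (C.inl.toLinearMap ∘ₗ C.d ∘ₗ W.ω ∘ₗ LeftInv.proj Γ) *
        toConv C.incGT.toLinearMap) := by
    refine comp_ad _ _ _ _ fun x y z => ?_
    simp only [Φ, LinearMap.comp_apply, TensorProduct.map_tmul, LinearMap.mul'_apply,
      AlgHom.toLinearMap_apply, map_mul]
    rw [← mul_assoc, inl_mul_incGT, mul_assoc]
  have h3 : toConv (Ψ ∘ₗ ad A) =
      toConv (-(C.inr.toLinearMap ∘ₗ Env.dif Γ ∘ₗ HopfAlgebra.antipode ℂ)) *
        (toConv (C.inl.toLinearMap ∘ₗ W.ω ∘ₗ LeftInv.proj Γ) * toConv C.incGT.toLinearMap) +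
      toConv (C.incGT.toLinearMap ∘ₗ HopfAlgebra.antipode ℂ) *
        (toConv (C.inl.toLinearMap ∘ₗ W.ω ∘ₗ LeftInv.proj Γ) *
          toConv (C.inr.toLinearMap ∘ₗ Env.dif Γ)) := by
    refine comp_ad_add _ _ _ _ _ _ _ fun x y z => ?_
    simp only [Ψ, LinearMap.comp_apply, TensorProduct.map_tmul, LinearMap.mul'_apply,
      AlgHom.toLinearMap_apply, LinearMap.neg_apply]
    rw [Env.dif_mul, map_add, map_mul, map_mul, mul_add, ← mul_assoc, ← mul_assoc, neg_mul,
      ← mul_assoc, hanti, neg_mul, neg_neg]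
    congr 1
    change C.inl _ * C.incGT _ * _ = C.incGT _ * _
    rw [inl_mul_incGT, mul_assoc]
  have hmap : ∀ f g : WithConv (A →ₗ[ℂ] Env Γ), toConv (C.inr.toLinearMap ∘ₗ (f * g).ofConv) =
    toConv (C.inr.toLinearMap ∘ₗ f.ofConv) * toConv (C.inr.toLinearMap ∘ₗ g.ofConv) :=
    toConv_comp_mul C.inr
  have h4 : toConv (-(C.inr.toLinearMap ∘ₗ Env.dif Γ ∘ₗ HopfAlgebra.antipode ℂ)) =
      toConv (C.inr.toLinearMap ∘ₗ Env.germ Γ) *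
        toConv (C.incGT.toLinearMap ∘ₗ HopfAlgebra.antipode ℂ) := by
    refine Eq.trans ?_ (hmap (toConv (Env.germ Γ)) (Env.cinv Γ))
    have h : toConv (Env.germ Γ) * Env.cinv Γ =
        -toConv (Env.dif Γ ∘ₗ HopfAlgebra.antipode ℂ) := by
      rw [Env.toConv_dif_antipode, neg_neg]
    rw [h]
    ext a
    exact (map_neg C.inr _).symm
  have h5 : toConv (C.inr.toLinearMap ∘ₗ Env.dif Γ) =
      toConv C.incGT.toLinearMap * toConv (C.inr.toLinearMap ∘ₗ Env.germ Γ) := by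
    refine Eq.trans ?_ (hmap (Env.cinc Γ) (toConv (Env.germ Γ)))
    rw [← Env.toConv_dif]
  rw [h1, toConv_sub, h2, h3, h4, h5, W.toConv_coactω_proj]
  simp only [mul_assoc]
  abel

/-- Write `F̂ωπ = X + G` with `G` the fibre part. The differential of `G` is `-G * G`, the cross
terms `X * G` and `G * X` cancel those in the differential of `X`, and `X * X` is the conjugate of
the square of `ωπ` because the inner antipode factors cancel. -/
theorem toConv_FhatHom_structMap : toConv (C.FhatHom.toLinearMap ∘ₗ W.structMap) =
    toConv (C.incGT.toLinearMap ∘ₗ HopfAlgebra.antipode ℂ) *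
      (toConv (C.inl.toLinearMap ∘ₗ W.structMap) * toConv C.incGT.toLinearMap) := by
  set J := toConv (C.incGT.toLinearMap ∘ₗ HopfAlgebra.antipode ℂ) with hJ
  set K := toConv C.incGT.toLinearMap with hK
  set G := toConv (C.inr.toLinearMap ∘ₗ Env.germ Γ) with hG
  set X := toConv (W.coactω ∘ₗ LeftInv.proj Γ) with hX
  set Y := toConv (C.inl.toLinearMap ∘ₗ W.ω ∘ₗ LeftInv.proj Γ) with hY
  have hKJ : K * J = 1 := conv_antipode_right _
  have h1 : toConv (C.FhatHom.toLinearMap ∘ₗ C.d ∘ₗ W.ω ∘ₗ LeftInv.proj Γ) =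
      toConv (C.dGT ∘ₗ W.coactω ∘ₗ LeftInv.proj Γ) - G * G := by
    have h2 : G * G = toConv (-(C.inr.toLinearMap ∘ₗ Env.d Γ ∘ₗ Env.germ Γ)) := by
      refine (toConv_comp_mul C.inr (toConv (Env.germ Γ)) (toConv (Env.germ Γ))).symm.trans ?_
      ext a
      change C.inr (conv (Env.germ Γ) (Env.germ Γ) a) = -C.inr (Env.d Γ (Env.germ Γ a))
      rw [Env.d_germ, map_neg, neg_neg]
    rw [h2]
    ext a
    change C.FhatHom (C.d (W.ω (LeftInv.proj Γ a))) =
      C.dGT (W.coactω (LeftInv.proj Γ a)) - -C.inr (Env.d Γ (Env.germ Γ a))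
    have h3 := C.dGT_mul 1 (Env.germ Γ a)
    rw [map_one, one_mul] at h3
    rw [FhatHom_d, W.FhatHom_ω, map_add, sub_neg_eq_add, LeftInv.toEnv_proj, h3, C.d_one, map_zero,
      zero_mul, zero_add, parity_of_mem_zero C.gr SetLike.GradedOne.one_mem, map_one, one_mul]
  have h4 : toConv (C.FhatHom.toLinearMap ∘ₗ
      conv (W.ω ∘ₗ LeftInv.proj Γ) (W.ω ∘ₗ LeftInv.proj Γ)) = (X + G) * (X + G) := by
    have h5 : X + G = toConv (C.FhatHom.toLinearMap ∘ₗ W.ω ∘ₗ LeftInv.proj Γ) := by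
      ext a
      exact (W.FhatHom_ω _).symm
    rw [h5]
    exact toConv_comp_mul C.FhatHom (toConv (W.ω ∘ₗ LeftInv.proj Γ)) _
  have h6 : toConv (C.inl.toLinearMap ∘ₗ
      conv (W.ω ∘ₗ LeftInv.proj Γ) (W.ω ∘ₗ LeftInv.proj Γ)) = Y * Y :=
    toConv_comp_mul C.inl (toConv (W.ω ∘ₗ LeftInv.proj Γ)) (toConv (W.ω ∘ₗ LeftInv.proj Γ))
  have h7 : X * X = J * (Y * Y * K) := by
    rw [hX, W.toConv_coactω_proj, ← hJ, ← hK, ← hY]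
    calc J * (Y * K) * (J * (Y * K)) = J * (Y * (K * J) * (Y * K)) := by simp only [mul_assoc]
      _ = _ := by rw [hKJ, mul_one, mul_assoc Y Y K]
  rw [structMap, LinearMap.comp_add, LinearMap.comp_add, toConv_add, toConv_add, h1, h4, h6,
    W.toConv_dGT_coactω, ← hJ, ← hK, ← hG, ← hX]
  simp only [add_mul, mul_add]
  rw [← h7]
  abel

theorem FhatHom_structMap (a : A) :
    C.FhatHom (W.structMap a) = C.hinc (W.structMap.rTensor A (ad A a)) := by
  have h := comp_ad (LinearMap.mul' ℂ C.GT ∘ₗ TensorProduct.map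
    (C.inl.toLinearMap ∘ₗ W.structMap) C.incGT.toLinearMap)
    (C.incGT.toLinearMap ∘ₗ HopfAlgebra.antipode ℂ) (C.inl.toLinearMap ∘ₗ W.structMap)
    C.incGT.toLinearMap (fun x y z => by
      simp only [LinearMap.comp_apply, TensorProduct.map_tmul, LinearMap.mul'_apply,
        AlgHom.toLinearMap_apply, map_mul]
      rw [← mul_assoc, inl_mul_incGT, mul_assoc])
  rw [← toConv_FhatHom_structMap] at h
  refine congr(($h).ofConv a).symm.trans ?_
  simp only [LinearMap.comp_apply]
  induction ad A a with
  | zero => simp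
  | add x y hx hy => simp only [map_add, hx, hy]
  | tmul x a => exact (C.hinc_tmul _ _).symm

theorem structMap_mem_hor (a : A) : W.structMap a ∈ C.hor :=
  C.mem_hor_of_FhatHom_eq (W.FhatHom_structMap a)

theorem tensor_ι (ϑ : LeftInv Γ) : W.tensor (TensorAlgebra.ι ℂ ϑ) = W.ω ϑ :=
  TensorAlgebra.lift_ι_apply _ _

theorem tensor_conv_ι (f g : A →ₗ[ℂ] LeftInv Γ) (a : A) :
    W.tensor (conv (TensorAlgebra.ι ℂ ∘ₗ f) (TensorAlgebra.ι ℂ ∘ₗ g) a) =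
      conv (W.ω ∘ₗ f) (W.ω ∘ₗ g) a := by
  have h : W.tensor.toLinearMap ∘ₗ TensorAlgebra.ι ℂ = W.ω := LinearMap.ext W.tensor_ι
  rw [algHom_conv, ← LinearMap.comp_assoc, ← LinearMap.comp_assoc, h]

theorem structMap_apply (a : A) : W.structMap a =
    C.d (W.ω (LeftInv.proj Γ a)) + W.tensor (InvTensor.quad Γ a) := by
  rw [InvTensor.quad, tensor_conv_ι]
  rfl

/-- On `𝓡` the term `dω(π(r))` of `structMap` is absent. Although `ω^⊗` need not vanish on the
relations of `Γ_inv^∧`, its values there are thus horizontal; the decomposition of `Ω(P)`, the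
curvature and `u_ω` all depend on this. -/
theorem tensor_quad_mem_hor {r : A} (hr : r ∈ Γ.ideal) :
    W.tensor (InvTensor.quad Γ r) ∈ C.hor := by
  have h := W.structMap_mem_hor r
  rwa [structMap_apply, LeftInv.proj_ideal Γ r hr, map_zero, map_zero, zero_add] at h

variable (s : EnvSection Γ)

/-- The map `ϑ ↦ dω(ϑ) - ω^⊗(δ(ϑ))`, which is the curvature. -/
def curv : LeftInv Γ →ₗ[ℂ] C.Ω := C.d ∘ₗ W.ω - W.tensor.toLinearMap ∘ₗ s.delta

theorem d_ω (ϑ : LeftInv Γ) : C.d (W.ω ϑ) = W.curv s ϑ + W.tensor (s.delta ϑ) := by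
  simp [curv]

/-- By `exists_delta_eq`, `dω - ω^⊗δ` differs from the horizontal `structMap` only by a value of
`ω^⊗` on a quadratic relation. -/
theorem curv_mem_hor (ϑ : LeftInv Γ) : W.curv s ϑ ∈ C.hor := by
  induction ϑ using LeftInv.induction with
  | h a =>
    obtain ⟨r, hr, h⟩ := s.exists_delta_eq a
    have h1 : W.curv s (LeftInv.proj Γ a) =
        W.structMap a - W.tensor (InvTensor.quad Γ r) := by
      rw [structMap_apply, curv, LinearMap.sub_apply, LinearMap.comp_apply, LinearMap.comp_apply,
        h, AlgHom.toLinearMap_apply, map_sub]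
      abel
    rw [h1]
    exact sub_mem (W.structMap_mem_hor a) (W.tensor_quad_mem_hor hr)

theorem u_mem_hor (ϑ : LeftInv Γ) (a : A) : W.u s ϑ a ∈ C.hor := by
  obtain ⟨r, hr, h⟩ := s.exists_rho_eq ϑ a
  rw [u, LinearMap.comp_apply, ← h]
  exact W.tensor_quad_mem_hor hr

end Connection

end BundleCalculus

/-! ### Surjectivity of the decomposition map -/

namespace BundleCalculus

variable {A : Type u} [Ring A] [StarRing A] [HopfAlgebra ℂ A] [StarModule ℂ A]
  [HopfStarAlgebra A]
variable {V : Type*} [Ring V] [StarRing V] [Algebra ℂ V] [StarModule ℂ V]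
variable {B : Type v} [Ring B] [StarRing B] [Algebra ℂ B] [StarModule ℂ B]
variable {P : QuantumPrincipalBundle A V B} {Γ : BicovariantStarCalculus A}

theorem hor_mul_hor (C : BundleCalculus P Γ) : C.hor * C.hor ≤ C.hor :=
  Submodule.mul_le.2 fun _ hx _ hy => C.mul_mem_hor hx hy

namespace Connection

variable {C : BundleCalculus P Γ} (W : C.Connection)

/-- The span of `1` and the values of a connection. -/
def oneForms : Submodule ℂ C.Ω := 1 ⊔ LinearMap.range W.ω

theorem one_le_oneForms : 1 ≤ W.oneForms := le_sup_left

theorem ω_mem_oneForms (ϑ : LeftInv Γ) : W.ω ϑ ∈ W.oneForms := Submodule.mem_sup_right ⟨ϑ, rfl⟩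

theorem hor_le_hor_mul_oneForms : C.hor ≤ C.hor * W.oneForms := by
  calc C.hor = C.hor * 1 := (mul_one _).symm
    _ ≤ _ := mul_le_mul_right W.one_le_oneForms _

/-- The error in moving `ω(ϑ)` to the right is `ℓ_ω(ϑ, x)`, which is horizontal. Reordering
therefore never raises the number of factors `ω`. -/
theorem ω_mul_mem (ϑ : LeftInv Γ) {x : C.Ω} (hx : x ∈ C.hor) :
    W.ω ϑ * x ∈ C.hor * W.oneForms := by
  have h : W.ω ϑ * x = W.ell ϑ x +
      C.pr LinearMap.id (toConv (W.ω ∘ₗ LeftInv.circ Γ ϑ)) (parity C.gr x) := by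
    rw [ell, twist_eq, sub_add_cancel]
  rw [h]
  refine add_mem (W.hor_le_hor_mul_oneForms (W.ell_mem_hor ϑ hx)) ?_
  exact C.pr_mem _ _ (C.act_mem_hor (C.parity_mem_hor hx)) fun y hy a =>
    Submodule.mul_mem_mul hy (W.ω_mem_oneForms _)

theorem d_mem_of_mem_hor {x : C.Ω} (hx : x ∈ C.hor) : C.d x ∈ C.hor * W.oneForms := by
  rw [W.d_eq]
  refine add_mem (W.hor_le_hor_mul_oneForms (W.covD_mem_hor hx)) ?_
  exact C.pr_mem _ _ (C.act_mem_hor hx) fun y hy a =>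
    Submodule.mul_mem_mul (C.parity_mem_hor hy) (W.ω_mem_oneForms _)

theorem oneForms_mul_hor : W.oneForms * C.hor ≤ C.hor * W.oneForms := by
  rw [oneForms, Submodule.sup_mul, one_mul]
  refine sup_le W.hor_le_hor_mul_oneForms (Submodule.mul_le.2 ?_)
  rintro _ ⟨ϑ, rfl⟩ x hx
  exact W.ω_mul_mem ϑ hx

theorem oneForms_pow_mul_hor (n : ℕ) : W.oneForms ^ n * C.hor ≤ C.hor * W.oneForms ^ n := by
  induction n with
  | zero => simp
  | succ n ih =>
    calc W.oneForms ^ (n + 1) * C.hor = W.oneForms ^ n * (W.oneForms * C.hor) := by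
          rw [pow_succ, mul_assoc]
      _ ≤ W.oneForms ^ n * (C.hor * W.oneForms) := mul_le_mul_right W.oneForms_mul_hor _
      _ = W.oneForms ^ n * C.hor * W.oneForms := (mul_assoc _ _ _).symm
      _ ≤ C.hor * W.oneForms ^ n * W.oneForms := mul_le_mul_left ih _
      _ = _ := by rw [mul_assoc, ← pow_succ]

/-- Reduces the induction on the filtration to products of exactly `n + 1` values of `ω`. -/
theorem oneForms_pow_succ (n : ℕ) :
    W.oneForms ^ (n + 1) ≤ W.oneForms ^ n ⊔ LinearMap.range W.ω ^ (n + 1) := by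
  induction n with
  | zero => simp [oneForms]
  | succ n ih =>
    have h : W.oneForms ^ (n + 1 + 1) =
        W.oneForms ^ (n + 1) ⊔ W.oneForms ^ (n + 1) * LinearMap.range W.ω := by
      conv_lhs => rw [pow_succ]
      conv_lhs => enter [2]; rw [oneForms]
      rw [Submodule.mul_sup, mul_one]
    rw [h]
    refine sup_le le_sup_left ((mul_le_mul_left ih _).trans ?_)
    rw [Submodule.sup_mul, ← pow_succ]
    refine sup_le_sup_right ?_ _
    rw [pow_succ]
    exact mul_le_mul_right le_sup_right _

theorem map_tensor_grade (n : ℕ) :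
    (InvTensor.grade Γ n).map W.tensor.toLinearMap = LinearMap.range W.ω ^ n := by
  rw [Submodule.map_pow, ← LinearMap.range_comp]
  congr 2
  exact LinearMap.ext W.tensor_ι

theorem tensor_mem {n : ℕ} {t : InvTensor Γ} (ht : t ∈ InvTensor.grade Γ n) :
    W.tensor t ∈ LinearMap.range W.ω ^ n := by
  rw [← map_tensor_grade]
  exact ⟨t, ht, rfl⟩

theorem range_pow_le (n : ℕ) : LinearMap.range W.ω ^ n ≤ W.oneForms ^ n :=
  pow_le_pow_left' le_sup_right n

/-- Every form is a combination of products of horizontal forms and values of `ω^⊗`. -/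
theorem hor_mul_range_tensor : C.hor * LinearMap.range W.tensor.toLinearMap = ⊤ := by
  have hU : W.oneForms ≤ LinearMap.range W.tensor.toLinearMap := by
    refine sup_le (Submodule.one_le.2 ⟨1, map_one W.tensor⟩) ?_
    rintro _ ⟨ϑ, rfl⟩
    exact ⟨TensorAlgebra.ι ℂ ϑ, W.tensor_ι ϑ⟩
  have hR : LinearMap.range W.tensor.toLinearMap * LinearMap.range W.tensor.toLinearMap ≤
      LinearMap.range W.tensor.toLinearMap := by
    refine Submodule.mul_le.2 ?_
    rintro _ ⟨x, rfl⟩ _ ⟨y, rfl⟩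
    exact ⟨x * y, map_mul W.tensor x y⟩
  have hH : C.hor * (C.hor * LinearMap.range W.tensor.toLinearMap) ≤
      C.hor * LinearMap.range W.tensor.toLinearMap := by
    rw [← mul_assoc]
    exact mul_le_mul_left C.hor_mul_hor _
  have hUM : C.hor * W.oneForms * (C.hor * LinearMap.range W.tensor.toLinearMap) ≤
      C.hor * LinearMap.range W.tensor.toLinearMap := by
    calc C.hor * W.oneForms * (C.hor * LinearMap.range W.tensor.toLinearMap)
        = C.hor * (W.oneForms * C.hor) * LinearMap.range W.tensor.toLinearMap := by
          simp only [mul_assoc]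
      _ ≤ C.hor * (C.hor * W.oneForms) * LinearMap.range W.tensor.toLinearMap :=
          mul_le_mul_left (mul_le_mul_right W.oneForms_mul_hor _) _
      _ = C.hor * (C.hor * (W.oneForms * LinearMap.range W.tensor.toLinearMap)) := by
          simp only [mul_assoc]
      _ ≤ C.hor * (C.hor * LinearMap.range W.tensor.toLinearMap) :=
          mul_le_mul_right (mul_le_mul_right ((mul_le_mul_left hU _).trans hR) _) _
      _ ≤ _ := hH
  -- The subspace contains `1` and is stable under left multiplication by `b` and by `db`, which
  -- generate `Ω(P)`. For `db` this uses its splitting into a horizontal part and values of `ω`.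
  have key : ∀ x ∈ Algebra.adjoin ℂ (Set.range C.incl ∪ Set.range fun b => C.d (C.incl b)),
      ∀ y ∈ C.hor * LinearMap.range W.tensor.toLinearMap,
      x * y ∈ C.hor * LinearMap.range W.tensor.toLinearMap := by
    intro x hx
    induction hx using Algebra.adjoin_induction with
    | mem x hx =>
      intro y hy
      rcases hx with ⟨b, rfl⟩ | ⟨b, rfl⟩
      · exact hH (Submodule.mul_mem_mul (C.incl_mem_hor b) hy)
      · exact hUM (Submodule.mul_mem_mul (W.d_mem_of_mem_hor (C.incl_mem_hor b)) hy)
    | algebraMap r =>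
      intro y hy
      rw [← Algebra.smul_def]
      exact Submodule.smul_mem _ _ hy
    | add x x' _ _ hx hx' =>
      intro y hy
      rw [add_mul]
      exact add_mem (hx y hy) (hx' y hy)
    | mul x x' _ _ hx hx' =>
      intro y hy
      rw [mul_assoc]
      exact hx _ (hx' y hy)
  refine eq_top_iff.2 fun x _ => ?_
  have h1 : (1 : C.Ω) ∈ C.hor * LinearMap.range W.tensor.toLinearMap := by
    rw [← one_mul (1 : C.Ω)]
    exact Submodule.mul_mem_mul C.one_mem_hor ⟨1, map_one W.tensor⟩
  have h2 := key x (by rw [C.generated]; trivial) 1 h1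
  rwa [mul_one] at h2

variable (s : EnvSection Γ)

theorem decomp_tmul (x : C.hor) (v : InvEnv Γ) :
    W.decomp s (x ⊗ₜ v) = x * W.tensor (s.sec v) := rfl

/-- A tensor of degree `n + 1` differs from its `ι`-representative by products `p q(r) q'` whose
outer degrees add up to `n - 1`. Since `ω^⊗(q(r))` is horizontal, it can be moved to the left past
the values of `ω`, and the difference falls into the filtration step `n`, which the induction
covers. -/
theorem hor_mul_oneForms_pow_le (n : ℕ) :
    C.hor * W.oneForms ^ n ≤ LinearMap.range (W.decomp s) := by
  induction n with
  | zero =>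
    rw [pow_zero, mul_one]
    intro x hx
    refine ⟨⟨x, hx⟩ ⊗ₜ 1, ?_⟩
    rw [decomp_tmul, s.sec_one, map_one, mul_one]
  | succ n ih =>
    refine (mul_le_mul_right (W.oneForms_pow_succ n) _).trans ?_
    rw [Submodule.mul_sup]
    refine sup_le ih (Submodule.mul_le.2 ?_)
    intro x hx y hy
    rw [← map_tensor_grade] at hy
    obtain ⟨t, ht, rfl⟩ := hy
    let t' := s.sec ((InvTensor.toEnv Γ).rangeRestrict t)
    have ht' : t' ∈ InvTensor.grade Γ (n + 1) := s.grade_mem _ t ht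
    have h1 : x * W.tensor t' ∈ LinearMap.range (W.decomp s) :=
      ⟨⟨x, hx⟩ ⊗ₜ (InvTensor.toEnv Γ).rangeRestrict t, W.decomp_tmul s _ _⟩
    have h2 : t - t' ∈ (C.hor * W.oneForms ^ n).comap
        (LinearMap.mulLeft ℂ x ∘ₗ W.tensor.toLinearMap) := by
      refine InvTensor.mem_of_toEnv_eq_zero Γ (sub_mem ht ht')
        (by rw [map_sub, s.toEnv_sec, sub_self]) ?_
      intro i j hij p hp r hr q hq
      rw [Submodule.mem_comap, LinearMap.comp_apply, LinearMap.mulLeft_apply,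
        AlgHom.toLinearMap_apply, map_mul, map_mul]
      have h3 : C.hor * (W.oneForms ^ i * C.hor * W.oneForms ^ j) ≤ C.hor * W.oneForms ^ n := by
        calc C.hor * (W.oneForms ^ i * C.hor * W.oneForms ^ j)
            ≤ C.hor * (C.hor * W.oneForms ^ i * W.oneForms ^ j) :=
              mul_le_mul_right (mul_le_mul_left (W.oneForms_pow_mul_hor i) _) _
          _ = C.hor * C.hor * W.oneForms ^ (i + j) := by rw [pow_add]; simp only [mul_assoc]
          _ ≤ C.hor * W.oneForms ^ n := mul_le_mul' C.hor_mul_hor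
              (pow_le_pow_right' W.one_le_oneForms (by omega))
      exact h3 (Submodule.mul_mem_mul hx (Submodule.mul_mem_mul (Submodule.mul_mem_mul
        (W.range_pow_le i (W.tensor_mem hp)) (W.tensor_quad_mem_hor hr))
        (W.range_pow_le j (W.tensor_mem hq))))
    have h4 : x * W.tensor t = x * W.tensor t' + x * W.tensor (t - t') := by
      rw [map_sub, mul_sub, add_sub_cancel]
    rw [AlgHom.toLinearMap_apply, h4]
    exact add_mem h1 (ih h2)

theorem decomp_surjective : Function.Surjective (W.decomp s) := by
  rw [← LinearMap.range_eq_top, eq_top_iff, ← W.hor_mul_range_tensor]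
  refine Submodule.mul_le.2 ?_
  rintro x hx _ ⟨t, rfl⟩
  rw [AlgHom.toLinearMap_apply]
  induction t using DirectSum.Decomposition.inductionOn (InvTensor.grade Γ) with
  | zero => rw [map_zero, mul_zero]; exact zero_mem _
  | @homogeneous n t =>
    exact W.hor_mul_oneForms_pow_le s n
      (Submodule.mul_mem_mul hx (W.range_pow_le n (W.tensor_mem t.2)))
  | add t t' h h' => rw [map_add, mul_add]; exact add_mem h h'

end Connection

end BundleCalculus

/-! ### Injectivity of the decomposition map, the horizontal projection and the curvature -/

namespace InvTensor

variable {A : Type u} [Ring A] [StarRing A] [HopfAlgebra ℂ A]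
variable (Γ : BicovariantStarCalculus A)

theorem gradedProj_toEnv (n : ℕ) (t : InvTensor Γ) :
    GradedAlgebra.proj (Env.grade Γ) n (toEnv Γ t) =
      toEnv Γ (GradedAlgebra.proj (grade Γ) n t) :=
  linearMap_ext_of_grade (𝒲 := grade Γ)
    (f := GradedAlgebra.proj (Env.grade Γ) n ∘ₗ (toEnv Γ).toLinearMap)
    (g := (toEnv Γ).toLinearMap ∘ₗ GradedAlgebra.proj (grade Γ) n) (fun m t ht => by
      simp only [LinearMap.comp_apply, AlgHom.toLinearMap_apply]
      by_cases h : m = n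
      · subst h
        rw [gradedProj_of_mem _ ht, gradedProj_of_mem _ (toEnv_mem Γ ht)]
      · rw [gradedProj_of_mem_ne _ h ht, gradedProj_of_mem_ne _ h (toEnv_mem Γ ht), map_zero]) t

/-- The projection of `Γ_inv^∧` onto the component of degree `n`. -/
def invProj (n : ℕ) : InvEnv Γ →ₗ[ℂ] InvEnv Γ :=
  (GradedAlgebra.proj (Env.grade Γ) n ∘ₗ (InvEnv Γ).val.toLinearMap).codRestrict
    (Subalgebra.toSubmodule (InvEnv Γ)) (by
      rintro ⟨_, t, rfl⟩
      exact ⟨GradedAlgebra.proj (grade Γ) n t, (gradedProj_toEnv Γ n t).symm⟩)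

theorem invProj_mem (n : ℕ) (x : InvEnv Γ) : (invProj Γ n x : Env Γ) ∈ Env.grade Γ n :=
  gradedProj_mem _ _ _

theorem _root_.QPB.EnvSection.sec_mem [StarModule ℂ A] {Γ : BicovariantStarCalculus A}
    (s : EnvSection Γ) {n : ℕ} {x : InvEnv Γ} (hx : (x : Env Γ) ∈ Env.grade Γ n) :
    s.sec x ∈ grade Γ n := by
  obtain ⟨_, t, rfl⟩ := x
  have h := s.grade_mem n (GradedAlgebra.proj (grade Γ) n t) (gradedProj_mem _ _ _)
  have h1 : (toEnv Γ).rangeRestrict (GradedAlgebra.proj (grade Γ) n t) =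
      ⟨toEnv Γ t, t, rfl⟩ := by
    refine Subtype.ext ?_
    change toEnv Γ _ = toEnv Γ t
    rw [← gradedProj_toEnv]
    exact gradedProj_of_mem _ hx
  rwa [h1] at h

end InvTensor

namespace BundleCalculus

variable {A : Type u} [Ring A] [StarRing A] [HopfAlgebra ℂ A] [StarModule ℂ A]
  [HopfStarAlgebra A]
variable {V : Type*} [Ring V] [StarRing V] [Algebra ℂ V] [StarModule ℂ V]
variable {B : Type v} [Ring B] [StarRing B] [Algebra ℂ B] [StarModule ℂ B]
variable {P : QuantumPrincipalBundle A V B} {Γ : BicovariantStarCalculus A}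

section Fiber

variable (C : BundleCalculus P Γ)

/-- The component of `Ω(P) ⊗̂ Γ^∧` of fibre degree `n`. -/
def fiberGrade (n : ℕ) : Submodule ℂ C.GT :=
  LinearMap.range C.inl.toLinearMap * (Env.grade Γ n).map C.inr.toLinearMap

theorem inl_mul_inr_mem (x : C.Ω) {n : ℕ} {v : Env Γ} (hv : v ∈ Env.grade Γ n) :
    C.inl x * C.inr v ∈ C.fiberGrade n :=
  Submodule.mul_mem_mul ⟨x, rfl⟩ ⟨v, hv, rfl⟩

theorem inr_mem {n : ℕ} {v : Env Γ} (hv : v ∈ Env.grade Γ n) : C.inr v ∈ C.fiberGrade n := by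
  have h := C.inl_mul_inr_mem 1 hv
  rwa [map_one, one_mul] at h

theorem hinc_mem (z : C.Ω ⊗[ℂ] A) : C.hinc z ∈ C.fiberGrade 0 := by
  induction z with
  | zero => simp
  | add x y hx hy => rw [map_add]; exact add_mem hx hy
  | tmul x a => rw [hinc_tmul]; exact C.inl_mul_inr_mem x (Env.inc_mem Γ a)

theorem fiberGrade_mul (m n : ℕ) : C.fiberGrade m * C.fiberGrade n ≤ C.fiberGrade (m + n) := by
  have h : (Env.grade Γ m).map C.inr.toLinearMap * LinearMap.range C.inl.toLinearMap ≤
      C.fiberGrade m := by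
    refine Submodule.mul_le.2 ?_
    rintro _ ⟨v, hv, rfl⟩ _ ⟨x, rfl⟩
    rw [AlgHom.toLinearMap_apply, AlgHom.toLinearMap_apply]
    induction x using DirectSum.Decomposition.inductionOn C.gr with
    | zero => rw [map_zero, mul_zero]; exact zero_mem _
    | add x y hx hy => rw [map_add, mul_add]; exact add_mem hx hy
    | @homogeneous k x =>
      rw [C.inr_mul_inl x.2 hv]
      rcases Nat.even_or_odd (m * k) with hk | hk
      · rw [hk.neg_one_pow, one_mul]
        exact C.inl_mul_inr_mem _ hv
      · rw [hk.neg_one_pow, neg_one_mul]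
        exact neg_mem (C.inl_mul_inr_mem _ hv)
  have hl : LinearMap.range C.inl.toLinearMap * LinearMap.range C.inl.toLinearMap ≤
      LinearMap.range C.inl.toLinearMap := by
    refine Submodule.mul_le.2 ?_
    rintro _ ⟨x, rfl⟩ _ ⟨y, rfl⟩
    exact ⟨x * y, map_mul C.inl x y⟩
  have hr : (Env.grade Γ m).map C.inr.toLinearMap * (Env.grade Γ n).map C.inr.toLinearMap ≤
      (Env.grade Γ (m + n)).map C.inr.toLinearMap := by
    refine Submodule.mul_le.2 ?_
    rintro _ ⟨x, hx, rfl⟩ _ ⟨y, hy, rfl⟩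
    exact ⟨x * y, SetLike.mul_mem_graded hx hy, map_mul C.inr x y⟩
  calc C.fiberGrade m * C.fiberGrade n = LinearMap.range C.inl.toLinearMap *
        ((Env.grade Γ m).map C.inr.toLinearMap * LinearMap.range C.inl.toLinearMap) *
          (Env.grade Γ n).map C.inr.toLinearMap := by simp only [fiberGrade, mul_assoc]
    _ ≤ LinearMap.range C.inl.toLinearMap * C.fiberGrade m *
          (Env.grade Γ n).map C.inr.toLinearMap := mul_le_mul_left (mul_le_mul_right h _) _
    _ = LinearMap.range C.inl.toLinearMap * LinearMap.range C.inl.toLinearMap *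
        ((Env.grade Γ m).map C.inr.toLinearMap * (Env.grade Γ n).map C.inr.toLinearMap) := by
          simp only [fiberGrade, mul_assoc]
    _ ≤ C.fiberGrade (m + n) := mul_le_mul' hl hr

/-- The elements of fibre degree less than `n`. -/
def fiberLt (n : ℕ) : Submodule ℂ C.GT := ⨆ (k : ℕ) (_ : k < n), C.fiberGrade k

theorem fiberGrade_le_fiberLt {m n : ℕ} (h : m < n) : C.fiberGrade m ≤ C.fiberLt n :=
  le_iSup₂_of_le m h le_rfl

theorem fiberGrade_mul_fiberLt (m n : ℕ) :
    C.fiberGrade m * C.fiberLt n ≤ C.fiberLt (m + n) := by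
  simp only [fiberLt, Submodule.mul_iSup]
  refine iSup₂_le fun k hk => (C.fiberGrade_mul m k).trans ?_
  exact C.fiberGrade_le_fiberLt (by omega)

theorem fiberLt_mul_fiberGrade (m n : ℕ) :
    C.fiberLt n * C.fiberGrade m ≤ C.fiberLt (n + m) := by
  simp only [fiberLt, Submodule.iSup_mul]
  refine iSup₂_le fun k hk => (C.fiberGrade_mul k m).trans ?_
  exact C.fiberGrade_le_fiberLt (by omega)

/-- The projection to fibre degree `n`, followed by the restriction to the fibre over the unit. -/
def fiberSymbol (n : ℕ) : C.GT →ₗ[ℂ] C.Ω ⊗[ℂ] Env Γ :=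
  (Env.fiber Γ ∘ₗ GradedAlgebra.proj (Env.grade Γ) n).lTensor C.Ω ∘ₗ C.toGT.symm.toLinearMap

theorem fiberSymbol_mul (n : ℕ) (x : C.Ω) (v : Env Γ) : C.fiberSymbol n (C.inl x * C.inr v) =
    x ⊗ₜ Env.fiber Γ (GradedAlgebra.proj (Env.grade Γ) n v) := by
  rw [← toGT_tmul, fiberSymbol, LinearMap.comp_apply, LinearEquiv.coe_coe,
    LinearEquiv.symm_apply_apply]
  rfl

theorem fiberSymbol_of_mem_ne {m n : ℕ} (h : m ≠ n) {y : C.GT} (hy : y ∈ C.fiberGrade m) :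
    C.fiberSymbol n y = 0 := by
  have h1 : C.fiberGrade m ≤ LinearMap.ker (C.fiberSymbol n) := by
    refine Submodule.mul_le.2 ?_
    rintro _ ⟨x, rfl⟩ _ ⟨v, hv, rfl⟩
    refine (C.fiberSymbol_mul n x v).trans ?_
    rw [gradedProj_of_mem_ne _ h hv, map_zero, TensorProduct.tmul_zero]
  exact h1 hy

theorem fiberSymbol_of_mem_fiberLt {m n : ℕ} (h : m ≤ n) {y : C.GT} (hy : y ∈ C.fiberLt m) :
    C.fiberSymbol n y = 0 := by
  have h1 : C.fiberLt m ≤ LinearMap.ker (C.fiberSymbol n) :=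
    iSup₂_le fun k hk z hz => C.fiberSymbol_of_mem_ne (by omega) hz
  exact h1 hy

theorem fiberSymbol_hinc_mul {n : ℕ} (z : C.Ω ⊗[ℂ] A) {t : InvTensor Γ}
    (ht : t ∈ InvTensor.grade Γ n) :
    C.fiberSymbol n (C.hinc z * C.inr (InvTensor.toEnv Γ t)) =
      TensorProduct.rid ℂ C.Ω ((Coalgebra.counit : A →ₗ[ℂ] ℂ).lTensor C.Ω z) ⊗ₜ
        InvTensor.toEnv Γ t := by
  induction z with
  | zero => simp
  | add x y hx hy => simp only [map_add, add_mul, TensorProduct.add_tmul, hx, hy]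
  | tmul x a =>
    have h : Env.inc Γ a * InvTensor.toEnv Γ t ∈ Env.grade Γ n := by
      have := SetLike.mul_mem_graded (Env.inc_mem Γ a) (InvTensor.toEnv_mem Γ ht)
      rwa [zero_add] at this
    rw [hinc_tmul, mul_assoc, ← map_mul, fiberSymbol_mul, gradedProj_of_mem _ h,
      Env.fiber_inc_mul, LinearMap.lTensor_tmul, TensorProduct.rid_tmul, TensorProduct.smul_tmul]

end Fiber

namespace Connection

variable {C : BundleCalculus P Γ} (W : C.Connection)

theorem coactω_mem (ϑ : LeftInv Γ) : W.coactω ϑ ∈ C.fiberGrade 0 := by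
  obtain ⟨S, hS⟩ := TensorProduct.exists_finset (LeftInv.coact Γ ϑ)
  rw [W.coactω_eq_sum hS]
  exact sum_mem fun p _ => C.inl_mul_inr_mem _ (Env.inc_mem Γ _)

/-- The leading term of `F̂ ω^⊗(t)` is `1 ⊗ t`. -/
theorem FhatHom_tensor {n : ℕ} {t : InvTensor Γ} (ht : t ∈ InvTensor.grade Γ n) :
    C.FhatHom (W.tensor t) - C.inr (InvTensor.toEnv Γ t) ∈ C.fiberLt n := by
  have key : ∀ t ∈ LinearMap.range (TensorAlgebra.ι ℂ : LeftInv Γ →ₗ[ℂ] InvTensor Γ) ^ n,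
      C.FhatHom (W.tensor t) - C.inr (InvTensor.toEnv Γ t) ∈ C.fiberLt n := by
    clear ht t
    intro t ht
    induction ht using Submodule.pow_induction_on_right' with
    | algebraMap r =>
      simp only [AlgHom.commutes, sub_self]
      exact zero_mem _
    | add x y i hx hy ihx ihy =>
      simp only [map_add]
      rw [add_sub_add_comm]
      exact add_mem ihx ihy
    | mul_mem i x hx ih m hm =>
      obtain ⟨ϑ, rfl⟩ := hm
      rw [map_mul, map_mul, tensor_ι, W.FhatHom_ω, map_mul, map_mul, InvTensor.toEnv_ι]
      -- Each of the three terms has fibre degree at most `i`: `X` has fibre degree zero, and `f -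
      -- a` has degree below that of `a`.
      have h : ∀ f a X b : C.GT, f * (X + b) - a * b = a * X + (f - a) * X + (f - a) * b := by
        intro f a X b
        noncomm_ring
      rw [h]
      have hx' : x ∈ InvTensor.grade Γ i := hx
      refine add_mem (add_mem ?_ ?_) ?_
      · exact C.fiberGrade_le_fiberLt (Nat.lt_succ_self i) (C.fiberGrade_mul i 0
          (Submodule.mul_mem_mul (C.inr_mem (InvTensor.toEnv_mem Γ hx')) (W.coactω_mem ϑ)))
      · have h1 := C.fiberLt_mul_fiberGrade 0 i (Submodule.mul_mem_mul ih (W.coactω_mem ϑ))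
        have h2 : C.fiberLt (i + 0) ≤ C.fiberLt (i + 1) :=
          iSup₂_le fun k hk => C.fiberGrade_le_fiberLt (by omega)
        exact h2 h1
      · exact C.fiberLt_mul_fiberGrade 1 i
          (Submodule.mul_mem_mul ih (C.inr_mem (LeftInv.toEnv_mem Γ ϑ)))
  exact key t ht

/-- In fibre degree `m` only `F^∧(x)(1 ⊗ t)` survives. Restriction to the fibre over the unit
applies the counit to the coefficients in `A`, and the counit axiom for `F^∧` leaves `x ⊗ t`. -/
theorem fiberSymbol_FhatHom {m n : ℕ} (h : m ≤ n) {x : C.Ω} (hx : x ∈ C.hor) {t : InvTensor Γ}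
    (ht : t ∈ InvTensor.grade Γ m) : C.fiberSymbol n (C.FhatHom (x * W.tensor t)) =
      if m = n then x ⊗ₜ InvTensor.toEnv Γ t else 0 := by
  have h1 : C.FhatHom (x * W.tensor t) = C.hinc (C.act x) * C.inr (InvTensor.toEnv Γ t) +
      C.hinc (C.act x) * (C.FhatHom (W.tensor t) - C.inr (InvTensor.toEnv Γ t)) := by
    rw [map_mul, C.FhatHom_of_mem_hor hx, mul_sub, add_sub_cancel]
  have h2 := C.fiberGrade_mul_fiberLt 0 m
    (Submodule.mul_mem_mul (C.hinc_mem (C.act x)) (W.FhatHom_tensor ht))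
  rw [h1, map_add, C.fiberSymbol_of_mem_fiberLt (by omega) h2, add_zero]
  split_ifs with hmn
  · subst hmn
    rw [C.fiberSymbol_hinc_mul _ ht, C.act_counit]
  · exact C.fiberSymbol_of_mem_ne (by omega) (C.fiberGrade_mul 0 m
      (Submodule.mul_mem_mul (C.hinc_mem _) (C.inr_mem (InvTensor.toEnv_mem Γ ht))))

variable (s : EnvSection Γ)

theorem fiberSymbol_decomp {m n : ℕ} (h : m ≤ n) (z : C.hor ⊗[ℂ] InvEnv Γ) :
    C.fiberSymbol n (C.FhatHom (W.decomp s ((InvTensor.invProj Γ m).lTensor C.hor z))) =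
      if m = n then TensorProduct.map C.hor.subtype (InvEnv Γ).val.toLinearMap
        ((InvTensor.invProj Γ m).lTensor C.hor z) else 0 := by
  induction z with
  | zero => simp
  | add x y hx hy =>
    simp only [map_add, hx, hy]
    split_ifs <;> simp
  | tmul x v =>
    rw [LinearMap.lTensor_tmul, decomp_tmul,
      W.fiberSymbol_FhatHom h x.2 (s.sec_mem (InvTensor.invProj_mem Γ m v)), s.isSection]
    rfl

theorem exists_sum_invProj (z : C.hor ⊗[ℂ] InvEnv Γ) :
    ∃ K, ∀ L, K ≤ L → ∑ n ∈ Finset.range L, (InvTensor.invProj Γ n).lTensor C.hor z = z := by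
  induction z with
  | zero => exact ⟨0, by simp⟩
  | tmul m x =>
    obtain ⟨K, hK⟩ := exists_sum_gradedProj (Env.grade Γ) (x : Env Γ)
    refine ⟨K, fun L hL => ?_⟩
    simp only [LinearMap.lTensor_tmul]
    rw [← TensorProduct.tmul_sum]
    congr 1
    refine Subtype.ext ?_
    rw [AddSubmonoidClass.coe_finsetSum]
    exact hK L hL
  | add x y hx hy =>
    obtain ⟨K, hK⟩ := hx
    obtain ⟨K', hK'⟩ := hy
    refine ⟨max K K', fun L hL => ?_⟩
    simp only [map_add, Finset.sum_add_distrib]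
    rw [hK L ((le_max_left _ _).trans hL), hK' L ((le_max_right _ _).trans hL)]

/-- The symbol of `F̂(m_ω(z))` in the highest degree occurring in `z` is the component of `z` in
that degree. If `m_ω(z) = 0`, the components vanish one after the other from the top. -/
theorem decomp_injective : Function.Injective (W.decomp s) := by
  rw [injective_iff_map_eq_zero]
  intro z hz
  obtain ⟨K, hK⟩ := exists_sum_invProj z
  have key : ∀ M, ∑ n ∈ Finset.range M, (InvTensor.invProj Γ n).lTensor C.hor z = z →
      z = 0 := by
    intro M
    induction M with
    | zero => intro h; simpa using h.symm
    | succ M ih =>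
      intro h
      -- Components of degree below `M` do not contribute to the symbol of degree `M`.
      have h1 : C.fiberSymbol M (C.FhatHom (W.decomp s z)) =
          TensorProduct.map C.hor.subtype (InvEnv Γ).val.toLinearMap
            ((InvTensor.invProj Γ M).lTensor C.hor z) := by
        conv_lhs => rw [← h]
        simp only [map_sum]
        rw [Finset.sum_range_succ, W.fiberSymbol_decomp s le_rfl, if_pos rfl,
          Finset.sum_eq_zero, zero_add]
        intro n hn
        have hn' := Finset.mem_range.1 hn
        rw [W.fiberSymbol_decomp s hn'.le, if_neg hn'.ne]
      rw [hz, map_zero, map_zero] at h1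
      have h2 : (InvTensor.invProj Γ M).lTensor C.hor z = 0 := by
        have hinj : Function.Injective (TensorProduct.map C.hor.subtype
            (InvEnv Γ).val.toLinearMap) :=
          TensorProduct.map_injective_of_flat_flat _ _ C.hor.subtype_injective
            Subtype.val_injective
        exact hinj (h1.symm.trans (map_zero _).symm)
      rw [Finset.sum_range_succ, h2, add_zero] at h
      exact ih h
  exact key K (hK K le_rfl)

theorem decomp_bijective : Function.Bijective (W.decomp s) :=
  ⟨W.decomp_injective s, W.decomp_surjective s⟩

theorem decompInv_decomp (z : C.hor ⊗[ℂ] InvEnv Γ) : W.decompInv s (W.decomp s z) = z := by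
  rw [decompInv, dif_pos (W.decomp_bijective s)]
  exact (LinearEquiv.ofBijective (W.decomp s) (W.decomp_bijective s)).symm_apply_apply z

theorem horProj_mul_tensor_sec {x : C.Ω} (hx : x ∈ C.hor) (v : InvEnv Γ) :
    (W.horProj s (x * W.tensor (s.sec v)) : C.Ω) =
      Coalgebra.counit (R := ℂ) (Env.proj Γ (v : Env Γ)) • x := by
  have h := W.decomp_tmul s ⟨x, hx⟩ v
  rw [horProj, LinearMap.comp_apply, LinearMap.comp_apply, ← h, decompInv_decomp,
    LinearMap.lTensor_tmul]
  rfl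

theorem horProj_of_mem {x : C.Ω} (hx : x ∈ C.hor) : (W.horProj s x : C.Ω) = x := by
  have h := W.horProj_mul_tensor_sec s hx 1
  rw [s.sec_one, map_one, mul_one] at h
  rw [h, OneMemClass.coe_one, map_one, Bialgebra.counit_one, one_smul]

/-- The decomposition map is left `hor(P)`-linear by its very form. This linearity brings elements
of `NΩ(P)` back into `N`. -/
theorem horProj_mul {x : C.Ω} (hx : x ∈ C.hor) (y : C.Ω) :
    (W.horProj s (x * y) : C.Ω) = x * W.horProj s y := by
  obtain ⟨z, rfl⟩ := W.decomp_surjective s y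
  induction z with
  | zero => simp
  | add z z' h h' =>
    simp only [map_add, mul_add, Submodule.coe_add, h, h']
  | tmul φ v =>
    rw [decomp_tmul, ← mul_assoc, W.horProj_mul_tensor_sec s (C.mul_mem_hor hx φ.2),
      W.horProj_mul_tensor_sec s φ.2, mul_smul_comm]

theorem horProj_tensor_delta (ϑ : LeftInv Γ) :
    (W.horProj s (W.tensor (s.delta ϑ)) : C.Ω) = 0 := by
  have h := W.horProj_mul_tensor_sec s C.one_mem_hor
    ((Env.d Γ ∘ₗ LeftInv.toEnv Γ).codRestrict (Subalgebra.toSubmodule (InvEnv Γ))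
      (d_toEnv_mem Γ) ϑ)
  rw [one_mul] at h
  refine h.trans ?_
  exact (congrArg (fun a : A => Coalgebra.counit (R := ℂ) a • (1 : C.Ω))
    (Env.proj_d Γ (LeftInv.toEnv Γ ϑ))).trans (by simp)

theorem D_apply (x : C.Ω) : W.D s x = W.horProj s (C.d x) := rfl

/-- In `dω = (dω - ω^⊗δ) + ω^⊗δ` the first term is horizontal, hence fixed by `h_ω`. The second is a
value of `ω^⊗ι` on `dϑ`, which `p_*` kills. -/
theorem curvature_eq : W.curvature s = W.curv s := by
  refine LinearMap.ext fun ϑ => ?_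
  rw [curvature, LinearMap.comp_apply, D_apply, W.d_ω s, map_add, Submodule.coe_add,
    W.horProj_of_mem s (W.curv_mem_hor s ϑ), W.horProj_tensor_delta, add_zero]

end Connection

end BundleCalculus

/-! ### Ideals of horizontal forms and the ideals of `Ω(P)` which they generate -/

namespace BundleCalculus

variable {A : Type u} [Ring A] [StarRing A] [HopfAlgebra ℂ A] [StarModule ℂ A]
  [HopfStarAlgebra A]
variable {V : Type*} [Ring V] [StarRing V] [Algebra ℂ V] [StarModule ℂ V]
variable {B : Type v} [Ring B] [StarRing B] [Algebra ℂ B] [StarModule ℂ B]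
variable {P : QuantumPrincipalBundle A V B} {Γ : BicovariantStarCalculus A}

section

variable (C : BundleCalculus P Γ)

theorem d_mul_eq (x y : C.Ω) : C.d (x * y) = C.d x * y + parity C.gr x * C.d y :=
  linearMap_ext_of_grade (𝒲 := C.gr) (f := C.d ∘ₗ LinearMap.mulRight ℂ y)
    (g := LinearMap.mulRight ℂ y ∘ₗ C.d + LinearMap.mulRight ℂ (C.d y) ∘ₗ parity C.gr)
    (fun n x hx => by
      simp only [LinearMap.comp_apply, LinearMap.mulRight_apply, LinearMap.add_apply]
      rw [C.d_mul n x y hx, parity_of_mem C.gr hx, mul_assoc]) x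

theorem parity_d (x : C.Ω) : parity C.gr (C.d x) = -C.d (parity C.gr x) :=
  linearMap_ext_of_grade (𝒲 := C.gr) (f := parity C.gr ∘ₗ C.d) (g := -(C.d ∘ₗ parity C.gr))
    (fun n x hx => by
      rw [LinearMap.comp_apply, LinearMap.neg_apply, LinearMap.comp_apply, parity,
        degreeScale_of_mem _ _ (C.d_mem n x hx), degreeScale_of_mem _ _ hx, map_smul, pow_succ,
        mul_neg_one, neg_smul]) x

theorem parity_comp_parity : parity C.gr ∘ₗ parity C.gr = LinearMap.id :=
  LinearMap.ext (parity_parity C.gr)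

theorem parity_pr (j : C.Ω →ₗ[ℂ] C.Ω) (f : A →ₗ[ℂ] C.Ω) (x : C.Ω) :
    parity C.gr (C.pr j (toConv f) x) =
      C.pr (parity C.gr ∘ₗ j) (toConv (parity C.gr ∘ₗ f)) x := by
  have h : (parityHom C.gr).toLinearMap = parity C.gr := LinearMap.ext (parityHom_apply C.gr)
  rw [← parityHom_apply, map_pr, h]

theorem d_pr (f : A →ₗ[ℂ] C.Ω) (x : C.Ω) : C.d (C.pr LinearMap.id (toConv f) x) =
    C.pr C.d (toConv f) x + C.pr (parity C.gr) (toConv (C.d ∘ₗ f)) x := by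
  rw [pr_apply, pr_apply, pr_apply]
  induction C.act x with
  | zero => simp
  | add x y hx hy => simp only [map_add, hx, hy]; abel
  | tmul x a => simp [d_mul_eq]

/-- Products of elements of `M₁ ⊗ A` and `M₂ ⊗ A`. -/
theorem mul_mem_range_rTensor {M₁ M₂ M₃ : Submodule ℂ C.Ω} (h : M₁ * M₂ ≤ M₃) {x y : C.Ω ⊗[ℂ] A}
    (hx : x ∈ LinearMap.range (M₁.subtype.rTensor A))
    (hy : y ∈ LinearMap.range (M₂.subtype.rTensor A)) :
    x * y ∈ LinearMap.range (M₃.subtype.rTensor A) := by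
  obtain ⟨s, rfl⟩ := hx
  obtain ⟨t, rfl⟩ := hy
  induction s with
  | zero => simp
  | add x y hx hy => rw [map_add, add_mul]; exact add_mem hx hy
  | tmul x a =>
    induction t with
    | zero => simp
    | add x y hx hy => rw [map_add, mul_add]; exact add_mem hx hy
    | tmul y b => exact ⟨⟨x * y, h (Submodule.mul_mem_mul x.2 y.2)⟩ ⊗ₜ (a * b), by simp⟩

theorem range_rTensor_mono {M₁ M₂ : Submodule ℂ C.Ω} (h : M₁ ≤ M₂) :
    LinearMap.range (M₁.subtype.rTensor A) ≤ LinearMap.range (M₂.subtype.rTensor A) := by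
  rw [← Submodule.subtype_comp_inclusion _ _ h, LinearMap.rTensor_comp]
  exact LinearMap.range_comp_le_range _ _

theorem map_mem_range_rTensor {M₁ M₂ : Submodule ℂ C.Ω} {f : C.Ω →ₗ[ℂ] C.Ω} (g : A →ₗ[ℂ] A)
    (h : ∀ x ∈ M₁, f x ∈ M₂) {z : C.Ω ⊗[ℂ] A}
    (hz : z ∈ LinearMap.range (M₁.subtype.rTensor A)) :
    TensorProduct.map f g z ∈ LinearMap.range (M₂.subtype.rTensor A) := by
  obtain ⟨t, rfl⟩ := hz
  induction t with
  | zero => simp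
  | add x y hx hy => simp only [map_add]; exact add_mem hx hy
  | tmul x a => exact ⟨⟨f x, h _ x.2⟩ ⊗ₜ g a, by simp⟩

/-- The ideal of the algebra of horizontal forms generated by a set. -/
def horSpan (G : Set C.Ω) : Submodule ℂ C.Ω :=
  Submodule.span ℂ {y | ∃ α ∈ C.hor, ∃ β ∈ C.hor, ∃ g ∈ G, y = α * g * β}

theorem mem_horSpan {G : Set C.Ω} {g : C.Ω} (hg : g ∈ G) : g ∈ C.horSpan G :=
  Submodule.subset_span ⟨1, C.one_mem_hor, 1, C.one_mem_hor, g, hg, by simp⟩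

end

namespace Connection

variable {C : BundleCalculus P Γ} (W : C.Connection)

/-- Ideals of the algebra of horizontal forms which are compatible with the action, the grading
and a connection. -/
structure IsHorIdeal (N : Submodule ℂ C.Ω) : Prop where
  le_hor : N ≤ C.hor
  hor_mul : ∀ x ∈ C.hor, ∀ y ∈ N, x * y ∈ N
  mul_hor : ∀ x ∈ C.hor, ∀ y ∈ N, y * x ∈ N
  act_mem : ∀ y ∈ N, C.act y ∈ LinearMap.range (N.subtype.rTensor A)
  parity_mem : ∀ y ∈ N, parity C.gr y ∈ N
  ell_mem : ∀ ϑ, ∀ y ∈ N, W.ell ϑ y ∈ N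

theorem isHorIdeal_horSpan {G : Set C.Ω} (hG : G ⊆ C.hor)
    (hact : ∀ g ∈ G, C.act g ∈ LinearMap.range ((C.horSpan G).subtype.rTensor A))
    (hpar : ∀ g ∈ G, parity C.gr g ∈ C.horSpan G)
    (hell : ∀ ϑ, ∀ x ∈ C.hor, W.ell ϑ x ∈ G) : W.IsHorIdeal (C.horSpan G) := by
  have hle : C.horSpan G ≤ C.hor := by
    refine Submodule.span_le.2 ?_
    rintro _ ⟨α, hα, β, hβ, g, hg, rfl⟩
    exact C.mul_mem_hor (C.mul_mem_hor hα (hG hg)) hβ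
  have hl : ∀ x ∈ C.hor, ∀ y ∈ C.horSpan G, x * y ∈ C.horSpan G := by
    intro x hx y hy
    have h : C.horSpan G ≤ (C.horSpan G).comap (LinearMap.mulLeft ℂ x) := by
      refine Submodule.span_le.2 ?_
      rintro _ ⟨α, hα, β, hβ, g, hg, rfl⟩
      exact Submodule.subset_span ⟨x * α, C.mul_mem_hor hx hα, β, hβ, g, hg, by
        simp [mul_assoc]⟩
    exact h hy
  have hr : ∀ x ∈ C.hor, ∀ y ∈ C.horSpan G, y * x ∈ C.horSpan G := by
    intro x hx y hy
    have h : C.horSpan G ≤ (C.horSpan G).comap (LinearMap.mulRight ℂ x) := by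
      refine Submodule.span_le.2 ?_
      rintro _ ⟨α, hα, β, hβ, g, hg, rfl⟩
      exact Submodule.subset_span ⟨α, hα, β * x, C.mul_mem_hor hβ hx, g, hg, by
        simp [mul_assoc]⟩
    exact h hy
  refine ⟨hle, hl, hr, ?_, ?_, fun ϑ y hy => C.mem_horSpan (hell ϑ y (hle hy))⟩
  · intro y hy
    have h : C.horSpan G ≤
        (LinearMap.range ((C.horSpan G).subtype.rTensor A)).comap C.act := by
      refine Submodule.span_le.2 ?_
      rintro _ ⟨α, hα, β, hβ, g, hg, rfl⟩
      rw [SetLike.mem_coe, Submodule.mem_comap, act_mul, act_mul]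
      exact C.mul_mem_range_rTensor (Submodule.mul_le.2 fun x hx y hy => hr y hy x hx)
        (C.mul_mem_range_rTensor (Submodule.mul_le.2 hl) (C.act_mem_hor hα) (hact g hg))
        (C.act_mem_hor hβ)
    exact h hy
  · intro y hy
    have h : C.horSpan G ≤ (C.horSpan G).comap (parity C.gr) := by
      refine Submodule.span_le.2 ?_
      rintro _ ⟨α, hα, β, hβ, g, hg, rfl⟩
      rw [SetLike.mem_coe, Submodule.mem_comap, parity_mul, parity_mul]
      exact hr _ (C.parity_mem_hor hβ) _ (hl _ (C.parity_mem_hor hα) _ (hpar g hg))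
    exact h hy

namespace IsHorIdeal

variable {W} {N : Submodule ℂ C.Ω}

theorem le_mul_top (N : Submodule ℂ C.Ω) : N ≤ N * ⊤ := by
  intro x hx
  rw [← mul_one x]
  exact Submodule.mul_mem_mul hx trivial

theorem mul_mem_right {x : C.Ω} (hx : x ∈ N * ⊤) (y : C.Ω) : x * y ∈ N * ⊤ := by
  have h : N * ⊤ * ⊤ ≤ N * ⊤ := by
    rw [mul_assoc]
    exact mul_le_mul_right le_top _
  exact h (Submodule.mul_mem_mul hx trivial)

/-- `Ω(P)` is spanned by products of horizontal forms and values of `ω^⊗`, so it is enough to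
multiply by `hor(P)` and by `ω(ϑ)`. In the latter case `ω(ϑ) n` is `ℓ_ω(ϑ, n) ∈ N` plus a sum of
terms `± nₖ ω(ϑ ∘ cₖ)`, with `nₖ ∈ N` by stability under `F^∧`. -/
theorem mul_mem_left (hN : W.IsHorIdeal N) (x : C.Ω) {y : C.Ω} (hy : y ∈ N * ⊤) :
    x * y ∈ N * ⊤ := by
  have hω : ∀ (ϑ : LeftInv Γ), ∀ y ∈ N * (⊤ : Submodule ℂ C.Ω),
      W.ω ϑ * y ∈ N * (⊤ : Submodule ℂ C.Ω) := by
    intro ϑ y hy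
    induction hy using Submodule.mul_induction_on' with
    | add x _ y _ hx hy => rw [mul_add]; exact add_mem hx hy
    | mem_mul_mem n hn y _ =>
      rw [← mul_assoc]
      refine mul_mem_right ?_ y
      have h : W.ω ϑ * n = W.ell ϑ n +
          C.pr LinearMap.id (toConv (W.ω ∘ₗ LeftInv.circ Γ ϑ)) (parity C.gr n) := by
        rw [ell, twist_eq, sub_add_cancel]
      rw [h]
      refine add_mem (le_mul_top N (hN.ell_mem ϑ n hn)) ?_
      exact C.pr_mem _ _ (hN.act_mem _ (hN.parity_mem n hn)) fun z hz a =>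
        Submodule.mul_mem_mul hz trivial
  have ht : ∀ (t : InvTensor Γ), ∀ y ∈ N * (⊤ : Submodule ℂ C.Ω),
      W.tensor t * y ∈ N * (⊤ : Submodule ℂ C.Ω) := by
    intro t
    induction t using TensorAlgebra.induction with
    | algebraMap r =>
      intro y hy
      rw [AlgHom.commutes, ← Algebra.smul_def]
      exact Submodule.smul_mem _ _ hy
    | ι ϑ =>
      intro y hy
      rw [tensor_ι]
      exact hω ϑ y hy
    | mul t t' h h' =>
      intro y hy
      rw [map_mul, mul_assoc]
      exact h _ (h' y hy)
    | add t t' h h' =>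
      intro y hy
      rw [map_add, add_mul]
      exact add_mem (h y hy) (h' y hy)
  have hh : ∀ z ∈ C.hor, ∀ y ∈ N * (⊤ : Submodule ℂ C.Ω),
      z * y ∈ N * (⊤ : Submodule ℂ C.Ω) := by
    intro z hz y hy
    induction hy using Submodule.mul_induction_on' with
    | add x _ y _ hx hy => rw [mul_add]; exact add_mem hx hy
    | mem_mul_mem n hn y _ =>
      rw [← mul_assoc]
      exact Submodule.mul_mem_mul (hN.hor_mul z hz n hn) trivial
  have hx : x ∈ C.hor * LinearMap.range W.tensor.toLinearMap := by
    rw [W.hor_mul_range_tensor]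
    trivial
  induction hx using Submodule.mul_induction_on' with
  | add x _ y _ hx hy => rw [add_mul]; exact add_mem hx hy
  | mem_mul_mem z hz w hw =>
    obtain ⟨t, rfl⟩ := hw
    rw [mul_assoc]
    exact hh z hz _ (ht t y hy)

theorem act_mem_mul_top (hN : W.IsHorIdeal N) {x : C.Ω} (hx : x ∈ N * ⊤) :
    C.act x ∈ LinearMap.range ((N * (⊤ : Submodule ℂ C.Ω)).subtype.rTensor A) := by
  induction hx using Submodule.mul_induction_on' with
  | add x _ y _ hx hy => rw [map_add]; exact add_mem hx hy
  | mem_mul_mem n hn y _ =>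
    rw [act_mul]
    refine C.mul_mem_range_rTensor le_rfl (hN.act_mem n hn) ?_
    have h : Function.Surjective ((⊤ : Submodule ℂ C.Ω).subtype.rTensor A) :=
      LinearMap.rTensor_surjective A fun x => ⟨⟨x, trivial⟩, rfl⟩
    exact h _

theorem horProj_mem (hN : W.IsHorIdeal N) (s : EnvSection Γ) {x : C.Ω} (hx : x ∈ N * ⊤) :
    (W.horProj s x : C.Ω) ∈ N := by
  induction hx using Submodule.mul_induction_on' with
  | add x _ y _ hx hy => rw [map_add]; exact add_mem hx hy
  | mem_mul_mem n hn y _ =>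
    rw [W.horProj_mul s (hN.le_hor hn)]
    exact hN.mul_hor _ (W.horProj s y).2 n hn

/-- The projection `h_ω` fixes horizontal forms and maps `NΩ(P)` into `N hor(P) ⊆ N`. Enlarging `N`
to an ideal of `Ω(P)` thus creates no new horizontal elements. -/
theorem mem_of_mem_mul_top (hN : W.IsHorIdeal N) (s : EnvSection Γ) {x : C.Ω} (hx : x ∈ N * ⊤)
    (h : x ∈ C.hor) :
    x ∈ N := by
  rw [← W.horProj_of_mem s h]
  exact hN.horProj_mem s hx

/-- The ideal of `Ω(P)` generated by an ideal of the horizontal forms. -/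
def ideal (hN : W.IsHorIdeal N) : Ideal C.Ω where
  carrier := N * (⊤ : Submodule ℂ C.Ω)
  add_mem' := add_mem
  zero_mem' := zero_mem _
  smul_mem' x _ hy := hN.mul_mem_left x hy

instance isTwoSided_ideal (hN : W.IsHorIdeal N) : hN.ideal.IsTwoSided :=
  ⟨fun y hx => mul_mem_right hx y⟩

/-- The quotient of `Ω(P)` by the ideal generated by an ideal of the horizontal forms. -/
abbrev Quot (hN : W.IsHorIdeal N) : Type _ := C.Ω ⧸ hN.ideal

/-- The quotient map. -/
def quotHom (hN : W.IsHorIdeal N) : C.Ω →ₐ[ℂ] hN.Quot := Ideal.Quotient.mkₐ ℂ hN.ideal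

theorem quotHom_eq_zero (hN : W.IsHorIdeal N) {x : C.Ω} :
    hN.quotHom x = 0 ↔ x ∈ N * (⊤ : Submodule ℂ C.Ω) :=
  Ideal.Quotient.eq_zero_iff_mem

theorem quotHom_surjective (hN : W.IsHorIdeal N) : Function.Surjective hN.quotHom :=
  Ideal.Quotient.mk_surjective

end IsHorIdeal

end Connection

end BundleCalculus

/-! ### The differential of `ℓ_ω(ϑ, φ)` modulo the `ℓ`'s -/

namespace BundleCalculus.Connection

variable {A : Type u} [Ring A] [StarRing A] [HopfAlgebra ℂ A] [StarModule ℂ A]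
  [HopfStarAlgebra A]
variable {V : Type*} [Ring V] [StarRing V] [Algebra ℂ V] [StarModule ℂ V]
variable {B : Type v} [Ring B] [StarRing B] [Algebra ℂ B] [StarModule ℂ B]
variable {P : QuantumPrincipalBundle A V B} {Γ : BicovariantStarCalculus A}
variable {C : BundleCalculus P Γ} (W : C.Connection)

theorem parity_ω (ϑ : LeftInv Γ) : parity C.gr (W.ω ϑ) = -W.ω ϑ :=
  parity_of_mem_one C.gr (W.mem_one ϑ)

theorem parity_ell (ϑ : LeftInv Γ) (x : C.Ω) :
    parity C.gr (W.ell ϑ x) = -W.ell ϑ (parity C.gr x) := by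
  have h : parity C.gr ∘ₗ W.ω ∘ₗ LeftInv.circ Γ ϑ = -(W.ω ∘ₗ LeftInv.circ Γ ϑ) :=
    LinearMap.ext fun a => W.parity_ω _
  rw [ell, ell, twist_eq, twist_eq, map_sub, parity_mul, parity_pr, parity_ω, h, toConv_neg,
    pr_neg_right, LinearMap.neg_apply, LinearMap.comp_id, ← LinearMap.comp_apply,
    ← C.pr_comp_parity, ← LinearMap.comp_apply, ← C.pr_comp_parity, LinearMap.id_comp]
  rw [neg_mul, neg_sub_neg, neg_sub, C.pr_comp_parity, LinearMap.comp_apply]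

theorem ell_add (ϑ : LeftInv Γ) (x y : C.Ω) : W.ell ϑ (x + y) = W.ell ϑ x + W.ell ϑ y :=
  map_add (W.ellMap ϑ) x y

/-- `dℓ(ϑ,φ) = dω(ϑ)φ - ℓ(ϑ,dφ) - ∑ φₖ dω(ϑ ∘ cₖ)`. -/
theorem d_ell (ϑ : LeftInv Γ) (x : C.Ω) : C.d (W.ell ϑ x) = C.d (W.ω ϑ) * x - W.ell ϑ (C.d x) -
    C.pr LinearMap.id (toConv (C.d ∘ₗ W.ω ∘ₗ LeftInv.circ Γ ϑ)) x := by
  have h1 : C.pr C.d (toConv (W.ω ∘ₗ LeftInv.circ Γ ϑ)) (parity C.gr x) =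
      -C.pr LinearMap.id (toConv (W.ω ∘ₗ LeftInv.circ Γ ϑ)) (parity C.gr (C.d x)) := by
    rw [parity_d, map_neg, neg_neg, ← LinearMap.comp_apply _ C.d, ← pr_comp_d, LinearMap.id_comp]
  have h2 : C.pr (parity C.gr) (toConv (C.d ∘ₗ W.ω ∘ₗ LeftInv.circ Γ ϑ)) (parity C.gr x) =
      C.pr LinearMap.id (toConv (C.d ∘ₗ W.ω ∘ₗ LeftInv.circ Γ ϑ)) x := by
    rw [← LinearMap.comp_apply, ← pr_comp_parity, parity_comp_parity]
  rw [ell, ell, twist_eq, twist_eq, map_sub, d_mul_eq, d_pr, parity_ω, h1, h2]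
  rw [neg_mul]
  abel

/-- `F^∧` of `∑ φₖ ω(π(cₖ))`, paired with a linear map. -/
theorem pr_pr_ω_proj (f : A →ₗ[ℂ] C.Ω) (x : C.Ω) :
    C.pr LinearMap.id (toConv f)
      (C.pr LinearMap.id (toConv (W.ω ∘ₗ LeftInv.proj Γ)) x) =
    C.pr LinearMap.id (toConv (W.ω ∘ₗ LeftInv.proj Γ) * toConv f) x := by
  let l : C.Ω →ₐ[ℂ] C.Ω ⊗[ℂ] A := Algebra.TensorProduct.includeLeft
  let r : A →ₐ[ℂ] C.Ω ⊗[ℂ] A := Algebra.TensorProduct.includeRight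
  have h1 : C.actHom.toLinearMap = C.pr l.toLinearMap (toConv r.toLinearMap) := by
    ext x
    rw [AlgHom.toLinearMap_apply, actHom_apply, pr_apply]
    induction C.act x with
    | zero => simp
    | add x y hx hy => simp only [map_add, ← hx, ← hy]
    | tmul x a => simp [l, r]
  have h2 : toConv (C.actHom.toLinearMap ∘ₗ W.ω ∘ₗ LeftInv.proj Γ) =
      toConv (r.toLinearMap ∘ₗ HopfAlgebra.antipode ℂ) *
        (toConv (l.toLinearMap ∘ₗ W.ω ∘ₗ LeftInv.proj Γ) * toConv r.toLinearMap) := by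
    rw [← comp_ad ((W.ω ∘ₗ LeftInv.proj Γ).rTensor A)]
    · ext a
      change C.actHom (W.ω (LeftInv.proj Γ a)) = _
      rw [actHom_apply, act_ω, LeftInv.coact_proj, LinearMap.rTensor_comp]
      rfl
    · intro x y z
      simp [l, r]
  have hr : toConv r.toLinearMap * toConv (r.toLinearMap ∘ₗ HopfAlgebra.antipode ℂ) = 1 :=
    conv_antipode_right r
  -- The leg in `A` contributed by the form cancels the antipode factor of the adjoint coaction.
  have h3 : C.act (C.pr LinearMap.id (toConv (W.ω ∘ₗ LeftInv.proj Γ)) x) =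
      C.pr l.toLinearMap (toConv (l.toLinearMap ∘ₗ W.ω ∘ₗ LeftInv.proj Γ) *
        toConv r.toLinearMap) x := by
    rw [← actHom_apply, map_pr, LinearMap.comp_id, h1, pr_pr, ← h1]
    refine congrArg (fun f => C.pr l.toLinearMap (toConv r.toLinearMap * f) x) h2 |>.trans ?_
    rw [← mul_assoc (toConv r.toLinearMap), hr, one_mul]
  rw [pr_apply _ _ (toConv f), h3, pr_apply, pr_apply]
  induction C.act x with
  | zero => simp
  | add x y hx hy => simp only [map_add, hx, hy]
  | tmul y a =>
    have h4 := toConv_map_comul (W.ω ∘ₗ LeftInv.proj Γ)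
    have h5 : (toConv (l.toLinearMap ∘ₗ W.ω ∘ₗ LeftInv.proj Γ) * toConv r.toLinearMap).ofConv a =
        TensorProduct.map (W.ω ∘ₗ LeftInv.proj Γ) LinearMap.id (Coalgebra.comul a) :=
      congr(($h4).ofConv a).symm
    rw [TensorProduct.map_tmul, LinearMap.mul'_apply, h5, TensorProduct.map_tmul,
      LinearMap.mul'_apply]
    change _ = y * conv (W.ω ∘ₗ LeftInv.proj Γ) f a
    rw [conv, LinearMap.comp_apply, LinearMap.comp_apply]
    induction Coalgebra.comul (R := ℂ) a with
    | zero => simp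
    | add x y hx hy => simp only [map_add, mul_add, hx, hy]
    | tmul b c => simp [l, mul_assoc]

theorem ell_pr_parity (ϑ : LeftInv Γ) (x : C.Ω) :
    W.ell ϑ (C.pr (parity C.gr) (toConv (W.ω ∘ₗ LeftInv.proj Γ)) x) =
      W.ω ϑ * C.pr (parity C.gr) (toConv (W.ω ∘ₗ LeftInv.proj Γ)) x +
      C.pr LinearMap.id (toConv (W.ω ∘ₗ LeftInv.proj Γ) *
        toConv (W.ω ∘ₗ LeftInv.circ Γ ϑ)) x := by
  have h : parity C.gr ∘ₗ W.ω ∘ₗ LeftInv.proj Γ = -(W.ω ∘ₗ LeftInv.proj Γ) :=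
    LinearMap.ext fun a => W.parity_ω _
  rw [ell, twist_eq, parity_pr, parity_comp_parity, h, toConv_neg, pr_neg_right,
    LinearMap.neg_apply, map_neg, sub_neg_eq_add, W.pr_pr_ω_proj]

section Regular

variable {Q : Type*} [Ring Q] [Algebra ℂ Q] {q : C.Ω →ₐ[ℂ] Q}

/-- After any homomorphism which kills the `ℓ`'s, `ω` behaves like a regular connection. Since
`map_n` also needs only this property of `q`, it can be applied before the `n`'s are divided out. -/
theorem map_ω_mul_pr (hq : ∀ ϑ, ∀ x ∈ C.hor, q (W.ell ϑ x) = 0) (ϑ : LeftInv Γ)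
    (g : WithConv (A →ₗ[ℂ] C.Ω)) {x : C.Ω} (hx : x ∈ C.hor) :
    q (W.ω ϑ * C.pr (parity C.gr) g x) =
      q (C.pr LinearMap.id (toConv (W.ω ∘ₗ LeftInv.circ Γ ϑ) * g) x) := by
  rw [mul_pr, map_pr, C.pr_congr (j' := q.toLinearMap ∘ₗ
    C.pr LinearMap.id (toConv (W.ω ∘ₗ LeftInv.circ Γ ϑ))) _ _ hx, ← map_pr, pr_pr]
  intro y hy
  have h := hq ϑ _ (C.parity_mem_hor hy)
  rw [ell, twist_eq, parity_parity, map_sub, sub_eq_zero] at h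
  exact h

/-- The exchange rule is applied twice, and the order of the factors matches `(ϑη) ∘ a = ∑ (ϑ ∘
a⁽¹⁾)(η ∘ a⁽²⁾)`. Degree two suffices, the rule being used for `δ(ϑ)`. -/
theorem map_tensor_mul (hq : ∀ ϑ, ∀ x ∈ C.hor, q (W.ell ϑ x) = 0) {t : InvTensor Γ}
    (ht : t ∈ InvTensor.grade Γ 2) {x : C.Ω} (hx : x ∈ C.hor) : q (W.tensor t * x) =
      q (C.pr LinearMap.id
        (toConv (W.tensor.toLinearMap ∘ₗ (InvTensor.circ Γ t).ofConv)) x) := by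
  have ht' : t ∈ LinearMap.range (TensorAlgebra.ι ℂ : LeftInv Γ →ₗ[ℂ] InvTensor Γ) *
      LinearMap.range (TensorAlgebra.ι ℂ : LeftInv Γ →ₗ[ℂ] InvTensor Γ) := by
    rw [← pow_two]
    exact ht
  clear ht
  induction ht' using Submodule.mul_induction_on' with
  | add t _ t' _ h h' =>
    have h1 : toConv (W.tensor.toLinearMap ∘ₗ (InvTensor.circ Γ (t + t')).ofConv) =
        toConv (W.tensor.toLinearMap ∘ₗ (InvTensor.circ Γ t).ofConv) +
          toConv (W.tensor.toLinearMap ∘ₗ (InvTensor.circ Γ t').ofConv) := by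
      rw [map_add]
      ext a
      exact map_add W.tensor _ _
    rw [map_add, add_mul, map_add, h, h', h1, pr_add_right, LinearMap.add_apply, map_add]
  | mem_mul_mem y hy z hz =>
    obtain ⟨ϑ, rfl⟩ := hy
    obtain ⟨η, rfl⟩ := hz
    have h1 : ∀ ϑ, toConv (W.tensor.toLinearMap ∘ₗ
        (InvTensor.circ Γ (TensorAlgebra.ι ℂ ϑ)).ofConv) =
        toConv (W.ω ∘ₗ LeftInv.circ Γ ϑ) := by
      intro ϑ
      rw [InvTensor.circ_ι]
      ext a
      exact W.tensor_ι _
    have h2 := hq η x hx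
    rw [ell, twist_eq, map_sub, sub_eq_zero, ← LinearMap.comp_apply, ← pr_comp_parity,
      LinearMap.id_comp] at h2
    rw [map_mul W.tensor, map_mul (InvTensor.circ Γ), toConv_comp_mul, h1, h1, tensor_ι, tensor_ι,
      mul_assoc, map_mul q, h2, ← map_mul q, W.map_ω_mul_pr hq _ _ hx]

/-- Expand `dℓ` by `d_ell`. In `ℓ(ϑ, dφ)` the covariant part of `dφ` gives an element which is
killed, and the part `(-1)^{∂φ} ∑ φₖ ω(π(cₖ))` gives two products of values of `ω`. With `dω = R_ω +
ω^⊗δ` and the exchange rule for `ω^⊗δ(ϑ)`, all terms quadratic in `ω` assemble to `u_ω`, following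
the four terms of `ρ`. -/
theorem map_n (hq : ∀ ϑ, ∀ x ∈ C.hor, q (W.ell ϑ x) = 0) (s : EnvSection Γ) (ϑ : LeftInv Γ)
    {x : C.Ω} (hx : x ∈ C.hor) : q (W.n s ϑ x) = q (C.d (W.ell ϑ x)) := by
  have h1 : q (W.ell ϑ (C.d x)) =
      q (C.pr LinearMap.id (toConv (W.ω ∘ₗ LeftInv.circ Γ ϑ) *
        toConv (W.ω ∘ₗ LeftInv.proj Γ)) x) +
      q (C.pr LinearMap.id (toConv (W.ω ∘ₗ LeftInv.proj Γ) *
        toConv (W.ω ∘ₗ LeftInv.circ Γ ϑ)) x) := by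
    rw [W.d_eq, ell_add, map_add, hq _ _ (W.covD_mem_hor hx), zero_add, ell_pr_parity, map_add,
      W.map_ω_mul_pr hq _ _ hx]
  have h2 : toConv (C.d ∘ₗ W.ω ∘ₗ LeftInv.circ Γ ϑ) =
      toConv (W.curv s ∘ₗ LeftInv.circ Γ ϑ) +
        toConv (W.tensor.toLinearMap ∘ₗ s.delta ∘ₗ LeftInv.circ Γ ϑ) := by
    ext a
    exact W.d_ω s _
  have h3 : toConv (W.u s ϑ) =
      toConv (W.tensor.toLinearMap ∘ₗ (InvTensor.circ Γ (s.delta ϑ)).ofConv) -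
      toConv (W.tensor.toLinearMap ∘ₗ s.delta ∘ₗ LeftInv.circ Γ ϑ) -
      toConv (W.ω ∘ₗ LeftInv.circ Γ ϑ) * toConv (W.ω ∘ₗ LeftInv.proj Γ) -
      toConv (W.ω ∘ₗ LeftInv.proj Γ) * toConv (W.ω ∘ₗ LeftInv.circ Γ ϑ) := by
    ext a
    change W.tensor (s.rho ϑ a) = _
    rw [EnvSection.rho]
    simp only [LinearMap.sub_apply, map_sub, tensor_conv_ι]
    rfl
  have h4 := W.map_tensor_mul hq (s.delta_mem ϑ) hx
  rw [d_ell, n, twist_eq, twist_eq, curvature_eq, W.d_ω s, h2, h3]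
  simp only [pr_sub_right, pr_add_right, LinearMap.sub_apply, LinearMap.add_apply, map_sub,
    map_add, add_mul, h1, h4]
  abel

end Regular

end BundleCalculus.Connection

/-! ### The ideal `𝓝_ω`: action, parity, differential -/

namespace BundleCalculus.Connection

variable {A : Type u} [Ring A] [StarRing A] [HopfAlgebra ℂ A] [StarModule ℂ A]
  [HopfStarAlgebra A]
variable {V : Type*} [Ring V] [StarRing V] [Algebra ℂ V] [StarModule ℂ V]
variable {B : Type v} [Ring B] [StarRing B] [Algebra ℂ B] [StarModule ℂ B]
variable {P : QuantumPrincipalBundle A V B} {Γ : BicovariantStarCalculus A}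
variable {C : BundleCalculus P Γ} (W : C.Connection)

/-- The elements `ℓ(ϑ,φ)` with horizontal `φ`. -/
def ellSet : Set C.Ω := {g | ∃ ϑ, ∃ φ ∈ C.hor, g = W.ell ϑ φ}

theorem ellSet_subset_hor : W.ellSet ⊆ C.hor := by
  rintro _ ⟨ϑ, φ, hφ, rfl⟩
  exact W.ell_mem_hor ϑ hφ

theorem ell_mem_ellSet (ϑ : LeftInv Γ) {x : C.Ω} (hx : x ∈ C.hor) : W.ell ϑ x ∈ W.ellSet :=
  ⟨ϑ, x, hx, rfl⟩

theorem act_ell_mem {N : Submodule ℂ C.Ω} (h : W.ellSet ⊆ N) (ϑ : LeftInv Γ) {x : C.Ω}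
    (hx : x ∈ C.hor) : C.act (W.ell ϑ x) ∈ LinearMap.range (N.subtype.rTensor A) := by
  obtain ⟨S, hS⟩ := TensorProduct.exists_finset (LeftInv.coact Γ ϑ)
  rw [W.act_ell hS hx]
  exact sum_mem fun p _ => C.map_mem_range_rTensor _
    (fun y hy => h (W.ell_mem_ellSet p.1 hy)) (C.act_mem_hor hx)

theorem isHorIdeal_ellSet : W.IsHorIdeal (C.horSpan W.ellSet) := by
  refine W.isHorIdeal_horSpan W.ellSet_subset_hor ?_ ?_ fun ϑ x hx => W.ell_mem_ellSet ϑ hx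
  · rintro _ ⟨ϑ, φ, hφ, rfl⟩
    exact W.act_ell_mem (fun g hg => C.mem_horSpan hg) ϑ hφ
  · rintro _ ⟨ϑ, φ, hφ, rfl⟩
    rw [parity_ell]
    exact neg_mem (C.mem_horSpan (W.ell_mem_ellSet ϑ (C.parity_mem_hor hφ)))

variable (s : EnvSection Γ)

/-- Here `map_n` is applied to the quotient by the ideal which the `ℓ`'s alone generate. -/
theorem n_sub_d_ell_mem (ϑ : LeftInv Γ) {x : C.Ω} (hx : x ∈ C.hor) :
    W.n s ϑ x - C.d (W.ell ϑ x) ∈ C.horSpan W.ellSet * ⊤ := by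
  have hN := W.isHorIdeal_ellSet
  rw [← hN.quotHom_eq_zero, map_sub, sub_eq_zero]
  refine W.map_n (fun ϑ x hx => ?_) s ϑ hx
  rw [hN.quotHom_eq_zero]
  exact IsHorIdeal.le_mul_top _ (C.mem_horSpan (W.ell_mem_ellSet ϑ hx))

theorem tensor_mem_gr {n : ℕ} {t : InvTensor Γ} (ht : t ∈ InvTensor.grade Γ n) :
    W.tensor t ∈ C.gr n := by
  have h : ∀ n, LinearMap.range W.ω ^ n ≤ C.gr n := by
    intro n
    induction n with
    | zero =>
      rw [pow_zero, Submodule.one_le]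
      exact SetLike.GradedOne.one_mem
    | succ n ih =>
      rw [pow_succ]
      refine Submodule.mul_le.2 fun x hx y hy => ?_
      obtain ⟨ϑ, rfl⟩ := hy
      exact SetLike.mul_mem_graded (ih hx) (W.mem_one ϑ)
  exact h n (W.tensor_mem ht)

theorem curv_mem (ϑ : LeftInv Γ) : W.curv s ϑ ∈ C.gr 2 := by
  rw [← add_sub_cancel_right (W.curv s ϑ) (W.tensor (s.delta ϑ)), ← d_ω]
  exact sub_mem (C.d_mem 1 _ (W.mem_one ϑ)) (W.tensor_mem_gr (s.delta_mem ϑ))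

theorem u_mem (ϑ : LeftInv Γ) (a : A) : W.u s ϑ a ∈ C.gr 2 :=
  W.tensor_mem_gr (s.rho_mem ϑ a)

theorem ell_mem {k : ℕ} (ϑ : LeftInv Γ) {x : C.Ω} (hx : x ∈ C.gr k) :
    W.ell ϑ x ∈ C.gr (k + 1) := by
  rw [ell, twist_eq, ← LinearMap.comp_apply, ← pr_comp_parity]
  refine sub_mem ?_ (C.pr_mem _ _ (C.act_mem hx) fun y hy a => ?_)
  · rw [add_comm]
    exact SetLike.mul_mem_graded (W.mem_one ϑ) hx
  · rw [LinearMap.id_comp, parity_of_mem C.gr hy]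
    refine SetLike.mul_mem_graded ?_ (W.mem_one _)
    rcases neg_one_pow_eq_or C.Ω k with h | h
    · simpa [h] using hy
    · simpa [h] using hy

theorem n_mem {k : ℕ} (ϑ : LeftInv Γ) {x : C.Ω} (hx : x ∈ C.gr k) :
    W.n s ϑ x ∈ C.gr (k + 2) := by
  rw [n, twist_eq, twist_eq, curvature_eq]
  refine add_mem (sub_mem ?_ ?_) ?_
  · rw [add_comm]
    exact SetLike.mul_mem_graded (W.curv_mem s ϑ) hx
  · exact C.pr_mem _ _ (C.act_mem hx) fun y hy a =>
      SetLike.mul_mem_graded hy (W.curv_mem s _)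
  · exact C.pr_mem _ _ (C.act_mem hx) fun y hy a => SetLike.mul_mem_graded hy (W.u_mem s ϑ a)

theorem n_mem_hor (ϑ : LeftInv Γ) {x : C.Ω} (hx : x ∈ C.hor) : W.n s ϑ x ∈ C.hor := by
  rw [n, twist_eq, twist_eq, curvature_eq]
  refine add_mem (sub_mem (C.mul_mem_hor (W.curv_mem_hor s ϑ) hx) ?_) ?_
  · exact C.pr_mem _ _ (C.act_mem_hor hx) fun y hy a => C.mul_mem_hor hy (W.curv_mem_hor s _)
  · exact C.pr_mem _ _ (C.act_mem_hor hx) fun y hy a => C.mul_mem_hor hy (W.u_mem_hor s ϑ a)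

theorem parity_n (ϑ : LeftInv Γ) (x : C.Ω) :
    parity C.gr (W.n s ϑ x) = W.n s ϑ (parity C.gr x) := by
  have h2 : ∀ {x : C.Ω}, x ∈ C.gr 2 → parity C.gr x = x := fun hx => by
    rw [parity_of_mem C.gr hx]; simp
  have h3 : parity C.gr ∘ₗ W.curv s ∘ₗ LeftInv.circ Γ ϑ = W.curv s ∘ₗ LeftInv.circ Γ ϑ :=
    LinearMap.ext fun a => h2 (W.curv_mem s _)
  have h4 : parity C.gr ∘ₗ W.u s ϑ = W.u s ϑ := LinearMap.ext fun a => h2 (W.u_mem s ϑ a)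
  simp only [n, twist_eq, curvature_eq]
  rw [map_add, map_sub, parity_mul, h2 (W.curv_mem s ϑ), parity_pr, parity_pr, h3, h4,
    LinearMap.comp_id, ← LinearMap.id_comp (parity C.gr), pr_comp_parity, pr_comp_parity]
  simp

/-- The elements `ℓ(ϑ,φ)` and `n(ϑ,φ)` with horizontal `φ`. -/
def irregSet : Set C.Ω := {g | ∃ ϑ, ∃ φ ∈ C.hor, g = W.ell ϑ φ ∨ g = W.n s ϑ φ}

theorem irregIdeal_eq : W.irregIdeal s = C.horSpan (W.irregSet s) := by
  refine congrArg (Submodule.span ℂ) (Set.ext fun y => ⟨?_, ?_⟩)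
  · rintro ⟨α, hα, β, hβ, ϑ, φ, hφ, h | h⟩
    · exact ⟨α, hα, β, hβ, _, ⟨ϑ, φ, hφ, Or.inl rfl⟩, h⟩
    · exact ⟨α, hα, β, hβ, _, ⟨ϑ, φ, hφ, Or.inr rfl⟩, h⟩
  · rintro ⟨α, hα, β, hβ, _, ⟨ϑ, φ, hφ, rfl | rfl⟩, h⟩
    · exact ⟨α, hα, β, hβ, ϑ, φ, hφ, Or.inl h⟩
    · exact ⟨α, hα, β, hβ, ϑ, φ, hφ, Or.inr h⟩

theorem ellSet_subset_irregSet : W.ellSet ⊆ W.irregSet s := by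
  rintro _ ⟨ϑ, φ, hφ, rfl⟩
  exact ⟨ϑ, φ, hφ, Or.inl rfl⟩

theorem irregSet_subset_hor : W.irregSet s ⊆ C.hor := by
  rintro _ ⟨ϑ, φ, hφ, rfl | rfl⟩
  · exact W.ell_mem_hor ϑ hφ
  · exact W.n_mem_hor s ϑ hφ

theorem irregSet_subset_irregIdeal : W.irregSet s ⊆ W.irregIdeal s := by
  rw [irregIdeal_eq]
  exact fun g hg => C.mem_horSpan hg

theorem ell_mem_irregIdeal (ϑ : LeftInv Γ) {x : C.Ω} (hx : x ∈ C.hor) :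
    W.ell ϑ x ∈ W.irregIdeal s :=
  W.irregSet_subset_irregIdeal s (W.ellSet_subset_irregSet s (W.ell_mem_ellSet ϑ hx))

theorem n_mem_irregIdeal (ϑ : LeftInv Γ) {x : C.Ω} (hx : x ∈ C.hor) :
    W.n s ϑ x ∈ W.irregIdeal s :=
  W.irregSet_subset_irregIdeal s ⟨ϑ, x, hx, Or.inr rfl⟩

theorem horSpan_ellSet_le : C.horSpan W.ellSet ≤ W.irregIdeal s := by
  rw [irregIdeal_eq]
  refine Submodule.span_mono ?_
  rintro _ ⟨α, hα, β, hβ, g, hg, rfl⟩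
  exact ⟨α, hα, β, hβ, g, W.ellSet_subset_irregSet s hg, rfl⟩

/-- As `F^∧` commutes with `d`, the covariance of `ℓ` passes to `dℓ`, which agrees with `n` modulo
the ideal of `Ω(P)` generated by the `ℓ`'s. So no explicit formula for `F^∧(n)` is needed. -/
theorem act_n_mem (ϑ : LeftInv Γ) {x : C.Ω} (hx : x ∈ C.hor) :
    C.act (W.n s ϑ x) ∈ LinearMap.range ((W.irregIdeal s).subtype.rTensor A) := by
  let T : Submodule ℂ C.Ω := Submodule.span ℂ {g | ∃ ϑ, ∃ φ ∈ C.hor, g = W.n s ϑ φ}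
  let K : Submodule ℂ C.Ω := C.horSpan W.ellSet * ⊤
  have hT : T ≤ W.irregIdeal s ⊓ C.hor := by
    refine Submodule.span_le.2 ?_
    rintro _ ⟨ϑ, φ, hφ, rfl⟩
    exact ⟨W.n_mem_irregIdeal s ϑ hφ, W.n_mem_hor s ϑ hφ⟩
  have hd : ∀ ϑ, ∀ y ∈ C.hor, C.d (W.ellMap ϑ y) ∈ T ⊔ K := by
    intro ϑ y hy
    have h : C.d (W.ell ϑ y) = W.n s ϑ y - (W.n s ϑ y - C.d (W.ell ϑ y)) := by abel
    rw [ellMap_apply, h]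
    exact sub_mem (Submodule.mem_sup_left (Submodule.subset_span ⟨ϑ, y, hy, rfl⟩))
      (Submodule.mem_sup_right (W.n_sub_d_ell_mem s ϑ hy))
  have h1 : C.act (W.n s ϑ x) ∈ LinearMap.range ((T ⊔ K).subtype.rTensor A) := by
    have h : W.n s ϑ x = C.d (W.ell ϑ x) + (W.n s ϑ x - C.d (W.ell ϑ x)) := by abel
    rw [h, map_add]
    refine add_mem ?_ (C.range_rTensor_mono le_sup_right
      (W.isHorIdeal_ellSet.act_mem_mul_top (W.n_sub_d_ell_mem s ϑ hx)))
    obtain ⟨S, hS⟩ := TensorProduct.exists_finset (LeftInv.coact Γ ϑ)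
    rw [act_d, W.act_ell hS hx, map_sum]
    refine sum_mem fun p _ => ?_
    rw [← LinearMap.comp_apply, LinearMap.rTensor_comp_map]
    exact C.map_mem_range_rTensor _ (hd p.1) (C.act_mem_hor hx)
  have h2 := C.act_mem_hor (W.n_mem_hor s ϑ hx)
  rw [mem_range_rTensor_iff] at h1 h2 ⊢
  intro f
  -- A slice is a combination `t` of `n`'s plus an element `k` of the ideal of `Ω(P)` generated by
  -- the `ℓ`'s. The slice and `t` are horizontal, hence so is `k`, which therefore lies in the
  -- corresponding ideal of `hor(P)`.
  obtain ⟨t, ht, k, hk, h⟩ := Submodule.mem_sup.1 (h1 f)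
  rw [← h]
  refine add_mem (hT ht).1 (W.horSpan_ellSet_le s
    (W.isHorIdeal_ellSet.mem_of_mem_mul_top s hk ?_))
  rw [← add_sub_cancel_left t k, h]
  exact sub_mem (h2 f) (hT ht).2

theorem isHorIdeal_irregIdeal : W.IsHorIdeal (W.irregIdeal s) := by
  have hle := W.irregSet_subset_irregIdeal s
  rw [irregIdeal_eq] at hle ⊢
  refine W.isHorIdeal_horSpan (W.irregSet_subset_hor s) ?_ ?_
    fun ϑ x hx => W.ellSet_subset_irregSet s (W.ell_mem_ellSet ϑ hx)
  · rintro _ ⟨ϑ, φ, hφ, rfl | rfl⟩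
    · exact W.act_ell_mem ((W.ellSet_subset_irregSet s).trans hle) ϑ hφ
    · rw [← irregIdeal_eq]
      exact W.act_n_mem s ϑ hφ
  · rintro _ ⟨ϑ, φ, hφ, rfl | rfl⟩
    · rw [parity_ell]
      exact neg_mem (hle ⟨ϑ, _, C.parity_mem_hor hφ, Or.inl rfl⟩)
    · rw [parity_n]
      exact hle ⟨ϑ, _, C.parity_mem_hor hφ, Or.inr rfl⟩

/-- The differential preserves the ideals of `Ω(P)` generated by ideals of horizontal forms, if it
does so on generators. -/
theorem d_mem_of_generators {G : Set C.Ω} {N : Submodule ℂ C.Ω} (hN : W.IsHorIdeal N)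
    (hG : G ⊆ N) (hd : ∀ g ∈ G, C.d g ∈ N * (⊤ : Submodule ℂ C.Ω)) {x : C.Ω}
    (hx : x ∈ C.horSpan G * ⊤) : C.d x ∈ N * (⊤ : Submodule ℂ C.Ω) := by
  have hG' : C.horSpan G ≤ N := by
    refine Submodule.span_le.2 ?_
    rintro _ ⟨α, hα, β, hβ, g, hg, rfl⟩
    exact hN.mul_hor _ hβ _ (hN.hor_mul _ hα _ (hG hg))
  have h1 : C.horSpan G ≤ (N * (⊤ : Submodule ℂ C.Ω)).comap C.d := by
    refine Submodule.span_le.2 ?_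
    rintro _ ⟨α, hα, β, hβ, g, hg, rfl⟩
    rw [SetLike.mem_coe, Submodule.mem_comap, d_mul_eq, d_mul_eq, parity_mul, add_mul]
    have h2 := IsHorIdeal.le_mul_top N (hG hg)
    have h3 := IsHorIdeal.le_mul_top N (hN.parity_mem _ (hG hg))
    exact add_mem (add_mem (IsHorIdeal.mul_mem_right (hN.mul_mem_left _ h2) _)
      (IsHorIdeal.mul_mem_right (hN.mul_mem_left _ (hd g hg)) _))
      (IsHorIdeal.mul_mem_right (hN.mul_mem_left _ h3) _)
  induction hx using Submodule.mul_induction_on' with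
  | add x _ y _ hx hy => rw [map_add]; exact add_mem hx hy
  | mem_mul_mem m hm y _ =>
    rw [d_mul_eq]
    exact add_mem (IsHorIdeal.mul_mem_right (h1 hm) _)
      (Submodule.mul_mem_mul (hN.parity_mem _ (hG' hm)) trivial)

/-- On generators: `dℓ` equals `n` up to the ideal generated by the `ℓ`'s, and `dn = d(n - dℓ)`
because `d² = 0`, where `n - dℓ` belongs to that ideal. -/
theorem d_mem_irregIdeal {x : C.Ω} (hx : x ∈ W.irregIdeal s * (⊤ : Submodule ℂ C.Ω)) :
    C.d x ∈ W.irregIdeal s * (⊤ : Submodule ℂ C.Ω) := by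
  have hN := W.isHorIdeal_irregIdeal s
  have hle : C.horSpan W.ellSet * ⊤ ≤ W.irregIdeal s * (⊤ : Submodule ℂ C.Ω) :=
    mul_le_mul_left (W.horSpan_ellSet_le s) _
  have hell : ∀ ϑ, ∀ x ∈ C.hor, C.d (W.ell ϑ x) ∈ W.irregIdeal s * (⊤ : Submodule ℂ C.Ω) := by
    intro ϑ x hx
    have h : C.d (W.ell ϑ x) = W.n s ϑ x - (W.n s ϑ x - C.d (W.ell ϑ x)) := by abel
    rw [h]
    exact sub_mem (IsHorIdeal.le_mul_top _ (W.n_mem_irregIdeal s ϑ hx))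
      (hle (W.n_sub_d_ell_mem s ϑ hx))
  refine W.d_mem_of_generators hN (W.irregSet_subset_irregIdeal s) ?_
    (by rwa [← W.irregIdeal_eq s])
  rintro _ ⟨ϑ, φ, hφ, rfl | rfl⟩
  · exact hell ϑ φ hφ
  · have h : C.d (W.n s ϑ φ) = C.d (W.n s ϑ φ - C.d (W.ell ϑ φ)) := by
      rw [map_sub, C.d_d, sub_zero]
    rw [h]
    refine W.d_mem_of_generators hN
      ((W.ellSet_subset_irregSet s).trans (W.irregSet_subset_irregIdeal s)) ?_
      (W.n_sub_d_ell_mem s ϑ hφ)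
    rintro _ ⟨ϑ, φ, hφ, rfl⟩
    exact hell ϑ φ hφ

theorem D_mem_irregIdeal {x : C.Ω} (hx : x ∈ W.irregIdeal s) : W.D s x ∈ W.irregIdeal s := by
  rw [D_apply]
  exact (W.isHorIdeal_irregIdeal s).horProj_mem s
    (W.d_mem_irregIdeal s (IsHorIdeal.le_mul_top _ hx))

end BundleCalculus.Connection

/-! ### Invariance of `𝓝_ω` under the star, and its homogeneity -/

section Antipode

variable {A : Type u} [Ring A] [StarRing A] [HopfAlgebra ℂ A] [StarModule ℂ A]
  [HopfStarAlgebra A]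

variable (A) in
/-- The map `a ↦ κ(a*)*`, which is the inverse of the antipode. -/
def antipodeInv : A →ₗ[ℂ] A :=
  (starLinearEquiv ℂ (A := A)).toLinearMap.comp
    ((HopfAlgebra.antipode ℂ).comp (starLinearEquiv ℂ (A := A)).toLinearMap)

/-- Conjugate the antipode identity for `a*`. -/
theorem antipodeInv_mul_comul (a : A) : LinearMap.mul' ℂ A
    (TensorProduct.map (antipodeInv A) LinearMap.id (TensorProduct.comm ℂ A A
      (Coalgebra.comul a))) = algebraMap ℂ A (Coalgebra.counit a) := by
  have h := HopfAlgebra.mul_antipode_lTensor_comul_apply (R := ℂ) (star a)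
  rw [HopfStarAlgebra.comul_star, HopfStarAlgebra.counit_star] at h
  have h1 := congrArg star h
  rw [← algebraMap_star_comm, star_star] at h1
  rw [← h1]
  induction Coalgebra.comul (R := ℂ) a with
  | zero => simp
  | add x y hx hy => simp only [map_add, star_add, hx, hy]
  | tmul x y => simp [antipodeInv]

/-- `(ϑ ∘ a)* = ϑ* ∘ κ(a)*`. -/
theorem LeftInv.st_circ (Γ : BicovariantStarCalculus A) (ϑ : LeftInv Γ) (a : A) :
    LeftInv.st Γ (LeftInv.circ Γ ϑ a) =
      LeftInv.circ Γ (LeftInv.st Γ ϑ) (star (HopfAlgebra.antipode ℂ a)) := by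
  induction ϑ using LeftInv.induction with
  | h b =>
    rw [circ_proj, map_sub, map_smulₛₗ, st_proj, st_proj, st_proj, map_neg, LinearMap.neg_apply,
      circ_proj, HopfAlgebra.antipode_mul_antidistrib, star_mul, HopfStarAlgebra.counit_star,
      HopfAlgebra.counit_antipode]
    simp only [starRingEnd_apply, smul_neg]
    abel

end Antipode

namespace BundleCalculus

variable {A : Type u} [Ring A] [StarRing A] [HopfAlgebra ℂ A] [StarModule ℂ A]
  [HopfStarAlgebra A]
variable {V : Type*} [Ring V] [StarRing V] [Algebra ℂ V] [StarModule ℂ V]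
variable {B : Type v} [Ring B] [StarRing B] [Algebra ℂ B] [StarModule ℂ B]
variable {P : QuantumPrincipalBundle A V B} {Γ : BicovariantStarCalculus A}

/-- `∑ F^∧(φₖ) (1 ⊗ κ⁻¹(cₖ)) = φ ⊗ 1`. -/
theorem antipodeInv_mul_act (C : BundleCalculus P Γ) (x : C.Ω) : LinearMap.mul' ℂ (C.Ω ⊗[ℂ] A)
    (TensorProduct.map (Algebra.TensorProduct.includeRight.toLinearMap ∘ₗ antipodeInv A)
      C.act (TensorProduct.comm ℂ C.Ω A (C.act x))) = x ⊗ₜ 1 := by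
  let M : A ⊗[ℂ] A →ₗ[ℂ] A := LinearMap.mul' ℂ A ∘ₗ
    TensorProduct.map (antipodeInv A) LinearMap.id ∘ₗ (TensorProduct.comm ℂ A A).toLinearMap
  have h1 : ∀ z : C.Ω ⊗[ℂ] A, LinearMap.mul' ℂ (C.Ω ⊗[ℂ] A)
      (TensorProduct.map (Algebra.TensorProduct.includeRight.toLinearMap ∘ₗ antipodeInv A)
        C.act (TensorProduct.comm ℂ C.Ω A z)) =
      M.lTensor C.Ω (TensorProduct.assoc ℂ C.Ω A A (C.act.rTensor A z)) := by
    intro z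
    induction z with
    | zero => simp
    | add x y hx hy => simp only [map_add, hx, hy]
    | tmul x a =>
      simp only [TensorProduct.comm_tmul, TensorProduct.map_tmul, LinearMap.mul'_apply,
        LinearMap.rTensor_tmul]
      induction C.act x with
      | zero => simp
      | add x y hx hy => simp only [map_add, mul_add, TensorProduct.add_tmul, hx, hy]
      | tmul y b => simp [M]
  have h2 : M ∘ₗ Coalgebra.comul = Algebra.linearMap ℂ A ∘ₗ Coalgebra.counit :=
    LinearMap.ext antipodeInv_mul_comul
  rw [h1, act_coassoc, ← LinearMap.comp_apply, ← LinearMap.lTensor_comp, h2]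
  conv_rhs => rw [← C.act_counit x]
  induction C.act x with
  | zero => simp
  | add x y hx hy => simp only [map_add, TensorProduct.add_tmul, hx, hy]
  | tmul y b =>
    simp [Algebra.algebraMap_eq_smul_one, TensorProduct.smul_tmul]

/-- `(∑ φₖ f(cₖ))* = (-1)^{∂φ} ∑ f(cₖ)* φₖ*` for one-forms `f(cₖ)`. -/
theorem st_mul_map (C : BundleCalculus P Γ) {k : ℕ} {f g : A →ₗ[ℂ] C.Ω} (hf : ∀ a, f a ∈ C.gr 1)
    (hg : ∀ a, g a = C.st (f (star a))) {z : C.Ω ⊗[ℂ] A}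
    (hz : z ∈ LinearMap.range ((C.gr k).subtype.rTensor A)) :
    C.st (LinearMap.mul' ℂ C.Ω (f.lTensor C.Ω z)) = (-1) ^ k * LinearMap.mul' ℂ C.Ω
      (g.rTensor C.Ω (TensorProduct.comm ℂ C.Ω A
        (TensorProduct.map C.st (starLinearEquiv ℂ (A := A)).toLinearMap z))) := by
  obtain ⟨t, rfl⟩ := hz
  induction t with
  | zero => simp
  | add x y hx hy => simp only [map_add, mul_add, hx, hy]
  | tmul x a =>
    have h := C.st_mul k 1 x (f a) x.2 (hf a)
    rw [mul_one] at h
    simp [h, hg]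

namespace Connection

variable {C : BundleCalculus P Γ} (W : C.Connection)

/-- The map `φ ⊗ c ↦ ℓ(ϑ ∘ κ⁻¹(c), φ)`. -/
def ellInv (ϑ : LeftInv Γ) : C.Ω ⊗[ℂ] A →ₗ[ℂ] C.Ω :=
  LinearMap.mul' ℂ C.Ω ∘ₗ (W.ω ∘ₗ LeftInv.circ Γ ϑ ∘ₗ antipodeInv A).rTensor C.Ω ∘ₗ
    (TensorProduct.comm ℂ C.Ω A).toLinearMap -
  LinearMap.mul' ℂ C.Ω ∘ₗ (W.ω ∘ₗ LeftInv.circ Γ ϑ).lTensor C.Ω ∘ₗ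
    LinearMap.mul' ℂ (C.Ω ⊗[ℂ] A) ∘ₗ
    TensorProduct.map (Algebra.TensorProduct.includeRight.toLinearMap ∘ₗ antipodeInv A) C.act ∘ₗ
    (TensorProduct.comm ℂ C.Ω A).toLinearMap ∘ₗ (parity C.gr).rTensor A

theorem ellInv_tmul (ϑ : LeftInv Γ) (x : C.Ω) (a : A) :
    W.ellInv ϑ (x ⊗ₜ a) = W.ell (LeftInv.circ Γ ϑ (antipodeInv A a)) x := by
  rw [ell, twist]
  simp only [ellInv, LinearMap.sub_apply, LinearMap.comp_apply, LinearMap.rTensor_tmul,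
    LinearEquiv.coe_coe, TensorProduct.comm_tmul, TensorProduct.map_tmul, LinearMap.mul'_apply]
  congr 1
  induction C.act (parity C.gr x) with
  | zero => simp
  | add x y hx hy => simp only [map_add, mul_add, hx, hy]
  | tmul y b => simp [LeftInv.circ_mul]

/-- In the twisted terms of `ℓ(ϑ ∘ κ⁻¹(cₖ), φₖ)` the inverse antipode cancels the coaction on `φₖ`,
and only `φ ω(ϑ)` remains of them, up to sign. -/
theorem ellInv_act {k : ℕ} (ϑ : LeftInv Γ) {x : C.Ω} (hx : x ∈ C.gr k) :
    W.ellInv ϑ (C.act x) = LinearMap.mul' ℂ C.Ω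
      ((W.ω ∘ₗ LeftInv.circ Γ ϑ ∘ₗ antipodeInv A).rTensor C.Ω
        (TensorProduct.comm ℂ C.Ω A (C.act x))) - (-1) ^ k * (x * W.ω ϑ) := by
  simp only [ellInv, LinearMap.sub_apply, LinearMap.comp_apply, LinearEquiv.coe_coe,
    ← act_parity, C.antipodeInv_mul_act, LinearMap.lTensor_tmul, LinearMap.mul'_apply,
    LeftInv.circ_one, parity_of_mem C.gr hx, mul_assoc]

/-- `ℓ(ϑ,φ)* = -∑ ℓ(ϑ* ∘ κ(cₖ)*, φₖ*)`. -/
theorem st_ell {k : ℕ} (ϑ : LeftInv Γ) {x : C.Ω} (hx : x ∈ C.gr k) :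
    C.st (W.ell ϑ x) = -W.ellInv (LeftInv.st Γ ϑ) (C.act (C.st x)) := by
  have h1 : C.st (W.ω ϑ * x) = (-1) ^ k * (C.st x * W.ω (LeftInv.st Γ ϑ)) := by
    rw [C.st_mul 1 k _ _ (W.mem_one ϑ) hx, one_mul, W.hermitian]
  have h2 := C.st_mul_map (g := W.ω ∘ₗ LeftInv.circ Γ (LeftInv.st Γ ϑ) ∘ₗ antipodeInv A)
    (f := W.ω ∘ₗ LeftInv.circ Γ ϑ) (fun a => W.mem_one _) (fun a => by
      simp only [LinearMap.comp_apply]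
      rw [← W.hermitian, LeftInv.st_circ]
      rfl) (C.act_mem hx)
  have h3 : parity C.gr x = (-1) ^ k * x := parity_of_mem C.gr hx
  have h4 : C.st ((-1) ^ k * C.twist x (W.ω ∘ₗ LeftInv.circ Γ ϑ)) =
      (-1) ^ k * C.st (C.twist x (W.ω ∘ₗ LeftInv.circ Γ ϑ)) := by
    rcases neg_one_pow_eq_or C.Ω k with h | h <;> simp [h]
  have h5 : C.twist ((-1) ^ k * x) (W.ω ∘ₗ LeftInv.circ Γ ϑ) =
      (-1) ^ k * C.twist x (W.ω ∘ₗ LeftInv.circ Γ ϑ) := by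
    rcases neg_one_pow_eq_or C.Ω k with h | h <;> simp [h, twist]
  rw [W.ellInv_act _ (C.st_mem k x hx), act_st, ell, map_sub, h1, h3, h5, h4, twist, h2,
    neg_sub]
  congr 1
  rcases neg_one_pow_eq_or C.Ω k with h | h <;> simp [h]

theorem ellInv_mem {N : Submodule ℂ C.Ω} (hN : W.ellSet ⊆ N) (ϑ : LeftInv Γ) {z : C.Ω ⊗[ℂ] A}
    (hz : z ∈ LinearMap.range (C.hor.subtype.rTensor A)) : W.ellInv ϑ z ∈ N := by
  obtain ⟨t, rfl⟩ := hz
  induction t with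
  | zero => simp
  | add x y hx hy => rw [map_add, map_add]; exact add_mem hx hy
  | tmul x a =>
    rw [LinearMap.rTensor_tmul, ellInv_tmul]
    exact hN (W.ell_mem_ellSet _ x.2)

theorem st_ell_mem {N : Submodule ℂ C.Ω} (hN : W.ellSet ⊆ N) (ϑ : LeftInv Γ) {k : ℕ} {x : C.Ω}
    (hx : x ∈ C.hor) (hk : x ∈ C.gr k) : C.st (W.ell ϑ x) ∈ N := by
  rw [W.st_ell ϑ hk]
  exact neg_mem (W.ellInv_mem hN _ (C.act_mem_hor (C.st_mem_hor hx)))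

/-- The ideals of `Ω(P)` generated by horizontal forms are spanned by homogeneous products. -/
theorem horSpan_mul_top_le {ι : Type*} (g : ι → C.Ω →ₗ[ℂ] C.Ω) (T : Submodule ℂ C.Ω)
    (h : ∀ m, ∀ i, ∀ x ∈ C.gr i, ∀ k, ∀ φ ∈ C.hor, φ ∈ C.gr k → ∀ j, ∀ y ∈ C.gr j,
      x * g m φ * y ∈ T) :
    C.horSpan {y | ∃ m, ∃ φ ∈ C.hor, y = g m φ} * ⊤ ≤ T := by
  have h1 : ∀ m, ∀ x, ∀ φ ∈ C.hor, ∀ y, x * g m φ * y ∈ T := by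
    intro m x φ hφ y
    refine C.hor_induction (p := fun φ => x * g m φ * y ∈ T) (by simp) ?_ ?_ hφ
    · intro φ φ' hφ hφ'
      rw [map_add, mul_add, add_mul]
      exact add_mem hφ hφ'
    · intro k φ hφ hk
      induction x using DirectSum.Decomposition.inductionOn C.gr with
      | zero => simp
      | add x x' hx hx' => rw [add_mul, add_mul]; exact add_mem hx hx'
      | @homogeneous i x =>
        induction y using DirectSum.Decomposition.inductionOn C.gr with
        | zero => simp
        | add y y' hy hy' => rw [mul_add]; exact add_mem hy hy'
        | @homogeneous j y => exact h m i x x.2 k φ hφ hk j y y.2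
  rw [horSpan, ← Submodule.span_univ, Submodule.span_mul_span, Submodule.span_le]
  rintro _ ⟨_, ⟨α, hα, β, hβ, _, ⟨m, φ, hφ, rfl⟩, rfl⟩, y, -, rfl⟩
  change α * g m φ * β * y ∈ T
  rw [mul_assoc (α * g m φ)]
  exact h1 m α φ hφ (β * y)

/-- The star reverses products only up to signs depending on degrees, so the argument is made on
homogeneous products, where the signs are harmless factors. -/
theorem st_mem_mul_top {N : Submodule ℂ C.Ω} (hN : W.IsHorIdeal N) {ι : Type*}
    (g : ι → C.Ω →ₗ[ℂ] C.Ω)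
    (hg : ∀ m k, ∀ φ ∈ C.hor, φ ∈ C.gr k → g m φ ∈ C.gr (k + 1) ∨ g m φ ∈ C.gr (k + 2))
    (h : ∀ m k, ∀ φ ∈ C.hor, φ ∈ C.gr k → C.st (g m φ) ∈ N * (⊤ : Submodule ℂ C.Ω)) {x : C.Ω}
    (hx : x ∈ C.horSpan {y | ∃ m, ∃ φ ∈ C.hor, y = g m φ} * ⊤) :
    C.st x ∈ N * (⊤ : Submodule ℂ C.Ω) := by
  refine horSpan_mul_top_le g ((N * (⊤ : Submodule ℂ C.Ω)).comap C.st) ?_ hx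
  intro m i x hx k φ hφ hk j y hy
  obtain ⟨l, hl⟩ : ∃ l, g m φ ∈ C.gr l := (hg m k φ hφ hk).elim (⟨_, ·⟩) (⟨_, ·⟩)
  rw [Submodule.mem_comap, C.st_mul _ _ _ _ (SetLike.mul_mem_graded hx hl) hy,
    C.st_mul _ _ _ _ hx hl]
  refine hN.mul_mem_left _ (hN.mul_mem_left _ (hN.mul_mem_left _ ?_))
  exact IsHorIdeal.mul_mem_right (h m k φ hφ hk) _

variable (s : EnvSection Γ)

/-- The map `φ ↦ n(ϑ,φ)`. -/
def nMap (ϑ : LeftInv Γ) : C.Ω →ₗ[ℂ] C.Ω :=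
  LinearMap.mulLeft ℂ (W.curvature s ϑ) -
    C.pr LinearMap.id (toConv (W.curvature s ∘ₗ LeftInv.circ Γ ϑ)) +
    C.pr LinearMap.id (toConv (W.u s ϑ))

theorem irregSet_eq : W.irregSet s = {y | ∃ m : LeftInv Γ ⊕ LeftInv Γ, ∃ φ ∈ C.hor,
    y = Sum.elim W.ellMap (W.nMap s) m φ} := by
  ext y
  constructor
  · rintro ⟨ϑ, φ, hφ, rfl | rfl⟩
    · exact ⟨Sum.inl ϑ, φ, hφ, rfl⟩
    · exact ⟨Sum.inr ϑ, φ, hφ, rfl⟩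
  · rintro ⟨ϑ | ϑ, φ, hφ, rfl⟩
    · exact ⟨ϑ, φ, hφ, Or.inl rfl⟩
    · exact ⟨ϑ, φ, hφ, Or.inr rfl⟩

theorem irreg_mem_gr (m : LeftInv Γ ⊕ LeftInv Γ) {k : ℕ} {x : C.Ω} (hx : x ∈ C.gr k) :
    Sum.elim W.ellMap (W.nMap s) m x ∈ C.gr (k + 1) ∨
      Sum.elim W.ellMap (W.nMap s) m x ∈ C.gr (k + 2) := by
  rcases m with ϑ | ϑ
  · exact Or.inl (W.ell_mem ϑ hx)
  · exact Or.inr (W.n_mem s ϑ hx)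

theorem irregIdeal_mul_top_le (T : Submodule ℂ C.Ω)
    (h : ∀ m, ∀ i, ∀ x ∈ C.gr i, ∀ k, ∀ φ ∈ C.hor, φ ∈ C.gr k → ∀ j, ∀ y ∈ C.gr j,
      x * Sum.elim W.ellMap (W.nMap s) m φ * y ∈ T) :
    W.irregIdeal s * ⊤ ≤ T := by
  rw [irregIdeal_eq, irregSet_eq]
  exact horSpan_mul_top_le _ T h

/-- A formula for `n*` is avoided by writing `n = (n - dℓ) + dℓ`. The first term lies in the ideal
generated by the `ℓ`'s, and the second is treated with `(dℓ)* = d(ℓ*)`. -/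
theorem st_mem_irregIdeal_mul_top {x : C.Ω} (hx : x ∈ W.irregIdeal s * (⊤ : Submodule ℂ C.Ω)) :
    C.st x ∈ W.irregIdeal s * (⊤ : Submodule ℂ C.Ω) := by
  have hN := W.isHorIdeal_irregIdeal s
  have hE : W.ellSet ⊆ W.irregIdeal s :=
    (W.ellSet_subset_irregSet s).trans (W.irregSet_subset_irregIdeal s)
  have hell : ∀ ϑ k, ∀ φ ∈ C.hor, φ ∈ C.gr k →
      C.st (W.ell ϑ φ) ∈ W.irregIdeal s * (⊤ : Submodule ℂ C.Ω) :=
    fun ϑ k φ hφ hk => IsHorIdeal.le_mul_top _ (W.st_ell_mem hE ϑ hφ hk)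
  refine W.st_mem_mul_top hN (Sum.elim W.ellMap (W.nMap s))
    (fun m k φ hφ hk => W.irreg_mem_gr s m hk) ?_ (by rwa [← irregSet_eq, ← irregIdeal_eq])
  rintro (ϑ | ϑ) k φ hφ hk
  · exact hell ϑ k φ hφ hk
  · have h : W.n s ϑ φ = (W.n s ϑ φ - C.d (W.ell ϑ φ)) + C.d (W.ell ϑ φ) := by abel
    change C.st (W.n s ϑ φ) ∈ _
    rw [h, map_add, C.st_d]
    exact add_mem (W.st_mem_mul_top hN W.ellMap (fun ϑ k φ hφ hk => Or.inl (W.ell_mem ϑ hk))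
      hell (W.n_sub_d_ell_mem s ϑ hφ)) (W.d_mem_irregIdeal s (hell ϑ k φ hφ hk))

theorem gradedProj_mem_irregIdeal_mul_top (n : ℕ) {x : C.Ω}
    (hx : x ∈ W.irregIdeal s * (⊤ : Submodule ℂ C.Ω)) :
    GradedAlgebra.proj C.gr n x ∈ W.irregIdeal s * (⊤ : Submodule ℂ C.Ω) := by
  have hN := W.isHorIdeal_irregIdeal s
  refine W.irregIdeal_mul_top_le s
    ((W.irregIdeal s * (⊤ : Submodule ℂ C.Ω)).comap (GradedAlgebra.proj C.gr n)) ?_ hx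
  intro m i x hx k φ hφ hk j y hy
  rw [Submodule.mem_comap]
  have h : x * Sum.elim W.ellMap (W.nMap s) m φ * y ∈
      W.irregIdeal s * (⊤ : Submodule ℂ C.Ω) := by
    refine IsHorIdeal.mul_mem_right (hN.mul_mem_left _ (IsHorIdeal.le_mul_top _
      (W.irregSet_subset_irregIdeal s ?_))) _
    rw [irregSet_eq]
    exact ⟨m, φ, hφ, rfl⟩
  obtain ⟨l, hl⟩ : ∃ l, x * Sum.elim W.ellMap (W.nMap s) m φ * y ∈ C.gr l := by
    rcases W.irreg_mem_gr s m hk with h | h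
    · exact ⟨_, SetLike.mul_mem_graded (SetLike.mul_mem_graded hx h) hy⟩
    · exact ⟨_, SetLike.mul_mem_graded (SetLike.mul_mem_graded hx h) hy⟩
  by_cases hln : l = n
  · subst hln
    rwa [gradedProj_of_mem C.gr hl]
  · rw [gradedProj_of_mem_ne C.gr hln hl]
    exact zero_mem _

/-- All generators have degree at least one, so passing to the quotient identifies no two elements
of `𝓑`. -/
theorem eq_zero_of_mem_gr_zero {x : C.Ω} (hx : x ∈ W.irregIdeal s * (⊤ : Submodule ℂ C.Ω))
    (h0 : x ∈ C.gr 0) : x = 0 := by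
  rw [← gradedProj_of_mem C.gr h0]
  refine W.irregIdeal_mul_top_le s (LinearMap.ker (GradedAlgebra.proj C.gr 0)) ?_ hx
  intro m i x hx k φ hφ hk j y hy
  rw [LinearMap.mem_ker]
  rcases W.irreg_mem_gr s m hk with h | h
  · exact gradedProj_of_mem_ne C.gr (by omega)
      (SetLike.mul_mem_graded (SetLike.mul_mem_graded hx h) hy)
  · exact gradedProj_of_mem_ne C.gr (by omega)
      (SetLike.mul_mem_graded (SetLike.mul_mem_graded hx h) hy)

theorem image_st_irregIdeal : C.st '' (W.irregIdeal s : Set C.Ω) = W.irregIdeal s := by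
  have hN := W.isHorIdeal_irregIdeal s
  have h : ∀ x ∈ W.irregIdeal s, C.st x ∈ W.irregIdeal s := fun x hx =>
    hN.mem_of_mem_mul_top s (W.st_mem_irregIdeal_mul_top s (IsHorIdeal.le_mul_top _ hx))
      (C.st_mem_hor (hN.le_hor hx))
  refine Set.Subset.antisymm ?_ fun x hx => ⟨C.st x, h x hx, C.st_st x⟩
  rintro _ ⟨x, hx, rfl⟩
  exact h x hx

end Connection

end BundleCalculus

/-! ### The quotient calculus -/

section Descent

variable {X : Type*} {Q : Type*} [Ring X] [Algebra ℂ X] [Ring Q] [Algebra ℂ Q] {q : X →ₐ[ℂ] Q}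
variable {M : Type*} [AddCommGroup M] [Module ℂ M] {σ : ℂ →+* ℂ}

/-- The map induced on a quotient algebra. -/
def descend (hq : Function.Surjective q) (f : X →ₛₗ[σ] M) (h : ∀ x, q x = 0 → f x = 0) :
    Q →ₛₗ[σ] M :=
  ((LinearMap.ker q.toLinearMap).liftQ f h).comp
    (q.toLinearMap.quotKerEquivOfSurjective hq).symm.toLinearMap

theorem descend_apply (hq : Function.Surjective q) (f : X →ₛₗ[σ] M)
    (h : ∀ x, q x = 0 → f x = 0) (x : X) : descend hq f h (q x) = f x := by
  have h1 : (q.toLinearMap.quotKerEquivOfSurjective hq).symm (q x) =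
      Submodule.Quotient.mk x := by
    rw [LinearEquiv.symm_apply_eq]
    rfl
  change (LinearMap.ker q.toLinearMap).liftQ f h
    ((q.toLinearMap.quotKerEquivOfSurjective hq).symm (q x)) = f x
  rw [h1]
  rfl

end Descent

namespace BundleCalculus

variable {A : Type u} [Ring A] [StarRing A] [HopfAlgebra ℂ A] [StarModule ℂ A]
  [HopfStarAlgebra A]
variable {V : Type*} [Ring V] [StarRing V] [Algebra ℂ V] [StarModule ℂ V]
variable {B : Type v} [Ring B] [StarRing B] [Algebra ℂ B] [StarModule ℂ B]
variable {P : QuantumPrincipalBundle A V B} {Γ : BicovariantStarCalculus A}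
variable {C : BundleCalculus.{u, v, w} P Γ} {Q : Type w} [Ring Q] [Algebra ℂ Q]

/-- The quotient maps of `Ω(P)` to which all the structure of a calculus descends. -/
structure IsQuotient (C : BundleCalculus.{u, v, w} P Γ) (q : C.Ω →ₐ[ℂ] Q) : Prop where
  surjective : Function.Surjective q
  proj : ∀ n x, q x = 0 → q (GradedAlgebra.proj C.gr n x) = 0
  d : ∀ x, q x = 0 → q (C.d x) = 0
  st : ∀ x, q x = 0 → q (C.st x) = 0
  Fhat : ∀ x, q x = 0 → q.toLinearMap.rTensor (Env Γ) (C.Fhat x) = 0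
  eq_zero : ∀ x ∈ C.gr 0, q x = 0 → x = 0

namespace IsQuotient

variable {q : C.Ω →ₐ[ℂ] Q} (hq : C.IsQuotient q)

/-- The grading of the quotient. -/
def gr (_ : C.IsQuotient q) (n : ℕ) : Submodule ℂ Q := (C.gr n).map q.toLinearMap

theorem map_mem_gr {n : ℕ} {x : C.Ω} (hx : x ∈ C.gr n) : q x ∈ hq.gr n := ⟨x, hx, rfl⟩

/-- The restriction of the quotient map to a homogeneous component. -/
def grMap (n : ℕ) : C.gr n →ₗ[ℂ] hq.gr n :=
  q.toLinearMap.restrict fun _ hx => hq.map_mem_gr hx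

/-- The decomposition into homogeneous components, mapped to the quotient. -/
def decomposeMap : C.Ω →ₗ[ℂ] DirectSum ℕ fun n => hq.gr n :=
  DirectSum.lmap hq.grMap ∘ₗ (DirectSum.decomposeLinearEquiv C.gr).toLinearMap

theorem decomposeMap_eq_zero (x : C.Ω) (hx : q x = 0) : hq.decomposeMap x = 0 :=
  DFinsupp.ext fun n => Subtype.ext (hq.proj n x hx)

/-- The decomposition into homogeneous components. -/
def decompose : Q →ₗ[ℂ] DirectSum ℕ fun n => hq.gr n :=
  descend (M := DirectSum ℕ fun n => hq.gr n) hq.surjective hq.decomposeMap hq.decomposeMap_eq_zero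

theorem decompose_apply {n : ℕ} {x : C.Ω} (hx : x ∈ C.gr n) :
    hq.decompose (q x) = DirectSum.lof ℂ ℕ (fun n => hq.gr n) n ⟨q x, hq.map_mem_gr hx⟩ := by
  rw [decompose, descend_apply]
  change DirectSum.lmap hq.grMap (DirectSum.decompose C.gr x) = _
  rw [DirectSum.decompose_of_mem C.gr hx]
  exact DirectSum.lmap_lof _ _ _

instance gradedMonoid : SetLike.GradedMonoid hq.gr where
  one_mem := ⟨1, SetLike.GradedOne.one_mem, map_one q⟩
  mul_mem := by
    rintro i j _ _ ⟨x, hx, rfl⟩ ⟨y, hy, rfl⟩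
    exact ⟨x * y, SetLike.mul_mem_graded hx hy, map_mul q x y⟩

instance decomposition : DirectSum.Decomposition hq.gr :=
  DirectSum.Decomposition.ofLinearMap hq.gr hq.decompose
    (by
      ext y
      obtain ⟨x, rfl⟩ := hq.surjective y
      induction x using DirectSum.Decomposition.inductionOn C.gr with
      | zero => simp
      | add x y hx hy => rw [map_add, map_add, map_add, hx, hy]
      | homogeneous x =>
        rw [LinearMap.comp_apply, hq.decompose_apply x.2]
        simp [DirectSum.lof_eq_of])
    (by
      ext n ⟨_, x, hx, rfl⟩ : 2
      simp only [LinearMap.comp_apply, DirectSum.lof_eq_of, DirectSum.coeLinearMap_of,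
        LinearMap.id_apply]
      exact hq.decompose_apply hx)

instance gradedAlgebra : GradedAlgebra hq.gr where

theorem parity_apply (x : C.Ω) : parity hq.gr (q x) = q (parity C.gr x) :=
  linearMap_ext_of_grade (𝒲 := C.gr) (f := parity hq.gr ∘ₗ q.toLinearMap)
    (g := q.toLinearMap ∘ₗ parity C.gr) (fun n x hx => by
      simp only [LinearMap.comp_apply, AlgHom.toLinearMap_apply]
      rw [parity, parity, degreeScale_of_mem C.gr _ hx,
        degreeScale_of_mem hq.gr _ (hq.map_mem_gr hx), map_smul]) x

/-- The homomorphism of graded tensor products induced by the quotient map. -/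
def mapGT : C.GT →ₐ[ℂ] GradedTensorProduct ℂ hq.gr (Env.grade Γ) :=
  GradedTensorProduct.lift C.gr (Env.grade Γ)
    ((GradedTensorProduct.includeLeft hq.gr (Env.grade Γ)).comp q)
    (GradedTensorProduct.includeRight hq.gr (Env.grade Γ)) (by
      intro i j x v
      have h := GradedTensorProduct.tmul_coe_mul_coe_tmul (R := ℂ) hq.gr (Env.grade Γ) (1 : Q) v
        ⟨q x, hq.map_mem_gr x.2⟩ (1 : Env Γ)
      have h' := GradedTensorProduct.tmul_one_mul_one_tmul (R := ℂ) hq.gr (Env.grade Γ) (q x) v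
      simp only [one_mul, mul_one] at h
      refine h'.trans ?_
      change _ = (-1 : ℤˣ) ^ (j * i) • (GradedTensorProduct.tmul ℂ (1 : Q) (v : Env Γ) *
        GradedTensorProduct.tmul ℂ (q x) (1 : Env Γ))
      rw [h, smul_smul, Int.units_mul_self, one_smul])

theorem mapGT_toGT (z : C.Ω ⊗[ℂ] Env Γ) : hq.mapGT (C.toGT z) =
    GradedTensorProduct.of ℂ hq.gr (Env.grade Γ) (q.toLinearMap.rTensor (Env Γ) z) := by
  induction z with
  | zero => simp
  | add x y hx hy => simp only [map_add, hx, hy]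
  | tmul x v =>
    refine (GradedTensorProduct.lift_tmul C.gr (Env.grade Γ) _ _ _ x v).trans ?_
    exact GradedTensorProduct.tmul_one_mul_one_tmul hq.gr (Env.grade Γ) (q x) v

/-- The differential of the quotient. -/
def dQuot : Q →ₗ[ℂ] Q := descend hq.surjective (q.toLinearMap ∘ₗ C.d) hq.d

@[simp] theorem dQuot_apply (x : C.Ω) : hq.dQuot (q x) = q (C.d x) := descend_apply _ _ _ x

/-- The `*`-structure of the quotient. -/
def stQuot : Q →ₗ⋆[ℂ] Q := descend hq.surjective (q.toLinearMap.comp C.st) hq.st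

@[simp] theorem stQuot_apply (x : C.Ω) : hq.stQuot (q x) = q (C.st x) := descend_apply _ _ _ x

/-- The map `F̂` of the quotient. -/
def FhatQuot : Q →ₗ[ℂ] Q ⊗[ℂ] Env Γ :=
  descend hq.surjective (q.toLinearMap.rTensor (Env Γ) ∘ₗ C.Fhat) hq.Fhat

@[simp] theorem FhatQuot_apply (x : C.Ω) :
    hq.FhatQuot (q x) = q.toLinearMap.rTensor (Env Γ) (C.Fhat x) := descend_apply _ _ _ x

theorem map_map (z : C.Ω ⊗[ℂ] Env Γ) {σ : ℂ →+* ℂ} {f : C.Ω →ₛₗ[σ] C.Ω} {g : Q →ₛₗ[σ] Q}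
    {h : Env Γ →ₛₗ[σ] Env Γ} (hfg : ∀ x, g (q x) = q (f x)) :
    TensorProduct.map g h (q.toLinearMap.rTensor (Env Γ) z) =
      q.toLinearMap.rTensor (Env Γ) (TensorProduct.map f h z) := by
  induction z with
  | zero => simp
  | add x y hx hy => simp only [map_add, hx, hy]
  | tmul x v => simp [hfg]

/-- The quotient calculus. -/
def calculus : BundleCalculus.{u, v, w} P Γ where
  Ω := Q
  gr := hq.gr
  d := hq.dQuot
  st := hq.stQuot
  d_mem := by
    rintro n _ ⟨x, hx, rfl⟩
    exact ⟨C.d x, C.d_mem n x hx, (hq.dQuot_apply x).symm⟩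
  d_d y := by
    obtain ⟨x, rfl⟩ := hq.surjective y
    simp [C.d_d]
  d_mul := by
    rintro n _ y ⟨x, hx, rfl⟩
    obtain ⟨y, rfl⟩ := hq.surjective y
    simp only [AlgHom.toLinearMap_apply]
    rw [← map_mul q, dQuot_apply, dQuot_apply, dQuot_apply, C.d_mul n x y hx]
    simp
  st_mem := by
    rintro n _ ⟨x, hx, rfl⟩
    exact ⟨C.st x, C.st_mem n x hx, (hq.stQuot_apply x).symm⟩
  st_st y := by
    obtain ⟨x, rfl⟩ := hq.surjective y
    simp [C.st_st]
  st_mul := by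
    rintro m n _ _ ⟨x, hx, rfl⟩ ⟨y, hy, rfl⟩
    simp only [AlgHom.toLinearMap_apply]
    rw [← map_mul q, stQuot_apply, stQuot_apply, stQuot_apply, C.st_mul m n x y hx hy]
    simp
  st_d y := by
    obtain ⟨x, rfl⟩ := hq.surjective y
    simp [C.st_d]
  incl := q.comp C.incl
  incl_injective := by
    intro a b h
    rw [← sub_eq_zero, ← map_sub] at h
    have h1 := hq.eq_zero _ (C.incl_mem (a - b)) h
    rw [map_sub, sub_eq_zero] at h1
    exact C.incl_injective h1
  range_incl := by
    rw [gr, ← C.range_incl, ← LinearMap.range_comp]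
    rfl
  incl_star b := by simp [C.incl_star]
  generated := by
    have h := congrArg (Subalgebra.map q) C.generated
    rw [AlgHom.map_adjoin, Set.image_union, ← Set.range_comp, ← Set.range_comp,
      Algebra.map_top, (AlgHom.range_eq_top q).2 hq.surjective] at h
    rw [← h]
    congr 3
    ext b
    simp
  Fhat := hq.FhatQuot
  Fhat_one := by
    rw [← map_one q, FhatQuot_apply, C.Fhat_one]
    simp
  Fhat_mul y y' := by
    obtain ⟨x, rfl⟩ := hq.surjective y
    obtain ⟨x', rfl⟩ := hq.surjective y'
    rw [← map_mul q, FhatQuot_apply, FhatQuot_apply, FhatQuot_apply, ← mapGT_toGT, ← mapGT_toGT,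
      ← mapGT_toGT, ← map_mul]
    exact congrArg hq.mapGT (C.Fhat_mul x x')
  Fhat_mem := by
    rintro n _ ⟨x, hx, rfl⟩
    have h := Submodule.mem_map_of_mem (f := q.toLinearMap.rTensor (Env Γ)) (C.Fhat_mem n x hx)
    simp only [AlgHom.toLinearMap_apply, FhatQuot_apply]
    refine Submodule.map_le_iff_le_comap.2 (iSup_le fun i => iSup_le fun j => iSup_le fun hij =>
      Submodule.map_le_iff_le_comap.1 ?_) h
    refine le_trans ?_ (le_iSup_of_le i (le_iSup_of_le j (le_iSup_of_le hij le_rfl)))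
    rintro _ ⟨_, ⟨t, rfl⟩, rfl⟩
    induction t with
    | zero => simp
    | add x y hx hy => simp only [map_add]; exact add_mem hx hy
    | tmul x v => exact ⟨⟨q x, hq.map_mem_gr x.2⟩ ⊗ₜ v, by simp⟩
  Fhat_d y := by
    obtain ⟨x, rfl⟩ := hq.surjective y
    rw [dQuot_apply, FhatQuot_apply, FhatQuot_apply, C.Fhat_d, map_add,
      map_map _ (f := C.d) hq.dQuot_apply, map_map _ (f := parity C.gr) hq.parity_apply]
  Fhat_st y := by
    obtain ⟨x, rfl⟩ := hq.surjective y
    rw [stQuot_apply, FhatQuot_apply, FhatQuot_apply, C.Fhat_st,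
      map_map _ (f := C.st) hq.stQuot_apply]
  Fhat_incl b := by
    rw [AlgHom.comp_apply, FhatQuot_apply, C.Fhat_incl, ← LinearMap.comp_apply,
      LinearMap.rTensor_comp_map]
    rfl

/-- The quotient map, as a homomorphism of calculi. -/
def hom : C.Hom hq.calculus where
  toAlgHom := q
  map_mem _ _ hx := hq.map_mem_gr hx
  map_d x := (hq.dQuot_apply x).symm
  map_st x := (hq.stQuot_apply x).symm
  map_incl _ := rfl
  map_Fhat := hq.FhatQuot_apply

/-- The projection of a connection. -/
def connection (W : C.Connection) : hq.calculus.Connection where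
  ω := q.toLinearMap ∘ₗ W.ω
  mem_one ϑ := hq.map_mem_gr (W.mem_one ϑ)
  hermitian ϑ := by
    change q (W.ω (LeftInv.st Γ ϑ)) = hq.stQuot (q (W.ω ϑ))
    rw [W.hermitian, stQuot_apply]
  Fhat_ω ϑ := by
    change hq.FhatQuot (q (W.ω ϑ)) = _
    rw [FhatQuot_apply, W.Fhat_ω, map_add, ← LinearMap.comp_apply, LinearMap.rTensor_comp_map]
    simp only [LinearMap.rTensor_tmul, AlgHom.toLinearMap_apply, map_one]
    rfl

end IsQuotient

end BundleCalculus

/-! ### Homomorphisms of calculi, horizontal forms and regularity in the quotient -/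

namespace BundleCalculus

variable {A : Type u} [Ring A] [StarRing A] [HopfAlgebra ℂ A] [StarModule ℂ A]
  [HopfStarAlgebra A]
variable {V : Type*} [Ring V] [StarRing V] [Algebra ℂ V] [StarModule ℂ V]
variable {B : Type v} [Ring B] [StarRing B] [Algebra ℂ B] [StarModule ℂ B]
variable {P : QuantumPrincipalBundle A V B} {Γ : BicovariantStarCalculus A}

namespace Hom

variable {C C' : BundleCalculus.{u, v, w} P Γ} (q : C.Hom C')

theorem parity_apply (x : C.Ω) : parity C'.gr (q.toAlgHom x) = q.toAlgHom (parity C.gr x) :=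
  linearMap_ext_of_grade (𝒲 := C.gr) (f := parity C'.gr ∘ₗ q.toAlgHom.toLinearMap)
    (g := q.toAlgHom.toLinearMap ∘ₗ parity C.gr) (fun n x hx => by
      simp only [LinearMap.comp_apply, AlgHom.toLinearMap_apply]
      rw [parity, parity, degreeScale_of_mem C.gr _ hx,
        degreeScale_of_mem C'.gr _ (q.map_mem n x hx), map_smul]) x

theorem act_apply (x : C.Ω) :
    C'.act (q.toAlgHom x) = q.toAlgHom.toLinearMap.rTensor A (C.act x) := by
  rw [act, act, LinearMap.comp_apply, q.map_Fhat, LinearMap.comp_apply]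
  induction C.Fhat x with
  | zero => simp
  | add x y hx hy => simp only [map_add, hx, hy]
  | tmul x v => simp

theorem twist_apply (f : A →ₗ[ℂ] C.Ω) (x : C.Ω) :
    C'.twist (q.toAlgHom x) (q.toAlgHom.toLinearMap ∘ₗ f) = q.toAlgHom (C.twist x f) := by
  rw [twist, twist, act_apply]
  induction C.act x with
  | zero => simp
  | add x y hx hy => simp only [map_add, hx, hy]
  | tmul x a => simp

theorem map_mem_hor {x : C.Ω} (hx : x ∈ C.hor) : q.toAlgHom x ∈ C'.hor := by
  obtain ⟨t, ht⟩ := hx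
  refine ⟨q.toAlgHom.toLinearMap.rTensor A t, ?_⟩
  rw [q.map_Fhat, ← ht]
  clear ht
  induction t with
  | zero => simp
  | add x y hx hy => simp only [map_add, hx, hy]
  | tmul x a => simp

section Connection

variable {W : C.Connection} {W' : C'.Connection}

theorem tensor_apply (h : ∀ ϑ, W'.ω ϑ = q.toAlgHom (W.ω ϑ)) (t : InvTensor Γ) :
    W'.tensor t = q.toAlgHom (W.tensor t) := by
  have h1 : W'.tensor = q.toAlgHom.comp W.tensor := by
    refine TensorAlgebra.hom_ext (LinearMap.ext fun ϑ => ?_)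
    change W'.tensor (TensorAlgebra.ι ℂ ϑ) = q.toAlgHom (W.tensor (TensorAlgebra.ι ℂ ϑ))
    rw [Connection.tensor_ι, Connection.tensor_ι, h]
  rw [h1]
  rfl

theorem ell_apply (h : ∀ ϑ, W'.ω ϑ = q.toAlgHom (W.ω ϑ)) (ϑ : LeftInv Γ) (x : C.Ω) :
    W'.ell ϑ (q.toAlgHom x) = q.toAlgHom (W.ell ϑ x) := by
  have h1 : W'.ω ∘ₗ LeftInv.circ Γ ϑ =
      q.toAlgHom.toLinearMap ∘ₗ W.ω ∘ₗ LeftInv.circ Γ ϑ := LinearMap.ext fun a => h _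
  rw [Connection.ell, Connection.ell, h1, parity_apply, twist_apply, h, map_sub, map_mul]

/-- Both decompositions use the same section `ι`, and `q` maps `φ ω^⊗(ιϑ)` to `q(φ) τ^⊗(ιϑ)`.
Compatibility of the covariant derivatives follows, as `q` commutes with `d`. -/
theorem horProj_apply (s : EnvSection Γ) (h : ∀ ϑ, W'.ω ϑ = q.toAlgHom (W.ω ϑ)) (x : C.Ω) :
    (W'.horProj s (q.toAlgHom x) : C'.Ω) = q.toAlgHom (W.horProj s x) := by
  obtain ⟨z, rfl⟩ := W.decomp_surjective s x
  induction z with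
  | zero => simp
  | add x y hx hy => simp only [map_add, Submodule.coe_add, hx, hy]
  | tmul x v =>
    rw [W.decomp_tmul, W.horProj_mul_tensor_sec s x.2, map_smul, map_mul, ← q.tensor_apply h,
      W'.horProj_mul_tensor_sec s (q.map_mem_hor x.2)]

theorem D_apply (s : EnvSection Γ) (h : ∀ ϑ, W'.ω ϑ = q.toAlgHom (W.ω ϑ)) (x : C.Ω) :
    W'.D s (q.toAlgHom x) = q.toAlgHom (W.D s x) := by
  rw [Connection.D_apply, Connection.D_apply, ← q.horProj_apply s h, q.map_d]

/-- A horizontal form `q(x)` of the quotient is fixed by its horizontal projection, which is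
`q(h_ω(x))`, the image of a horizontal form. -/
theorem map_hor (s : EnvSection Γ) (h : ∀ ϑ, W'.ω ϑ = q.toAlgHom (W.ω ϑ))
    (hq : Function.Surjective q.toAlgHom) :
    C.hor.map q.toAlgHom.toLinearMap = C'.hor := by
  refine le_antisymm ?_ fun y hy => ?_
  · rintro _ ⟨x, hx, rfl⟩
    exact q.map_mem_hor hx
  · obtain ⟨x, rfl⟩ := hq y
    refine ⟨W.horProj s x, (W.horProj s x).2, ?_⟩
    rw [AlgHom.toLinearMap_apply, ← q.horProj_apply s h]
    exact W'.horProj_of_mem s hy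

theorem isRegular (s : EnvSection Γ) (h : ∀ ϑ, W'.ω ϑ = q.toAlgHom (W.ω ϑ))
    (hq : Function.Surjective q.toAlgHom)
    (hell : ∀ ϑ, ∀ x ∈ C.hor, q.toAlgHom (W.ell ϑ x) = 0) : W'.IsRegular := by
  intro ϑ y hy
  rw [← q.map_hor s h hq] at hy
  obtain ⟨x, hx, rfl⟩ := hy
  have h1 := q.ell_apply h ϑ x
  rw [hell ϑ x hx, Connection.ell, sub_eq_zero] at h1
  exact h1

end Connection

end Hom

theorem inl_mul_toGT (C : BundleCalculus P Γ) (x : C.Ω) (z : C.Ω ⊗[ℂ] Env Γ) :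
    C.inl x * C.toGT z = C.toGT ((LinearMap.mulLeft ℂ x).rTensor (Env Γ) z) := by
  induction z with
  | zero => simp
  | add y z hy hz => simp only [map_add, mul_add, hy, hz]
  | tmul y v =>
    rw [toGT_tmul, LinearMap.rTensor_tmul, toGT_tmul, LinearMap.mulLeft_apply, map_mul, mul_assoc]

namespace Connection

variable {C : BundleCalculus.{u, v, w} P Γ} (W : C.Connection)

/-- For `n ∈ N` the element `F̂(n) = F^∧(n)` has its first legs in `N`, and multiplying by `F̂(y)`
on the right keeps them in `NΩ(P)`. -/
theorem IsHorIdeal.rTensor_Fhat {W : C.Connection} {N : Submodule ℂ C.Ω} (hN : W.IsHorIdeal N)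
    {x : C.Ω} (hx : x ∈ N * (⊤ : Submodule ℂ C.Ω)) :
    hN.quotHom.toLinearMap.rTensor (Env Γ) (C.Fhat x) = 0 := by
  have h1 : ∀ y ∈ N, ∀ z : C.GT,
      hN.quotHom.toLinearMap.rTensor (Env Γ) (C.toGT.symm (C.inl y * z)) = 0 := by
    intro y hy z
    obtain ⟨z, rfl⟩ := C.toGT.surjective z
    have h2 : hN.quotHom.toLinearMap ∘ₗ LinearMap.mulLeft ℂ y = 0 := by
      ext x
      exact hN.quotHom_eq_zero.2 (Submodule.mul_mem_mul hy trivial)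
    rw [inl_mul_toGT, LinearEquiv.symm_apply_apply, ← LinearMap.comp_apply,
      ← LinearMap.rTensor_comp, h2]
    simp
  have h3 : ∀ w ∈ LinearMap.range (N.subtype.rTensor A), ∀ z : C.GT,
      hN.quotHom.toLinearMap.rTensor (Env Γ) (C.toGT.symm (C.hinc w * z)) = 0 := by
    rintro _ ⟨t, rfl⟩ z
    induction t with
    | zero => simp
    | add x y hx hy => rw [map_add, map_add, add_mul, map_add, map_add, hx, hy, add_zero]
    | tmul y a =>
      rw [LinearMap.rTensor_tmul, hinc_tmul, mul_assoc]
      exact h1 _ y.2 _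
  induction hx using Submodule.mul_induction_on' with
  | add x _ y _ hx hy => rw [map_add, map_add, hx, hy, add_zero]
  | mem_mul_mem n hn y _ =>
    have h4 : C.Fhat (n * y) = C.toGT.symm (C.FhatHom n * C.FhatHom y) := by
      rw [← map_mul, FhatHom_apply, LinearEquiv.symm_apply_apply]
    rw [h4, C.FhatHom_of_mem_hor (hN.le_hor hn)]
    exact h3 _ (hN.act_mem n hn) _

theorem isQuotient_irregIdeal (s : EnvSection Γ) :
    C.IsQuotient (W.isHorIdeal_irregIdeal s).quotHom := by
  have h0 : ∀ {x}, (W.isHorIdeal_irregIdeal s).quotHom x = 0 ↔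
    x ∈ W.irregIdeal s * (⊤ : Submodule ℂ C.Ω) := (W.isHorIdeal_irregIdeal s).quotHom_eq_zero
  exact ⟨(W.isHorIdeal_irregIdeal s).quotHom_surjective,
    fun n x hx => h0.2 (W.gradedProj_mem_irregIdeal_mul_top s n (h0.1 hx)),
    fun x hx => h0.2 (W.d_mem_irregIdeal s (h0.1 hx)),
    fun x hx => h0.2 (W.st_mem_irregIdeal_mul_top s (h0.1 hx)),
    fun x hx => (W.isHorIdeal_irregIdeal s).rTensor_Fhat (h0.1 hx),
    fun x hx h => W.eq_zero_of_mem_gr_zero s (h0.1 h) hx⟩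

end Connection

end BundleCalculus

end QPB

end

theorem mainTheorem9
    {A : Type*} [Ring A] [StarRing A] [HopfAlgebra ℂ A] [StarModule ℂ A] [QPB.HopfStarAlgebra A]
    {V : Type*} [Ring V] [StarRing V] [Algebra ℂ V] [StarModule ℂ V]
    {B : Type*} [Ring B] [StarRing B] [Algebra ℂ B] [StarModule ℂ B]
    (P : QPB.QuantumPrincipalBundle A V B) (Γ : QPB.BicovariantStarCalculus A)
    (C : QPB.BundleCalculus P Γ) (W : C.Connection) (s : QPB.EnvSection Γ) :
    W.irregIdeal s ≤ C.hor ∧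
    (∀ x ∈ W.irregIdeal s,
      C.act x ∈ LinearMap.range ((W.irregIdeal s).subtype.rTensor A)) ∧
    C.st '' (W.irregIdeal s : Set C.Ω) = W.irregIdeal s ∧
    (∀ x ∈ W.irregIdeal s, W.D s x ∈ W.irregIdeal s) ∧
    ∃ (C' : QPB.BundleCalculus P Γ) (q : C.Hom C') (W' : C'.Connection),
      Function.Surjective q.toAlgHom ∧
      C.hor ⊓ LinearMap.ker q.toAlgHom.toLinearMap = W.irregIdeal s ∧
      C.hor.map q.toAlgHom.toLinearMap = C'.hor ∧
      (∀ ϑ, W'.ω ϑ = q.toAlgHom (W.ω ϑ)) ∧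
      (∀ φ ∈ C.hor, W'.D s (q.toAlgHom φ) = q.toAlgHom (W.D s φ)) ∧
      W'.IsRegular := by
  have hN := W.isHorIdeal_irregIdeal s
  -- The calculus `Ω'(P)` is the quotient of `Ω(P)` by `𝓝_ω Ω(P)`.
  have hq := W.isQuotient_irregIdeal s
  have hω : ∀ ϑ, (hq.connection W).ω ϑ = hq.hom.toAlgHom (W.ω ϑ) := fun _ => rfl
  have h0 : ∀ x, hq.hom.toAlgHom x = 0 ↔ x ∈ W.irregIdeal s * (⊤ : Submodule ℂ C.Ω) :=
    fun x => (W.isHorIdeal_irregIdeal s).quotHom_eq_zero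
  refine ⟨hN.le_hor, hN.act_mem, W.image_st_irregIdeal s, fun x hx => W.D_mem_irregIdeal s hx,
    hq.calculus, hq.hom, hq.connection W, hq.surjective, ?_, hq.hom.map_hor s hω hq.surjective, hω,
    fun x _ => hq.hom.D_apply s hω x, ?_⟩
  · ext x
    refine ⟨fun hx => hN.mem_of_mem_mul_top s ((h0 x).1 hx.2) hx.1, fun hx => ⟨hN.le_hor hx, ?_⟩⟩
    exact (h0 x).2 (QPB.BundleCalculus.Connection.IsHorIdeal.le_mul_top _ hx)
  · exact hq.hom.isRegular s hω hq.surjective fun ϑ x hx =>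
      (h0 _).2 (QPB.BundleCalculus.Connection.IsHorIdeal.le_mul_top _ (W.ell_mem_irregIdeal s ϑ hx))
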